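/- Let $k$ be an algebraically closed field of characteristic zero, $n$ a positive integer with $4\mid n$, $q\in k$ a primitive $n^2$-th root of unity and $\mathfrak q=q^n$. Let $U$ be the associative $k$-algebra (underlying the small quasi-quantum group of $\mathfrak{sl}_2$) generated by $\kappa,\hat\kappa,E,F$ with relations $$\kappa^n=1,\quad \hat\kappa^n=\kappa^{-2},\quad \kappa\hat\kappa=\hat\kappa\kappa,\quad \kappa E\kappa^{-1}=\mathfrak qE,\quad \kappa F\kappa^{-1}=\mathfrak q^{-1}F,$$ $$\hat\kappa E\hat\kappa^{-1}=\mathfrak q q^{-2}E,\quad \hat\kappa F\hat\kappa^{-1}=\mathfrak q^{-1}q^{2}F,\quad E^{n^2}=F^{n^2}=0,\quad FE-q^{-1}EF=1-\kappa^{-1}\hat\kappa .$$ For $1\le i\le n^2/2$ and $j\in\{0,1\}$ put, with $m=n/2$, $$e_{2i,j}=\Big(\frac1{mn}\sum_{t=0}^{mn-1}q^{-2it}(\kappa^{-1}\hat\kappa)^t\Big)\cdot\frac12\big(1+(-1)^j\kappa\hat\kappa^{n/2}\big),\quad \alpha_{2i,j}=F^{n^2-1}e_{2i,j},\quad \beta_{2i,j}=E^{2i-2}\alpha_{2i,j}.$$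 Among the elements $g$ of the span of the products $F^a t E^b$ with $0\le a\le n^2-2$, $b\ge 0$ and $t$ in the subalgebra generated by $\kappa,\hat\kappa$, there is exactly one with $Fg=\beta_{2i,j}$; it satisfies $\kappa^{-1}\hat\kappa\, g=q^{-2i}g$ and $\kappa\hat\kappa^{n/2}g=(-1)^jg$. Let $\gamma_{2i,j}$ be this element or, more generally, any element of $U$ satisfying these three equations, and put $P_{2i,j}=U\gamma_{2i,j}$ and $S_{2i,j}=\mathrm{Soc}(P_{2i,j})$. All modules are left modules. For every such choice of the $\gamma_{2i,j}$ the following hold. (a) The $P_{2i,j}$ ($1\le i\le n^2/2$, $j=0,1$) are indecomposable projective and pairwise non-isomorphic, and every indecomposable projective $U$-module is isomorphic to one of them. (b) The $S_{2i,j}$ ($1\le i\le n^2/2$, $j=0,1$) are simple and pairwise non-isomorphic, and every simple $U$-module is isomorphic to one of them. (c) $U$ has exactly $n^2$ isomorphism classes of indecomposable projective modules, and each indecomposable projective module has $k$-dimension $2n^2$. (d) $U$ has exactly $n^2$ isomorphism classes of simple modules, each simple module has odd $k$-dimension, and $\dim S_{2i,j}=n^2-2i+1$. (e) For $(i,j)\ne(i',j')$,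 the modules $P_{2i,j}$ and $P_{2i',j'}$ belong to the same block of $U$ if and only if $2i+2i'=n^2+2$ and $j+j'=1$ (and $P_{2i,j}$ belongs to a block). (f) $U$ has exactly $n^2/2$ blocks, each of dimension $2n^4$, and each block is Morita equivalent over $k$ to the (basic) algebra $\Lambda$ given by the quiver with two vertices, two arrows $x_1,y_1$ from the first vertex to the second and two arrows $x_2,y_2$ from the second to the first, and the relations $x_sx_t=y_sy_t$, $x_sy_t=y_sx_t=0$ for $\{s,t\}=\{1,2\}$. (g) $U$ is of tame representation type: it has infinitely many isomorphism classes of finite-dimensional indecomposable modules, and for every $d$ there are finitely many $U$-$k[T]$-bimodules $M_1,\dots,M_r$ (with $k$ acting centrally), free of rank $d$ over $k[T]$, such that all but finitely many isomorphism classes of $d$-dimensional indecomposable $U$-modules are represented by modules of the form $M_l\otimes_{k[T]}k[T]/(T-c)$ with $1\le l\le r$, $c\in k$. -/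

import Mathlib

open CategoryTheory Polynomial

universe u v w

noncomputable section

/-! ### General notions for modules over algebras -/

/-- A module is indecomposable if it is nonzero and is not a direct sum of two nonzero
submodules. -/
def IsIndecomposableModule (A : Type v) [Ring A] (M : Type w) [AddCommGroup M] [Module A M] :
    Prop :=
  Nontrivial M ∧ ∀ p q : Submodule A M, IsCompl p q → p = ⊥ ∨ q = ⊥

/-- The socle of a module: the sum of its simple submodules. -/
def moduleSocle (A : Type v) [Ring A] (M : Type w) [AddCommGroup M] [Module A M] :
    Submodule A M :=
  sSup {p : Submodule A M | IsSimpleModule A p}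

/-- The set of isomorphism classes of `A`-modules having the property `C`. -/
def isoClasses (A : Type u) [Ring A] (C : ModuleCat.{u} A → Prop) :
    Set (Quotient (isIsomorphicSetoid (ModuleCat.{u} A))) :=
  {c | ∃ M : ModuleCat.{u} A, C M ∧ c = Quotient.mk _ M}

/-! ### Blocks -/

/-- A block idempotent: a primitive idempotent of the centre. -/
structure IsBlockIdempotent {A : Type v} [Ring A] (e : A) : Prop where
  idem : IsIdempotentElem e
  central : e ∈ Set.center A
  ne_zero : e ≠ 0
  primitive : ∀ f : A, IsIdempotentElem f → f ∈ Set.center A → f * e = f → f = 0 ∨ f = e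

/-- Two modules belong to the same block: some block idempotent is the identity on both. -/
def SameBlock (A : Type v) [Ring A] (M N : Type w) [AddCommGroup M] [Module A M]
    [AddCommGroup N] [Module A N] : Prop :=
  ∃ e : A, IsBlockIdempotent e ∧ (∀ x : M, e • x = x) ∧ (∀ x : N, e • x = x)

/-- For an idempotent `e` of a `k`-algebra `A`, the ring `eAe` (which is `Ae = eA` when `e` is
central) is a `k`-algebra through `c ↦ c e`. -/
instance cornerAlgebra {k : Type u} [CommRing k] {A : Type v} [Ring A] [Algebra k A] {e : A}
    (he : IsIdempotentElem e) : Algebra k he.Corner :=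
  RingHom.toAlgebra'
    { toFun := fun c => ⟨c • e, c • e, by
        simp only [mul_smul_comm, smul_mul_assoc, he.eq]⟩
      map_one' := Subtype.ext (one_smul k e)
      map_mul' := fun a b => Subtype.ext (by
        change (a * b) • e = (a • e) * (b • e)
        simp only [mul_smul_comm, smul_mul_assoc, he.eq, smul_smul, mul_comm])
      map_zero' := Subtype.ext (zero_smul k e)
      map_add' := fun a b => Subtype.ext (add_smul a b e) }
    (fun c x => Subtype.ext (by
      obtain ⟨h₁, h₂⟩ := (Subsemigroup.mem_corner_iff he).1 x.2
      change (c • e) * x.1 = x.1 * (c • e)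
      rw [smul_mul_assoc, mul_smul_comm, h₁, h₂]))

/-! ### Basic algebras and representation type -/

/-- A finite-dimensional algebra over an algebraically closed field `k` is basic if its quotient by
the Jacobson radical is a product of copies of `k`. -/
def IsBasicAlgebra (k : Type u) [Field k] (A : Type v) [Ring A] [Algebra k A] : Prop :=
  FiniteDimensional k A ∧
    ∃ r : ℕ, Nonempty ((A ⧸ Ring.jacobson A) ≃ₐ[k] (Fin r → k))

/-- The space `k^d` on which `A` acts through a matrix representation `ρ`. -/
def RepSpace {k : Type u} [Field k] {A : Type v} [Ring A] [Algebra k A] {d : ℕ}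
    (_ρ : A →ₐ[k] Matrix (Fin d) (Fin d) k) : Type u :=
  Fin d → k

instance {k : Type u} [Field k] {A : Type v} [Ring A] [Algebra k A] {d : ℕ}
    (ρ : A →ₐ[k] Matrix (Fin d) (Fin d) k) : AddCommGroup (RepSpace ρ) :=
  inferInstanceAs (AddCommGroup (Fin d → k))

instance {k : Type u} [Field k] {A : Type v} [Ring A] [Algebra k A] {d : ℕ}
    (ρ : A →ₐ[k] Matrix (Fin d) (Fin d) k) : Module A (RepSpace ρ) :=
  letI : Module (Module.End k (Fin d → k)) (RepSpace ρ) :=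
    inferInstanceAs (Module (Module.End k (Fin d → k)) (Fin d → k))
  Module.compHom (RepSpace ρ)
    (((Matrix.toLinAlgEquiv' : Matrix (Fin d) (Fin d) k ≃ₐ[k] _).toAlgHom.comp ρ).toRingHom)

/-- An `A`-`k[X]`-bimodule (with `k` acting centrally) that is free of rank `d` over `k[X]` is,
after a choice of basis, an algebra homomorphism `Φ : A → M_d(k[X])`. Its tensor product with
`k[X]/(X - c)` is the `A`-module `k^d` given by evaluating all matrix entries at `c`. -/
def specialize {k : Type u} [Field k] {A : Type v} [Ring A] [Algebra k A] {d : ℕ}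
    (Φ : A →ₐ[k] Matrix (Fin d) (Fin d) k[X]) (c : k) : A →ₐ[k] Matrix (Fin d) (Fin d) k :=
  (AlgHom.mapMatrix (aeval c : k[X] →ₐ[k] k)).comp Φ

/-- Tame representation type: there are infinitely many isomorphism classes of finitely generated
indecomposable modules, and for every `d` there are finitely many `A`-`k[X]`-bimodules, free of
finite rank over `k[X]`, such that all but finitely many (up to isomorphism) of the
`d`-dimensional indecomposable modules are of the form `Φ ⊗_{k[X]} k[X]/(X - c)`. -/
def IsTame (k : Type u) [Field k] (A : Type u) [Ring A] [Algebra k A] : Prop :=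
  (isoClasses A fun M => IsIndecomposableModule A M ∧ Module.Finite A M).Infinite ∧
  ∀ d : ℕ, ∃ (r : ℕ) (Φ : Fin r → (A →ₐ[k] Matrix (Fin d) (Fin d) k[X]))
    (s : ℕ) (X : Fin s → ModuleCat.{u} A),
    ∀ (M : Type u) [AddCommGroup M] [Module k M] [Module A M] [IsScalarTower k A M],
      FiniteDimensional k M → Module.finrank k M = d → IsIndecomposableModule A M →
      (∃ t, Nonempty (M ≃ₗ[A] X t)) ∨
      (∃ t c, Nonempty (M ≃ₗ[A] RepSpace (specialize (Φ t) c)))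

/-! ### The algebra underlying the small quasi-quantum group of `sl₂` -/

namespace QuasiSl2

/-- The four generators `𝓀, 𝓀̂, E, F`. -/
inductive Gen
  | kk | kh | E | F

/-- The defining relations, with `𝔮 = q ^ n`. Since `𝓀 ^ n = 1`, the inverse of `𝓀` is
`𝓀 ^ (n - 1)`, and `𝓀̂ ^ n = 𝓀⁻²` is written as `𝓀̂ ^ n 𝓀 ^ 2 = 1`; in particular `𝓀̂` is
invertible. -/
inductive Rel (k : Type u) [Field k] (n : ℕ) (q : k) :
    FreeAlgebra k Gen → FreeAlgebra k Gen → Prop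
  | kk_pow : Rel k n q (FreeAlgebra.ι k Gen.kk ^ n) 1
  | kh_pow : Rel k n q (FreeAlgebra.ι k Gen.kh ^ n * FreeAlgebra.ι k Gen.kk ^ 2) 1
  | kk_kh : Rel k n q (FreeAlgebra.ι k Gen.kk * FreeAlgebra.ι k Gen.kh)
      (FreeAlgebra.ι k Gen.kh * FreeAlgebra.ι k Gen.kk)
  | kk_E : Rel k n q (FreeAlgebra.ι k Gen.kk * FreeAlgebra.ι k Gen.E)
      (q ^ n • (FreeAlgebra.ι k Gen.E * FreeAlgebra.ι k Gen.kk))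
  | kk_F : Rel k n q (FreeAlgebra.ι k Gen.kk * FreeAlgebra.ι k Gen.F)
      ((q ^ n)⁻¹ • (FreeAlgebra.ι k Gen.F * FreeAlgebra.ι k Gen.kk))
  | kh_E : Rel k n q (FreeAlgebra.ι k Gen.kh * FreeAlgebra.ι k Gen.E)
      ((q ^ n * (q ^ 2)⁻¹) • (FreeAlgebra.ι k Gen.E * FreeAlgebra.ι k Gen.kh))
  | kh_F : Rel k n q (FreeAlgebra.ι k Gen.kh * FreeAlgebra.ι k Gen.F)
      (((q ^ n)⁻¹ * q ^ 2) • (FreeAlgebra.ι k Gen.F * FreeAlgebra.ι k Gen.kh))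
  | E_pow : Rel k n q (FreeAlgebra.ι k Gen.E ^ (n ^ 2)) 0
  | F_pow : Rel k n q (FreeAlgebra.ι k Gen.F ^ (n ^ 2)) 0
  | F_E : Rel k n q
      (FreeAlgebra.ι k Gen.F * FreeAlgebra.ι k Gen.E
        - q⁻¹ • (FreeAlgebra.ι k Gen.E * FreeAlgebra.ι k Gen.F))
      (1 - FreeAlgebra.ι k Gen.kk ^ (n - 1) * FreeAlgebra.ι k Gen.kh)

/-- The associative algebra underlying the small quasi-quantum group. -/
def QU (k : Type u) [Field k] (n : ℕ) (q : k) : Type u :=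
  RingQuot (Rel k n q)

instance (k : Type u) [Field k] (n : ℕ) (q : k) : Ring (QU k n q) :=
  inferInstanceAs (Ring (RingQuot (Rel k n q)))

instance (k : Type u) [Field k] (n : ℕ) (q : k) : Algebra k (QU k n q) :=
  inferInstanceAs (Algebra k (RingQuot (Rel k n q)))

section Elements

variable {k : Type u} [Field k] (n : ℕ) (q : k)

/-- The image of a generator in the algebra. -/
def gen (g : Gen) : QU k n q :=
  show RingQuot (Rel k n q) from RingQuot.mkAlgHom k (Rel k n q) (FreeAlgebra.ι k g)

/-- The element `𝓀⁻¹ 𝓀̂`. -/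
def cartan : QU k n q := gen n q Gen.kk ^ (n - 1) * gen n q Gen.kh

/-- The element `𝓀 𝓀̂ ^ (n / 2)`. -/
def parity : QU k n q := gen n q Gen.kk * gen n q Gen.kh ^ (n / 2)

/-- The idempotent `φ_{2i} = (1 / (m n)) ∑_{t < m n} q ^ (-2 i t) (𝓀⁻¹ 𝓀̂) ^ t`, `m = n / 2`. -/
def phi (i : ℕ) : QU k n q :=
  (((n / 2 * n : ℕ) : k)⁻¹) •
    ∑ t ∈ Finset.range (n / 2 * n), (q⁻¹ ^ (2 * i * t)) • cartan n q ^ t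

/-- The idempotent `(1 / 2) (1 + (-1) ^ j 𝓀 𝓀̂ ^ (n / 2))`. -/
def parityIdem (j : Fin 2) : QU k n q :=
  (2 : k)⁻¹ • (1 + (-1 : k) ^ (j : ℕ) • parity n q)

/-- The idempotent `e_{2i,j}`. -/
def idem (i : ℕ) (j : Fin 2) : QU k n q := phi n q i * parityIdem n q j

/-- `α_{2i,j} = F ^ (n² - 1) e_{2i,j}`. -/
def alpha (i : ℕ) (j : Fin 2) : QU k n q := gen n q Gen.F ^ (n ^ 2 - 1) * idem n q i j

/-- `β_{2i,j} = E ^ (2 i - 2) α_{2i,j}`. -/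
def beta (i : ℕ) (j : Fin 2) : QU k n q := gen n q Gen.E ^ (2 * i - 2) * alpha n q i j

/-- The conditions on `γ_{2i,j}`: it satisfies `F γ_{2i,j} = β_{2i,j}`, and it has the same left
eigenvalues for `𝓀⁻¹ 𝓀̂` and `𝓀 𝓀̂ ^ (n / 2)` as `E ^ (2 i - 1) α_{2i,j}`, namely `q ^ (-2 i)` and
`(-1) ^ j`. -/
structure IsGamma (i : ℕ) (j : Fin 2) (g : QU k n q) : Prop where
  F_mul : gen n q Gen.F * g = beta n q i j
  cartan_mul : cartan n q * g = q⁻¹ ^ (2 * i) • g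
  parity_mul : parity n q * g = (-1 : k) ^ (j : ℕ) • g

/-- The span of the products `F ^ a t E ^ b` with `a ≤ n² - 2` and `t` in the subalgebra generated
by `𝓀` and `𝓀̂`. -/
def truncated : Submodule k (QU k n q) :=
  Submodule.span k {x | ∃ a < n ^ 2 - 1, ∃ b : ℕ,
    ∃ t ∈ Algebra.adjoin k {gen n q Gen.kk, gen n q Gen.kh},
      x = gen n q Gen.F ^ a * t * gen n q Gen.E ^ b}

/-- The left ideal generated by `g`; for `g = γ_{2i,j}` this is the module `P_{2i,j}`. -/
abbrev PMod {n : ℕ} {q : k} (g : QU k n q) : Submodule (QU k n q) (QU k n q) :=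
  Submodule.span (QU k n q) {g}

/-- The socle of `PMod g`; for `g = γ_{2i,j}` this is the module `S_{2i,j}`. -/
abbrev SMod {n : ℕ} {q : k} (g : QU k n q) : Submodule (QU k n q) (PMod g) :=
  moduleSocle (QU k n q) (PMod g)

end Elements

/-! ### The eight-dimensional algebra `Λ` -/

/-- Generators of `Λ`: the two trivial paths and the four arrows, where `x₁, y₁` go from the first
vertex to the second and `x₂, y₂` go back. -/
inductive QGen
  | e1 | e2 | x1 | y1 | x2 | y2

/-- The relations of the path algebra of the quiver, followed by the relations
`x_s x_t = y_s y_t`, `x_s y_t = y_s x_t = 0` for `{s, t} = {1, 2}`. Paths are composed from left to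
right. -/
inductive QRel (k : Type u) [Field k] : FreeAlgebra k QGen → FreeAlgebra k QGen → Prop
  | e1_idem : QRel k (FreeAlgebra.ι k QGen.e1 * FreeAlgebra.ι k QGen.e1) (FreeAlgebra.ι k QGen.e1)
  | e2_idem : QRel k (FreeAlgebra.ι k QGen.e2 * FreeAlgebra.ι k QGen.e2) (FreeAlgebra.ι k QGen.e2)
  | e1_e2 : QRel k (FreeAlgebra.ι k QGen.e1 * FreeAlgebra.ι k QGen.e2) 0
  | e2_e1 : QRel k (FreeAlgebra.ι k QGen.e2 * FreeAlgebra.ι k QGen.e1) 0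
  | e_sum : QRel k (FreeAlgebra.ι k QGen.e1 + FreeAlgebra.ι k QGen.e2) 1
  | x1_path : QRel k
      (FreeAlgebra.ι k QGen.e1 * FreeAlgebra.ι k QGen.x1 * FreeAlgebra.ι k QGen.e2)
      (FreeAlgebra.ι k QGen.x1)
  | y1_path : QRel k
      (FreeAlgebra.ι k QGen.e1 * FreeAlgebra.ι k QGen.y1 * FreeAlgebra.ι k QGen.e2)
      (FreeAlgebra.ι k QGen.y1)
  | x2_path : QRel k
      (FreeAlgebra.ι k QGen.e2 * FreeAlgebra.ι k QGen.x2 * FreeAlgebra.ι k QGen.e1)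
      (FreeAlgebra.ι k QGen.x2)
  | y2_path : QRel k
      (FreeAlgebra.ι k QGen.e2 * FreeAlgebra.ι k QGen.y2 * FreeAlgebra.ι k QGen.e1)
      (FreeAlgebra.ι k QGen.y2)
  | x1_x2 : QRel k (FreeAlgebra.ι k QGen.x1 * FreeAlgebra.ι k QGen.x2)
      (FreeAlgebra.ι k QGen.y1 * FreeAlgebra.ι k QGen.y2)
  | x2_x1 : QRel k (FreeAlgebra.ι k QGen.x2 * FreeAlgebra.ι k QGen.x1)
      (FreeAlgebra.ι k QGen.y2 * FreeAlgebra.ι k QGen.y1)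
  | x1_y2 : QRel k (FreeAlgebra.ι k QGen.x1 * FreeAlgebra.ι k QGen.y2) 0
  | x2_y1 : QRel k (FreeAlgebra.ι k QGen.x2 * FreeAlgebra.ι k QGen.y1) 0
  | y1_x2 : QRel k (FreeAlgebra.ι k QGen.y1 * FreeAlgebra.ι k QGen.x2) 0
  | y2_x1 : QRel k (FreeAlgebra.ι k QGen.y2 * FreeAlgebra.ι k QGen.x1) 0

/-- The algebra `Λ` given by the quiver and relations. -/
def BasicLambda (k : Type u) [Field k] : Type u := RingQuot (QRel k)

instance (k : Type u) [Field k] : Ring (BasicLambda k) :=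
  inferInstanceAs (Ring (RingQuot (QRel k)))

instance (k : Type u) [Field k] : Algebra k (BasicLambda k) :=
  inferInstanceAs (Algebra k (RingQuot (QRel k)))

end QuasiSl2

end

/-!
The algebra `U` is an algebra of matrices. Let `R = k[x, y] / (xy, x² - y²)` (`ArrowRing`), graded
by `ℤ/2` with `x, y` odd. A vertex is a pair of one of `n² / 2` blocks and one of two types, and
each of the `n² / 2 · n²` indices (a block and a position modulo `n²`) is assigned a vertex of its
block. The graded matrices are those over `R` whose entries vanish between different blocks, are
even between indices of the same type and odd between the two types of a block. The elements `κ` and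
`κ̂` act by diagonal matrices of roots of unity, `E` and `F` by weighted cyclic shifts of the
positions whose weights are units except where the type changes; there they are the odd elements
`x`, `y` up to scalars (`repGen_rel`). The eigenvalues of `κ`, `κ̂` and `E F` separate the
positions, so the image of this representation contains all diagonal matrix units, hence all graded
matrices (`rep_range`); these have dimension `n⁶`. As `n⁶` monomials `F^a t E^b` span `U`
(`span_redMono`), the representation is an isomorphism onto the graded matrices (`rep_injective`,
`model`), and the monomials are linearly independent.

What remains is the representation theory of an arbitrary algebra of graded matrices
(`MatrixModel`). The column of an index with vertex `w` is a projective module `P w`. Every nonzero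
element of it has a multiple equal to the element `soc w`, whose entry is `s = x² = y²`, so that `P
w` is indecomposable with simple socle `L w`, and counting entries gives the dimensions. The central
idempotents are diagonal and constant on blocks, which determines the blocks of the algebra
(`isBlockIdempotent_iff`). Choosing one index for each vertex of a block yields a full idempotent
(`FullCorner`) whose corner consists of the `2 × 2` graded matrices, and this corner is `Λ`
(`lamModel`); hence the Morita equivalence.

For tameness (`MatrixModel.isTame`), let `M` be indecomposable. If some `soc w` acts on `M` as a
nonzero map, a linear functional on `M` yields a surjection onto `P w` (`functionalHom`), so `M ≅ P
w`. Otherwise all arrows annihilate the images of arrows, which are therefore direct summands of the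
parts of `M` at the vertices, so that the arrows act from one type of a single block to the other
(`exists_oneWay`). Such a module is an indecomposable pencil, a pair of linear maps `A, B : V → W`.
If `dim V ≠ dim W`, the reflection functors reduce the dimensions and show that the dimensions
determine the pencil (`pencilIso_of_finrank_gt`, `pencilIso_of_finrank_lt`). If they agree, some `A
+ c B` is invertible, for otherwise the pencil has a polynomial solution and `dim W < dim V`
(`PencilIndec.lt_of_chain`). Then the pencil is a single Jordan block; those with `A` invertible
form a one-parameter family over `k[T]` for each dimension (`familyRep`), and one more pencil
remains.

The elements `γ` are controlled by `F γ = β`. In terms of the basis `F^a t E^b`, left multiplication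
by `F` is invertible from the span of the monomials with `a < n² - 1` to the elements killed by
`F^(n² - 1)`, and `β` is such an element (`exists_isGamma`). Since `F E β = 0`, the eigenvalues of
`γ` force all rows of its matrix except one, that of the vertex `gammaVert`, to vanish
(`IsGamma.entry_eq_zero`). In that row `E F` is a multiple of `s`, while `E F γ = E^(2i-1) F^(n²-1)
e` has a nonzero entry; so `soc` does not annihilate `γ`, and right multiplication by `γ` embeds `P
(gammaVert hi j)` as `U γ` (`IsGamma.equivPMod`). All assertions are then read off from the model,
the vertices of a block corresponding to `(2i, 0)` and `(n² + 2 - 2i, 1)`.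
-/

noncomputable section

namespace QuasiSl2

/-! ### The graded local ring of the arrows -/

/-- The commutative ring `k[x, y] / (xy, x² - y²)`, with basis `1, x, y, s = x² = y²`. It is graded
by `ℤ/2`, with `1, s` even and `x, y` odd; the algebra `Λ` consists of the `2 × 2` matrices over it
whose diagonal entries are even and whose other entries are odd. -/
@[ext]
structure ArrowRing (k : Type u) where
  /-- the coefficient of `1` -/
  c1 : k
  /-- the coefficient of `x` -/
  cx : k
  /-- the coefficient of `y` -/
  cy : k
  /-- the coefficient of `s` -/
  cs : k

namespace ArrowRing

section Ring

variable {k : Type u} [Field k]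

instance : Zero (ArrowRing k) := ⟨⟨0, 0, 0, 0⟩⟩
instance : One (ArrowRing k) := ⟨⟨1, 0, 0, 0⟩⟩
instance : Add (ArrowRing k) := ⟨fun a b => ⟨a.c1 + b.c1, a.cx + b.cx, a.cy + b.cy, a.cs + b.cs⟩⟩
instance : Neg (ArrowRing k) := ⟨fun a => ⟨-a.c1, -a.cx, -a.cy, -a.cs⟩⟩
instance : Mul (ArrowRing k) := ⟨fun a b => ⟨a.c1 * b.c1, a.c1 * b.cx + a.cx * b.c1,
  a.c1 * b.cy + a.cy * b.c1, a.c1 * b.cs + a.cs * b.c1 + a.cx * b.cx + a.cy * b.cy⟩⟩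
instance : SMul k (ArrowRing k) := ⟨fun c a => ⟨c * a.c1, c * a.cx, c * a.cy, c * a.cs⟩⟩

@[simp] lemma zero_c1 : (0 : ArrowRing k).c1 = 0 := rfl
@[simp] lemma zero_cx : (0 : ArrowRing k).cx = 0 := rfl
@[simp] lemma zero_cy : (0 : ArrowRing k).cy = 0 := rfl
@[simp] lemma zero_cs : (0 : ArrowRing k).cs = 0 := rfl
@[simp] lemma one_c1 : (1 : ArrowRing k).c1 = 1 := rfl
@[simp] lemma one_cx : (1 : ArrowRing k).cx = 0 := rfl
@[simp] lemma one_cy : (1 : ArrowRing k).cy = 0 := rfl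
@[simp] lemma one_cs : (1 : ArrowRing k).cs = 0 := rfl
@[simp] lemma add_c1 (a b : ArrowRing k) : (a + b).c1 = a.c1 + b.c1 := rfl
@[simp] lemma add_cx (a b : ArrowRing k) : (a + b).cx = a.cx + b.cx := rfl
@[simp] lemma add_cy (a b : ArrowRing k) : (a + b).cy = a.cy + b.cy := rfl
@[simp] lemma add_cs (a b : ArrowRing k) : (a + b).cs = a.cs + b.cs := rfl
@[simp] lemma neg_c1 (a : ArrowRing k) : (-a).c1 = -a.c1 := rfl
@[simp] lemma neg_cx (a : ArrowRing k) : (-a).cx = -a.cx := rfl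
@[simp] lemma neg_cy (a : ArrowRing k) : (-a).cy = -a.cy := rfl
@[simp] lemma neg_cs (a : ArrowRing k) : (-a).cs = -a.cs := rfl
@[simp] lemma mul_c1 (a b : ArrowRing k) : (a * b).c1 = a.c1 * b.c1 := rfl
@[simp] lemma mul_cx (a b : ArrowRing k) : (a * b).cx = a.c1 * b.cx + a.cx * b.c1 := rfl
@[simp] lemma mul_cy (a b : ArrowRing k) : (a * b).cy = a.c1 * b.cy + a.cy * b.c1 := rfl
@[simp] lemma mul_cs (a b : ArrowRing k) :
    (a * b).cs = a.c1 * b.cs + a.cs * b.c1 + a.cx * b.cx + a.cy * b.cy := rfl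
@[simp] lemma smul_c1 (c : k) (a : ArrowRing k) : (c • a).c1 = c * a.c1 := rfl
@[simp] lemma smul_cx (c : k) (a : ArrowRing k) : (c • a).cx = c * a.cx := rfl
@[simp] lemma smul_cy (c : k) (a : ArrowRing k) : (c • a).cy = c * a.cy := rfl
@[simp] lemma smul_cs (c : k) (a : ArrowRing k) : (c • a).cs = c * a.cs := rfl

instance : CommRing (ArrowRing k) where
  add_assoc a b c := by ext <;> simp [add_assoc]
  zero_add a := by ext <;> simp
  add_zero a := by ext <;> simp
  add_comm a b := by ext <;> simp [add_comm]
  neg_add_cancel a := by ext <;> simp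
  mul_assoc a b c := by ext <;> simp <;> ring
  one_mul a := by ext <;> simp
  mul_one a := by ext <;> simp
  zero_mul a := by ext <;> simp
  mul_zero a := by ext <;> simp
  left_distrib a b c := by ext <;> simp <;> ring
  right_distrib a b c := by ext <;> simp <;> ring
  mul_comm a b := by ext <;> simp <;> ring
  nsmul := nsmulRec
  zsmul := zsmulRec

@[simp] lemma sub_c1 (a b : ArrowRing k) : (a - b).c1 = a.c1 - b.c1 := by simp [sub_eq_add_neg]
@[simp] lemma sub_cx (a b : ArrowRing k) : (a - b).cx = a.cx - b.cx := by simp [sub_eq_add_neg]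
@[simp] lemma sub_cy (a b : ArrowRing k) : (a - b).cy = a.cy - b.cy := by simp [sub_eq_add_neg]
@[simp] lemma sub_cs (a b : ArrowRing k) : (a - b).cs = a.cs - b.cs := by simp [sub_eq_add_neg]

instance : Module k (ArrowRing k) where
  one_smul a := by ext <;> simp
  mul_smul c d a := by ext <;> simp [mul_assoc]
  smul_zero c := by ext <;> simp
  smul_add c a b := by ext <;> simp [mul_add]
  add_smul c d a := by ext <;> simp [add_mul]
  zero_smul a := by ext <;> simp

instance : Algebra k (ArrowRing k) :=
  Algebra.ofModule (fun c a b => by ext <;> simp <;> ring) (fun c a b => by ext <;> simp <;> ring)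

lemma algebraMap_eq (c : k) : algebraMap k (ArrowRing k) c = ⟨c, 0, 0, 0⟩ := by
  rw [Algebra.algebraMap_eq_smul_one]; ext <;> simp

variable (k) in
/-- The first odd generator. -/
def x : ArrowRing k := ⟨0, 1, 0, 0⟩
variable (k) in
/-- The second odd generator. -/
def y : ArrowRing k := ⟨0, 0, 1, 0⟩
variable (k) in
/-- The socle generator `s = x² = y²`. -/
def s : ArrowRing k := ⟨0, 0, 0, 1⟩

@[simp] lemma x_c1 : (x k).c1 = 0 := rfl
@[simp] lemma x_cx : (x k).cx = 1 := rfl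
@[simp] lemma x_cy : (x k).cy = 0 := rfl
@[simp] lemma x_cs : (x k).cs = 0 := rfl
@[simp] lemma y_c1 : (y k).c1 = 0 := rfl
@[simp] lemma y_cx : (y k).cx = 0 := rfl
@[simp] lemma y_cy : (y k).cy = 1 := rfl
@[simp] lemma y_cs : (y k).cs = 0 := rfl
@[simp] lemma s_c1 : (s k).c1 = 0 := rfl
@[simp] lemma s_cx : (s k).cx = 0 := rfl
@[simp] lemma s_cy : (s k).cy = 0 := rfl
@[simp] lemma s_cs : (s k).cs = 1 := rfl

lemma x_mul_x : x k * x k = s k := by ext <;> simp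
lemma y_mul_y : y k * y k = s k := by ext <;> simp
lemma x_mul_y : x k * y k = 0 := by ext <;> simp
lemma y_mul_x : y k * x k = 0 := by ext <;> simp
lemma s_mul_s : s k * s k = 0 := by ext <;> simp
lemma s_ne_zero : s k ≠ 0 := fun h => one_ne_zero (congrArg cs h)

lemma isUnit_of_c1_ne_zero {a : ArrowRing k} (h : a.c1 ≠ 0) : IsUnit a := by
  refine IsUnit.of_mul_eq_one ⟨a.c1⁻¹, -a.cx * a.c1⁻¹ ^ 2, -a.cy * a.c1⁻¹ ^ 2,
    -a.cs * a.c1⁻¹ ^ 2 + (a.cx ^ 2 + a.cy ^ 2) * a.c1⁻¹ ^ 3⟩ ?_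
  ext <;> simp <;> field_simp <;> ring

/-- The homogeneous parts of `ArrowRing k`: even for `true`, odd for `false`. -/
def part : Bool → Submodule k (ArrowRing k)
  | true =>
    { carrier := {a | a.cx = 0 ∧ a.cy = 0}
      add_mem' := by rintro a b ⟨h1, h2⟩ ⟨h3, h4⟩; simp [*]
      zero_mem' := by simp
      smul_mem' := by rintro c a ⟨h1, h2⟩; simp [*] }
  | false =>
    { carrier := {a | a.c1 = 0 ∧ a.cs = 0}
      add_mem' := by rintro a b ⟨h1, h2⟩ ⟨h3, h4⟩; simp [*]
      zero_mem' := by simp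
      smul_mem' := by rintro c a ⟨h1, h2⟩; simp [*] }

lemma mem_part_true {a : ArrowRing k} : a ∈ part true ↔ a.cx = 0 ∧ a.cy = 0 := Iff.rfl
lemma mem_part_false {a : ArrowRing k} : a ∈ part false ↔ a.c1 = 0 ∧ a.cs = 0 := Iff.rfl

lemma mul_mem_part {b c : Bool} {a a' : ArrowRing k} (h : a ∈ part b) (h' : a' ∈ part c) :
    a * a' ∈ part (b == c) := by
  cases b <;> cases c <;> simp only [mem_part_true, mem_part_false] at h h' <;>
    constructor <;> simp [h, h']

/-- The projection onto a homogeneous part. -/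
def proj : Bool → ArrowRing k →ₗ[k] ArrowRing k
  | true =>
    { toFun := fun a => ⟨a.c1, 0, 0, a.cs⟩
      map_add' := fun a b => by ext <;> simp
      map_smul' := fun c a => by ext <;> simp }
  | false =>
    { toFun := fun a => ⟨0, a.cx, a.cy, 0⟩
      map_add' := fun a b => by ext <;> simp
      map_smul' := fun c a => by ext <;> simp }

lemma proj_mem (b : Bool) (a : ArrowRing k) : proj b a ∈ part b := by
  cases b
  · exact ⟨rfl, rfl⟩
  · exact ⟨rfl, rfl⟩

lemma proj_eq {b : Bool} {a : ArrowRing k} (h : a ∈ part b) : proj b a = a := by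
  cases b
  · obtain ⟨h1, h2⟩ := h; ext <;> simp [proj, h1, h2]
  · obtain ⟨h1, h2⟩ := h; ext <;> simp [proj, h1, h2]

lemma one_mem : (1 : ArrowRing k) ∈ part true := ⟨rfl, rfl⟩
lemma s_mem : s k ∈ part true := ⟨rfl, rfl⟩
lemma x_mem : x k ∈ part false := ⟨rfl, rfl⟩
lemma y_mem : y k ∈ part false := ⟨rfl, rfl⟩

lemma eq_of_mem_part_true {a : ArrowRing k} (h : a ∈ part true) : a = a.c1 • 1 + a.cs • s k := by
  ext <;> simp [h.1, h.2]

lemma eq_of_mem_part_false {a : ArrowRing k} (h : a ∈ part false) :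
    a = a.cx • x k + a.cy • y k := by
  ext <;> simp [h.1, h.2]

/-- The ring is graded Frobenius: every nonzero homogeneous element has a homogeneous multiple
equal to `s`. -/
lemma exists_mul_eq_s {b : Bool} {a : ArrowRing k} (h : a ∈ part b) (h0 : a ≠ 0) :
    ∃ t ∈ part (k := k) b, t * a = s k := by
  cases b
  · by_cases hx : a.cx = 0
    · have hy : a.cy ≠ 0 := fun hy => h0 (by rw [eq_of_mem_part_false h, hx, hy]; simp)
      refine ⟨a.cy⁻¹ • y k, Submodule.smul_mem _ _ y_mem, ?_⟩
      ext <;> simp [h.1, hy]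
    · refine ⟨a.cx⁻¹ • x k, Submodule.smul_mem _ _ x_mem, ?_⟩
      ext <;> simp [h.1, hx]
  · by_cases hx : a.c1 = 0
    · have hy : a.cs ≠ 0 := fun hy => h0 (by rw [eq_of_mem_part_true h, hx, hy]; simp)
      refine ⟨a.cs⁻¹ • 1, Submodule.smul_mem _ _ one_mem, ?_⟩
      ext <;> simp [h.1, h.2, hx, hy]
    · refine ⟨a.c1⁻¹ • s k, Submodule.smul_mem _ _ s_mem, ?_⟩
      ext <;> simp [hx]

lemma mul_s (a : ArrowRing k) : a * s k = a.c1 • s k := by ext <;> simp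

/-- Coordinates of a homogeneous part. -/
def partEquiv : (b : Bool) → part (k := k) b ≃ₗ[k] (Fin 2 → k)
  | true =>
    { toFun := fun a => ![a.1.c1, a.1.cs]
      map_add' := fun a b => by ext i; fin_cases i <;> simp
      map_smul' := fun c a => by ext i; fin_cases i <;> simp
      invFun := fun f => ⟨⟨f 0, 0, 0, f 1⟩, rfl, rfl⟩
      left_inv := fun a => Subtype.ext (by ext <;> simp [a.2.1, a.2.2])
      right_inv := fun f => by ext i; fin_cases i <;> simp }
  | false =>
    { toFun := fun a => ![a.1.cx, a.1.cy]
      map_add' := fun a b => by ext i; fin_cases i <;> simp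
      map_smul' := fun c a => by ext i; fin_cases i <;> simp
      invFun := fun f => ⟨⟨0, f 0, f 1, 0⟩, rfl, rfl⟩
      left_inv := fun a => Subtype.ext (by ext <;> simp [a.2.1, a.2.2])
      right_inv := fun f => by ext i; fin_cases i <;> simp }

end Ring

end ArrowRing

/-! ### Algebras of graded matrices -/

open ArrowRing

section Grading

variable {k : Type u} [Field k] {B : Type} [DecidableEq B]

/-- The admissible entries between two vertices. A vertex is a block together with one of its two
types: entries between different blocks vanish, entries between vertices of the same type are even,
and entries between the two types of a block are odd. -/
def gr (k : Type u) [Field k] (w w' : B × Bool) : Submodule k (ArrowRing k) :=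
  if w.1 = w'.1 then part (w.2 == w'.2) else ⊥

/-- The projection onto the admissible entries. -/
def grProj (k : Type u) [Field k] (w w' : B × Bool) : ArrowRing k →ₗ[k] ArrowRing k :=
  if w.1 = w'.1 then proj (w.2 == w'.2) else 0

lemma gr_mul {w w' w'' : B × Bool} {t t' : ArrowRing k} (h : t ∈ gr k w w')
    (h' : t' ∈ gr k w' w'') : t * t' ∈ gr k w w'' := by
  obtain ⟨b, c⟩ := w
  obtain ⟨b', c'⟩ := w'
  obtain ⟨b'', c''⟩ := w''
  unfold gr at *
  by_cases h1 : b = b'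
  · by_cases h2 : b' = b''
    · subst h1 h2
      simp only [if_true] at *
      have := mul_mem_part h h'
      convert this using 2
      cases c <;> cases c' <;> cases c'' <;> rfl
    · have : t' = 0 := by simpa [h2] using h'
      simp [this]
  · have : t = 0 := by simpa [h1] using h
    simp [this]

lemma grProj_mem (w w' : B × Bool) (t : ArrowRing k) : grProj k w w' t ∈ gr k w w' := by
  unfold gr grProj
  split_ifs
  · exact proj_mem _ _
  · simp

lemma grProj_eq {w w' : B × Bool} {t : ArrowRing k} (h : t ∈ gr k w w') : grProj k w w' t = t := by
  unfold gr at h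
  unfold grProj
  split_ifs at h ⊢
  · exact proj_eq h
  · simpa using h.symm

lemma gr_self (w : B × Bool) : gr k w w = part true := by simp [gr]

lemma gr_eq_part (b : B) (c c' : Bool) : gr k (b, c) (b, c') = part (c == c') := by simp [gr]

lemma eq_zero_of_mem_gr {w w' : B × Bool} (hw : w.1 ≠ w'.1) {t : ArrowRing k}
    (h : t ∈ gr k w w') : t = 0 := by
  simpa [gr, hw] using h

lemma one_mem_gr (w : B × Bool) : (1 : ArrowRing k) ∈ gr k w w := by
  rw [gr_self]; exact one_mem

lemma s_mem_gr (w : B × Bool) : s k ∈ gr k w w := by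
  rw [gr_self]; exact s_mem

lemma x_mem_gr (b : B) (c : Bool) : x k ∈ gr k (b, !c) (b, c) := by
  rw [gr_eq_part]; cases c <;> exact x_mem

lemma y_mem_gr (b : B) (c : Bool) : y k ∈ gr k (b, !c) (b, c) := by
  rw [gr_eq_part]; cases c <;> exact y_mem

lemma exists_mul_eq_s_of_gr {w w' : B × Bool} {t : ArrowRing k} (h : t ∈ gr k w w')
    (h0 : t ≠ 0) : ∃ t' ∈ gr k w' w, t' * t = s k := by
  obtain ⟨b, c⟩ := w
  obtain ⟨b', c'⟩ := w'
  by_cases hb : b = b'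
  · subst hb
    rw [gr_eq_part] at h ⊢
    have : (c' == c) = (c == c') := by cases c <;> cases c' <;> rfl
    rw [this]
    exact exists_mul_eq_s h h0
  · exact absurd (eq_zero_of_mem_gr hb h) h0

lemma eq_of_c1_ne_zero {w w' : B × Bool} {t : ArrowRing k} (h : t ∈ gr k w w')
    (h0 : t.c1 ≠ 0) : w = w' := by
  obtain ⟨b, c⟩ := w
  obtain ⟨b', c'⟩ := w'
  by_cases hb : b = b'
  · subst hb
    rw [gr_eq_part] at h
    cases c <;> cases c' <;> first | rfl | exact absurd h.1 h0
  · exact absurd (by rw [eq_zero_of_mem_gr hb h]; rfl) h0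

end Grading

/-- A presentation of `A` as the algebra of all matrices over `ArrowRing k`, with rows and columns
indexed by `X`, whose entries are admissible for an assignment `v` of vertices to the indices. Every
vertex `w` is assigned to some index; one such index `o w` is chosen. -/
structure MatrixModel (k : Type u) [Field k] (A : Type v) [Ring A] [Algebra k A] (X B : Type)
    [Fintype X] [DecidableEq X] [DecidableEq B] where
  /-- the vertex of an index -/
  v : X → B × Bool
  /-- the chosen index of a vertex -/
  o : B × Bool → X
  v_o : ∀ w, v (o w) = w
  /-- the embedding into the matrix algebra -/
  toHom : A →ₐ[k] Matrix X X (ArrowRing k)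
  injective : Function.Injective toHom
  mem_gr : ∀ a x y, toHom a x y ∈ gr k (v x) (v y)
  surj : ∀ m : Matrix X X (ArrowRing k), (∀ x y, m x y ∈ gr k (v x) (v y)) → ∃ a, toHom a = m

namespace MatrixModel

variable {k : Type u} [Field k] {A : Type v} [Ring A] [Algebra k A] {X B : Type}
  [Fintype X] [DecidableEq X] [DecidableEq B] (S : MatrixModel k A X B)

attribute [simp] MatrixModel.v_o

lemma exists_unit (x y : X) (t : ArrowRing k) :
    ∃ a, S.toHom a = Matrix.single x y (grProj k (S.v x) (S.v y) t) := by
  refine S.surj _ fun x' y' => ?_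
  by_cases h : x = x' ∧ y = y'
  · obtain ⟨rfl, rfl⟩ := h
    rw [Matrix.single_apply_same]
    exact grProj_mem _ _ _
  · rw [Matrix.single_apply_of_ne _ _ _ _ _ h]
    exact zero_mem _

/-- The element of `A` whose matrix has the single entry `t`, projected to the admissible entries,
at the position `(x, y)`. -/
def unit (x y : X) : ArrowRing k →ₗ[k] A where
  toFun t := (S.exists_unit x y t).choose
  map_add' t t' := S.injective (by
    have h := map_add S.toHom (S.exists_unit x y t).choose (S.exists_unit x y t').choose
    rw [(S.exists_unit x y t).choose_spec, (S.exists_unit x y t').choose_spec,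
      ← Matrix.single_add, ← map_add] at h
    exact (S.exists_unit x y (t + t')).choose_spec.trans h.symm)
  map_smul' c t := S.injective (by
    have h := map_smul S.toHom c (S.exists_unit x y t).choose
    rw [(S.exists_unit x y t).choose_spec, Matrix.smul_single, ← map_smul] at h
    exact (S.exists_unit x y (c • t)).choose_spec.trans h.symm)

lemma toHom_unit (x y : X) (t : ArrowRing k) :
    S.toHom (S.unit x y t) = Matrix.single x y (grProj k (S.v x) (S.v y) t) :=
  (S.exists_unit x y t).choose_spec

lemma toHom_unit_of_mem {x y : X} {t : ArrowRing k} (h : t ∈ gr k (S.v x) (S.v y)) :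
    S.toHom (S.unit x y t) = Matrix.single x y t := by
  rw [toHom_unit, grProj_eq h]

lemma unit_mul {x y z : X} {t t' : ArrowRing k} (h : t ∈ gr k (S.v x) (S.v y))
    (h' : t' ∈ gr k (S.v y) (S.v z)) : S.unit x y t * S.unit y z t' = S.unit x z (t * t') :=
  S.injective (by
    rw [map_mul, S.toHom_unit_of_mem h, S.toHom_unit_of_mem h', S.toHom_unit_of_mem (gr_mul h h'),
      Matrix.single_mul_single_same])

lemma unit_mul_of_ne {x y y' z : X} (hy : y ≠ y') (t t' : ArrowRing k) :
    S.unit x y t * S.unit y' z t' = 0 :=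
  S.injective (by
    rw [map_mul, S.toHom_unit, S.toHom_unit, Matrix.single_mul_single_of_ne _ _ _ _ hy, map_zero])

lemma unit_injective {x y : X} {t : ArrowRing k} (h : t ∈ gr k (S.v x) (S.v y))
    (h0 : S.unit x y t = 0) : t = 0 := by
  have := S.toHom_unit_of_mem h
  rw [h0, map_zero] at this
  simpa using (congrFun (congrFun this x) y).symm

lemma eq_sum (a : A) : a = ∑ x, ∑ y, S.unit x y (S.toHom a x y) :=
  S.injective (by
    rw [map_sum]
    simp_rw [map_sum, S.toHom_unit_of_mem (S.mem_gr a _ _)]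
    exact Matrix.matrix_eq_sum_single _)

/-- The diagonal matrix unit at an index. -/
def eps (x : X) : A := S.unit x x 1

lemma sum_eps : ∑ x, S.eps x = 1 := S.injective (by
  rw [map_sum, map_one]
  simp_rw [eps, S.toHom_unit_of_mem (one_mem_gr _)]
  funext i j
  simp [Matrix.sum_apply, Matrix.single_apply, Matrix.one_apply, ite_and])

lemma unit_proj (x y : X) (t : ArrowRing k) :
    S.unit x y (grProj k (S.v x) (S.v y) t) = S.unit x y t :=
  S.injective (by rw [toHom_unit, toHom_unit, grProj_eq (grProj_mem _ _ _)])

lemma eps_mul_unit (x y : X) (t : ArrowRing k) : S.eps x * S.unit x y t = S.unit x y t := by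
  rw [← S.unit_proj x y t, eps, S.unit_mul (one_mem_gr _) (grProj_mem _ _ _), one_mul]

lemma unit_mul_eps (x y : X) (t : ArrowRing k) : S.unit x y t * S.eps y = S.unit x y t := by
  rw [← S.unit_proj x y t, eps, S.unit_mul (grProj_mem _ _ _) (one_mem_gr _), mul_one]

lemma eps_mul_eps (x : X) : S.eps x * S.eps x = S.eps x := S.eps_mul_unit x x 1

lemma eps_mul_eps_of_ne {x y : X} (h : x ≠ y) : S.eps x * S.eps y = 0 :=
  S.unit_mul_of_ne h _ _

lemma eps_mul_mul_eps (x y : X) (a : A) : S.eps x * a * S.eps y = S.unit x y (S.toHom a x y) :=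
  S.injective (by
    rw [map_mul, map_mul, eps, eps, S.toHom_unit_of_mem (one_mem_gr _),
      S.toHom_unit_of_mem (one_mem_gr _), S.toHom_unit_of_mem (S.mem_gr a x y),
      Matrix.single_mul_mul_single, one_mul, mul_one])

lemma eps_ne_zero (x : X) : S.eps x ≠ 0 := fun h =>
  one_ne_zero (congrArg ArrowRing.c1 (S.unit_injective (one_mem_gr _) h))

/-- The socle element of the projective module of a vertex. -/
def soc (w : B × Bool) : A := S.unit (S.o w) (S.o w) (s k)

lemma soc_ne_zero (w : B × Bool) : S.soc w ≠ 0 := fun h =>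
  s_ne_zero (S.unit_injective (s_mem_gr _) h)

lemma finiteDimensional (S : MatrixModel k A X B) : FiniteDimensional k A := by
  have : FiniteDimensional k (ArrowRing k) := by
    refine FiniteDimensional.of_injective (V₂ := Fin 4 → k)
      { toFun := fun a => ![a.c1, a.cx, a.cy, a.cs]
        map_add' := fun a b => by ext i; fin_cases i <;> simp
        map_smul' := fun c a => by ext i; fin_cases i <;> simp } fun a b h => ?_
    ext
    · exact congrFun h 0
    · exact congrFun h 1
    · exact congrFun h 2
    · exact congrFun h 3
  exact FiniteDimensional.of_injective S.toHom.toLinearMap S.injective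

/-- `A` is linearly isomorphic to the product of its spaces of admissible entries. -/
def entriesEquiv : A ≃ₗ[k] (∀ p : X × X, gr k (S.v p.1) (S.v p.2)) where
  toFun a p := ⟨S.toHom a p.1 p.2, S.mem_gr a _ _⟩
  map_add' a b := by ext p : 2; simp
  map_smul' c a := by ext p : 2; simp
  invFun f := ∑ x, ∑ y, S.unit x y (f (x, y)).1
  left_inv a := (S.eq_sum a).symm
  right_inv f := by
    funext p
    refine Subtype.ext ?_
    obtain ⟨x, y⟩ := p
    simp only [map_sum]
    rw [Matrix.sum_apply, Finset.sum_eq_single x, Matrix.sum_apply, Finset.sum_eq_single y,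
      S.toHom_unit_of_mem (f (x, y)).2, Matrix.single_apply_same]
    · intro z _ hz
      rw [S.toHom_unit, Matrix.single_apply_of_ne _ _ _ _ _ (by simp [hz])]
    · simp
    · intro z _ hz
      rw [Matrix.sum_apply]
      refine Finset.sum_eq_zero fun z' _ => ?_
      rw [S.toHom_unit, Matrix.single_apply_of_ne _ _ _ _ _ (by simp [hz])]
    · simp

end MatrixModel

lemma finrank_gr {k : Type u} [Field k] {B : Type} [DecidableEq B] (w w' : B × Bool) :
    Module.finrank k (gr k w w') = if w.1 = w'.1 then 2 else 0 := by
  unfold gr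
  by_cases h : w.1 = w'.1
  · rw [if_pos h, if_pos h, (partEquiv _).finrank_eq]; simp
  · rw [if_neg h, if_neg h, finrank_bot]

instance {k : Type u} [Field k] {B : Type} [DecidableEq B] (w w' : B × Bool) :
    FiniteDimensional k (gr k w w') := by
  unfold gr
  by_cases h : w.1 = w'.1
  · rw [if_pos h]; exact Module.Finite.equiv (partEquiv _).symm
  · rw [if_neg h]; infer_instance

namespace MatrixModel

variable {k : Type u} [Field k] {A : Type v} [Ring A] [Algebra k A] {X B : Type}
  [Fintype X] [DecidableEq X] [DecidableEq B] (S : MatrixModel k A X B)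

lemma finrank_eq : Module.finrank k A = ∑ p : X × X, if (S.v p.1).1 = (S.v p.2).1 then 2 else 0 := by
  rw [S.entriesEquiv.finrank_eq, Module.finrank_pi_fintype]
  simp_rw [finrank_gr]

end MatrixModel

/-! ### Modules with an essential simple submodule -/

section General

variable {A : Type v} [Ring A] {M : Type w} [AddCommGroup M] [Module A M]

lemma isIndecomposableModule_congr {M' : Type*} [AddCommGroup M'] [Module A M']
    (e : M ≃ₗ[A] M') (h : IsIndecomposableModule A M) : IsIndecomposableModule A M' := by
  obtain ⟨h1, h2⟩ := h
  refine ⟨e.symm.toEquiv.nontrivial, fun p q hpq => ?_⟩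
  have hb : ∀ r : Submodule A M', (Submodule.orderIsoMapComap e).symm r = ⊥ → r = ⊥ := fun r hr => by
    rwa [map_eq_bot_iff] at hr
  exact (h2 _ _ ((Submodule.orderIsoMapComap e).symm.isCompl hpq)).imp (hb p) (hb q)

/-- If a nonzero element lies in every nonzero submodule then the module is indecomposable. -/
lemma isIndecomposableModule_of_essential {σ : M} (h0 : σ ≠ 0)
    (h : ∀ N : Submodule A M, N ≠ ⊥ → σ ∈ N) : IsIndecomposableModule A M := by
  refine ⟨⟨σ, 0, h0⟩, fun p q hpq => ?_⟩
  by_contra! hc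
  exact h0 ((Submodule.disjoint_def.1 hpq.disjoint) σ (h p hc.1) (h q hc.2))

lemma isSimpleModule_span_of_essential {σ : M} (h0 : σ ≠ 0)
    (h : ∀ N : Submodule A M, N ≠ ⊥ → σ ∈ N) : IsSimpleModule A (Submodule.span A {σ}) := by
  rw [isSimpleModule_iff_isAtom]
  refine ⟨by simpa using h0, fun N hN => ?_⟩
  by_contra hb
  exact hN.not_ge ((Submodule.span_singleton_le_iff_mem _ _).2 (h N hb))

lemma moduleSocle_of_essential {σ : M} (h0 : σ ≠ 0)
    (h : ∀ N : Submodule A M, N ≠ ⊥ → σ ∈ N) : moduleSocle A M = Submodule.span A {σ} := by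
  refine le_antisymm (sSup_le fun N hN => ?_) (le_sSup (isSimpleModule_span_of_essential h0 h))
  have hN' : IsSimpleModule A N := hN
  have hat := isSimpleModule_iff_isAtom.1 hN'
  have hle := (Submodule.span_singleton_le_iff_mem _ _).2 (h N hat.1)
  rcases hat.le_iff.1 hle with h1 | h1
  · exact absurd (by simpa using h1) h0
  · exact h1.ge

/-- The splitting argument: an indecomposable module with a surjection onto a nonzero projective
module is isomorphic to it. -/
lemma nonempty_equiv_of_surjective (hM : IsIndecomposableModule A M) {P : Type*} [AddCommGroup P]
    [Module A P] [Module.Projective A P] [Nontrivial P] (f : M →ₗ[A] P)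
    (hf : Function.Surjective f) : Nonempty (M ≃ₗ[A] P) := by
  obtain ⟨g, hg⟩ := Module.projective_lifting_property f LinearMap.id hf
  have hc := LinearMap.isCompl_of_proj (p := LinearMap.range g)
    (f := (LinearMap.rangeRestrict g).comp f) (by
      rintro ⟨_, y, rfl⟩
      have := LinearMap.congr_fun hg y
      refine Subtype.ext ?_
      simp only [LinearMap.comp_apply, LinearMap.id_apply] at this
      simp [this])
  rcases hM.2 _ _ hc with h | h
  · obtain ⟨y, hy⟩ := exists_ne (0 : P)
    have h1 : g y ∈ LinearMap.range g := ⟨y, rfl⟩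
    rw [h, Submodule.mem_bot] at h1
    have := LinearMap.congr_fun hg y
    simp only [LinearMap.comp_apply, LinearMap.id_apply, h1, map_zero] at this
    exact absurd this.symm hy
  · refine ⟨LinearEquiv.ofBijective f ⟨(injective_iff_map_eq_zero _).2 fun m hm => ?_, hf⟩⟩
    have : m ∈ LinearMap.ker ((LinearMap.rangeRestrict g).comp f) := by
      rw [LinearMap.mem_ker, LinearMap.comp_apply, hm, map_zero]
    rwa [h, Submodule.mem_bot] at this

end General

/-! ### Projective and simple modules over an algebra of graded matrices -/

namespace MatrixModel

variable {k : Type u} [Field k] {A : Type v} [Ring A] [Algebra k A] {X B : Type}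
  [Fintype X] [DecidableEq X] [DecidableEq B] (S : MatrixModel k A X B)

lemma unit_mul_mul_eps {x y : X} {t : ArrowRing k} (h : t ∈ gr k (S.v x) (S.v y)) (a : A) (z : X) :
    S.unit x y t * a * S.eps z = S.unit x z (t * S.toHom a y z) := by
  rw [← S.unit_mul h (S.mem_gr a y z), ← S.eps_mul_mul_eps, ← mul_assoc, ← mul_assoc,
    S.unit_mul_eps]

/-- The projective module of a vertex: the left ideal of a diagonal matrix unit. -/
abbrev P (w : B × Bool) : Submodule A A := Submodule.span A {S.eps (S.o w)}

/-- The simple module of a vertex: the socle of its projective module. -/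
abbrev L (w : B × Bool) : Submodule A A := Submodule.span A {S.soc w}

lemma mem_P {w : B × Bool} {a : A} : a ∈ S.P w ↔ a * S.eps (S.o w) = a := by
  rw [Submodule.mem_span_singleton]
  constructor
  · rintro ⟨b, rfl⟩
    rw [smul_eq_mul, mul_assoc, S.eps_mul_eps]
  · intro h
    exact ⟨a, h⟩

lemma eps_mem_P (w : B × Bool) : S.eps (S.o w) ∈ S.P w := Submodule.mem_span_singleton_self _

lemma soc_mem_P (w : B × Bool) : S.soc w ∈ S.P w := S.mem_P.2 (S.unit_mul_eps _ _ _)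

lemma exists_entry_ne_zero {w : B × Bool} {a : A} (ha : a ∈ S.P w) (h0 : a ≠ 0) :
    ∃ x, S.toHom a x (S.o w) ≠ 0 := by
  by_contra! hc
  apply h0
  rw [← S.mem_P.1 ha, ← one_mul (a * _), ← S.sum_eps, Finset.sum_mul]
  refine Finset.sum_eq_zero fun x _ => ?_
  rw [← mul_assoc, S.eps_mul_mul_eps, hc, map_zero]

lemma exists_mul_eq_soc {w : B × Bool} {a : A} (ha : a ∈ S.P w) (h0 : a ≠ 0) :
    ∃ b, b * a = S.soc w := by
  obtain ⟨x, hx⟩ := S.exists_entry_ne_zero ha h0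
  obtain ⟨t, ht, hts⟩ := exists_mul_eq_s_of_gr (S.mem_gr a x (S.o w)) hx
  refine ⟨S.unit (S.o w) x t, ?_⟩
  rw [← S.mem_P.1 ha, ← mul_assoc, S.unit_mul_mul_eps ht, hts, soc]

lemma soc_mem_of_le_P {w : B × Bool} {N : Submodule A A} (h : N ≤ S.P w) (h0 : N ≠ ⊥) :
    S.soc w ∈ N := by
  obtain ⟨a, ha, ha0⟩ := N.ne_bot_iff.1 h0
  obtain ⟨b, hb⟩ := S.exists_mul_eq_soc (h ha) ha0
  rw [← hb]
  exact N.smul_mem b ha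

lemma soc_mem_submodule {w : B × Bool} (N : Submodule A (S.P w)) (h0 : N ≠ ⊥) :
    (⟨S.soc w, S.soc_mem_P w⟩ : S.P w) ∈ N := by
  obtain ⟨⟨a, ha⟩, haN, ha0⟩ := N.ne_bot_iff.1 h0
  obtain ⟨b, hb⟩ := S.exists_mul_eq_soc ha fun h => ha0 (Subtype.ext h)
  have := N.smul_mem b haN
  convert this using 1
  exact Subtype.ext hb.symm

instance projective_P (w : B × Bool) : Module.Projective A (S.P w) := by
  refine Module.Projective.of_split (S.P w).subtype
    ((LinearMap.toSpanSingleton A A (S.eps (S.o w))).codRestrict (S.P w) fun a =>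
      Submodule.smul_mem _ a (S.eps_mem_P w)) ?_
  refine LinearMap.ext fun a => Subtype.ext ?_
  exact S.mem_P.1 a.2

instance nontrivial_P (w : B × Bool) : Nontrivial (S.P w) :=
  ⟨⟨⟨_, S.eps_mem_P w⟩, 0, fun h => S.eps_ne_zero _ (congrArg Subtype.val h)⟩⟩

lemma isIndecomposable_of_le_P {w : B × Bool} {N : Submodule A A} (h : N ≤ S.P w) (h0 : N ≠ ⊥) :
    IsIndecomposableModule A N := by
  refine isIndecomposableModule_of_essential (σ := ⟨S.soc w, S.soc_mem_of_le_P h h0⟩)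
    (fun hh => S.soc_ne_zero w (congrArg Subtype.val hh)) fun N' hN' => ?_
  obtain ⟨⟨a, ha⟩, haN, ha0⟩ := N'.ne_bot_iff.1 hN'
  obtain ⟨b, hb⟩ := S.exists_mul_eq_soc (h ha) fun h => ha0 (Subtype.ext h)
  have := N'.smul_mem b haN
  convert this using 1
  exact Subtype.ext hb.symm

lemma isIndecomposable_P (w : B × Bool) : IsIndecomposableModule A (S.P w) :=
  S.isIndecomposable_of_le_P le_rfl
    ((Submodule.ne_bot_iff _).2 ⟨_, S.eps_mem_P w, S.eps_ne_zero _⟩)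

/-- An element `m = ε m` of a module which is not killed by the socle element generates a copy of
the projective module. -/
def equivSpan {M : Type w} [AddCommGroup M] [Module A M] {w : B × Bool} {m : M}
    (hm : S.eps (S.o w) • m = m) (hs : S.soc w • m ≠ 0) : S.P w ≃ₗ[A] Submodule.span A {m} :=
  LinearEquiv.ofBijective
    (((LinearMap.toSpanSingleton A M m).domRestrict (S.P w)).codRestrict (Submodule.span A {m})
      fun a => Submodule.smul_mem _ _ (Submodule.mem_span_singleton_self m)) (by
    constructor
    · rw [injective_iff_map_eq_zero]
      rintro ⟨a, ha⟩ h
      by_contra h0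
      obtain ⟨b, hb⟩ := S.exists_mul_eq_soc ha fun h => h0 (Subtype.ext h)
      apply hs
      have h1 : a • m = 0 := congrArg Subtype.val h
      rw [← hb, mul_smul, h1, smul_zero]
    · rintro ⟨y, hy⟩
      obtain ⟨a, rfl⟩ := Submodule.mem_span_singleton.1 hy
      refine ⟨⟨a * S.eps (S.o w), S.mem_P.2 (by rw [mul_assoc, S.eps_mul_eps])⟩, Subtype.ext ?_⟩
      change (a * S.eps (S.o w)) • m = a • m
      rw [mul_smul, hm])

lemma soc_eq_mul (w : B × Bool) : S.eps (S.o w) * S.soc w = S.soc w := S.eps_mul_unit _ _ _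

lemma isSimple_L (w : B × Bool) : IsSimpleModule A (S.L w) := by
  rw [isSimpleModule_iff_isAtom]
  refine ⟨by simpa using S.soc_ne_zero w, fun N hN => ?_⟩
  by_contra hb
  refine hN.not_ge ((Submodule.span_singleton_le_iff_mem _ _).2 (S.soc_mem_of_le_P (w := w) ?_ hb))
  exact hN.le.trans ((Submodule.span_singleton_le_iff_mem _ _).2 (S.soc_mem_P w))

lemma moduleSocle_P (w : B × Bool) :
    moduleSocle A (S.P w) = Submodule.span A {⟨S.soc w, S.soc_mem_P w⟩} :=
  moduleSocle_of_essential (fun h => S.soc_ne_zero w (congrArg Subtype.val h)) S.soc_mem_submodule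

/-- The socle of a module isomorphic to a projective of a vertex is the simple module of it. -/
lemma nonempty_socle_equiv {M : Type w} [AddCommGroup M] [Module A M] {w : B × Bool}
    (e : S.P w ≃ₗ[A] M) : Nonempty (moduleSocle A M ≃ₗ[A] S.L w) := by
  have h0 : e ⟨S.soc w, S.soc_mem_P w⟩ ≠ 0 := fun h =>
    S.soc_ne_zero w (congrArg Subtype.val (e.map_eq_zero_iff.1 h))
  have h : moduleSocle A M = Submodule.span A {e ⟨S.soc w, S.soc_mem_P w⟩} := by
    refine moduleSocle_of_essential h0 fun N hN => ?_
    have := S.soc_mem_submodule (N.comap e.toLinearMap) fun hb => hN (by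
      rw [eq_bot_iff]
      intro m hm
      have : e.symm m ∈ N.comap e.toLinearMap := by simpa using hm
      rw [hb, Submodule.mem_bot] at this
      simpa using this)
    exact this
  have h1 : (moduleSocle A (S.P w)).map e.toLinearMap = moduleSocle A M := by
    rw [h, moduleSocle_P, Submodule.map_span, Set.image_singleton]
    rfl
  have h2 : (moduleSocle A (S.P w)).map (S.P w).subtype = S.L w := by
    rw [moduleSocle_P, Submodule.map_span, Set.image_singleton]
    rfl
  exact ⟨(LinearEquiv.ofEq _ _ h1).symm ≪≫ₗ (e.submoduleMap _).symm ≪≫ₗ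
    Submodule.equivMapOfInjective _ (Submodule.subtype_injective _) _ ≪≫ₗ LinearEquiv.ofEq _ _ h2⟩

lemma eps_mul_eq_zero_of_mem_L {w w' : B × Bool} (h : w ≠ w') {a : A} (ha : a ∈ S.L w) :
    S.eps (S.o w') * a = 0 := by
  obtain ⟨b, rfl⟩ := Submodule.mem_span_singleton.1 ha
  have h1 : S.soc w = S.eps (S.o w) * S.soc w := (S.soc_eq_mul w).symm
  have hc : (S.toHom b (S.o w') (S.o w)).c1 = 0 := by
    by_contra hc
    have := eq_of_c1_ne_zero (S.mem_gr b (S.o w') (S.o w)) hc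
    rw [S.v_o, S.v_o] at this
    exact h this.symm
  rw [smul_eq_mul, h1, ← mul_assoc, ← mul_assoc, S.eps_mul_mul_eps, soc,
    S.unit_mul (S.mem_gr _ _ _) (s_mem_gr _), mul_s, hc, zero_smul, map_zero]

lemma eq_of_equiv_L {w w' : B × Bool} (e : S.L w ≃ₗ[A] S.L w') : w = w' := by
  by_contra h
  let σ : S.L w' := ⟨S.soc w', Submodule.mem_span_singleton_self _⟩
  have h1 : S.eps (S.o w') • σ = σ := Subtype.ext (S.soc_eq_mul w')
  have h2 : S.eps (S.o w') • e.symm σ = 0 :=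
    Subtype.ext (S.eps_mul_eq_zero_of_mem_L h (e.symm σ).2)
  rw [← map_smul, h1] at h2
  exact S.soc_ne_zero w' (congrArg Subtype.val (e.symm.map_eq_zero_iff.1 h2))

lemma eq_of_equiv_P {w w' : B × Bool} (e : S.P w ≃ₗ[A] S.P w') : w = w' := by
  obtain ⟨f⟩ := S.nonempty_socle_equiv e
  obtain ⟨g⟩ := S.nonempty_socle_equiv (LinearEquiv.refl A (S.P w'))
  exact S.eq_of_equiv_L (f.symm ≪≫ₗ g)

/-- Multiplication by the socle element, as a map from the projective to the simple module. -/
def toL (w : B × Bool) : S.P w →ₗ[A] S.L w :=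
  ((LinearMap.toSpanSingleton A A (S.soc w)).domRestrict (S.P w)).codRestrict (S.L w)
    fun _ => Submodule.smul_mem _ _ (Submodule.mem_span_singleton_self _)

lemma toL_apply (w : B × Bool) (a : S.P w) : (S.toL w a : A) = a.1 * S.soc w := rfl

lemma toL_surjective (w : B × Bool) : Function.Surjective (S.toL w) := by
  rintro ⟨y, hy⟩
  obtain ⟨a, rfl⟩ := Submodule.mem_span_singleton.1 hy
  refine ⟨⟨a * S.eps (S.o w), S.mem_P.2 (by rw [mul_assoc, S.eps_mul_eps])⟩, Subtype.ext ?_⟩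
  rw [toL_apply]
  change a * S.eps (S.o w) * S.soc w = a * S.soc w
  rw [mul_assoc, S.soc_eq_mul]

lemma toL_eq_zero_iff {w : B × Bool} (a : S.P w) :
    S.toL w a = 0 ↔ ∀ x, (S.toHom a.1 x (S.o w)).c1 = 0 := by
  have key : ∀ x, S.eps x * (a.1 * S.soc w) =
      S.unit x (S.o w) ((S.toHom a.1 x (S.o w)).c1 • s k) := fun x => by
    rw [← S.soc_eq_mul, ← mul_assoc, ← mul_assoc, S.eps_mul_mul_eps, soc,
      S.unit_mul (S.mem_gr _ _ _) (s_mem_gr _), mul_s]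
  constructor
  · intro h x
    have h1 : a.1 * S.soc w = 0 := congrArg Subtype.val h
    have h2 := key x
    rw [h1, mul_zero] at h2
    have h3 := S.unit_injective (by
      rw [← mul_s]; exact gr_mul (S.mem_gr _ _ _) (s_mem_gr _)) h2.symm
    simpa using congrArg ArrowRing.cs h3
  · intro h
    refine Subtype.ext ?_
    rw [toL_apply, ← one_mul (a.1 * _), ← S.sum_eps, Finset.sum_mul]
    refine Finset.sum_eq_zero fun x _ => ?_
    rw [key, h, zero_smul, map_zero]

/-- The projective module of a vertex is local: an element outside the kernel of `toL`
generates it. -/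
lemma exists_mul_eq_eps {w : B × Bool} {a : S.P w} (h : S.toL w a ≠ 0) :
    ∃ b, b * a.1 = S.eps (S.o w) := by
  rw [Ne, toL_eq_zero_iff] at h
  push Not at h
  obtain ⟨x, hx⟩ := h
  have hv := eq_of_c1_ne_zero (S.mem_gr _ _ _) hx
  have hm := S.mem_gr a.1 x (S.o w)
  obtain ⟨c, hc⟩ := isUnit_of_c1_ne_zero hx
  rw [hv, S.v_o, gr_self] at hm
  -- the inverse of an even unit is even
  have hc2 : (↑c⁻¹ : ArrowRing k) ∈ part true := by
    have h1 : (c : ArrowRing k) * ↑c⁻¹ = 1 := c.mul_inv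
    rw [← hc] at hm hx
    have h2 := congrArg ArrowRing.cx h1
    have h3 := congrArg ArrowRing.cy h1
    simp only [mul_cx, mul_cy, hm.1, hm.2, zero_mul, add_zero, one_cx, one_cy, mul_eq_zero,
      hx, false_or] at h2 h3
    exact ⟨h2, h3⟩
  refine ⟨S.unit (S.o w) x ↑c⁻¹, ?_⟩
  rw [← S.mem_P.1 a.2, ← mul_assoc, S.unit_mul_mul_eps, ← hc, Units.inv_mul, eps]
  rw [hv, gr_self]
  exact hc2

lemma exists_eps_smul_ne_zero {M : Type w} [AddCommGroup M] [Module A M] {m : M} (h : m ≠ 0) :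
    ∃ x, S.eps x • m ≠ 0 := by
  by_contra! hc
  exact h (by rw [← one_smul A m, ← S.sum_eps, Finset.sum_smul]; simp [hc])

lemma exists_vertex {M : Type w} [AddCommGroup M] [Module A M] {x : X} {m : M}
    (h : S.eps x • m ≠ 0) : S.eps (S.o (S.v x)) • (S.unit (S.o (S.v x)) x 1 • m) =
      S.unit (S.o (S.v x)) x 1 • m ∧ S.unit (S.o (S.v x)) x 1 • m ≠ 0 := by
  refine ⟨by rw [smul_smul, S.eps_mul_unit], fun h0 => h ?_⟩
  have : S.unit x (S.o (S.v x)) 1 * S.unit (S.o (S.v x)) x 1 = S.eps x := by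
    rw [S.unit_mul, one_mul, eps]
    · rw [S.v_o]; exact one_mem_gr _
    · rw [S.v_o]; exact one_mem_gr _
  rw [← this, mul_smul, h0, smul_zero]

/-- The map from the projective module of a vertex given by an element of a module. -/
def fromP {M : Type w} [AddCommGroup M] [Module A M] (w : B × Bool) (m : M) : S.P w →ₗ[A] M :=
  (LinearMap.toSpanSingleton A M m).domRestrict (S.P w)

lemma fromP_apply {M : Type w} [AddCommGroup M] [Module A M] (w : B × Bool) (m : M) (a : S.P w) :
    S.fromP w m a = a.1 • m := rfl

/-- Every simple module is the simple module of a vertex. -/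
lemma exists_equiv_L {M : Type w} [AddCommGroup M] [Module A M] (hM : IsSimpleModule A M) :
    ∃ w, Nonempty (M ≃ₗ[A] S.L w) := by
  have := IsSimpleModule.nontrivial A M
  obtain ⟨m, hm⟩ := exists_ne (0 : M)
  obtain ⟨x, hx⟩ := S.exists_eps_smul_ne_zero hm
  obtain ⟨h1, h2⟩ := S.exists_vertex hx
  set w := S.v x
  set m' := S.unit (S.o w) x 1 • m
  refine ⟨w, ?_⟩
  have hsurj : Function.Surjective (S.fromP w m') := by
    rw [← LinearMap.range_eq_top]
    refine (eq_bot_or_eq_top _).resolve_left fun h => h2 ?_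
    have : S.fromP w m' ⟨_, S.eps_mem_P w⟩ ∈ LinearMap.range (S.fromP w m') := ⟨_, rfl⟩
    rw [h, Submodule.mem_bot, fromP_apply, h1] at this
    exact this
  have hL := S.isSimple_L w
  -- an element killed by the socle element acts nilpotently on `m'`
  have hker : LinearMap.ker (S.toL w) ≤ LinearMap.ker (S.fromP w m') := by
    intro a ha
    rw [LinearMap.mem_ker] at ha ⊢
    by_contra hne
    have htop : Submodule.span A {S.fromP w m' a} = ⊤ :=
      (eq_bot_or_eq_top _).resolve_left (by simpa using hne)
    obtain ⟨b, hb⟩ := Submodule.mem_span_singleton.1 (htop ▸ Submodule.mem_top : m' ∈ _)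
    rw [fromP_apply, smul_smul] at hb
    have hb' : S.unit (S.o w) (S.o w) (S.toHom (b * a.1) (S.o w) (S.o w)) • m' = m' := by
      rw [← S.eps_mul_mul_eps, mul_smul, h1, mul_smul, hb, h1]
    have hc : (S.toHom (b * a.1) (S.o w) (S.o w)).c1 = 0 := by
      have : S.toL w (b • a) = 0 := by rw [map_smul, ha, smul_zero]
      exact (S.toL_eq_zero_iff _).1 this (S.o w)
    have hm := S.mem_gr (b * a.1) (S.o w) (S.o w)
    have hsq : S.unit (S.o w) (S.o w) (S.toHom (b * a.1) (S.o w) (S.o w)) *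
        S.unit (S.o w) (S.o w) (S.toHom (b * a.1) (S.o w) (S.o w)) = 0 := by
      rw [S.unit_mul hm hm]
      rw [gr_self] at hm
      rw [eq_of_mem_part_true hm, hc, zero_smul, zero_add, smul_mul_smul_comm, s_mul_s, smul_zero,
        map_zero]
    apply h2
    rw [← hb', ← hb', smul_smul, hsq, zero_smul]
  have hmax : IsCoatom (LinearMap.ker (S.toL w)) := by
    rw [← isSimpleModule_iff_isCoatom]
    exact IsSimpleModule.congr ((S.toL w).quotKerEquivOfSurjective (S.toL_surjective w))
  have heq : LinearMap.ker (S.toL w) = LinearMap.ker (S.fromP w m') := by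
    refine (hmax.le_iff.1 hker).resolve_left (fun h => h2 ?_) |>.symm
    have : (⟨_, S.eps_mem_P w⟩ : S.P w) ∈ LinearMap.ker (S.fromP w m') := h ▸ Submodule.mem_top
    rw [LinearMap.mem_ker, fromP_apply, h1] at this
    exact this
  exact ⟨((S.fromP w m').quotKerEquivOfSurjective hsurj).symm ≪≫ₗ
    Submodule.quotEquivOfEq _ _ heq.symm ≪≫ₗ
    (S.toL w).quotKerEquivOfSurjective (S.toL_surjective w)⟩

/-- Every indecomposable projective module is the projective module of a vertex. -/
lemma exists_equiv_P {M : Type w} [AddCommGroup M] [Module A M] [Module.Projective A M]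
    (hM : IsIndecomposableModule A M) : ∃ w, Nonempty (M ≃ₗ[A] S.P w) := by
  have := hM.1
  have := S.finiteDimensional
  have : IsNoetherianRing A := isNoetherian_of_tower k inferInstance
  obtain ⟨m, hm⟩ := exists_ne (0 : M)
  -- a projective module has a nonzero functional, whose image has a simple quotient
  obtain ⟨f, hf⟩ : ∃ f : M →ₗ[A] A, f m ≠ 0 := by
    obtain ⟨g, hg⟩ := (Module.projective_def' (R := A) (P := M)).1 inferInstance
    have : g m ≠ 0 := fun h => hm (by
      have := LinearMap.congr_fun hg m
      rw [LinearMap.comp_apply, h, map_zero] at this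
      exact this.symm)
    obtain ⟨i, hi⟩ := Finsupp.ne_iff.1 this
    exact ⟨(Finsupp.lapply i).comp g, hi⟩
  have hnt : Nontrivial (LinearMap.range f) := ⟨⟨⟨f m, m, rfl⟩, 0, fun h => hf (congrArg Subtype.val h)⟩⟩
  obtain ⟨N, hN⟩ := IsCoatomic.exists_coatom (α := Submodule A (LinearMap.range f))
  have hQ := isSimpleModule_iff_isCoatom.2 hN
  obtain ⟨w, ⟨e⟩⟩ := S.exists_equiv_L hQ
  let g : M →ₗ[A] S.L w := e.toLinearMap ∘ₗ N.mkQ ∘ₗ f.rangeRestrict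
  have hg : Function.Surjective g :=
    e.surjective.comp ((Submodule.mkQ_surjective N).comp f.surjective_rangeRestrict)
  obtain ⟨h, hh⟩ := Module.projective_lifting_property (S.toL w) g (S.toL_surjective w)
  refine ⟨w, nonempty_equiv_of_surjective hM h ?_⟩
  obtain ⟨m', hm'⟩ := hg ⟨S.soc w, Submodule.mem_span_singleton_self _⟩
  have h1 : S.toL w (h m') ≠ 0 := by
    rw [← LinearMap.comp_apply, hh, hm']
    exact fun h => S.soc_ne_zero w (congrArg Subtype.val h)
  obtain ⟨b, hb⟩ := S.exists_mul_eq_eps h1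
  intro y
  refine ⟨(y.1 * b) • m', ?_⟩
  refine Subtype.ext ?_
  rw [map_smul]
  change y.1 * b * (h m').1 = y.1
  rw [mul_assoc, hb, S.mem_P.1 y.2]

end MatrixModel

/-! ### Dimensions of the projective and simple modules -/

namespace MatrixModel

variable {k : Type u} [Field k] {A : Type v} [Ring A] [Algebra k A] {X B : Type}
  [Fintype X] [DecidableEq X] [DecidableEq B] (S : MatrixModel k A X B)

/-- A column in the projective module of `w` is the free choice of its admissible entries, and there
are two dimensions of these in each row of the block. -/
lemma finrank_P (w : B × Bool) :
    Module.finrank k (S.P w) = ∑ x, if (S.v x).1 = w.1 then 2 else 0 := by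
  let g : S.P w →ₗ[k] (∀ x, gr k (S.v x) w) :=
    { toFun := fun a x => ⟨S.toHom a.1 x (S.o w), by
        have h := S.mem_gr a.1 x (S.o w)
        rwa [S.v_o] at h⟩
      map_add' := fun a b => by
        funext x
        refine Subtype.ext ?_
        change S.toHom (a.1 + b.1) x (S.o w) = _
        rw [map_add]; rfl
      map_smul' := fun c a => by
        funext x
        refine Subtype.ext ?_
        change S.toHom (c • a.1) x (S.o w) = _
        rw [map_smul]; rfl }
  have hg : Function.Bijective g := by
    constructor
    · rw [injective_iff_map_eq_zero]
      intro a ha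
      by_contra h0
      obtain ⟨x, hx⟩ := S.exists_entry_ne_zero a.2 fun h => h0 (Subtype.ext h)
      exact hx (congrArg Subtype.val (congrFun ha x))
    · intro f
      refine ⟨⟨∑ x, S.unit x (S.o w) (f x).1, Submodule.sum_mem _ fun x _ =>
        S.mem_P.2 (S.unit_mul_eps _ _ _)⟩, ?_⟩
      funext x
      refine Subtype.ext ?_
      change S.toHom (∑ x, S.unit x (S.o w) (f x).1) x (S.o w) = _
      rw [map_sum, Matrix.sum_apply, Finset.sum_eq_single x, S.toHom_unit_of_mem,
        Matrix.single_apply_same]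
      · simp
      · intro z _ hz
        rw [S.toHom_unit, Matrix.single_apply_of_ne _ _ _ _ _ (by simp [hz])]
      · simp
  rw [(LinearEquiv.ofBijective g hg).finrank_eq, Module.finrank_pi_fintype]
  simp_rw [finrank_gr]

lemma unit_s_mem_L {w : B × Bool} {x : X} (hx : S.v x = w) :
    S.unit x (S.o w) (s k) ∈ S.L w := by
  refine Submodule.mem_span_singleton.2 ⟨S.unit x (S.o w) 1, ?_⟩
  rw [smul_eq_mul, soc, S.unit_mul _ (s_mem_gr _), one_mul]
  rw [hx, S.v_o]
  exact one_mem_gr _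

/-- The simple module of `w` has a basis of columns with the single entry `s`, in the rows whose
vertex is `w`. -/
lemma finrank_L (w : B × Bool) :
    Module.finrank k (S.L w) = Fintype.card {x // S.v x = w} := by
  let g : ({x // S.v x = w} → k) →ₗ[k] S.L w :=
    { toFun := fun f => ⟨∑ x, f x • S.unit x.1 (S.o w) (s k), Submodule.sum_mem _ fun x _ =>
        Submodule.smul_of_tower_mem _ _ (S.unit_s_mem_L x.2)⟩
      map_add' := fun a b => Subtype.ext (by
        simp [add_smul, Finset.sum_add_distrib])
      map_smul' := fun c a => Subtype.ext (by
        simp [mul_smul, Finset.smul_sum]) }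
  have hg : Function.Bijective g := by
    constructor
    · rw [injective_iff_map_eq_zero]
      intro f hf
      funext x
      have h1 : ∑ x, f x • S.unit x.1 (S.o w) (s k) = 0 := congrArg Subtype.val hf
      have h2 := congrArg (fun a => (S.toHom a x.1 (S.o w)).cs) h1
      simp only [map_sum, map_smul, map_zero] at h2
      have hs : ∀ z : {x // S.v x = w}, s k ∈ gr k (S.v z.1) (S.v (S.o w)) := fun z => by
        rw [z.2, S.v_o]; exact s_mem_gr _
      rw [Matrix.sum_apply, Finset.sum_eq_single x, S.toHom_unit_of_mem (hs x), Matrix.smul_apply,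
        Matrix.single_apply_same] at h2
      · simpa using h2
      · intro z _ hz
        rw [S.toHom_unit_of_mem (hs z), Matrix.smul_apply, Matrix.single_apply_of_ne, smul_zero]
        simp [Subtype.coe_inj, hz]
      · simp
    · rintro ⟨a, ha⟩
      obtain ⟨b, rfl⟩ := Submodule.mem_span_singleton.1 ha
      refine ⟨fun x => (S.toHom b x.1 (S.o w)).c1, Subtype.ext ?_⟩
      change ∑ x : {x // S.v x = w}, (S.toHom b x.1 (S.o w)).c1 • S.unit x.1 (S.o w) (s k) =
        b * S.soc w
      have key : ∀ x, S.eps x * (b * S.soc w) =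
          (S.toHom b x (S.o w)).c1 • S.unit x (S.o w) (s k) := fun x => by
        rw [← S.soc_eq_mul, ← mul_assoc, ← mul_assoc, S.eps_mul_mul_eps, soc,
          S.unit_mul (S.mem_gr _ _ _) (s_mem_gr _), mul_s, map_smul]
      rw [← one_mul (b * _), ← S.sum_eps, Finset.sum_mul]
      simp_rw [key]
      rw [← Fintype.sum_subtype_add_sum_subtype fun x => S.v x = w, eq_comm, add_eq_left]
      refine Finset.sum_eq_zero fun x _ => ?_
      have : (S.toHom b x.1 (S.o w)).c1 = 0 := by
        by_contra hc
        have := eq_of_c1_ne_zero (S.mem_gr _ _ _) hc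
        exact x.2 (this.trans (S.v_o w))
      rw [this, zero_smul]
  rw [← (LinearEquiv.ofBijective g hg).finrank_eq, Module.finrank_fintype_fun_eq_card]

/-! ### Blocks -/

/-- The central idempotent of a block. -/
def blockIdem (b : B) : A := ∑ x with (S.v x).1 = b, S.eps x

lemma toHom_eps (x : X) : S.toHom (S.eps x) = Matrix.single x x 1 :=
  S.toHom_unit_of_mem (one_mem_gr _)

lemma toHom_blockIdem (b : B) :
    S.toHom (S.blockIdem b) = Matrix.diagonal fun x => if (S.v x).1 = b then 1 else 0 := by
  rw [blockIdem, map_sum]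
  simp_rw [toHom_eps]
  funext i j
  rw [Matrix.sum_apply]
  by_cases hij : i = j
  · subst hij
    simp [Matrix.single_apply]
  · simp only [Matrix.diagonal_apply_ne _ hij]
    refine Finset.sum_eq_zero fun x _ => ?_
    rw [Matrix.single_apply_of_ne]
    rintro ⟨rfl, rfl⟩
    exact hij rfl

lemma toHom_eq_zero {x y : X} (h : (S.v x).1 ≠ (S.v y).1) (a : A) : S.toHom a x y = 0 :=
  eq_zero_of_mem_gr h (S.mem_gr a x y)

lemma blockIdem_mul_comm (b : B) (a : A) : S.blockIdem b * a = a * S.blockIdem b :=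
  S.injective (by
    rw [map_mul, map_mul, toHom_blockIdem]
    funext x y
    rw [Matrix.diagonal_mul, Matrix.mul_diagonal]
    by_cases h : (S.v x).1 = (S.v y).1
    · rw [h, mul_comm]
    · rw [S.toHom_eq_zero h, mul_zero, zero_mul])

lemma blockIdem_mem_center (b : B) : S.blockIdem b ∈ Set.center A :=
  Semigroup.mem_center_iff.2 fun a => (S.blockIdem_mul_comm b a).symm

lemma blockIdem_idem (b : B) : IsIdempotentElem (S.blockIdem b) :=
  S.injective (by
    rw [map_mul, toHom_blockIdem, Matrix.diagonal_mul_diagonal]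
    congr 1
    funext x
    split_ifs <;> simp)

lemma sum_blockIdem [Fintype B] : ∑ b, S.blockIdem b = 1 := by
  rw [← S.sum_eps]
  simp_rw [blockIdem]
  exact Finset.sum_fiberwise _ _ _

lemma blockIdem_mul_eps {b : B} {x : X} (h : (S.v x).1 = b) :
    S.blockIdem b * S.eps x = S.eps x :=
  S.injective (by
    rw [map_mul, toHom_blockIdem, toHom_eps]
    funext i j
    rw [Matrix.diagonal_mul]
    by_cases hi : x = i
    · subst hi; simp [h]
    · rw [Matrix.single_apply_of_ne, mul_zero]
      simp [hi])

lemma blockIdem_mul_eps_of_ne {b : B} {x : X} (h : (S.v x).1 ≠ b) :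
    S.blockIdem b * S.eps x = 0 :=
  S.injective (by
    rw [map_mul, toHom_blockIdem, toHom_eps, map_zero]
    funext i j
    rw [Matrix.diagonal_mul]
    by_cases hi : x = i
    · subst hi; simp [h]
    · rw [Matrix.single_apply_of_ne, mul_zero]
      · rfl
      · simp [hi])

lemma blockIdem_ne_zero (b : B) : S.blockIdem b ≠ 0 := fun h => by
  have := S.blockIdem_mul_eps (b := b) (x := S.o (b, false)) (by rw [S.v_o])
  rw [h, zero_mul] at this
  exact S.eps_ne_zero _ this.symm

/-- A central idempotent is a diagonal matrix with entries `0` and `1`, constant on blocks. -/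
lemma exists_diagonal {f : A} (hf : IsIdempotentElem f) (hc : f ∈ Set.center A) :
    ∃ c : X → ArrowRing k, S.toHom f = Matrix.diagonal c ∧ (∀ x, c x = 0 ∨ c x = 1) ∧
      ∀ x y, (S.v x).1 = (S.v y).1 → c x = c y := by
  have hc' : ∀ a, f * a = a * f := fun a => (Semigroup.mem_center_iff.1 hc a).symm
  have hd : S.toHom f = Matrix.diagonal fun x => S.toHom f x x := by
    funext x y
    by_cases h : x = y
    · subst h; simp
    · rw [Matrix.diagonal_apply_ne _ h]
      have h1 : S.eps x * f * S.eps y = 0 := by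
        rw [mul_assoc, hc', ← mul_assoc, S.eps_mul_eps_of_ne h, zero_mul]
      rw [S.eps_mul_mul_eps] at h1
      exact S.unit_injective (S.mem_gr _ _ _) h1
  have h01 : ∀ x, S.toHom f x x = 0 ∨ S.toHom f x x = 1 := by
    intro x
    have hm := S.mem_gr f x x
    rw [gr_self] at hm
    have h1 : S.toHom f x x * S.toHom f x x = S.toHom f x x := by
      have h2 : S.toHom f * S.toHom f = S.toHom f := by rw [← map_mul, hf.eq]
      have h3 := congrFun (congrFun h2 x) x
      rw [hd, Matrix.diagonal_mul_diagonal, Matrix.diagonal_apply_eq,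
        Matrix.diagonal_apply_eq] at h3
      exact h3
    have h2 := congrArg ArrowRing.c1 h1
    have h3 := congrArg ArrowRing.cs h1
    simp only [mul_c1, mul_cs, hm.1, hm.2, mul_zero, add_zero] at h2 h3
    rcases eq_or_ne (S.toHom f x x).c1 0 with h4 | h4
    · left
      rw [h4, zero_mul, mul_zero, add_zero] at h3
      ext <;> simp [h4, ← h3, hm.1, hm.2]
    · right
      have h5 : (S.toHom f x x).c1 = 1 := by simpa [h4] using h2
      rw [h5, one_mul, mul_one] at h3
      have h6 : (S.toHom f x x).cs = 0 := by simpa using h3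
      ext <;> simp [h5, h6, hm.1, hm.2]
  refine ⟨_, hd, h01, fun x y hxy => ?_⟩
  -- compare the diagonal entries by commuting with a nonzero matrix unit
  obtain ⟨t, ht, ht0⟩ : ∃ t ∈ gr k (S.v x) (S.v y), t ≠ 0 := by
    generalize S.v x = wx at *
    generalize S.v y = wy at *
    obtain ⟨b, c⟩ := wx
    obtain ⟨b', c'⟩ := wy
    obtain rfl : b = b' := hxy
    rw [gr_eq_part]
    cases c <;> cases c'
    · exact ⟨1, one_mem, fun h => one_ne_zero (congrArg ArrowRing.c1 h)⟩
    · exact ⟨_, x_mem, fun h => one_ne_zero (congrArg ArrowRing.cx h)⟩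
    · exact ⟨_, x_mem, fun h => one_ne_zero (congrArg ArrowRing.cx h)⟩
    · exact ⟨1, one_mem, fun h => one_ne_zero (congrArg ArrowRing.c1 h)⟩
  have h1 := congrArg (fun a => S.toHom a x y) (hc' (S.unit x y t))
  simp only [map_mul, S.toHom_unit_of_mem ht] at h1
  rw [hd, Matrix.diagonal_mul, Matrix.mul_diagonal, Matrix.single_apply_same] at h1
  rcases h01 x with h | h <;> rcases h01 y with h' | h' <;> rw [h, h'] at h1 ⊢
  · simp [ht0.symm] at h1
  · simp [ht0] at h1

/-- A central idempotent below the identity of a block is diagonal and constant on the block, hence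
is zero or the whole identity. -/
lemma isBlockIdempotent_blockIdem (b : B) : IsBlockIdempotent (S.blockIdem b) where
  idem := S.blockIdem_idem b
  central := S.blockIdem_mem_center b
  ne_zero := S.blockIdem_ne_zero b
  primitive f hf hc hfb := by
    obtain ⟨c, hd, h01, hcst⟩ := S.exists_diagonal hf hc
    have h0 : ∀ x, (S.v x).1 ≠ b → c x = 0 := fun x hx => by
      have h1 := congrArg S.toHom hfb
      rw [map_mul, hd, toHom_blockIdem, Matrix.diagonal_mul_diagonal] at h1
      have h2 := congrFun (Matrix.diagonal_injective h1) x
      simpa [hx] using h2.symm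
    have hcs : ∀ x, (S.v x).1 = b → c x = c (S.o (b, false)) := fun x hx =>
      hcst _ _ (by rw [S.v_o, hx])
    rcases h01 (S.o (b, false)) with h | h
    · left
      refine S.injective ?_
      rw [hd, map_zero, ← Matrix.diagonal_zero]
      congr 1
      funext x
      by_cases hx : (S.v x).1 = b
      · rw [hcs x hx, h]
      · exact h0 x hx
    · right
      refine S.injective ?_
      rw [hd, toHom_blockIdem]
      congr 1
      funext x
      by_cases hx : (S.v x).1 = b
      · rw [hcs x hx, h, if_pos hx]
      · rw [if_neg hx]; exact h0 x hx

/-- A primitive central idempotent with a nonzero entry at an index is the identity of the block of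
that index. -/
lemma isBlockIdempotent_iff {e : A} : IsBlockIdempotent e ↔ ∃ b, e = S.blockIdem b := by
  refine ⟨fun h => ?_, fun ⟨b, hb⟩ => hb ▸ S.isBlockIdempotent_blockIdem b⟩
  obtain ⟨c, hd, h01, hcst⟩ := S.exists_diagonal h.idem h.central
  obtain ⟨x, hx⟩ : ∃ x, c x ≠ 0 := by
    by_contra! hc
    refine h.ne_zero (S.injective ?_)
    rw [hd, map_zero, ← Matrix.diagonal_zero]
    congr 1
    funext x
    exact hc x
  refine ⟨(S.v x).1, ?_⟩
  refine ((h.primitive _ (S.blockIdem_idem (S.v x).1) (S.blockIdem_mem_center _)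
    (S.injective ?_)).resolve_left (S.blockIdem_ne_zero _)).symm
  rw [map_mul, hd, toHom_blockIdem, Matrix.diagonal_mul_diagonal]
  congr 1
  funext y
  by_cases hy : (S.v y).1 = (S.v x).1
  · rw [hcst _ _ hy, (h01 x).resolve_left hx, mul_one]
  · rw [if_neg hy, zero_mul]

lemma blockIdem_injective : Function.Injective S.blockIdem := fun b b' h => by
  by_contra hne
  have h1 := S.blockIdem_mul_eps (b := b) (x := S.o (b, false)) (by rw [S.v_o])
  rw [h, S.blockIdem_mul_eps_of_ne (by rw [S.v_o]; exact hne)] at h1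
  exact S.eps_ne_zero _ h1.symm

lemma ncard_blockIdempotent (S : MatrixModel k A X B) [Fintype B] :
    {e : A | IsBlockIdempotent e}.ncard = Fintype.card B := by
  have : {e : A | IsBlockIdempotent e} = Set.range S.blockIdem := by
    ext e
    rw [Set.mem_ofPred_eq, S.isBlockIdempotent_iff]
    simp [eq_comm]
  rw [this, ← Set.image_univ, Set.ncard_image_of_injective _ S.blockIdem_injective, Set.ncard_univ,
    Nat.card_eq_fintype_card]

lemma blockIdem_smul_of_mem {b : B} {M : Type w} [AddCommGroup M] [Module A M] {x : X} {m : M}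
    (hm : S.eps x • m = m) (hx : (S.v x).1 = b) (y : Submodule.span A {m}) :
    S.blockIdem b • y = y := by
  obtain ⟨y, hy⟩ := y
  obtain ⟨a, rfl⟩ := Submodule.mem_span_singleton.1 hy
  refine Subtype.ext ?_
  change S.blockIdem b • a • m = a • m
  rw [← hm, smul_smul, smul_smul, S.blockIdem_mul_comm, mul_assoc, S.blockIdem_mul_eps hx, mul_smul]

/-- The projective module of `w` belongs to the block of `w` and to no other, since the
idempotents of the blocks are orthogonal. -/
lemma sameBlock_iff {M M' : Type w} [AddCommGroup M] [Module A M] [AddCommGroup M'] [Module A M']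
    {w w' : B × Bool} (e : S.P w ≃ₗ[A] M) (e' : S.P w' ≃ₗ[A] M') :
    SameBlock A M M' ↔ w.1 = w'.1 := by
  have key : ∀ (w : B × Bool) {M : Type w} [AddCommGroup M] [Module A M] (e : S.P w ≃ₗ[A] M) (b : B),
      (∀ x : M, S.blockIdem b • x = x) ↔ w.1 = b := by
    intro w M _ _ e b
    constructor
    · intro h
      by_contra hne
      have h1 := h (e ⟨_, S.eps_mem_P w⟩)
      rw [← map_smul] at h1
      have h2 : S.blockIdem b * S.eps (S.o w) = S.eps (S.o w) := congrArg Subtype.val (e.injective h1)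
      rw [S.blockIdem_mul_eps_of_ne (by rw [S.v_o]; exact hne)] at h2
      exact S.eps_ne_zero _ h2.symm
    · intro h x
      obtain ⟨y, rfl⟩ := e.surjective x
      rw [← map_smul, S.blockIdem_smul_of_mem (x := S.o w) (S.eps_mul_eps _) (by rw [S.v_o, h])]
  constructor
  · rintro ⟨f, hf, h1, h2⟩
    obtain ⟨b, rfl⟩ := S.isBlockIdempotent_iff.1 hf
    exact ((key w e b).1 h1).trans ((key w' e' b).1 h2).symm
  · intro h
    exact ⟨_, S.isBlockIdempotent_blockIdem w.1, (key w e _).2 rfl, (key w' e' _).2 h.symm⟩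

end MatrixModel

/-! ### Morita equivalence with the corner of a full idempotent -/

/-- An identification of `D` with the corner `e C e` of an idempotent `e` which is full, in the
sense that `C e C = C`. -/
structure FullCorner (k : Type u) [Field k] (C : Type u) [Ring C] [Algebra k C] (D : Type u)
    [Ring D] [Algebra k D] where
  /-- the embedding of `D` into `C`, with `e` the image of `1` -/
  j : D →ₗ[k] C
  map_mul : ∀ a b, j (a * b) = j a * j b
  injective : Function.Injective j
  range : ∀ c, ∃ d, j d = j 1 * c * j 1
  /-- the index set of a decomposition of `1` in `C e C` -/
  ι : Type
  [fin : Fintype ι]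
  /-- the left factors of the decomposition of `1` -/
  l : ι → C
  /-- the right factors of the decomposition of `1` -/
  r : ι → C
  full : ∑ i, l i * j 1 * r i = 1

namespace FullCorner

attribute [instance] FullCorner.fin

variable {k : Type u} [Field k] {C : Type u} [Ring C] [Algebra k C] {D : Type u} [Ring D]
  [Algebra k D] (J : FullCorner k C D)

lemma one_mul_j (d : D) : J.j 1 * J.j d = J.j d := by rw [← J.map_mul, one_mul]

lemma j_mul_one (d : D) : J.j d * J.j 1 = J.j d := by rw [← J.map_mul, mul_one]

/-- The part `e M` of a `C`-module `M`. -/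
def Part (M : Type w) [AddCommGroup M] [Module C M] : AddSubgroup M where
  carrier := {m | J.j 1 • m = m}
  add_mem' {a b} ha hb := by
    rw [Set.mem_ofPred_eq] at *
    rw [smul_add, ha, hb]
  zero_mem' := smul_zero _
  neg_mem' {a} ha := by
    rw [Set.mem_ofPred_eq] at *
    rw [smul_neg, ha]

variable {M : Type w} [AddCommGroup M] [Module C M]

lemma mem_Part {m : M} : m ∈ J.Part M ↔ J.j 1 • m = m := Iff.rfl

lemma j_smul_mem (d : D) (m : M) : J.j d • m ∈ J.Part M := by
  rw [mem_Part, smul_smul, J.one_mul_j]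

instance : Module D (J.Part M) where
  smul d m := ⟨J.j d • m.1, J.j_smul_mem d m.1⟩
  one_smul m := Subtype.ext m.2
  mul_smul a b m := Subtype.ext (by
    change J.j (a * b) • m.1 = J.j a • J.j b • m.1
    rw [J.map_mul, mul_smul])
  smul_zero a := Subtype.ext (smul_zero _)
  smul_add a x y := Subtype.ext (smul_add _ _ _)
  add_smul a b x := Subtype.ext (by
    change J.j (a + b) • x.1 = J.j a • x.1 + J.j b • x.1
    rw [map_add, add_smul])
  zero_smul x := Subtype.ext (by
    change J.j 0 • x.1 = 0
    rw [map_zero, zero_smul])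

lemma coe_smul (d : D) (m : J.Part M) : ((d • m : J.Part M) : M) = J.j d • m.1 := rfl

/-- The restriction of a `C`-linear map to the parts `e M`. -/
def mapPart {M' : Type*} [AddCommGroup M'] [Module C M'] (f : M →ₗ[C] M') :
    J.Part M →ₗ[D] J.Part M' where
  toFun m := ⟨f m.1, by rw [mem_Part, ← map_smul, m.2]⟩
  map_add' a b := Subtype.ext (map_add f _ _)
  map_smul' d m := Subtype.ext (map_smul f _ _)

lemma sum_smul_part (m : M) : ∑ i, J.l i • (J.j 1 • J.r i • m) = m := by
  simp_rw [smul_smul]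
  rw [← Finset.sum_smul]
  simp_rw [← mul_assoc]
  rw [J.full, one_smul]

/-- The extension of a linear map between the parts `e M` to the whole modules. -/
def extend {M' : Type*} [AddCommGroup M'] [Module C M'] (g : J.Part M →ₗ[D] J.Part M') :
    M →ₗ[C] M' where
  toFun m := ∑ i, J.l i • (g ⟨J.j 1 • J.r i • m, J.j_smul_mem 1 _⟩ : M')
  map_add' m m' := by
    rw [← Finset.sum_add_distrib]
    refine Finset.sum_congr rfl fun i _ => ?_
    rw [← smul_add, ← AddSubgroup.coe_add, ← map_add]
    congr 3
    exact Subtype.ext (by simp [smul_add])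
  map_smul' a m := by
    have key : ∀ i, (g ⟨J.j 1 • J.r i • a • m, J.j_smul_mem 1 _⟩ : M') =
        ∑ t, (J.j 1 * J.r i * a * J.l t) • (g ⟨J.j 1 • J.r t • m, J.j_smul_mem 1 _⟩ : M') := by
      intro i
      choose d hd using fun t => J.range (J.r i * a * J.l t)
      have h1 : (⟨J.j 1 • J.r i • a • m, J.j_smul_mem 1 _⟩ : J.Part M) =
          ∑ t, d t • ⟨J.j 1 • J.r t • m, J.j_smul_mem 1 _⟩ := by
        refine Subtype.ext ?_
        rw [AddSubgroup.val_finsetSum]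
        simp_rw [coe_smul, hd]
        conv_lhs => rw [← J.sum_smul_part m]
        simp_rw [Finset.smul_sum]
        refine Finset.sum_congr rfl fun t _ => ?_
        simp_rw [smul_smul, mul_assoc]
        rw [← mul_assoc (J.j 1) (J.j 1), J.j_mul_one]
      rw [h1, map_sum, AddSubgroup.val_finsetSum]
      refine Finset.sum_congr rfl fun t _ => ?_
      rw [map_smul, coe_smul, hd, mul_smul, (g _).2]
      simp only [mul_assoc]
    simp_rw [key, RingHom.id_apply, Finset.smul_sum]
    rw [Finset.sum_comm]
    refine Finset.sum_congr rfl fun t _ => ?_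
    simp_rw [smul_smul]
    rw [← Finset.sum_smul]
    congr 1
    simp_rw [← mul_assoc]
    rw [← Finset.sum_mul, ← Finset.sum_mul, J.full, one_mul]

lemma extend_apply {M' : Type*} [AddCommGroup M'] [Module C M'] (g : J.Part M →ₗ[D] J.Part M')
    (m : J.Part M) : J.extend g m.1 = (g m).1 := by
  change ∑ i, J.l i • (g ⟨J.j 1 • J.r i • m.1, J.j_smul_mem 1 _⟩ : M') = (g m).1
  choose d hd using fun t => J.range (J.r t)
  have h1 : ∀ i, (⟨J.j 1 • J.r i • m.1, J.j_smul_mem 1 _⟩ : J.Part M) = d i • m := fun i =>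
    Subtype.ext (by rw [coe_smul, hd, mul_smul, m.2, mul_smul])
  simp_rw [h1, map_smul, coe_smul, hd, mul_smul, J.mem_Part.1 (g m).2]
  exact J.sum_smul_part _

/-- The functor `M ↦ e M`. -/
def functor : ModuleCat.{u} C ⥤ ModuleCat.{u} D where
  obj M := ModuleCat.of D (J.Part M)
  map f := ModuleCat.ofHom (J.mapPart f.hom)

instance : J.functor.Faithful where
  map_injective {M M'} f g h := by
    ext m
    rw [← J.sum_smul_part m, map_sum, map_sum]
    refine Finset.sum_congr rfl fun i _ => ?_
    rw [(f.hom).map_smul (J.l i), (g.hom).map_smul (J.l i)]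
    congr 1
    have := congrArg (fun φ => (φ.hom ⟨J.j 1 • J.r i • m, J.j_smul_mem 1 _⟩ : J.Part M').1) h
    exact this

instance : J.functor.Full where
  map_surjective {M M'} g := ⟨ModuleCat.ofHom (J.extend g.hom), by
    ext m
    exact Subtype.ext (J.extend_apply g.hom m)⟩

/-- Right multiplication on `e C`. -/
def rmul (c : C) : J.Part C →ₗ[D] J.Part C where
  toFun x := ⟨x.1 * c, by rw [mem_Part, smul_eq_mul, ← mul_assoc, ← smul_eq_mul (J.j 1), x.2]⟩
  map_add' x y := Subtype.ext (add_mul _ _ _)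
  map_smul' d x := Subtype.ext (mul_assoc _ _ _)

/-- For a module `N` over the corner, `Hom(e C, N)` is a `C`-module through right
multiplication. -/
instance (N : Type u) [AddCommGroup N] [Module D N] : Module C (J.Part C →ₗ[D] N) where
  smul c f := LinearMap.comp f (J.rmul c)
  one_smul f := LinearMap.ext fun _ => congrArg f (Subtype.ext (mul_one _))
  mul_smul a b f := LinearMap.ext fun _ => congrArg f (Subtype.ext (mul_assoc _ _ _).symm)
  smul_zero a := LinearMap.ext fun _ => rfl
  smul_add a f g := LinearMap.ext fun _ => rfl
  add_smul a b f := LinearMap.ext fun x => by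
    refine Eq.trans ?_ (map_add f (J.rmul a x) (J.rmul b x))
    exact congrArg f (Subtype.ext (mul_add _ _ _))
  zero_smul f := LinearMap.ext fun x => by
    refine Eq.trans ?_ (map_zero f)
    exact congrArg f (Subtype.ext (mul_zero _))

lemma hom_smul_apply {N : Type u} [AddCommGroup N] [Module D N] (c : C) (f : J.Part C →ₗ[D] N)
    (x : J.Part C) : (c • f) x = f (J.rmul c x) := rfl

lemma j_mem (d : D) : J.j d ∈ J.Part C := J.one_mul_j d

/-- Evaluation at `e` identifies `e Hom(e C, N)` with `N`. -/
def evalOne (N : Type u) [AddCommGroup N] [Module D N] : J.Part (J.Part C →ₗ[D] N) →ₗ[D] N where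
  toFun f := f.1 ⟨J.j 1, J.j_mem 1⟩
  map_add' f g := rfl
  map_smul' d f := by
    rw [coe_smul, hom_smul_apply, RingHom.id_apply, ← map_smul]
    congr 1
    refine Subtype.ext ?_
    change J.j 1 * J.j d = J.j d * J.j 1
    rw [J.one_mul_j, J.j_mul_one]

/-- An element `f` of `e Hom(e C, N)` satisfies `f x = f (x e)`, and `x e` lies in `e C e`, so comes
from some `d` in `D`; hence `f x = d • f e`, and this formula also defines the preimages. -/
lemma evalOne_bijective (N : Type u) [AddCommGroup N] [Module D N] :
    Function.Bijective (J.evalOne N) := by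
  choose d hd using fun x : J.Part C => J.range x.1
  have hd' : ∀ x : J.Part C, J.j (d x) = x.1 * J.j 1 := fun x => by
    rw [hd, ← smul_eq_mul (J.j 1), x.2]
  constructor
  · rw [injective_iff_map_eq_zero]
    intro f hf
    refine Subtype.ext (LinearMap.ext fun x => ?_)
    have h1 := f.2
    rw [mem_Part] at h1
    rw [← h1]
    change f.1 (J.rmul (J.j 1) x) = 0
    have h2 : J.rmul (J.j 1) x = d x • ⟨J.j 1, J.j_mem 1⟩ := Subtype.ext (by
      rw [coe_smul, smul_eq_mul, J.j_mul_one, hd']; rfl)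
    rw [h2, map_smul]
    change d x • J.evalOne N f = 0
    rw [hf, smul_zero]
  · intro n
    let f : J.Part C →ₗ[D] N :=
      { toFun := fun x => d x • n
        map_add' := fun x y => by
          rw [← add_smul]
          congr 1
          apply J.injective
          rw [map_add, hd', hd', hd', AddSubgroup.coe_add, add_mul]
        map_smul' := fun a x => by
          rw [RingHom.id_apply, smul_smul]
          congr 1
          apply J.injective
          rw [J.map_mul, hd', hd', coe_smul, smul_eq_mul, mul_assoc] }
    refine ⟨⟨f, ?_⟩, ?_⟩
    · refine LinearMap.ext fun x => ?_
      change d (J.rmul (J.j 1) x) • n = d x • n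
      congr 1
      apply J.injective
      rw [hd', hd']
      change x.1 * J.j 1 * J.j 1 = _
      rw [mul_assoc, J.j_mul_one]
    · change d ⟨J.j 1, J.j_mem 1⟩ • n = n
      have : d ⟨J.j 1, J.j_mem 1⟩ = 1 := J.injective (by rw [hd', J.j_mul_one])
      rw [this, one_smul]

instance : J.functor.EssSurj where
  mem_essImage N := ⟨ModuleCat.of C (J.Part C →ₗ[D] N),
    ⟨(LinearEquiv.ofBijective (J.evalOne N) (J.evalOne_bijective N)).toModuleIso⟩⟩

instance : J.functor.IsEquivalence where

open scoped ModuleCat.Algebra in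
instance : J.functor.Linear k where
  map_smul {M M'} f c := by
    ext m
    refine Subtype.ext ?_
    change algebraMap k C c • f.hom m.1 = J.j (algebraMap k D c) • f.hom m.1
    rw [Algebra.algebraMap_eq_smul_one c, Algebra.algebraMap_eq_smul_one c, map_smul,
      ← mul_one (c • (1 : C)), smul_mul_assoc, one_mul,
      ← (J.mem_Part.1 (J.mapPart f.hom m).2 : J.j 1 • f.hom m.1 = f.hom m.1), smul_smul, smul_smul,
      smul_mul_assoc, one_mul, smul_mul_assoc, J.j_mul_one]

lemma isMoritaEquivalent (J : FullCorner k C D) : IsMoritaEquivalent k C D :=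
  ⟨⟨{ eqv := J.functor.asEquivalence
      linear := inferInstanceAs (J.functor.Linear k) }⟩⟩

end FullCorner

/-! ### The algebra `Λ` as an algebra of graded matrices -/

/-- A subspace of an algebra is everything if it contains `1` and is stable under left
multiplication by a set of generators. -/
lemma eq_top_of_generators {k : Type u} [Field k] {G : Type} {A : Type u} [Ring A] [Algebra k A]
    (π : FreeAlgebra k G →ₐ[k] A) (hπ : Function.Surjective π) (W : Submodule k A) (h1 : 1 ∈ W)
    (h : ∀ g, ∀ z ∈ W, π (FreeAlgebra.ι k g) * z ∈ W) : W = ⊤ := by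
  have key : ∀ a : FreeAlgebra k G, ∀ z ∈ W, π a * z ∈ W := by
    intro a
    induction a using FreeAlgebra.induction with
    | grade0 c =>
      intro z hz
      rw [AlgHom.commutes, ← Algebra.smul_def]
      exact W.smul_mem c hz
    | grade1 g => exact h g
    | mul a b ha hb =>
      intro z hz
      rw [map_mul, mul_assoc]
      exact ha _ (hb _ hz)
    | add a b ha hb =>
      intro z hz
      rw [map_add, add_mul]
      exact W.add_mem (ha _ hz) (hb _ hz)
  rw [eq_top_iff]
  intro y _
  obtain ⟨a, rfl⟩ := hπ y
  rw [← mul_one (π a)]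
  exact key a 1 h1

section Lambda

variable {k : Type u} [Field k]

/-- The quotient map onto `Λ`. -/
def lamMk (k : Type u) [Field k] : FreeAlgebra k QGen →ₐ[k] BasicLambda k :=
  RingQuot.mkAlgHom k (QRel k)

lemma lamMk_surjective : Function.Surjective (lamMk k) := RingQuot.mkAlgHom_surjective k (QRel k)

/-- A generator of `Λ`. -/
def lam (k : Type u) [Field k] (g : QGen) : BasicLambda k := lamMk k (FreeAlgebra.ι k g)

lemma lamMk_ι (g : QGen) : lamMk k (FreeAlgebra.ι k g) = lam k g := rfl

lemma lam_rel {a b : FreeAlgebra k QGen} (h : QRel k a b) : lamMk k a = lamMk k b :=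
  RingQuot.mkAlgHom_rel k h

open QGen

lemma lam_e1_e1 : lam k e1 * lam k e1 = lam k e1 := by
  simpa only [map_mul, lamMk_ι] using lam_rel (k := k) .e1_idem
lemma lam_e2_e2 : lam k e2 * lam k e2 = lam k e2 := by
  simpa only [map_mul, lamMk_ι] using lam_rel (k := k) .e2_idem
lemma lam_e1_e2 : lam k e1 * lam k e2 = 0 := by
  simpa only [map_mul, map_zero, lamMk_ι] using lam_rel (k := k) .e1_e2
lemma lam_e2_e1 : lam k e2 * lam k e1 = 0 := by
  simpa only [map_mul, map_zero, lamMk_ι] using lam_rel (k := k) .e2_e1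
lemma lam_e_sum : lam k e1 + lam k e2 = 1 := by
  simpa only [map_add, map_one, lamMk_ι] using lam_rel (k := k) .e_sum
lemma lam_x1_path : lam k e1 * lam k x1 * lam k e2 = lam k x1 := by
  simpa only [map_mul, lamMk_ι] using lam_rel (k := k) .x1_path
lemma lam_y1_path : lam k e1 * lam k y1 * lam k e2 = lam k y1 := by
  simpa only [map_mul, lamMk_ι] using lam_rel (k := k) .y1_path
lemma lam_x2_path : lam k e2 * lam k x2 * lam k e1 = lam k x2 := by
  simpa only [map_mul, lamMk_ι] using lam_rel (k := k) .x2_path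
lemma lam_y2_path : lam k e2 * lam k y2 * lam k e1 = lam k y2 := by
  simpa only [map_mul, lamMk_ι] using lam_rel (k := k) .y2_path
lemma lam_x1_x2 : lam k y1 * lam k y2 = lam k x1 * lam k x2 := by
  simpa only [map_mul, lamMk_ι] using (lam_rel (k := k) .x1_x2).symm
lemma lam_x2_x1 : lam k y2 * lam k y1 = lam k x2 * lam k x1 := by
  simpa only [map_mul, lamMk_ι] using (lam_rel (k := k) .x2_x1).symm
lemma lam_x1_y2 : lam k x1 * lam k y2 = 0 := by
  simpa only [map_mul, map_zero, lamMk_ι] using lam_rel (k := k) .x1_y2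
lemma lam_x2_y1 : lam k x2 * lam k y1 = 0 := by
  simpa only [map_mul, map_zero, lamMk_ι] using lam_rel (k := k) .x2_y1
lemma lam_y1_x2 : lam k y1 * lam k x2 = 0 := by
  simpa only [map_mul, map_zero, lamMk_ι] using lam_rel (k := k) .y1_x2
lemma lam_y2_x1 : lam k y2 * lam k x1 = 0 := by
  simpa only [map_mul, map_zero, lamMk_ι] using lam_rel (k := k) .y2_x1

/-- The source vertex of a generator. -/
def QGen.src : QGen → QGen
  | e1 | x1 | y1 => e1
  | e2 | x2 | y2 => e2

/-- The target vertex of a generator. -/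
def QGen.tgt : QGen → QGen
  | e1 | x2 | y2 => e1
  | e2 | x1 | y1 => e2

lemma lam_src (g : QGen) : lam k g.src * lam k g = lam k g := by
  cases g <;> simp only [QGen.src]
  · exact lam_e1_e1
  · exact lam_e2_e2
  · rw [← lam_x1_path, ← mul_assoc, ← mul_assoc, lam_e1_e1]
  · rw [← lam_y1_path, ← mul_assoc, ← mul_assoc, lam_e1_e1]
  · rw [← lam_x2_path, ← mul_assoc, ← mul_assoc, lam_e2_e2]
  · rw [← lam_y2_path, ← mul_assoc, ← mul_assoc, lam_e2_e2]

lemma lam_tgt (g : QGen) : lam k g * lam k g.tgt = lam k g := by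
  cases g <;> simp only [QGen.tgt]
  · exact lam_e1_e1
  · exact lam_e2_e2
  · rw [← lam_x1_path, mul_assoc, lam_e2_e2]
  · rw [← lam_y1_path, mul_assoc, lam_e2_e2]
  · rw [← lam_x2_path, mul_assoc, lam_e1_e1]
  · rw [← lam_y2_path, mul_assoc, lam_e1_e1]

lemma lam_mul_of_ne {g h : QGen} (hne : g.tgt ≠ h.src) : lam k g * lam k h = 0 := by
  have h0 : lam k g.tgt * lam k h.src = 0 := by
    cases g <;> cases h <;> simp only [QGen.src, QGen.tgt, ne_eq, not_true_eq_false] at hne ⊢ <;>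
      first | exact lam_e1_e2 | exact lam_e2_e1
  rw [← lam_tgt g, ← lam_src h, mul_assoc, ← mul_assoc (lam k g.tgt), h0, zero_mul, mul_zero]

/-- The eight paths which form a basis of `Λ`. -/
def lamBasis (k : Type u) [Field k] : Fin 8 → BasicLambda k :=
  ![lam k e1, lam k e2, lam k x1, lam k y1, lam k x2, lam k y2, lam k x1 * lam k x2,
    lam k x2 * lam k x1]

/-- Products of two generators of `Λ` are paths of the basis, equal to one by a relation, or zero. -/
lemma lam_mul_mem (g h : QGen) :
    lam k g * lam k h ∈ Submodule.span k (Set.range (lamBasis k)) := by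
  have hb : ∀ i, lamBasis k i ∈ Submodule.span k (Set.range (lamBasis k)) := fun i =>
    Submodule.subset_span ⟨i, rfl⟩
  by_cases hgh : g.tgt = h.src
  · have hl : ∀ h : QGen, lam k h ∈ Submodule.span k (Set.range (lamBasis k)) := by
      intro h
      cases h
      · exact hb 0
      · exact hb 1
      · exact hb 2
      · exact hb 3
      · exact hb 4
      · exact hb 5
    by_cases h1 : g = h.src
    · rw [h1, lam_src]; exact hl h
    by_cases h2 : h = g.tgt
    · rw [h2, lam_tgt]; exact hl g
    cases g <;> cases h <;>
      simp only [QGen.src, QGen.tgt, reduceCtorEq, not_true_eq_false] at hgh h1 h2 <;>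
      first
      | exact hb 6
      | exact hb 7
      | exact lam_x1_x2 (k := k) ▸ hb 6
      | exact lam_x2_x1 (k := k) ▸ hb 7
      | (rw [lam_x1_y2]; exact zero_mem _)
      | (rw [lam_x2_y1]; exact zero_mem _)
      | (rw [lam_y1_x2]; exact zero_mem _)
      | (rw [lam_y2_x1]; exact zero_mem _)
  · rw [lam_mul_of_ne hgh]
    exact zero_mem _

/-- The span of the paths is a left ideal containing `1`. -/
lemma span_lamBasis : Submodule.span k (Set.range (lamBasis k)) = ⊤ := by
  have hb : ∀ i, lamBasis k i ∈ Submodule.span k (Set.range (lamBasis k)) := fun i =>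
    Submodule.subset_span ⟨i, rfl⟩
  refine eq_top_of_generators (lamMk k) lamMk_surjective _ ?_ ?_
  · rw [← lam_e_sum]
    exact add_mem (hb 0) (hb 1)
  · intro g z hz
    rw [lamMk_ι]
    induction hz using Submodule.span_induction with
    | zero => rw [mul_zero]; exact zero_mem _
    | add x y _ _ hx hy => rw [mul_add]; exact add_mem hx hy
    | smul c x _ hx => rw [mul_smul_comm]; exact Submodule.smul_mem _ c hx
    | mem x hx =>
      obtain ⟨i, rfl⟩ := hx
      -- paths of length three vanish
      have h6 : lam k g * (lam k x1 * lam k x2) ∈ Submodule.span k (Set.range (lamBasis k)) := by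
        by_cases hg : g.tgt = e1
        · cases g <;> simp only [QGen.tgt, reduceCtorEq] at hg
          · rw [← mul_assoc, show lam k e1 * lam k x1 = _ from lam_src x1]; exact hb 6
          · rw [← lam_x1_x2, ← mul_assoc, lam_x2_y1, zero_mul]; exact zero_mem _
          · rw [← mul_assoc, lam_y2_x1, zero_mul]; exact zero_mem _
        · rw [← mul_assoc, lam_mul_of_ne hg, zero_mul]; exact zero_mem _
      have h7 : lam k g * (lam k x2 * lam k x1) ∈ Submodule.span k (Set.range (lamBasis k)) := by
        by_cases hg : g.tgt = e2
        · cases g <;> simp only [QGen.tgt, reduceCtorEq] at hg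
          · rw [← mul_assoc, show lam k e2 * lam k x2 = _ from lam_src x2]; exact hb 7
          · rw [← lam_x2_x1, ← mul_assoc, lam_x1_y2, zero_mul]; exact zero_mem _
          · rw [← mul_assoc, lam_y1_x2, zero_mul]; exact zero_mem _
        · rw [← mul_assoc, lam_mul_of_ne hg, zero_mul]; exact zero_mem _
      fin_cases i
      · exact lam_mul_mem g e1
      · exact lam_mul_mem g e2
      · exact lam_mul_mem g x1
      · exact lam_mul_mem g y1
      · exact lam_mul_mem g x2
      · exact lam_mul_mem g y2
      · exact h6
      · exact h7

/-- The matrices representing the generators of `Λ`. -/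
def lamMatrix (k : Type u) [Field k] : QGen → Matrix Bool Bool (ArrowRing k)
  | e1 => Matrix.single false false 1
  | e2 => Matrix.single true true 1
  | x1 => Matrix.single false true (x k)
  | y1 => Matrix.single false true (y k)
  | x2 => Matrix.single true false (x k)
  | y2 => Matrix.single true false (y k)

/-- The representation of `Λ` by graded `2 × 2` matrices. -/
def lamHom (k : Type u) [Field k] : BasicLambda k →ₐ[k] Matrix Bool Bool (ArrowRing k) :=
  RingQuot.liftAlgHom k ⟨FreeAlgebra.lift k (lamMatrix k), by
    intro a b h
    cases h <;> simp only [map_mul, map_add, map_zero, map_one, FreeAlgebra.lift_ι_apply,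
      lamMatrix, Matrix.single_mul_single_same, one_mul, mul_one, x_mul_x, y_mul_y, x_mul_y, y_mul_x,
      Matrix.single_zero]
    · exact Matrix.single_mul_single_of_ne _ _ _ _ (by decide) _
    · exact Matrix.single_mul_single_of_ne _ _ _ _ (by decide) _
    · funext i j
      cases i <;> cases j <;> simp⟩

lemma lamHom_lam (g : QGen) : lamHom k (lam k g) = lamMatrix k g := by
  refine (RingQuot.liftAlgHom_mkAlgHom_apply k _ _ _).trans ?_
  rw [FreeAlgebra.lift_ι_apply]

lemma lamHom_injective : Function.Injective (lamHom k) := by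
  rw [injective_iff_map_eq_zero]
  intro a ha
  have hmem : a ∈ Submodule.span k (Set.range (lamBasis k)) := by
    rw [span_lamBasis]; exact Submodule.mem_top
  obtain ⟨c, rfl⟩ := (Submodule.mem_span_range_iff_exists_fun k).1 hmem
  rw [Fin.sum_univ_eight] at ha ⊢
  simp only [lamBasis, Matrix.cons_val, map_add, map_smul, map_mul, lamHom_lam, lamMatrix,
    Matrix.single_mul_single_same, x_mul_x] at ha
  have h00 := congrFun (congrFun ha false) false
  have h01 := congrFun (congrFun ha false) true
  have h10 := congrFun (congrFun ha true) false
  have h11 := congrFun (congrFun ha true) true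
  simp [ArrowRing.ext_iff] at h00 h01 h10 h11
  simp [h00, h01, h10, h11]

/-- The presentation of `Λ` as an algebra of graded `2 × 2` matrices. -/
def lamModel (k : Type u) [Field k] : MatrixModel k (BasicLambda k) Bool Unit where
  v c := ((), c)
  o w := w.2
  v_o _ := rfl
  toHom := lamHom k
  injective := lamHom_injective
  mem_gr a := by
    have hmem : a ∈ Submodule.span k (Set.range (lamBasis k)) := by
      rw [span_lamBasis]; exact Submodule.mem_top
    induction hmem using Submodule.span_induction with
    | zero => intro i j; rw [map_zero]; exact zero_mem _
    | add x y _ _ hx hy => intro i j; rw [map_add]; exact add_mem (hx i j) (hy i j)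
    | smul c x _ hx => intro i j; rw [map_smul]; exact Submodule.smul_mem _ c (hx i j)
    | mem x hx =>
      obtain ⟨t, rfl⟩ := hx
      intro i j
      rw [gr_eq_part]
      fin_cases t <;> cases i <;> cases j <;>
        simp [lamBasis, lamHom_lam, lamMatrix, x_mul_x, mem_part_true,
          mem_part_false]
  surj m hm := by
    refine ⟨(m false false).c1 • lam k e1 + (m true true).c1 • lam k e2 +
      (m false true).cx • lam k x1 + (m false true).cy • lam k y1 +
      (m true false).cx • lam k x2 + (m true false).cy • lam k y2 +
      (m false false).cs • (lam k x1 * lam k x2) + (m true true).cs • (lam k x2 * lam k x1), ?_⟩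
    simp only [map_add, map_smul, map_mul, lamHom_lam, lamMatrix, Matrix.single_mul_single_same,
      x_mul_x]
    have h00 := hm false false
    have h01 := hm false true
    have h10 := hm true false
    have h11 := hm true true
    simp only [gr_eq_part] at h00 h01 h10 h11
    funext i j
    cases i <;> cases j
    · rw [eq_of_mem_part_true h00]; simp
    · rw [eq_of_mem_part_false h01]; simp
    · rw [eq_of_mem_part_false h10]; simp
    · rw [eq_of_mem_part_true h11]; simp

/-- The quotient of `Λ` by the arrows. -/
def lamTop (k : Type u) [Field k] : BasicLambda k →ₐ[k] (Fin 2 → k) where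
  toFun a := ![(lamHom k a false false).c1, (lamHom k a true true).c1]
  map_one' := by ext i; fin_cases i <;> simp
  map_mul' a b := by
    have h01 := (lamModel k).mem_gr a false true
    have h10 := (lamModel k).mem_gr a true false
    change lamHom k a false true ∈ gr k ((), false) ((), true) at h01
    change lamHom k a true false ∈ gr k ((), true) ((), false) at h10
    rw [gr_eq_part] at h01 h10
    ext i
    fin_cases i
    · simp [Matrix.mul_apply, h01.1]
    · simp [Matrix.mul_apply, h10.1]
  map_zero' := by ext i; fin_cases i <;> simp
  map_add' a b := by ext i; fin_cases i <;> simp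
  commutes' c := by
    ext i
    fin_cases i <;> simp [Matrix.algebraMap_matrix_apply, ArrowRing.algebraMap_eq]

lemma lamTop_surjective : Function.Surjective (lamTop k) := by
  intro f
  refine ⟨f 0 • lam k e1 + f 1 • lam k e2, ?_⟩
  ext i
  fin_cases i <;> simp [lamTop, lamHom_lam, lamMatrix]

/-- The arrows generate a nilpotent ideal. -/
lemma lamTop_pow_three {a : BasicLambda k} (h : lamTop k a = 0) : a ^ 3 = 0 := by
  have h0 : (lamHom k a false false).c1 = 0 := congrFun h 0
  have h1 : (lamHom k a true true).c1 = 0 := congrFun h 1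
  have hm := (lamModel k).mem_gr a
  have h00 := hm false false
  have h01 := hm false true
  have h10 := hm true false
  have h11 := hm true true
  change lamHom k a false false ∈ gr k ((), false) ((), false) at h00
  change lamHom k a false true ∈ gr k ((), false) ((), true) at h01
  change lamHom k a true false ∈ gr k ((), true) ((), false) at h10
  change lamHom k a true true ∈ gr k ((), true) ((), true) at h11
  rw [gr_eq_part] at h00 h01 h10 h11
  have e01 : (lamHom k a false true).c1 = 0 := h01.1
  have e10 : (lamHom k a true false).c1 = 0 := h10.1
  refine lamHom_injective ?_
  rw [map_pow, map_zero, pow_succ, pow_two]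
  funext i j
  cases i <;> cases j <;> (simp only [Matrix.mul_apply, Fintype.sum_bool]; ext) <;>
    simp [h0, h1, e01, e10, h00.1, h00.2, h11.1, h11.2]

/-- The kernel of the projection of `Λ` to `k × k` is nilpotent and the quotient semisimple, so the
kernel is the Jacobson radical. -/
lemma ker_lamTop : RingHom.ker (lamTop k) = Ring.jacobson (BasicLambda k) := by
  apply le_antisymm
  · intro a ha
    rw [← Ideal.jacobson_bot, Ideal.mem_jacobson_iff]
    intro y
    refine ⟨1 - y * a + (y * a) ^ 2, ?_⟩
    have h3 : (y * a) ^ 3 = 0 := lamTop_pow_three (by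
      rw [map_mul, (RingHom.mem_ker.1 ha : lamTop k a = 0), mul_zero])
    have : (1 - y * a + (y * a) ^ 2) * y * a + (1 - y * a + (y * a) ^ 2) - 1 = (y * a) ^ 3 := by
      rw [mul_assoc _ y a]
      noncomm_ring
    rw [this, h3]
    exact zero_mem _
  · intro a ha
    rw [RingHom.mem_ker]
    funext i
    have hs : Function.Surjective ((Pi.evalRingHom (fun _ : Fin 2 => k) i).comp
        (lamTop k : BasicLambda k →+* (Fin 2 → k))) :=
      (Function.surjective_eval i).comp lamTop_surjective
    have := RingHom.ker_isMaximal_of_surjective _ hs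
    exact Ring.jacobson_le_of_isMaximal (RingHom.ker ((Pi.evalRingHom (fun _ : Fin 2 => k) i).comp
        (lamTop k : BasicLambda k →+* (Fin 2 → k)))) ha

lemma isBasicAlgebra_lambda : IsBasicAlgebra k (BasicLambda k) := by
  refine ⟨(lamModel k).finiteDimensional, 2, ⟨?_⟩⟩
  exact (Ideal.quotientEquivAlgOfEq k ker_lamTop.symm).trans
    (Ideal.quotientKerAlgEquivOfSurjective lamTop_surjective)

end Lambda

/-! ### The Morita class of a block -/

namespace MatrixModel

section Corner

variable {k : Type u} [Field k] {A : Type v} [Ring A] [Algebra k A] {X B : Type}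
  [Fintype X] [DecidableEq X] [DecidableEq B] (S : MatrixModel k A X B)

/-- The representation of a block by the matrices indexed by its indices. -/
def cornerHom (b : B) (he : IsIdempotentElem (S.blockIdem b)) :
    he.Corner →ₐ[k] Matrix {x // (S.v x).1 = b} {x // (S.v x).1 = b} (ArrowRing k) where
  toFun a := (S.toHom a.1).submatrix Subtype.val Subtype.val
  map_one' := by
    change (S.toHom (S.blockIdem b)).submatrix Subtype.val Subtype.val = 1
    rw [toHom_blockIdem]
    funext i j
    rw [Matrix.submatrix_apply, Matrix.diagonal_apply, Matrix.one_apply]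
    simp only [Subtype.coe_inj, i.2, if_true]
  map_mul' a c := by
    change (S.toHom (a.1 * c.1)).submatrix Subtype.val Subtype.val = _
    rw [map_mul]
    funext i j
    rw [Matrix.submatrix_apply, Matrix.mul_apply, Matrix.mul_apply,
      ← Fintype.sum_subtype_add_sum_subtype fun x => (S.v x).1 = b]
    refine add_eq_left.2 (Finset.sum_eq_zero fun x _ => ?_)
    rw [S.toHom_eq_zero (by rw [i.2]; exact fun h => x.2 h.symm), zero_mul]
  map_zero' := by
    change (S.toHom 0).submatrix Subtype.val Subtype.val = 0
    rw [map_zero]; rfl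
  map_add' a c := by
    change (S.toHom (a.1 + c.1)).submatrix Subtype.val Subtype.val = _
    rw [map_add]; rfl
  commutes' c := by
    change (S.toHom (c • S.blockIdem b)).submatrix Subtype.val Subtype.val = _
    rw [map_smul, toHom_blockIdem]
    funext i j
    rw [Matrix.submatrix_apply, Matrix.smul_apply, Matrix.diagonal_apply,
      Matrix.algebraMap_matrix_apply, Algebra.algebraMap_eq_smul_one]
    simp only [Subtype.coe_inj, i.2, if_true, smul_ite, smul_zero]

/-- The presentation of a block by graded matrices. -/
def cornerModel (b : B) (he : IsIdempotentElem (S.blockIdem b)) :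
    MatrixModel k he.Corner {x // (S.v x).1 = b} Unit where
  v x := ((), (S.v x.1).2)
  o w := ⟨S.o (b, w.2), by rw [S.v_o]⟩
  v_o w := by rw [S.v_o]
  toHom := S.cornerHom b he
  injective := by
    rw [injective_iff_map_eq_zero]
    intro a ha
    refine Subtype.ext (S.injective ?_)
    rw [← ((Subsemigroup.mem_corner_iff he).1 a.2).1, map_mul, toHom_blockIdem]
    change _ = S.toHom 0
    rw [map_zero]
    funext x y
    rw [Matrix.diagonal_mul, Matrix.zero_apply]
    by_cases hx : (S.v x).1 = b
    · by_cases hy : (S.v y).1 = b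
      · have : S.toHom a.1 x y = 0 := congrFun (congrFun ha ⟨x, hx⟩) ⟨y, hy⟩
        rw [this, mul_zero]
      · rw [S.toHom_eq_zero (by rw [hx]; exact fun h => hy h.symm), mul_zero]
    · rw [if_neg hx, zero_mul]
  mem_gr a x y := by
    have h := S.mem_gr a.1 x.1 y.1
    unfold gr at h ⊢
    rw [if_pos (by rw [x.2, y.2])] at h
    exact h
  surj m hm := by
    let m' : Matrix X X (ArrowRing k) := fun x y =>
      if h : (S.v x).1 = b ∧ (S.v y).1 = b then m ⟨x, h.1⟩ ⟨y, h.2⟩ else 0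
    obtain ⟨a, ha⟩ := S.surj m' (by
        intro x y
        change (if h : (S.v x).1 = b ∧ (S.v y).1 = b then m ⟨x, h.1⟩ ⟨y, h.2⟩ else 0) ∈ _
        split_ifs with h
        · have := hm ⟨x, h.1⟩ ⟨y, h.2⟩
          unfold gr at this ⊢
          rw [if_pos (by rw [h.1, h.2])]
          exact this
        · exact zero_mem _)
    have hmem : a ∈ Subsemigroup.corner (S.blockIdem b) := by
      rw [Subsemigroup.mem_corner_iff he, ← S.blockIdem_mul_comm, and_self]
      refine S.injective ?_
      rw [map_mul, toHom_blockIdem, ha]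
      funext x y
      rw [Matrix.diagonal_mul]
      by_cases hx : (S.v x).1 = b
      · rw [if_pos hx, one_mul]
      · rw [if_neg hx, zero_mul]
        have : m' x y = 0 := dif_neg fun h => hx h.1
        exact this.symm
    refine ⟨⟨a, hmem⟩, ?_⟩
    funext x y
    change S.toHom a x.1 y.1 = _
    rw [ha]
    exact dif_pos ⟨x.2, y.2⟩

end Corner

section Morita

variable {k : Type u} [Field k] {C : Type u} [Ring C] [Algebra k C] {X : Type}
  [Fintype X] [DecidableEq X] (S : MatrixModel k C X Unit)

/-- The inclusion of `Λ` as the corner given by the two chosen indices. -/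
def lamIncl : BasicLambda k →ₗ[k] C :=
  ∑ c, ∑ d, S.unit (S.o ((), c)) (S.o ((), d)) ∘ₗ
    (LinearMap.proj d ∘ₗ LinearMap.proj c ∘ₗ (lamHom k).toLinearMap :
      BasicLambda k →ₗ[k] ArrowRing k)

lemma lamIncl_apply (a : BasicLambda k) :
    S.lamIncl a = ∑ c, ∑ d, S.unit (S.o ((), c)) (S.o ((), d)) (lamHom k a c d) := by
  simp only [lamIncl, LinearMap.sum_apply]
  rfl

lemma o_ne {c d : Bool} (h : c ≠ d) : S.o ((), c) ≠ S.o ((), d) := fun he => h (by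
  have := congrArg (fun x => (S.v x).2) he
  simpa only [S.v_o] using this)

lemma lamHom_mem_gr (a : BasicLambda k) (c d : Bool) :
    lamHom k a c d ∈ gr k (S.v (S.o ((), c))) (S.v (S.o ((), d))) := by
  rw [S.v_o, S.v_o]
  exact (lamModel k).mem_gr a c d

lemma lamIncl_mul (a b : BasicLambda k) : S.lamIncl (a * b) = S.lamIncl a * S.lamIncl b := by
  simp only [lamIncl_apply, map_mul, Matrix.mul_apply, map_sum]
  rw [Finset.sum_mul]
  refine Finset.sum_congr rfl fun c _ => ?_
  rw [Finset.sum_mul, Finset.sum_comm]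
  refine Finset.sum_congr rfl fun d _ => ?_
  symm
  rw [Finset.mul_sum, Finset.sum_eq_single d, Finset.mul_sum]
  · refine Finset.sum_congr rfl fun e _ => ?_
    rw [S.unit_mul (S.lamHom_mem_gr a c d) (S.lamHom_mem_gr b d e)]
  · intro d' _ hd
    rw [Finset.mul_sum]
    exact Finset.sum_eq_zero fun e _ => S.unit_mul_of_ne (S.o_ne hd.symm) _ _
  · simp

lemma lamIncl_one : S.lamIncl 1 = ∑ c, S.eps (S.o ((), c)) := by
  rw [lamIncl_apply]
  refine Finset.sum_congr rfl fun c _ => ?_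
  rw [Finset.sum_eq_single c, map_one, Matrix.one_apply_eq, eps]
  · intro d _ hd
    rw [map_one, Matrix.one_apply_ne hd.symm, map_zero]
  · simp

lemma lamIncl_one_mul_mul (a : C) : S.lamIncl 1 * a * S.lamIncl 1 =
    ∑ c, ∑ d, S.unit (S.o ((), c)) (S.o ((), d)) (S.toHom a (S.o ((), c)) (S.o ((), d))) := by
  rw [lamIncl_one, Finset.sum_mul, Finset.sum_mul]
  refine Finset.sum_congr rfl fun c _ => ?_
  rw [Finset.mul_sum]
  exact Finset.sum_congr rfl fun d _ => S.eps_mul_mul_eps _ _ _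

/-- `Λ` is the corner of a full idempotent of every algebra of graded matrices with one block. -/
def fullCorner : FullCorner k C (BasicLambda k) where
  j := S.lamIncl
  map_mul := S.lamIncl_mul
  injective := by
    rw [injective_iff_map_eq_zero]
    intro a ha
    refine (lamModel k).injective ?_
    rw [map_zero]
    funext c d
    have h1 := congrArg (fun z => S.eps (S.o ((), c)) * z * S.eps (S.o ((), d))) ha
    simp only [mul_zero, zero_mul, lamIncl_apply, Finset.mul_sum, Finset.sum_mul] at h1
    rw [Finset.sum_eq_single c, Finset.sum_eq_single d, S.eps_mul_unit, S.unit_mul_eps] at h1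
    · exact S.unit_injective (S.lamHom_mem_gr a c d) h1
    · intro d' _ hd
      rw [mul_assoc, eps, eps, S.unit_mul_of_ne (S.o_ne hd), mul_zero]
    · simp
    · intro c' _ hc
      refine Finset.sum_eq_zero fun d' _ => ?_
      rw [eps, S.unit_mul_of_ne (S.o_ne hc.symm), zero_mul]
    · simp
  range a := by
    obtain ⟨d, hd⟩ := (lamModel k).surj
      (fun c d => S.toHom a (S.o ((), c)) (S.o ((), d))) fun c d => by
        have := S.mem_gr a (S.o ((), c)) (S.o ((), d))
        rwa [S.v_o, S.v_o] at this
    refine ⟨d, ?_⟩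
    rw [lamIncl_one_mul_mul, lamIncl_apply]
    refine Finset.sum_congr rfl fun c _ => Finset.sum_congr rfl fun c' _ => ?_
    rw [← congrFun (congrFun hd c) c']
    rfl
  ι := X
  l x := S.unit x (S.o (S.v x)) 1
  r x := S.unit (S.o (S.v x)) x 1
  full := by
    rw [← S.sum_eps]
    refine Finset.sum_congr rfl fun x _ => ?_
    rw [lamIncl_one, Finset.mul_sum, Finset.sum_eq_single (S.v x).2]
    · rw [S.unit_mul_eps, S.unit_mul, one_mul, eps]
      · rw [S.v_o]; exact one_mem_gr _
      · rw [S.v_o]; exact one_mem_gr _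
    · intro c _ hc
      refine S.unit_mul_of_ne ?_ _ _
      exact S.o_ne hc.symm
    · simp

end Morita

variable {k : Type u} [Field k] {A : Type u} [Ring A] [Algebra k A] {X B : Type}
  [Fintype X] [DecidableEq X] [DecidableEq B] (S : MatrixModel k A X B)

lemma isMoritaEquivalent_block (b : B) (he : IsIdempotentElem (S.blockIdem b)) :
    IsMoritaEquivalent k he.Corner (BasicLambda k) :=
  (S.cornerModel b he).fullCorner.isMoritaEquivalent

lemma finrank_block (b : B) (he : IsIdempotentElem (S.blockIdem b)) :
    Module.finrank k he.Corner = 2 * Fintype.card {x // (S.v x).1 = b} ^ 2 := by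
  rw [(S.cornerModel b he).finrank_eq]
  simp only [if_true, Finset.sum_const, Finset.card_univ, Fintype.card_prod, smul_eq_mul]
  ring

end MatrixModel

/-! ### Indecomposable operators -/

section Operator

variable {k : Type u} [Field k] {V : Type u} [AddCommGroup V] [Module k V]

/-- A nilpotent operator without invariant decompositions is a single Jordan block. -/
lemma exists_basis_of_nilpotent [FiniteDimensional k V] [Nontrivial V] (D : Module.End k V)
    (hD : IsNilpotent D) (hind : ∀ p p' : Submodule k V, IsCompl p p' → p ≤ p.comap D →
      p' ≤ p'.comap D → p = ⊥ ∨ p' = ⊥) :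
    ∃ b : Module.Basis (Fin (Module.finrank k V)) k V, ∀ s,
      D (b s) = if h : s.1 + 1 < Module.finrank k V then b ⟨s.1 + 1, h⟩ else 0 := by
  classical
  -- `v` generates the longest chain `v, D v, …, D ^ r v`
  obtain ⟨r, hr, hr'⟩ : ∃ r, D ^ (r + 1) = 0 ∧ D ^ r ≠ 0 := by
    have hne : Nat.find hD ≠ 0 := fun h => by
      have := Nat.find_spec hD
      rw [h, pow_zero] at this
      exact one_ne_zero this
    obtain ⟨r, hr⟩ := Nat.exists_eq_succ_of_ne_zero hne
    exact ⟨r, by rw [← Nat.succ_eq_add_one, ← hr]; exact Nat.find_spec hD,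
      Nat.find_min hD (by omega)⟩
  have hrt : ∀ t, r < t → D ^ t = 0 := fun t ht => by
    rw [← Nat.sub_add_cancel (show r + 1 ≤ t from ht), pow_add, hr, mul_zero]
  obtain ⟨v, hv⟩ : ∃ v, (D ^ r) v ≠ 0 := by
    by_contra! h
    exact hr' (LinearMap.ext h)
  obtain ⟨φ, hφ⟩ : ∃ φ : V →ₗ[k] k, φ ((D ^ r) v) ≠ 0 := by
    by_contra! h
    exact hv ((Module.forall_dual_apply_eq_zero_iff k _).1 h)
  let Ψ : (Fin (r + 1) → k) →ₗ[k] V := Fintype.linearCombination k fun t : Fin (r + 1) => (D ^ t.1) v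
  let θ : V →ₗ[k] (Fin (r + 1) → k) := LinearMap.pi fun t => φ ∘ₗ (D ^ t.1)
  have hΨ : ∀ a, Ψ a = ∑ t, a t • (D ^ t.1) v := fun a => rfl
  have hθ : ∀ u t, θ u t = φ ((D ^ t.1) u) := fun u t => rfl
  -- the pairing of the chain with `φ` is triangular
  have hinj : ∀ a, θ (Ψ a) = 0 → a = 0 := by
    intro a ha
    by_contra hne
    have hex : ∃ t : ℕ, ∃ h : t < r + 1, a ⟨t, h⟩ ≠ 0 := by
      by_contra! hc
      exact hne (funext fun t => hc t.1 t.2)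
    obtain ⟨ht, hat⟩ := Nat.find_spec hex
    set t0 := Nat.find hex
    have h1 := congrFun ha ⟨r - t0, by omega⟩
    rw [hθ, hΨ, map_sum, map_sum, Finset.sum_eq_single ⟨t0, ht⟩] at h1
    · rw [map_smul, ← Module.End.mul_apply, ← pow_add, map_smul,
        Nat.sub_add_cancel (by omega : t0 ≤ r), smul_eq_mul, Pi.zero_apply] at h1
      exact (mul_ne_zero hat hφ) h1
    · intro t _ hne
      rcases lt_or_gt_of_ne (fun h => hne (Fin.ext h) : t.1 ≠ t0) with hlt | hlt
      · have := Nat.find_min hex hlt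
        push Not at this
        rw [this t.2, zero_smul, map_zero, map_zero]
      · rw [map_smul, ← Module.End.mul_apply, ← pow_add, hrt _ (by simp only; omega)]
        simp
    · simp
  have hΨinj : Function.Injective Ψ := (injective_iff_map_eq_zero _).2 fun a ha =>
    hinj a (by rw [ha, map_zero])
  have hcompl : IsCompl (LinearMap.range Ψ) (LinearMap.ker θ) := by
    have hdisj : Disjoint (LinearMap.range Ψ) (LinearMap.ker θ) := by
      rw [Submodule.disjoint_def]
      rintro _ ⟨a, rfl⟩ h
      rw [hinj a h, map_zero]
    refine ⟨hdisj, codisjoint_iff.2 (Submodule.eq_top_of_finrank_eq ?_)⟩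
    have h1 := Submodule.finrank_sup_add_finrank_inf_eq (LinearMap.range Ψ) (LinearMap.ker θ)
    rw [hdisj.eq_bot, finrank_bot, add_zero, LinearMap.finrank_range_of_inj hΨinj] at h1
    have h2 := LinearMap.finrank_range_add_finrank_ker θ
    have h3 := Submodule.finrank_le (LinearMap.range θ)
    have h4 := Submodule.finrank_le (LinearMap.range Ψ ⊔ LinearMap.ker θ)
    omega
  have hP : LinearMap.range Ψ ≤ (LinearMap.range Ψ).comap D := by
    rintro _ ⟨a, rfl⟩
    rw [Submodule.mem_comap, hΨ, map_sum]
    refine Submodule.sum_mem _ fun t _ => ?_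
    rw [map_smul, ← Module.End.mul_apply, ← pow_succ']
    refine Submodule.smul_mem _ _ ?_
    rcases Nat.lt_or_ge (t.1 + 1) (r + 1) with h | h
    · exact ⟨Pi.single ⟨t.1 + 1, h⟩ 1, by simp [Ψ, Fintype.linearCombination_apply_single]⟩
    · rw [hrt _ (by omega)]; exact zero_mem _
  have hP' : LinearMap.ker θ ≤ (LinearMap.ker θ).comap D := by
    intro u hu
    rw [Submodule.mem_comap, LinearMap.mem_ker]
    funext t
    rw [hθ, ← Module.End.mul_apply, ← pow_succ]
    rcases Nat.lt_or_ge (t.1 + 1) (r + 1) with h | h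
    · exact congrFun hu ⟨t.1 + 1, h⟩
    · rw [hrt _ (by omega)]; simp
  have hker : LinearMap.ker θ = ⊥ := by
    refine (hind _ _ hcompl hP hP').resolve_left fun h => hv ?_
    have h1 : Ψ (Pi.single ⟨r, by omega⟩ 1) ∈ LinearMap.range Ψ := ⟨_, rfl⟩
    rw [h, Submodule.mem_bot] at h1
    simpa [Ψ, Fintype.linearCombination_apply_single] using h1
  have hsurj : Function.Surjective Ψ := by
    rw [← LinearMap.range_eq_top]
    have := hcompl.sup_eq_top
    rwa [hker, sup_bot_eq] at this
  let e := LinearEquiv.ofBijective Ψ ⟨hΨinj, hsurj⟩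
  have hdim : r + 1 = Module.finrank k V := by
    rw [← e.finrank_eq, Module.finrank_fintype_fun_eq_card, Fintype.card_fin]
  let b0 : Module.Basis (Fin (r + 1)) k V := Module.Basis.ofEquivFun e.symm
  have hb0 : ∀ t, b0 t = (D ^ t.1) v := fun t => by
    rw [Module.Basis.coe_ofEquivFun, LinearEquiv.symm_symm]
    change Ψ (Pi.single t 1) = _
    simp [Ψ, Fintype.linearCombination_apply_single]
  rw [← hdim]
  refine ⟨b0, fun s => ?_⟩
  rw [hb0, ← Module.End.mul_apply, ← pow_succ']
  split_ifs with h
  · rw [hb0]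
  · rw [hrt _ (by omega)]; rfl

/-- An operator without invariant decompositions over an algebraically closed field is a single
Jordan block. -/
lemma exists_jordan_basis [IsAlgClosed k] [FiniteDimensional k V] [Nontrivial V]
    (T : Module.End k V) (hind : ∀ p p' : Submodule k V, IsCompl p p' → p ≤ p.comap T →
      p' ≤ p'.comap T → p = ⊥ ∨ p' = ⊥) :
    ∃ c : k, IsNilpotent (T - algebraMap k (Module.End k V) c) ∧
      ∃ b : Module.Basis (Fin (Module.finrank k V)) k V, ∀ s,
        T (b s) = c • b s + if h : s.1 + 1 < Module.finrank k V then b ⟨s.1 + 1, h⟩ else 0 := by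
  obtain ⟨c, hc⟩ := Module.End.exists_eigenvalue T
  set D := T - algebraMap k (Module.End k V) c with hDdef
  have hD : ∀ x, D x = T x - c • x := fun x => rfl
  have hcomm : Commute T D := by
    rw [hDdef]
    exact (Commute.refl T).sub_right (Algebra.commutes c T).symm
  have hinv : ∀ p : Submodule k V, p ≤ p.comap D ↔ p ≤ p.comap T := by
    intro p
    constructor <;> intro h x hx
    · have := p.add_mem (h hx) (p.smul_mem c hx)
      rw [hD, sub_add_cancel] at this
      exact this
    · rw [Submodule.mem_comap, hD]
      exact p.sub_mem (h hx) (p.smul_mem c hx)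
  obtain ⟨N, hN⟩ := Filter.eventually_atTop.1 (LinearMap.eventually_isCompl_ker_pow_range_pow D)
  have hnil : IsNilpotent D := by
    have hcompl := hN (N + 1) (by omega)
    refine ⟨N + 1, ?_⟩
    have hr : LinearMap.range (D ^ (N + 1)) = ⊥ := by
      refine (hind _ _ hcompl ?_ ?_).resolve_left ?_
      · intro x hx
        rw [Submodule.mem_comap, LinearMap.mem_ker, ← Module.End.mul_apply,
          ← (hcomm.pow_right _).eq, Module.End.mul_apply, LinearMap.mem_ker.1 hx, map_zero]
      · rintro _ ⟨y, rfl⟩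
        exact ⟨T y, by rw [← Module.End.mul_apply, ← (hcomm.pow_right _).eq, Module.End.mul_apply]⟩
      · intro h
        obtain ⟨x, hx⟩ := hc.exists_hasEigenvector
        have h1 : D x = 0 := by rw [hD, hx.apply_eq_smul, sub_self]
        have h2 : x ∈ LinearMap.ker (D ^ (N + 1)) := by
          rw [LinearMap.mem_ker, pow_succ, Module.End.mul_apply, h1, map_zero]
        rw [h, Submodule.mem_bot] at h2
        exact hx.2 h2
    exact LinearMap.range_eq_bot.1 hr
  refine ⟨c, hnil, ?_⟩
  obtain ⟨b, hb⟩ := exists_basis_of_nilpotent D hnil fun p p' h h1 h2 =>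
    hind p p' h ((hinv p).1 h1) ((hinv p').1 h2)
  refine ⟨b, fun s => ?_⟩
  rw [← hb, hD, add_sub_cancel]

lemma eq_of_isNilpotent_sub {T : Module.End k V} {c c' : k}
    (h : IsNilpotent (T - algebraMap k (Module.End k V) c)) {x : V} (hx : x ≠ 0)
    (hT : T x = c' • x) : c' = c := by
  obtain ⟨N, hN⟩ := h
  have key : ∀ N : ℕ, ((T - algebraMap k (Module.End k V) c) ^ N) x = (c' - c) ^ N • x := by
    intro N
    induction N with
    | zero => simp
    | succ N ih =>
      rw [pow_succ, Module.End.mul_apply]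
      have : (T - algebraMap k (Module.End k V) c) x = (c' - c) • x := by
        rw [LinearMap.sub_apply, hT, Module.algebraMap_end_apply, sub_smul]
      rw [this, map_smul, ih, smul_smul, pow_succ, mul_comm]
  have h1 := key N
  rw [hN, LinearMap.zero_apply, eq_comm, smul_eq_zero] at h1
  exact sub_eq_zero.1 (eq_zero_of_pow_eq_zero (h1.resolve_right hx))

end Operator

/-! ### Indecomposable pencils -/

section Pencil

variable {k : Type u} [Field k]

/-- Indecomposability of a pair of linear maps, as a representation of the Kronecker quiver. -/
def PencilIndec {V W : Type u} [AddCommGroup V] [Module k V] [AddCommGroup W] [Module k W]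
    (A B : V →ₗ[k] W) : Prop :=
  (Nontrivial V ∨ Nontrivial W) ∧ ∀ (p p' : Submodule k V) (q q' : Submodule k W), IsCompl p p' →
    IsCompl q q' → p ≤ q.comap A → p ≤ q.comap B → p' ≤ q'.comap A → p' ≤ q'.comap B →
    (p = ⊥ ∧ q = ⊥) ∨ (p' = ⊥ ∧ q' = ⊥)

/-- Isomorphism of pairs of linear maps, as representations of the Kronecker quiver. -/
def PencilIso {V W V' W' : Type u} [AddCommGroup V] [Module k V] [AddCommGroup W] [Module k W]
    [AddCommGroup V'] [Module k V'] [AddCommGroup W'] [Module k W']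
    (A B : V →ₗ[k] W) (A' B' : V' →ₗ[k] W') : Prop :=
  ∃ (g : V ≃ₗ[k] V') (h : W ≃ₗ[k] W'), (∀ x, h (A x) = A' (g x)) ∧ ∀ x, h (B x) = B' (g x)

variable {V W V' W' : Type u} [AddCommGroup V] [Module k V] [AddCommGroup W] [Module k W]
  [AddCommGroup V'] [Module k V'] [AddCommGroup W'] [Module k W']
  {A B : V →ₗ[k] W} {A' B' : V' →ₗ[k] W'}

lemma PencilIndec.symm (h : PencilIndec A B) : PencilIndec B A :=
  ⟨h.1, fun p p' q q' h1 h2 h3 h4 h5 h6 => h.2 p p' q q' h1 h2 h4 h3 h6 h5⟩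

/-- A common kernel vector splits off. -/
lemma PencilIndec.eq_bot_of_ker (h : PencilIndec A B) {x : V} (hx : x ≠ 0) (hA : A x = 0)
    (hB : B x = 0) : Module.finrank k V = 1 ∧ Module.finrank k W = 0 := by
  obtain ⟨p', hp'⟩ := Submodule.exists_isCompl (Submodule.span k {x})
  rcases h.2 _ p' ⊥ ⊤ hp' isCompl_bot_top
    ((Submodule.span_singleton_le_iff_mem _ _).2 (by simpa using hA))
    ((Submodule.span_singleton_le_iff_mem _ _).2 (by simpa using hB)) (by simp) (by simp)
    with h1 | h1
  · exact absurd (by simpa using h1.1) hx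
  · have h2 := hp'.sup_eq_top
    rw [h1.1, sup_bot_eq] at h2
    refine ⟨?_, ?_⟩
    · rw [← finrank_top k V, ← h2, finrank_span_singleton hx]
    · rw [← finrank_top k W, h1.2, finrank_bot]

/-- If the images do not span, the pencil is the simple representation at the sink. -/
lemma PencilIndec.eq_bot_of_range (h : PencilIndec A B)
    (hs : ¬ Function.Surjective (A.coprod B)) : Module.finrank k V = 0 := by
  obtain ⟨q', hq'⟩ := Submodule.exists_isCompl (LinearMap.range (A.coprod B))
  rcases h.2 ⊤ ⊥ _ q' isCompl_top_bot hq' (fun x _ => ⟨(x, 0), by simp⟩) (fun x _ => ⟨(0, x), by simp⟩)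
    (by simp) (by simp) with h1 | h1
  · rw [← finrank_top k V, h1.1, finrank_bot]
  · refine absurd (LinearMap.range_eq_top.1 ?_) hs
    have := hq'.sup_eq_top
    rwa [h1.2, sup_bot_eq] at this

variable (A B)

/-- The target of the first reflection functor: the cokernel of `V → W × W`. -/
abbrev Refl : Type u := (W × W) ⧸ LinearMap.range (A.prod B)

/-- The first map of the first reflection functor. -/
def reflA : W →ₗ[k] Refl A B := (LinearMap.range (A.prod B)).mkQ ∘ₗ LinearMap.inl k W W

/-- The second map of the first reflection functor. -/
def reflB : W →ₗ[k] Refl A B := -((LinearMap.range (A.prod B)).mkQ ∘ₗ LinearMap.inr k W W)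

variable {A B}

lemma reflA_sub_reflB (a b : W) : reflA A B a - reflB A B b =
    (LinearMap.range (A.prod B)).mkQ (a, b) := by
  rw [reflA, reflB, LinearMap.neg_apply, sub_neg_eq_add, LinearMap.comp_apply, LinearMap.comp_apply,
    ← map_add]
  simp

lemma reflA_apply_eq (x : V) : reflA A B (A x) = reflB A B (B x) := by
  rw [← sub_eq_zero, reflA_sub_reflB]
  exact (Submodule.Quotient.mk_eq_zero _).2 ⟨x, rfl⟩

lemma finrank_refl [FiniteDimensional k V] [FiniteDimensional k W]
    (hinj : Function.Injective (A.prod B)) :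
    Module.finrank k (Refl A B) + Module.finrank k V = 2 * Module.finrank k W := by
  rw [← LinearMap.finrank_range_of_inj hinj, Submodule.finrank_quotient_add_finrank,
    Module.finrank_prod, two_mul]

/-- The first reflection functor preserves indecomposable pencils: a decomposition of the
reflected pencil restricts to `W`, and its preimages in `V` complete it to a decomposition of the
original pencil. -/
lemma PencilIndec.refl (h : PencilIndec A B) (hinj : Function.Injective (A.prod B)) :
    PencilIndec (reflA A B) (reflB A B) := by
  refine ⟨Or.inl ?_, fun p p' q q' hp hq h1 h2 h3 h4 => ?_⟩
  · rcases h.1 with hV | hW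
    · by_contra hW
      rw [not_nontrivial_iff_subsingleton] at hW
      obtain ⟨x, hx⟩ := exists_ne (0 : V)
      exact hx (hinj (Subsingleton.elim _ _))
    · exact hW
  have hmk : ∀ {p : Submodule k W} {q : Submodule k (Refl A B)}, p ≤ q.comap (reflA A B) →
      p ≤ q.comap (reflB A B) → ∀ a ∈ p, ∀ b ∈ p, (LinearMap.range (A.prod B)).mkQ (a, b) ∈ q := by
    intro p q h1 h2 a ha b hb
    rw [← reflA_sub_reflB]
    exact q.sub_mem (h1 ha) (h2 hb)
  have hr : IsCompl (p.comap A ⊓ p.comap B) (p'.comap A ⊓ p'.comap B) := by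
    constructor
    · rw [Submodule.disjoint_def]
      rintro x ⟨hx1, hx2⟩ ⟨hx3, hx4⟩
      refine hinj ?_
      rw [map_zero]
      exact Prod.ext (Submodule.disjoint_def.1 hp.disjoint _ hx1 hx3)
        (Submodule.disjoint_def.1 hp.disjoint _ hx2 hx4)
    · rw [codisjoint_iff, eq_top_iff]
      intro x _
      obtain ⟨a, ha, a', ha', hA⟩ := Submodule.mem_sup.1 (hp.sup_eq_top ▸ Submodule.mem_top : A x ∈ _)
      obtain ⟨b, hb, b', hb', hB⟩ := Submodule.mem_sup.1 (hp.sup_eq_top ▸ Submodule.mem_top : B x ∈ _)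
      have hsum : (LinearMap.range (A.prod B)).mkQ (a, b) +
          (LinearMap.range (A.prod B)).mkQ (a', b') = 0 := by
        rw [← map_add, Prod.mk_add_mk, hA, hB]
        exact (Submodule.Quotient.mk_eq_zero _).2 ⟨x, rfl⟩
      have hq1 := hmk h1 h2 a ha b hb
      have hq2 := hmk h3 h4 a' ha' b' hb'
      have hz : (LinearMap.range (A.prod B)).mkQ (a, b) = 0 := by
        refine Submodule.disjoint_def.1 hq.disjoint _ hq1 ?_
        rw [eq_neg_of_add_eq_zero_left hsum]
        exact q'.neg_mem hq2
      rw [hz, zero_add] at hsum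
      obtain ⟨y, hy⟩ := (Submodule.Quotient.mk_eq_zero _).1 hz
      obtain ⟨y', hy'⟩ := (Submodule.Quotient.mk_eq_zero _).1 hsum
      have hxy : x = y + y' := hinj (by
        rw [map_add, hy, hy', Prod.mk_add_mk, hA, hB]
        rfl)
      rw [hxy]
      have e1 : A y = a := congrArg Prod.fst hy
      have e2 : B y = b := congrArg Prod.snd hy
      have e3 : A y' = a' := congrArg Prod.fst hy'
      have e4 : B y' = b' := congrArg Prod.snd hy'
      refine Submodule.add_mem_sup ⟨?_, ?_⟩ ⟨?_, ?_⟩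
      · change A y ∈ p; rwa [e1]
      · change B y ∈ p; rwa [e2]
      · change A y' ∈ p'; rwa [e3]
      · change B y' ∈ p'; rwa [e4]
  have htop : ∀ {q : Submodule k (Refl A B)}, (⊤ : Submodule k W) ≤ q.comap (reflA A B) →
      (⊤ : Submodule k W) ≤ q.comap (reflB A B) → q = ⊤ := by
    intro q h1 h2
    rw [eq_top_iff]
    intro z _
    obtain ⟨⟨a, b⟩, rfl⟩ := Submodule.mkQ_surjective _ z
    exact hmk h1 h2 a trivial b trivial
  rcases h.2 _ _ p p' hr hp inf_le_left inf_le_right inf_le_left inf_le_right with hb | hb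
  · refine Or.inl ⟨hb.2, ?_⟩
    have h5 := hp.sup_eq_top
    rw [hb.2, bot_sup_eq] at h5
    have h6 := htop (h5 ▸ h3) (h5 ▸ h4)
    have := hq.inf_eq_bot
    rwa [h6, inf_top_eq] at this
  · refine Or.inr ⟨hb.2, ?_⟩
    have h5 := hp.sup_eq_top
    rw [hb.2, sup_bot_eq] at h5
    have h6 := htop (h5 ▸ h1) (h5 ▸ h2)
    have := hq.inf_eq_bot
    rwa [h6, top_inf_eq] at this

/-- An isomorphism between reflected pencils comes from one of the pencils: `V` is recovered as the
kernel of the projection of `W × W` to the cokernel. -/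
lemma PencilIso.of_refl (hinj : Function.Injective (A.prod B))
    (hinj' : Function.Injective (A'.prod B'))
    (h : PencilIso (reflA A B) (reflB A B) (reflA A' B') (reflB A' B')) :
    PencilIso A B A' B' := by
  obtain ⟨g, c, h1, h2⟩ := h
  have hc : ∀ a b, c ((LinearMap.range (A.prod B)).mkQ (a, b)) =
      (LinearMap.range (A'.prod B')).mkQ (g a, g b) := by
    intro a b
    rw [← reflA_sub_reflB, ← reflA_sub_reflB, map_sub, h1, h2]
  have hmap : (LinearMap.range (A.prod B)).map (g.prodCongr g).toLinearMap =
      LinearMap.range (A'.prod B') := by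
    ext ⟨a, b⟩
    rw [← Submodule.Quotient.mk_eq_zero (LinearMap.range (A'.prod B'))]
    constructor
    · rintro ⟨⟨a', b'⟩, hab, hab'⟩
      obtain ⟨rfl, rfl⟩ : g a' = a ∧ g b' = b := ⟨congrArg Prod.fst hab', congrArg Prod.snd hab'⟩
      have := hc a' b'
      have hz : (LinearMap.range (A.prod B)).mkQ (a', b') = 0 :=
        (Submodule.Quotient.mk_eq_zero _).2 hab
      rw [hz, map_zero] at this
      exact this.symm
    · intro hz
      refine ⟨(g.symm a, g.symm b), (Submodule.Quotient.mk_eq_zero _).1 ?_, by simp⟩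
      have := hc (g.symm a) (g.symm b)
      rw [g.apply_symm_apply, g.apply_symm_apply] at this
      exact c.map_eq_zero_iff.1 (this.trans hz)
  let f : V ≃ₗ[k] V' := LinearEquiv.ofInjective _ hinj ≪≫ₗ
    (g.prodCongr g).submoduleMap _ ≪≫ₗ LinearEquiv.ofEq _ _ hmap ≪≫ₗ
    (LinearEquiv.ofInjective _ hinj').symm
  have hf : ∀ x, (A'.prod B') (f x) = (g (A x), g (B x)) := by
    intro x
    have : LinearEquiv.ofInjective _ hinj' (f x) = LinearEquiv.ofEq _ _ hmap
        ((g.prodCongr g).submoduleMap _ (LinearEquiv.ofInjective _ hinj x)) := by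
      simp only [f, LinearEquiv.trans_apply, LinearEquiv.apply_symm_apply]
    exact congrArg Subtype.val this
  exact ⟨f, g, fun x => (congrArg Prod.fst (hf x)).symm, fun x => (congrArg Prod.snd (hf x)).symm⟩

end Pencil

section Pencil

variable {k : Type u} [Field k]
variable {V W V' W' : Type u} [AddCommGroup V] [Module k V] [AddCommGroup W] [Module k W]
  [AddCommGroup V'] [Module k V'] [AddCommGroup W'] [Module k W']
  {A B : V →ₗ[k] W} {A' B' : V' →ₗ[k] W'}

variable (A B) in
/-- The first map of the second reflection functor, whose source is the kernel of
`V × V → W`. -/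
def coreflA : LinearMap.ker (A.coprod B) →ₗ[k] V :=
  LinearMap.fst k V V ∘ₗ (LinearMap.ker (A.coprod B)).subtype

variable (A B) in
/-- The second map of the second reflection functor. -/
def coreflB : LinearMap.ker (A.coprod B) →ₗ[k] V :=
  LinearMap.snd k V V ∘ₗ (LinearMap.ker (A.coprod B)).subtype

lemma finrank_corefl [FiniteDimensional k V] [FiniteDimensional k W]
    (hs : Function.Surjective (A.coprod B)) :
    Module.finrank k (LinearMap.ker (A.coprod B)) + Module.finrank k W =
      2 * Module.finrank k V := by
  have h := LinearMap.finrank_range_add_finrank_ker (A.coprod B)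
  rw [LinearMap.range_eq_top.2 hs, finrank_top, Module.finrank_prod] at h
  omega

/-- The second reflection functor preserves indecomposable pencils: a decomposition of the
reflected pencil restricts to `V`, and its images in `W` complete it to a decomposition of the
original pencil. -/
lemma PencilIndec.corefl (h : PencilIndec A B) (hs : Function.Surjective (A.coprod B)) :
    PencilIndec (coreflA A B) (coreflB A B) := by
  refine ⟨Or.inr ?_, fun p p' q q' hp hq h1 h2 h3 h4 => ?_⟩
  · rcases h.1 with hV | hW
    · exact hV
    · by_contra hV
      rw [not_nontrivial_iff_subsingleton] at hV
      obtain ⟨y, hy⟩ := exists_ne (0 : W)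
      obtain ⟨x, rfl⟩ := hs y
      exact hy (by rw [Subsingleton.elim x 0, map_zero])
  have hr : IsCompl (q.map A ⊔ q.map B) (q'.map A ⊔ q'.map B) := by
    constructor
    · rw [Submodule.disjoint_def]
      intro z hz hz'
      obtain ⟨_, ⟨a, ha, rfl⟩, _, ⟨b, hb, rfl⟩, rfl⟩ := Submodule.mem_sup.1 hz
      obtain ⟨_, ⟨a', ha', rfl⟩, _, ⟨b', hb', rfl⟩, hab⟩ := Submodule.mem_sup.1 hz'
      have hker : (a - a', b - b') ∈ LinearMap.ker (A.coprod B) := by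
        rw [LinearMap.mem_ker, LinearMap.coprod_apply, map_sub, map_sub]
        have h0 : A a + B b - (A a' + B b') = 0 := by rw [hab, sub_self]
        rw [← h0]
        abel
      obtain ⟨x, hx, x', hx', hxx⟩ := Submodule.mem_sup.1
        (hp.sup_eq_top ▸ Submodule.mem_top :
          (⟨_, hker⟩ : LinearMap.ker (A.coprod B)) ∈ p ⊔ p')
      have e1 : x.1.1 + x'.1.1 = a - a' := congrArg (fun t => t.1.1) hxx
      have e2 : x.1.2 + x'.1.2 = b - b' := congrArg (fun t => t.1.2) hxx
      have f1 : a = x.1.1 := by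
        rw [← sub_eq_zero]
        refine Submodule.disjoint_def.1 hq.disjoint _ (q.sub_mem ha (h1 hx)) ?_
        have : a - x.1.1 = x'.1.1 + a' := by rw [← sub_add_cancel a a', ← e1]; abel
        rw [this]
        exact q'.add_mem (h3 hx') ha'
      have f2 : b = x.1.2 := by
        rw [← sub_eq_zero]
        refine Submodule.disjoint_def.1 hq.disjoint _ (q.sub_mem hb (h2 hx)) ?_
        have : b - x.1.2 = x'.1.2 + b' := by rw [← sub_add_cancel b b', ← e2]; abel
        rw [this]
        exact q'.add_mem (h4 hx') hb'
      rw [f1, f2]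
      exact x.2
    · rw [codisjoint_iff, eq_top_iff]
      intro z _
      obtain ⟨⟨a, b⟩, rfl⟩ := hs z
      have : ∀ c, A c ∈ q.map A ⊔ q.map B ⊔ (q'.map A ⊔ q'.map B) ∧
          B c ∈ q.map A ⊔ q.map B ⊔ (q'.map A ⊔ q'.map B) := by
        intro c
        obtain ⟨d, hd, d', hd', rfl⟩ :=
          Submodule.mem_sup.1 (hq.sup_eq_top ▸ Submodule.mem_top : c ∈ q ⊔ q')
        rw [map_add, map_add]
        exact ⟨Submodule.add_mem_sup (Submodule.mem_sup_left ⟨d, hd, rfl⟩)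
            (Submodule.mem_sup_left ⟨d', hd', rfl⟩),
          Submodule.add_mem_sup (Submodule.mem_sup_right ⟨d, hd, rfl⟩)
            (Submodule.mem_sup_right ⟨d', hd', rfl⟩)⟩
      exact add_mem (this a).1 (this b).2
  have hbot : ∀ {p : Submodule k (LinearMap.ker (A.coprod B))} {q : Submodule k V}, q = ⊥ →
      p ≤ q.comap (coreflA A B) → p ≤ q.comap (coreflB A B) → p = ⊥ := by
    rintro p q rfl h1 h2
    rw [eq_bot_iff]
    intro x hx
    exact Subtype.ext (Prod.ext ((Submodule.mem_bot k).1 (h1 hx)) ((Submodule.mem_bot k).1 (h2 hx)))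
  rcases h.2 q q' _ _ hq hr (fun x hx => Submodule.mem_sup_left ⟨x, hx, rfl⟩)
    (fun x hx => Submodule.mem_sup_right ⟨x, hx, rfl⟩)
    (fun x hx => Submodule.mem_sup_left ⟨x, hx, rfl⟩)
    (fun x hx => Submodule.mem_sup_right ⟨x, hx, rfl⟩) with hb | hb
  · exact Or.inl ⟨hbot hb.1 h1 h2, hb.1⟩
  · exact Or.inr ⟨hbot hb.1 h3 h4, hb.1⟩

/-- An isomorphism between reflected pencils comes from one of the pencils: `W` is recovered as the
quotient of `V × V` by the kernel. -/
lemma PencilIso.of_corefl (hs : Function.Surjective (A.coprod B))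
    (hs' : Function.Surjective (A'.coprod B'))
    (h : PencilIso (coreflA A B) (coreflB A B) (coreflA A' B') (coreflB A' B')) :
    PencilIso A B A' B' := by
  obtain ⟨c, g, h1, h2⟩ := h
  have hc : ∀ x : LinearMap.ker (A.coprod B), (g.prodCongr g) x.1 = (c x).1 := fun x =>
    Prod.ext (h1 x) (h2 x)
  have hmap : (LinearMap.ker (A.coprod B)).map (g.prodCongr g).toLinearMap =
      LinearMap.ker (A'.coprod B') := by
    apply le_antisymm
    · rintro _ ⟨x, hx, rfl⟩
      exact (hc ⟨x, hx⟩) ▸ (c ⟨x, hx⟩).2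
    · intro y hy
      refine ⟨(c.symm ⟨y, hy⟩).1, (c.symm ⟨y, hy⟩).2, ?_⟩
      exact (hc _).trans (by rw [c.apply_symm_apply])
  let f : W ≃ₗ[k] W' := ((A.coprod B).quotKerEquivOfSurjective hs).symm ≪≫ₗ
    Submodule.Quotient.equiv _ _ (g.prodCongr g) hmap ≪≫ₗ
    (A'.coprod B').quotKerEquivOfSurjective hs'
  have hf : ∀ a b, f (A a + B b) = A' (g a) + B' (g b) := by
    intro a b
    have : ((A.coprod B).quotKerEquivOfSurjective hs).symm (A a + B b) =
        (LinearMap.ker (A.coprod B)).mkQ (a, b) := by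
      rw [LinearEquiv.symm_apply_eq]
      exact (LinearMap.quotKerEquivOfSurjective_apply_mk _ hs (a, b)).symm
    simp only [f, LinearEquiv.trans_apply, this]
    rfl
  refine ⟨g, f, fun x => ?_, fun x => ?_⟩
  · simpa using hf x 0
  · simpa using hf 0 x

/-! ### Pencils between spaces of different dimension -/

lemma PencilIndec.injective_prod (h : PencilIndec A B) (hW : Module.finrank k W ≠ 0) :
    Function.Injective (A.prod B) := by
  rw [injective_iff_map_eq_zero]
  intro x hx
  by_contra h0
  exact hW (h.eq_bot_of_ker h0 (congrArg Prod.fst hx) (congrArg Prod.snd hx)).2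

/-- Two indecomposable pencils of the same dimensions `dim V > dim W` are isomorphic: reflect until
the target vanishes. -/
lemma pencilIso_of_finrank_gt (m : ℕ) {V W V' W' : Type u} [AddCommGroup V] [Module k V]
    [AddCommGroup W] [Module k W] [AddCommGroup V'] [Module k V'] [AddCommGroup W'] [Module k W']
    [FiniteDimensional k V] [FiniteDimensional k W] [FiniteDimensional k V'] [FiniteDimensional k W']
    {A B : V →ₗ[k] W} {A' B' : V' →ₗ[k] W'}
    (h : PencilIndec A B) (h' : PencilIndec A' B') (hm : Module.finrank k W = m)
    (hV : Module.finrank k V = Module.finrank k V') (hW : Module.finrank k W = Module.finrank k W')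
    (hgt : Module.finrank k W < Module.finrank k V) : PencilIso A B A' B' := by
  induction m using Nat.strong_induction_on generalizing V W V' W' with
  | _ m ih =>
    by_cases h0 : Module.finrank k W = 0
    · have hs : Subsingleton W' := Module.finrank_zero_iff.1 (hW.symm.trans h0)
      exact ⟨LinearEquiv.ofFinrankEq V V' hV, LinearEquiv.ofFinrankEq W W' hW,
        fun x => Subsingleton.elim _ _, fun x => Subsingleton.elim _ _⟩
    · have hi := h.injective_prod h0
      have hi' := h'.injective_prod (hW ▸ h0)
      have d := finrank_refl hi
      have d' := finrank_refl hi'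
      exact PencilIso.of_refl hi hi' (ih _ (by omega) (h.refl hi) (h'.refl hi') rfl hW (by omega)
        (by omega))

/-- Two indecomposable pencils of the same dimensions `dim V < dim W` are isomorphic: reflect until
the source vanishes. -/
lemma pencilIso_of_finrank_lt (m : ℕ) {V W V' W' : Type u} [AddCommGroup V] [Module k V]
    [AddCommGroup W] [Module k W] [AddCommGroup V'] [Module k V'] [AddCommGroup W'] [Module k W']
    [FiniteDimensional k V] [FiniteDimensional k W] [FiniteDimensional k V'] [FiniteDimensional k W']
    {A B : V →ₗ[k] W} {A' B' : V' →ₗ[k] W'}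
    (h : PencilIndec A B) (h' : PencilIndec A' B') (hm : Module.finrank k V = m)
    (hV : Module.finrank k V = Module.finrank k V') (hW : Module.finrank k W = Module.finrank k W')
    (hgt : Module.finrank k V < Module.finrank k W) : PencilIso A B A' B' := by
  induction m using Nat.strong_induction_on generalizing V W V' W' with
  | _ m ih =>
    by_cases h0 : Module.finrank k V = 0
    · have hs : Subsingleton V := Module.finrank_zero_iff.1 h0
      exact ⟨LinearEquiv.ofFinrankEq V V' hV, LinearEquiv.ofFinrankEq W W' hW,
        fun x => by rw [Subsingleton.elim x 0]; simp, fun x => by rw [Subsingleton.elim x 0]; simp⟩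
    · have hi : Function.Surjective (A.coprod B) := by
        by_contra hs
        exact h0 (h.eq_bot_of_range hs)
      have hi' : Function.Surjective (A'.coprod B') := by
        by_contra hs
        exact h0 (hV.trans (h'.eq_bot_of_range hs))
      have d := finrank_corefl hi
      have d' := finrank_corefl hi'
      exact PencilIso.of_corefl hi hi' (ih _ (by omega) (h.corefl hi) (h'.corefl hi') rfl (by omega)
        hV (by omega))

/-! ### Pencils between spaces of the same dimension -/

/-- A polynomial solution of a pencil, with coefficients `z i`, forces the source of an
indecomposable pencil to be larger than the target: reflection shortens the solution. -/
lemma PencilIndec.lt_of_chain (N : ℕ) {V W : Type u} [AddCommGroup V] [Module k V]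
    [AddCommGroup W] [Module k W] [FiniteDimensional k V] [FiniteDimensional k W]
    {A B : V →ₗ[k] W} (h : PencilIndec A B) (z : ℕ → V)
    (h0 : A (z 0) = 0) (hz : ∀ i, A (z (i + 1)) = B (z i)) (hN : ∀ i, N < i → z i = 0)
    (hne : ∃ i, z i ≠ 0) : Module.finrank k W < Module.finrank k V := by
  induction N generalizing V W with
  | zero =>
    obtain ⟨i, hi⟩ := hne
    obtain rfl : i = 0 := by
      by_contra hi0
      exact hi (hN i (Nat.pos_of_ne_zero hi0))
    have := h.eq_bot_of_ker hi h0 (by rw [← hz, hN 1 one_pos, map_zero])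
    omega
  | succ N ih =>
    by_cases hA : ∀ i, A (z i) = 0
    · obtain ⟨i, hi⟩ := hne
      have := h.eq_bot_of_ker hi (hA i) (by rw [← hz, hA])
      omega
    · push Not at hA
      obtain ⟨i, hi⟩ := hA
      by_cases hW : Module.finrank k W = 0
      · have : Subsingleton W := Module.finrank_zero_iff.1 hW
        exact absurd (Subsingleton.elim _ _) hi
      have hinj := h.injective_prod hW
      have d := finrank_refl hinj
      have hlt := ih (h.refl hinj) (fun j => A (z (N + 1 - j))) ?_ ?_ ?_ ⟨N + 1 - i, ?_⟩
      · omega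
      · change reflA A B (A (z (N + 1))) = 0
        rw [reflA_apply_eq, ← hz, hN (N + 1 + 1) (by omega), map_zero, map_zero]
      · intro j
        change reflA A B (A (z (N + 1 - (j + 1)))) = reflB A B (A (z (N + 1 - j)))
        rcases Nat.lt_or_ge j (N + 1) with hj | hj
        · obtain ⟨t, ht⟩ : ∃ t, N + 1 - j = t + 1 := ⟨N - j, by omega⟩
          rw [ht, show N + 1 - (j + 1) = t by omega, reflA_apply_eq, hz]
        · rw [show N + 1 - j = 0 by omega, show N + 1 - (j + 1) = 0 by omega, h0, map_zero, map_zero]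
      · intro j hj
        rw [show N + 1 - j = 0 by omega, h0]
      · rcases Nat.lt_or_ge (N + 1) i with h1 | h1
        · exact absurd (by rw [hN i h1, map_zero]) hi
        · rwa [show N + 1 - (N + 1 - i) = i by omega]

/-- An indecomposable pencil between spaces of the same dimension is regular. -/
lemma PencilIndec.exists_injective [IsAlgClosed k] [FiniteDimensional k V] [FiniteDimensional k W]
    (h : PencilIndec A B) (hd : Module.finrank k V = Module.finrank k W) :
    ∃ c : k, Function.Injective (A + c • B) := by
  by_contra! hc
  let bV := Module.finBasis k V
  let bW := (Module.finBasis k W).reindex (finCongr hd.symm)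
  let MA := LinearMap.toMatrix bV bW A
  let MB := LinearMap.toMatrix bV bW B
  let M : Matrix (Fin (Module.finrank k V)) (Fin (Module.finrank k V)) k[X] :=
    MA.map C + (X : k[X]) • MB.map C
  have hev : ∀ c, (M.det).eval c = 0 := by
    intro c
    have h1 : (M.det).eval c = (LinearMap.toMatrix bV bW (A + c • B)).det := by
      rw [← coe_evalRingHom, RingHom.map_det]
      congr 1
      have h2 : LinearMap.toMatrix bV bW (A + c • B) = MA + c • MB := by rw [map_add, map_smul]
      rw [h2]
      ext i j
      change eval c (C (MA i j) + X * C (MB i j)) = MA i j + c * MB i j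
      rw [eval_add, eval_mul, eval_C, eval_X, eval_C]
    rw [h1, ← Matrix.exists_mulVec_eq_zero_iff]
    have h2 := hc c
    rw [injective_iff_map_eq_zero] at h2
    push Not at h2
    obtain ⟨x, hx, hx0⟩ := h2
    refine ⟨bV.repr x, fun h => hx0 (by simpa using h), ?_⟩
    rw [LinearMap.toMatrix_mulVec_repr, hx]
    simp
  -- As `det (A + X B)` vanishes, `A + X B` has a polynomial null vector, whose coefficients `e t`
  -- satisfy `A (e (t + 1)) = -B (e t)`.
  have hdet : M.det = 0 := Polynomial.funext fun c => by rw [hev, eval_zero]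
  obtain ⟨f, hf0, hf⟩ := Matrix.exists_mulVec_eq_zero_iff.2 hdet
  have hrow : ∀ i, ∑ j, (C (MA i j) * f j + X * (C (MB i j) * f j)) = 0 := fun i => by
    refine Eq.trans (Finset.sum_congr rfl fun j _ => ?_) (congrFun hf i)
    change _ = (C (MA i j) + X * C (MB i j)) * f j
    rw [add_mul, mul_assoc]
  let e : ℕ → V := fun t => bV.equivFun.symm fun j => (f j).coeff t
  have hmul : ∀ (T : V →ₗ[k] W) t, bW.equivFun (T (e t)) =
      fun i => ∑ j, LinearMap.toMatrix bV bW T i j * (f j).coeff t := by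
    intro T t
    have := LinearMap.toMatrix_mulVec_repr bV bW T (e t)
    have h1 : (bV.repr (e t) : Fin _ → k) = fun j => (f j).coeff t :=
      bV.equivFun.apply_symm_apply _
    rw [h1] at this
    exact this.symm
  have he0 : A (e 0) = 0 := by
    apply bW.equivFun.injective
    rw [hmul, map_zero]
    ext i
    have := congrArg (fun p => p.coeff 0) (hrow i)
    simpa [finsetSum_coeff, MA] using this
  have he : ∀ t, A (e (t + 1)) = -B (e t) := by
    intro t
    apply bW.equivFun.injective
    rw [hmul, map_neg, hmul]
    ext i
    have := congrArg (fun p => p.coeff (t + 1)) (hrow i)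
    rw [finsetSum_coeff] at this
    simp only [coeff_add, coeff_C_mul, coeff_X_mul, coeff_zero, Finset.sum_add_distrib] at this
    exact eq_neg_of_add_eq_zero_left this
  obtain ⟨j, hj⟩ := Function.ne_iff.1 hf0
  refine absurd (h.lt_of_chain (Finset.univ.sup fun j => (f j).natDegree)
    (fun t => (-1 : k) ^ t • e t) ?_ ?_ ?_ ⟨(f j).natDegree, ?_⟩) (by omega)
  · simp [he0]
  · intro t
    simp only [map_smul, he, pow_succ]
    simp
  · intro t ht
    have : (fun j => (f j).coeff t) = 0 := by
      ext j
      exact coeff_eq_zero_of_natDegree_lt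
        (lt_of_le_of_lt (Finset.le_sup (f := fun j => (f j).natDegree) (Finset.mem_univ j)) ht)
    change _ • bV.equivFun.symm (fun j => (f j).coeff t) = 0
    rw [this, map_zero, smul_zero]
  · intro h0
    rw [smul_eq_zero_iff_right (pow_ne_zero _ (by simp))] at h0
    have := congrFun (bV.equivFun.symm.map_eq_zero_iff.1 h0) j
    exact hj (leadingCoeff_eq_zero.1 this)

/-- The normal form of an indecomposable pencil whose first map is invertible. -/
lemma PencilIndec.exists_basis [IsAlgClosed k] [FiniteDimensional k V]
    (h : PencilIndec A B) (hA : Function.Bijective A) :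
    ∃ c : k, (∀ c' x, x ≠ 0 → B x = c' • A x → c' = c) ∧
    ∃ b : Module.Basis (Fin (Module.finrank k V)) k V, ∀ s,
      B (b s) = c • A (b s) +
        if h : s.1 + 1 < Module.finrank k V then A (b ⟨s.1 + 1, h⟩) else 0 := by
  let e := LinearEquiv.ofBijective A hA
  have : Nontrivial V := h.1.elim id fun _ => e.toEquiv.nontrivial
  have hT : ∀ x, A ((e.symm.toLinearMap ∘ₗ B) x) = B x := fun x => e.apply_symm_apply _
  obtain ⟨c, hc, b, hb⟩ := exists_jordan_basis (e.symm.toLinearMap ∘ₗ B) fun p p' hp h1 h2 => by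
    have hmap : ∀ p : Submodule k V, p ≤ p.comap (e.symm.toLinearMap ∘ₗ B) → p ≤ (p.map A).comap B :=
      fun p h1 x hx => ⟨_, h1 hx, hT x⟩
    rcases h.2 p p' (p.map A) (p'.map A) hp
      (hp.map (Submodule.orderIsoMapComap e)) (Submodule.le_comap_map _ _) (hmap p h1)
      (Submodule.le_comap_map _ _) (hmap p' h2) with h3 | h3
    · exact Or.inl h3.1
    · exact Or.inr h3.1
  refine ⟨c, fun c' x hx hB => eq_of_isNilpotent_sub hc hx ?_, b, fun s => ?_⟩
  · apply hA.1
    rw [hT, hB, map_smul]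
  · rw [← hT, hb, map_add, map_smul]
    split_ifs <;> simp

/-- The normal form of an indecomposable pencil between spaces of the same dimension whose first
map is not invertible. -/
lemma PencilIndec.exists_basis_of_not_injective [IsAlgClosed k] [FiniteDimensional k V]
    [FiniteDimensional k W] (h : PencilIndec A B) (hd : Module.finrank k V = Module.finrank k W)
    (hA : ¬ Function.Injective A) : Function.Bijective B ∧
    ∃ b : Module.Basis (Fin (Module.finrank k V)) k V, ∀ s,
      A (b s) = if h : s.1 + 1 < Module.finrank k V then B (b ⟨s.1 + 1, h⟩) else 0 := by
  have hbij : ∀ T : V →ₗ[k] W, Function.Injective T → Function.Bijective T := fun T hT =>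
    ⟨hT, (LinearMap.injective_iff_surjective_of_finrank_eq_finrank hd).1 hT⟩
  obtain ⟨x, hx, hx0⟩ : ∃ x, A x = 0 ∧ x ≠ 0 := by
    rw [injective_iff_map_eq_zero] at hA
    push Not at hA
    exact hA
  obtain ⟨c, hc⟩ := h.exists_injective hd
  have hcB : c • B x ≠ 0 := fun h0 => hx0 (hc (by simp [hx, h0]))
  have hc0 : c ≠ 0 := fun h0 => hcB (by rw [h0, zero_smul])
  -- The operator `(A + c B)⁻¹ A` has a single eigenvalue, and that is `0`, so `B` is injective.
  have hS : PencilIndec (A + c • B) A := ⟨h.1, fun p p' q q' hp hq h1 h2 h3 h4 => by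
    have key : ∀ (p : Submodule k V) (q : Submodule k W), p ≤ q.comap (A + c • B) →
        p ≤ q.comap A → p ≤ q.comap B := by
      intro p q h1 h2 y hy
      have := q.sub_mem (h1 hy) (h2 hy)
      rw [LinearMap.add_apply, add_sub_cancel_left, LinearMap.smul_apply] at this
      exact (q.smul_mem_iff hc0).1 this
    exact h.2 p p' q q' hp hq h2 (key p q h1 h2) h4 (key p' q' h3 h4)⟩
  obtain ⟨μ, hμ, -⟩ := hS.exists_basis (hbij _ hc)
  have hμ0 : 0 = μ := hμ 0 x hx0 (by simp [hx])
  have hB : Function.Injective B := by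
    rw [injective_iff_map_eq_zero]
    intro y hy
    by_contra hy0
    exact one_ne_zero ((hμ 1 y hy0 (by simp [hy])).trans hμ0.symm)
  refine ⟨hbij _ hB, ?_⟩
  obtain ⟨ν, hν, b, hb⟩ := h.symm.exists_basis (hbij _ hB)
  have hν0 : 0 = ν := hν 0 x hx0 (by simp [hx])
  exact ⟨b, fun s => by rw [hb, ← hν0, zero_smul, zero_add]⟩

/-- In given dimensions there is at most one indecomposable pencil whose first map is not
invertible. -/
lemma PencilIndec.iso_of_not_bijective [IsAlgClosed k] [FiniteDimensional k V]
    [FiniteDimensional k W] [FiniteDimensional k V'] [FiniteDimensional k W']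
    (h : PencilIndec A B) (h' : PencilIndec A' B')
    (hV : Module.finrank k V = Module.finrank k V') (hW : Module.finrank k W = Module.finrank k W')
    (hA : ¬ Function.Bijective A) (hA' : ¬ Function.Bijective A') : PencilIso A B A' B' := by
  rcases lt_trichotomy (Module.finrank k V) (Module.finrank k W) with hd | hd | hd
  · exact pencilIso_of_finrank_lt _ h h' rfl hV hW hd
  · have hd' := hV.symm.trans (hd.trans hW)
    obtain ⟨hB, b, hb⟩ := h.exists_basis_of_not_injective hd fun hi =>
      hA ⟨hi, (LinearMap.injective_iff_surjective_of_finrank_eq_finrank hd).1 hi⟩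
    obtain ⟨hB', b', hb'⟩ := h'.exists_basis_of_not_injective hd' fun hi =>
      hA' ⟨hi, (LinearMap.injective_iff_surjective_of_finrank_eq_finrank hd').1 hi⟩
    let g : V ≃ₗ[k] V' := b.equiv b' (finCongr hV)
    have hg : ∀ s, g (b s) = b' (finCongr hV s) := fun s => b.equiv_apply s b' _
    let e : W ≃ₗ[k] W' := (LinearEquiv.ofBijective B hB).symm.trans
      (g.trans (LinearEquiv.ofBijective B' hB'))
    have he : ∀ x, e (B x) = B' (g x) := fun x => by
      change B' (g ((LinearEquiv.ofBijective B hB).symm (LinearEquiv.ofBijective B hB x))) = _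
      rw [LinearEquiv.symm_apply_apply]
    refine ⟨g, e, fun x => ?_, he⟩
    have : e.toLinearMap ∘ₗ A = A' ∘ₗ g.toLinearMap := b.ext fun s => by
      simp only [LinearMap.comp_apply, LinearEquiv.coe_coe, hg, hb, hb']
      by_cases hs : s.1 + 1 < Module.finrank k V
      · rw [dif_pos hs, dif_pos (by change s.1 + 1 < _; omega), he, hg]
        rfl
      · rw [dif_neg hs, dif_neg (by change ¬ s.1 + 1 < _; omega), map_zero]
    exact LinearMap.congr_fun this x
  · exact pencilIso_of_finrank_gt _ h h' rfl hV hW hd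

end Pencil

namespace MatrixModel

/-! ### Infinitely many indecomposable modules -/

section Infinite

variable {k : Type u} [Field k] {A : Type u} [Ring A] [Algebra k A] {X B : Type}
  [Fintype X] [DecidableEq X] [DecidableEq B] (S : MatrixModel k A X B)

/-- Generators of pairwise non-isomorphic submodules of an indecomposable projective module,
parametrized by the affine line. -/
def lineElt (b : B) (c : k) : A := S.unit (S.o (b, true)) (S.o (b, false)) (y k - c • x k)

lemma line_mem_gr (b : B) (c : k) :
    y k - c • x k ∈ gr k (S.v (S.o (b, true))) (S.v (S.o (b, false))) := by
  rw [S.v_o, S.v_o]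
  exact Submodule.sub_mem _ (y_mem_gr b false) (Submodule.smul_mem _ _ (x_mem_gr b false))

lemma line_mem_gr' (b : B) (c : k) :
    x k + c • y k ∈ gr k (S.v (S.o (b, false))) (S.v (S.o (b, true))) := by
  rw [S.v_o, S.v_o]
  exact Submodule.add_mem _ (x_mem_gr b true) (Submodule.smul_mem _ _ (y_mem_gr b true))

lemma lineElt_ne_zero (b : B) (c : k) : S.lineElt b c ≠ 0 := fun h => by
  have h1 : y k - c • x k = 0 :=
    S.unit_injective (S.line_mem_gr b c) h
  simpa using congrArg ArrowRing.cy h1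

/-- The element that annihilates `A * lineElt b c` on the left, and thereby determines `c`. -/
lemma unit_mul_mul_lineElt (b : B) (c c' : k) (a : A) :
    S.unit (S.o (b, false)) (S.o (b, true)) (x k + c • y k) * (a * S.lineElt b c') =
      S.unit (S.o (b, false)) (S.o (b, false))
        ((x k + c • y k) * S.toHom a (S.o (b, true)) (S.o (b, true)) * (y k - c' • x k)) := by
  rw [lineElt, ← S.eps_mul_unit (S.o (b, true)), ← mul_assoc, ← mul_assoc,
    S.unit_mul_mul_eps (S.line_mem_gr' b c), S.unit_mul _ (S.line_mem_gr b c')]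
  exact gr_mul (S.line_mem_gr' b c) (S.mem_gr a _ _)

/-- The element `x + c y` between the vertices annihilates the module of the parameter `c` but not
that of any other parameter. -/
lemma lineElt_injective (b : B) {c c' : k}
    (e : Submodule.span A {S.lineElt b c} ≃ₗ[A] Submodule.span A {S.lineElt b c'}) : c = c' := by
  obtain ⟨⟨m, hm⟩, he⟩ := e.surjective ⟨_, Submodule.mem_span_singleton_self (S.lineElt b c')⟩
  obtain ⟨a, rfl⟩ := Submodule.mem_span_singleton.1 hm
  set z := S.unit (S.o (b, false)) (S.o (b, true)) (x k + c • y k) with hz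
  have h1 : z • (⟨a • S.lineElt b c, hm⟩ : Submodule.span A {S.lineElt b c}) = 0 := by
    ext
    change z * (a * S.lineElt b c) = 0
    rw [hz, S.unit_mul_mul_lineElt, mul_right_comm]
    have : (x k + c • y k) * (y k - c • x k) = 0 := by ext <;> simp
    rw [this, zero_mul, map_zero]
  have h2 := congrArg Subtype.val (congrArg (z • ·) he)
  simp only [← map_smul, h1, map_zero] at h2
  have h3 : z * (1 * S.lineElt b c') = 0 := by rw [one_mul]; exact h2.symm
  rw [hz, S.unit_mul_mul_lineElt, map_one, Matrix.one_apply_eq, mul_one] at h3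
  have h4 : (x k + c • y k) * (y k - c' • x k) = 0 :=
    S.unit_injective (gr_mul (S.line_mem_gr' b c) (S.line_mem_gr b c')) h3
  have := congrArg ArrowRing.cs h4
  simp at this
  linear_combination this

/-- The cyclic submodules generated by the elements `lineElt b c` of one projective module are
indecomposable, since their socle is simple, and pairwise non-isomorphic. -/
lemma infinite_isoClasses [Infinite k] [Nonempty B] (S : MatrixModel k A X B) :
    (isoClasses A fun M => IsIndecomposableModule A M ∧ Module.Finite A M).Infinite := by
  obtain ⟨b⟩ := ‹Nonempty B›
  refine Set.infinite_of_injective_forall_mem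
    (f := fun c : k => Quotient.mk (isIsomorphicSetoid (ModuleCat.{u} A))
      (ModuleCat.of A (Submodule.span A {S.lineElt b c}))) ?_ ?_
  · intro c c' h
    obtain ⟨e⟩ := Quotient.exact h
    exact S.lineElt_injective b e.toLinearEquiv
  · intro c
    refine ⟨_, ⟨?_, ?_⟩, rfl⟩
    · refine S.isIndecomposable_of_le_P (w := (b, false)) ?_ ?_
      · rw [Submodule.span_singleton_le_iff_mem, S.mem_P]
        exact S.unit_mul_eps _ _ _
      · rw [Ne, Submodule.span_singleton_eq_bot]
        exact S.lineElt_ne_zero b c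
    · exact Module.Finite.iff_fg.2 ⟨{S.lineElt b c}, by simp⟩

end Infinite

/-! ### Modules over algebras of graded matrices -/

section Modules

variable {k : Type u} [Field k] {A : Type u} [Ring A] [Algebra k A] {X B : Type}
  [Fintype X] [DecidableEq X] [DecidableEq B] (S : MatrixModel k A X B)
variable {M M' : Type u} [AddCommGroup M] [Module A M] [AddCommGroup M'] [Module A M']

lemma toFiber_smul (x : X) (a : A) (m : M) : S.unit (S.o (S.v x)) x 1 • a • m =
    ∑ y, S.unit (S.o (S.v x)) (S.o (S.v y)) (S.toHom a x y) • S.unit (S.o (S.v y)) y 1 • m := by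
  have h : ∀ y, S.unit (S.o (S.v x)) x 1 * a * S.eps y =
      S.unit (S.o (S.v x)) (S.o (S.v y)) (S.toHom a x y) * S.unit (S.o (S.v y)) y 1 := fun y => by
    rw [S.unit_mul_mul_eps, S.unit_mul, one_mul, mul_one]
    · rw [S.v_o, S.v_o]; exact S.mem_gr _ _ _
    · rw [S.v_o]; exact one_mem_gr _
    · rw [S.v_o]; exact one_mem_gr _
  rw [smul_smul, ← mul_one (S.unit _ x 1 * a), ← S.sum_eps, Finset.mul_sum, Finset.sum_smul]
  exact Finset.sum_congr rfl fun y _ => by rw [h, mul_smul]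

lemma fromFiber_toFiber (x : X) : S.unit x (S.o (S.v x)) 1 * S.unit (S.o (S.v x)) x 1 = S.eps x := by
  rw [S.unit_mul, one_mul, eps]
  all_goals rw [S.v_o]; exact one_mem_gr _

lemma toFiber_fromFiber (x : X) :
    S.unit (S.o (S.v x)) x 1 * S.unit x (S.o (S.v x)) 1 = S.eps (S.o (S.v x)) := by
  rw [S.unit_mul, one_mul, eps]
  all_goals rw [S.v_o]; exact one_mem_gr _

lemma eq_sum_fromFiber (m : M) :
    m = ∑ x, S.unit x (S.o (S.v x)) 1 • S.unit (S.o (S.v x)) x 1 • m := by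
  simp_rw [smul_smul, S.fromFiber_toFiber]
  rw [← Finset.sum_smul, S.sum_eps, one_smul]

lemma ext_toFiber {m m' : M}
    (h : ∀ x, S.unit (S.o (S.v x)) x 1 • m = S.unit (S.o (S.v x)) x 1 • m') : m = m' := by
  rw [S.eq_sum_fromFiber m, S.eq_sum_fromFiber m']
  simp_rw [h]

/-- An indecomposable module lies in a block. -/
lemma exists_block [Fintype B] (hM : IsIndecomposableModule A M) :
    ∃ b, ∀ m : M, S.blockIdem b • m = m := by
  obtain ⟨m, hm⟩ := @exists_ne M hM.1 0
  obtain ⟨b, hb⟩ : ∃ b, S.blockIdem b • m ≠ 0 := by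
    by_contra! h
    apply hm
    rw [← one_smul A m, ← S.sum_blockIdem, Finset.sum_smul]
    exact Finset.sum_eq_zero fun b _ => h b
  refine ⟨b, ?_⟩
  set e := S.blockIdem b
  have hee : ∀ m : M, e • e • m = e • m := fun m => by
    rw [smul_smul, (S.blockIdem_idem b).eq]
  have hea : ∀ (a : A) (m : M), e • a • m = a • e • m := fun a m => by
    rw [smul_smul, smul_smul, S.blockIdem_mul_comm]
  let T : M →ₗ[A] M := { toFun := fun m => e • m, map_add' := smul_add e, map_smul' := hea }
  have hT : IsIdempotentElem T := LinearMap.ext hee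
  rcases hM.2 _ _ (LinearMap.IsIdempotentElem.isCompl hT) with h | h
  · exact absurd (LinearMap.congr_fun (LinearMap.range_eq_bot.1 h) m) hb
  · intro m
    refine LinearMap.ker_eq_bot.1 h ?_
    exact hee m

variable [Module k M] [IsScalarTower k A M] [Module k M'] [IsScalarTower k A M']

variable (M) in
/-- The part of a module sitting at a vertex. -/
def fiber (w : B × Bool) : Submodule k M where
  carrier := {m | S.eps (S.o w) • m = m}
  add_mem' h h' := by
    rw [Set.mem_ofPred_eq] at *
    rw [smul_add, h, h']
  zero_mem' := smul_zero _
  smul_mem' c m h := by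
    rw [Set.mem_ofPred_eq] at *
    rw [smul_algebra_smul_comm, h]

lemma mem_fiber {w : B × Bool} {m : M} : m ∈ S.fiber M w ↔ S.eps (S.o w) • m = m := Iff.rfl

lemma unit_smul_mem_fiber (w : B × Bool) (y : X) (t : ArrowRing k) (m : M) :
    S.unit (S.o w) y t • m ∈ S.fiber M w := by
  rw [S.mem_fiber, smul_smul, S.eps_mul_unit]

lemma toFiber_sum_fromFiber {f : X → M} (hf : ∀ x, f x ∈ S.fiber M (S.v x)) (y : X) :
    S.unit (S.o (S.v y)) y 1 • ∑ x, S.unit x (S.o (S.v x)) 1 • f x = f y := by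
  rw [Finset.smul_sum, Finset.sum_eq_single y]
  · rw [smul_smul, S.toFiber_fromFiber]
    exact hf y
  · intro x _ hx
    rw [smul_smul, S.unit_mul_of_ne hx.symm, zero_smul]
  · simp

variable (M) in
/-- A module is the direct sum of copies of its parts at the vertices. -/
def fiberEquiv : M ≃ₗ[k] (∀ x, S.fiber M (S.v x)) where
  toFun m x := ⟨S.unit (S.o (S.v x)) x 1 • m, S.unit_smul_mem_fiber _ _ _ _⟩
  map_add' m m' := by ext x; simp [smul_add]
  map_smul' c m := by ext x; simp [smul_algebra_smul_comm]
  invFun f := ∑ x, S.unit x (S.o (S.v x)) 1 • (f x : M)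
  left_inv m := (S.eq_sum_fromFiber m).symm
  right_inv f := by
    ext x
    exact S.toFiber_sum_fromFiber (fun x => (f x).2) x

/-- The submodule given by a family of subspaces of the parts at the vertices. -/
def ofFamily (p : B × Bool → Submodule k M)
    (hp : ∀ w w', ∀ t ∈ gr k w w', ∀ m ∈ p w', S.unit (S.o w) (S.o w') t • m ∈ p w) :
    Submodule A M where
  carrier := {m | ∀ x, S.unit (S.o (S.v x)) x 1 • m ∈ p (S.v x)}
  add_mem' h h' x := by
    rw [smul_add]
    exact (p _).add_mem (h x) (h' x)
  zero_mem' x := by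
    rw [smul_zero]
    exact (p _).zero_mem
  smul_mem' a m h x := by
    rw [S.toFiber_smul]
    exact Submodule.sum_mem _ fun y _ => hp _ _ _ (S.mem_gr _ _ _) _ (h y)

/-- The decompositions of an indecomposable module given by families of subspaces are trivial. -/
lemma eq_bot_of_family (hM : IsIndecomposableModule A M) (p p' : B × Bool → Submodule k M)
    (hp : ∀ w w', ∀ t ∈ gr k w w', ∀ m ∈ p w', S.unit (S.o w) (S.o w') t • m ∈ p w)
    (hp' : ∀ w w', ∀ t ∈ gr k w w', ∀ m ∈ p' w', S.unit (S.o w) (S.o w') t • m ∈ p' w)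
    (hinf : ∀ w, p w ⊓ p' w = ⊥) (hsup : ∀ w, p w ⊔ p' w = S.fiber M w) :
    (∀ w, p w = ⊥) ∨ (∀ w, p' w = ⊥) := by
  have hmem : ∀ (p : B × Bool → Submodule k M)
      (hp : ∀ w w', ∀ t ∈ gr k w w', ∀ m ∈ p w', S.unit (S.o w) (S.o w') t • m ∈ p w),
      (∀ w, p w ≤ S.fiber M w) → ∀ x, ∀ m ∈ p (S.v x),
        S.unit x (S.o (S.v x)) 1 • m ∈ S.ofFamily p hp := by
    intro p hp h x m hm y
    rw [smul_smul]
    by_cases hxy : x = y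
    · subst hxy
      rw [S.toFiber_fromFiber, S.mem_fiber.1 (h _ hm)]
      exact hm
    · rw [S.unit_mul_of_ne (Ne.symm hxy), zero_smul]
      exact (p _).zero_mem
  have hle : ∀ w, p w ≤ S.fiber M w := fun w => hsup w ▸ le_sup_left
  have hle' : ∀ w, p' w ≤ S.fiber M w := fun w => hsup w ▸ le_sup_right
  have hbot : ∀ (p : B × Bool → Submodule k M)
      (hp : ∀ w w', ∀ t ∈ gr k w w', ∀ m ∈ p w', S.unit (S.o w) (S.o w') t • m ∈ p w),
      (∀ w, p w ≤ S.fiber M w) → S.ofFamily p hp = ⊥ → ∀ w, p w = ⊥ := by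
    intro p hp h h0 w
    rw [eq_bot_iff]
    intro m hm
    have h1 := hmem p hp h (S.o w) m (by rwa [S.v_o])
    rw [h0, Submodule.mem_bot, S.v_o] at h1
    have h2 : S.eps (S.o w) • m = m := h w hm
    rw [Submodule.mem_bot, ← h2]
    exact h1
  have hc : IsCompl (S.ofFamily p hp) (S.ofFamily p' hp') := by
    rw [isCompl_iff, Submodule.disjoint_def, codisjoint_iff, eq_top_iff]
    constructor
    · intro m h1 h2
      refine S.ext_toFiber fun x => ?_
      have : S.unit (S.o (S.v x)) x 1 • m ∈ p (S.v x) ⊓ p' (S.v x) := ⟨h1 x, h2 x⟩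
      rw [hinf, Submodule.mem_bot] at this
      rw [this, smul_zero]
    · intro m _
      rw [S.eq_sum_fromFiber m]
      refine Submodule.sum_mem _ fun x _ => ?_
      have h1 : S.unit (S.o (S.v x)) x 1 • m ∈ S.fiber M (S.v x) := S.unit_smul_mem_fiber _ _ _ _
      rw [← hsup] at h1
      obtain ⟨a, ha, a', ha', hs⟩ := Submodule.mem_sup.1 h1
      rw [← hs, smul_add]
      exact Submodule.add_mem_sup (hmem p hp hle x a ha) (hmem p' hp' hle' x a' ha')
  exact (hM.2 _ _ hc).imp (hbot p hp hle) (hbot p' hp' hle')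

/-- Maps between the parts at the vertices that commute with the action extend to an isomorphism
of modules. -/
lemma nonempty_equiv_of_family (g : B × Bool → M →ₗ[k] M') (g' : B × Bool → M' →ₗ[k] M)
    (hg : ∀ w, ∀ m ∈ S.fiber M w, g w m ∈ S.fiber M' w)
    (hg' : ∀ w, ∀ m ∈ S.fiber M' w, g' w m ∈ S.fiber M w)
    (hgg : ∀ w, ∀ m ∈ S.fiber M w, g' w (g w m) = m)
    (hgg' : ∀ w, ∀ m ∈ S.fiber M' w, g w (g' w m) = m)
    (hcomm : ∀ w w', ∀ t ∈ gr k w w', ∀ m ∈ S.fiber M w',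
      g w (S.unit (S.o w) (S.o w') t • m) = S.unit (S.o w) (S.o w') t • g w' m) :
    Nonempty (M ≃ₗ[A] M') := by
  let F : M → M' := fun m => ∑ x, S.unit x (S.o (S.v x)) 1 • g (S.v x) (S.unit (S.o (S.v x)) x 1 • m)
  let F' : M' → M := fun m => ∑ x, S.unit x (S.o (S.v x)) 1 • g' (S.v x) (S.unit (S.o (S.v x)) x 1 • m)
  have hF : ∀ m y, S.unit (S.o (S.v y)) y 1 • F m = g (S.v y) (S.unit (S.o (S.v y)) y 1 • m) :=
    fun m y => S.toFiber_sum_fromFiber (fun x => hg _ _ (S.unit_smul_mem_fiber _ _ _ _)) y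
  have hF' : ∀ m y, S.unit (S.o (S.v y)) y 1 • F' m = g' (S.v y) (S.unit (S.o (S.v y)) y 1 • m) :=
    fun m y => S.toFiber_sum_fromFiber (fun x => hg' _ _ (S.unit_smul_mem_fiber _ _ _ _)) y
  refine ⟨{ toFun := F, invFun := F', map_add' := ?_, map_smul' := ?_, left_inv := ?_, right_inv := ?_ }⟩
  · intro m m'
    refine S.ext_toFiber fun x => ?_
    rw [smul_add, hF, hF, hF, smul_add, map_add]
  · intro a m
    refine S.ext_toFiber fun x => ?_
    rw [hF, RingHom.id_apply, S.toFiber_smul, S.toFiber_smul, map_sum]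
    refine Finset.sum_congr rfl fun y _ => ?_
    rw [hcomm _ _ _ (S.mem_gr _ _ _) _ (S.unit_smul_mem_fiber _ _ _ _), hF]
  · intro m
    refine S.ext_toFiber fun x => ?_
    rw [hF', hF, hgg _ _ (S.unit_smul_mem_fiber _ _ _ _)]
  · intro m
    refine S.ext_toFiber fun x => ?_
    rw [hF, hF', hgg' _ _ (S.unit_smul_mem_fiber _ _ _ _)]

end Modules

end MatrixModel

namespace MatrixModel

/-! ### Splitting off the projective modules -/

section Socle

variable {k : Type u} [Field k] {A : Type u} [Ring A] [Algebra k A] {X B : Type}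
  [Fintype X] [DecidableEq X] [DecidableEq B] (S : MatrixModel k A X B)
variable {M : Type u} [AddCommGroup M] [Module A M] [Module k M]

lemma unit_eq_zero {x y : X} {t : ArrowRing k} (h : grProj k (S.v x) (S.v y) t = 0) :
    S.unit x y t = 0 := by
  rw [← S.unit_proj, h, map_zero]

lemma eq_of_forall_cs {w w' : B × Bool} {t t' : ArrowRing k} (h : t ∈ gr k w w') (h' : t' ∈ gr k w w')
    (ht : ∀ r ∈ gr k w' w, (r * t).cs = (r * t').cs) : t = t' := by
  by_contra hne
  obtain ⟨r, hr, hs⟩ := exists_mul_eq_s_of_gr (Submodule.sub_mem _ h h') (sub_ne_zero.2 hne)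
  have := congrArg ArrowRing.cs hs
  rw [mul_sub] at this
  have h2 : (r * t).cs - (r * t').cs = 1 := by
    rw [sub_eq_add_neg] at this ⊢
    exact this
  rw [ht r hr, sub_self] at h2
  exact zero_ne_one h2

lemma eq_of_mem_P {w : B × Bool} {a a' : A} (h : a ∈ S.P w) (h' : a' ∈ S.P w)
    (he : ∀ z, S.toHom a z (S.o w) = S.toHom a' z (S.o w)) : a = a' := by
  by_contra hne
  obtain ⟨z, hz⟩ := S.exists_entry_ne_zero (Submodule.sub_mem _ h h') (sub_ne_zero.2 hne)
  apply hz
  rw [map_sub, Matrix.sub_apply, he, sub_self]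

/-- The entry in row `x` of the homomorphism to the projective module of `w` induced by a linear
functional: pairing with the trace form, which is nondegenerate. -/
def functionalEntry (φ : Module.Dual k M) (w : B × Bool) (m : M) (z : X) : ArrowRing k :=
  ⟨φ (S.unit (S.o w) z (s k) • m), φ (S.unit (S.o w) z (x k) • m), φ (S.unit (S.o w) z (y k) • m),
    φ (S.unit (S.o w) z 1 • m)⟩

/-- The entries are admissible because `unit` vanishes on the elements of the wrong parity. -/
lemma functionalEntry_mem (φ : Module.Dual k M) (w : B × Bool) (m : M) (z : X) :
    S.functionalEntry φ w m z ∈ gr k (S.v z) w := by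
  have h0 : ∀ t, grProj k w (S.v z) t = 0 → S.unit (S.o w) z t = 0 := fun t ht =>
    S.unit_eq_zero (by rwa [S.v_o])
  unfold gr
  split_ifs with hb
  · have h1 : ∀ t, proj (w.2 == (S.v z).2) t = 0 → S.unit (S.o w) z t = 0 := fun t ht =>
      h0 t (by rwa [grProj, if_pos hb.symm])
    rw [Bool.beq_comm]
    cases hc : (w.2 == (S.v z).2) <;> rw [hc] at h1
    · rw [mem_part_false]
      constructor
      · change φ _ = 0
        rw [h1 _ (by ext <;> simp [proj]), zero_smul, map_zero]
      · change φ _ = 0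
        rw [h1 _ (by ext <;> simp [proj]), zero_smul, map_zero]
    · rw [mem_part_true]
      constructor
      · change φ _ = 0
        rw [h1 _ (by ext <;> simp [proj]), zero_smul, map_zero]
      · change φ _ = 0
        rw [h1 _ (by ext <;> simp [proj]), zero_smul, map_zero]
  · have h1 : ∀ t, S.unit (S.o w) z t = 0 := fun t => h0 t (by rw [grProj, if_neg (Ne.symm hb)]; rfl)
    rw [Submodule.mem_bot]
    simp only [functionalEntry, h1, zero_smul, map_zero]
    rfl

lemma unit_mem_P (w : B × Bool) (z : X) (t : ArrowRing k) : S.unit z (S.o w) t ∈ S.P w :=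
  S.mem_P.2 (S.unit_mul_eps _ _ _)

/-- The matrix with the column `functionalEntry φ w m`. -/
def functionalElt (φ : Module.Dual k M) (w : B × Bool) (m : M) : A :=
  ∑ z, S.unit z (S.o w) (S.functionalEntry φ w m z)

lemma functionalElt_mem (φ : Module.Dual k M) (w : B × Bool) (m : M) :
    S.functionalElt φ w m ∈ S.P w :=
  Submodule.sum_mem _ fun z _ => S.unit_mem_P w z _

lemma toHom_functionalElt (φ : Module.Dual k M) (w : B × Bool) (m : M) (z : X) :
    S.toHom (S.functionalElt φ w m) z (S.o w) = S.functionalEntry φ w m z := by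
  rw [functionalElt, map_sum, Matrix.sum_apply, Finset.sum_eq_single z]
  · rw [S.toHom_unit_of_mem (by rw [S.v_o]; exact S.functionalEntry_mem φ w m z),
      Matrix.single_apply_same]
  · intro z' _ hz
    rw [S.toHom_unit_of_mem (by rw [S.v_o]; exact S.functionalEntry_mem φ w m z'),
      Matrix.single_apply_of_row_ne hz]
  · simp

lemma functionalElt_add (φ : Module.Dual k M) (w : B × Bool) (m m' : M) :
    S.functionalElt φ w (m + m') = S.functionalElt φ w m + S.functionalElt φ w m' :=
  S.eq_of_mem_P (S.functionalElt_mem _ _ _)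
    (Submodule.add_mem _ (S.functionalElt_mem _ _ _) (S.functionalElt_mem _ _ _)) fun z => by
      rw [map_add, Matrix.add_apply, S.toHom_functionalElt, S.toHom_functionalElt,
        S.toHom_functionalElt]
      ext <;> simp [functionalEntry]

variable [IsScalarTower k A M]

lemma mul_functionalEntry_cs (φ : Module.Dual k M) (w : B × Bool) (m : M) (z : X) (r : ArrowRing k) :
    (r * S.functionalEntry φ w m z).cs = φ (S.unit (S.o w) z r • m) := by
  have h : r = r.c1 • 1 + r.cx • x k + r.cy • y k + r.cs • s k := by ext <;> simp
  conv_rhs => rw [h]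
  simp only [map_add, map_smul, add_smul, smul_assoc, smul_eq_mul, functionalEntry, mul_cs]
  ring

lemma functionalElt_smul (φ : Module.Dual k M) (w : B × Bool) (a : A) (m : M) :
    S.functionalElt φ w (a • m) = a * S.functionalElt φ w m :=
  S.eq_of_mem_P (S.functionalElt_mem _ _ _)
    (Submodule.smul_mem _ a (S.functionalElt_mem _ _ _)) fun z => by
      rw [map_mul, Matrix.mul_apply, S.toHom_functionalElt]
      simp_rw [S.toHom_functionalElt]
      refine eq_of_forall_cs (S.functionalEntry_mem φ w _ z) (Submodule.sum_mem _ fun z' _ =>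
        gr_mul (S.mem_gr a z z') (S.functionalEntry_mem φ w m z')) fun r hr => ?_
      have hcs : ∀ f : X → ArrowRing k, (∑ z, f z).cs = ∑ z, (f z).cs := fun f =>
        map_sum (⟨⟨ArrowRing.cs, rfl⟩, fun _ _ => rfl⟩ : ArrowRing k →+ k) f _
      have hsum : S.unit (S.o w) z r * a = ∑ z', S.unit (S.o w) z' (r * S.toHom a z z') := by
        rw [← mul_one (S.unit _ z r * a), ← S.sum_eps, Finset.mul_sum]
        exact Finset.sum_congr rfl fun z' _ => S.unit_mul_mul_eps (by rwa [S.v_o]) a z'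
      rw [S.mul_functionalEntry_cs, smul_smul, hsum, Finset.sum_smul, map_sum, Finset.mul_sum, hcs]
      refine Finset.sum_congr rfl fun z' _ => ?_
      rw [← S.mul_functionalEntry_cs, mul_assoc]

/-- The homomorphism to the projective module of `w` induced by a linear functional: the algebra is
symmetric, so homomorphisms to it are the same as linear functionals. -/
def functionalHom (φ : Module.Dual k M) (w : B × Bool) : M →ₗ[A] S.P w where
  toFun m := ⟨S.functionalElt φ w m, S.functionalElt_mem φ w m⟩
  map_add' m m' := Subtype.ext (S.functionalElt_add φ w m m')
  map_smul' a m := Subtype.ext (S.functionalElt_smul φ w a m)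

lemma toHom_functionalHom (φ : Module.Dual k M) (w : B × Bool) (m : M) (z : X) :
    S.toHom (S.functionalHom φ w m) z (S.o w) = S.functionalEntry φ w m z :=
  S.toHom_functionalElt φ w m z

/-- An indecomposable module on which a socle element acts non-trivially is projective. -/
lemma nonempty_equiv_P_of_soc_smul (hM : IsIndecomposableModule A M) {w : B × Bool} {m : M}
    (h : S.soc w • m ≠ 0) : Nonempty (M ≃ₗ[A] S.P w) := by
  obtain ⟨φ, hφ⟩ : ∃ φ : Module.Dual k M, φ (S.soc w • m) ≠ 0 := by
    by_contra! hc
    exact h ((Module.forall_dual_apply_eq_zero_iff k _).1 hc)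
  have h1 : S.toL w (S.functionalHom φ w m) ≠ 0 := by
    rw [Ne, S.toL_eq_zero_iff]
    intro h0
    have := h0 (S.o w)
    rw [S.toHom_functionalHom] at this
    exact hφ this
  obtain ⟨a, ha⟩ := S.exists_mul_eq_eps h1
  refine nonempty_equiv_of_surjective hM (S.functionalHom φ w) ?_
  rintro ⟨p, hp⟩
  refine ⟨(p * a) • m, Subtype.ext ?_⟩
  rw [map_smul]
  change p * a * (S.functionalHom φ w m).1 = p
  rw [mul_assoc, ha]
  exact S.mem_P.1 hp

end Socle

/-! ### Modules on which the arrows act in one direction -/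

section OneWay

variable {k : Type u} [Field k] {A : Type u} [Ring A] [Algebra k A] {X B : Type}
  [Fintype X] [DecidableEq X] [DecidableEq B] (S : MatrixModel k A X B)
variable (M M' : Type u) [AddCommGroup M] [Module A M] [Module k M] [IsScalarTower k A M]
  [AddCommGroup M'] [Module A M'] [Module k M'] [IsScalarTower k A M']

/-- A module of the block `b` on which the socle of the algebra acts as zero and on which only the
arrows that start at the vertex `(b, c)` act non-trivially. -/
structure OneWay (b : B) (c : Bool) : Prop where
  fiber_eq_bot : ∀ w : B × Bool, w.1 ≠ b → S.fiber M w = ⊥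
  even_smul : ∀ w, ∀ t ∈ gr k w w, ∀ m ∈ S.fiber M w, S.unit (S.o w) (S.o w) t • m = t.c1 • m
  odd_smul : ∀ t ∈ gr k (b, c) (b, !c), ∀ m ∈ S.fiber M (b, !c),
    S.unit (S.o (b, c)) (S.o (b, !c)) t • m = 0

variable {M M'}

variable {S} in
/-- An entry between two vertices acts by its scalar part if the vertices agree, along the one
direction of the arrows, or as zero. -/
lemma OneWay.unit_smul {b : B} {c : Bool} (h : S.OneWay M b c) {w w' : B × Bool} {t : ArrowRing k}
    (ht : t ∈ gr k w w') {m : M} (hm : m ∈ S.fiber M w') :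
    (w = w' ∧ S.unit (S.o w) (S.o w') t • m = t.c1 • m) ∨ (w = (b, !c) ∧ w' = (b, c)) ∨
      S.unit (S.o w) (S.o w') t • m = 0 := by
  by_cases hw : w = w'
  · subst hw
    exact Or.inl ⟨rfl, h.even_smul w t ht m hm⟩
  by_cases hb : w.1 = w'.1
  · by_cases hb' : w'.1 = b
    · obtain ⟨b1, c1⟩ := w
      obtain ⟨b2, c2⟩ := w'
      simp only at hb hb'
      subst hb hb'
      obtain rfl : c1 = !c2 := by
        cases c1 <;> cases c2 <;> simp_all
      by_cases hc : c2 = c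
      · subst hc
        exact Or.inr (Or.inl ⟨rfl, rfl⟩)
      · obtain rfl : c = !c2 := by cases c <;> cases c2 <;> simp_all
        refine Or.inr (Or.inr ?_)
        have := h.odd_smul t (by rwa [Bool.not_not]) m (by rwa [Bool.not_not])
        rwa [Bool.not_not] at this
    · rw [h.fiber_eq_bot w' hb', Submodule.mem_bot] at hm
      rw [hm, smul_zero]
      exact Or.inr (Or.inr rfl)
  · rw [eq_zero_of_mem_gr hb ht, map_zero, zero_smul]
    exact Or.inr (Or.inr rfl)

/-- An indecomposable module on which all socle elements act as zero has arrows acting in one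
direction only: the images of the arrows are killed by the arrows, so they split off. -/
lemma exists_oneWay [Fintype B] (hM : IsIndecomposableModule A M)
    (h0 : ∀ w, ∀ m : M, S.soc w • m = 0) : ∃ b c, S.OneWay M b c := by
  obtain ⟨b, hb⟩ := S.exists_block hM
  have heven : ∀ w, ∀ t ∈ gr k w w, ∀ m ∈ S.fiber M w, S.unit (S.o w) (S.o w) t • m = t.c1 • m := by
    intro w t ht m hm
    rw [gr_self] at ht
    rw [eq_of_mem_part_true ht, map_add, map_smul, map_smul, add_smul, smul_assoc, smul_assoc]
    change _ • S.eps (S.o w) • m + _ • S.soc w • m = _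
    rw [h0, smul_zero, add_zero, S.mem_fiber.1 hm]
    simp
  have hfib : ∀ w : B × Bool, w.1 ≠ b → S.fiber M w = ⊥ := by
    intro w hw
    rw [eq_bot_iff]
    intro m hm
    rw [Submodule.mem_bot, ← hb m, ← S.mem_fiber.1 hm, smul_smul,
      S.blockIdem_mul_eps_of_ne (by rwa [S.v_o]), zero_smul]
  -- `R w` is the sum of the images of the arrows that end at `w`; it is killed by all arrows.
  let R : B × Bool → Submodule k M := fun w => Submodule.span k
    {m | ∃ w', w' ≠ w ∧ ∃ t ∈ gr k w w', ∃ m' ∈ S.fiber M w', m = S.unit (S.o w) (S.o w') t • m'}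
  have hR : ∀ w, R w ≤ S.fiber M w := by
    intro w
    rw [Submodule.span_le]
    rintro m ⟨w', -, t, -, m', -, rfl⟩
    exact S.unit_smul_mem_fiber _ _ _ _
  have hkill : ∀ w w', w ≠ w' → ∀ t ∈ gr k w w', ∀ m ∈ R w', S.unit (S.o w) (S.o w') t • m = 0 := by
    intro w w' hw t ht m hm
    induction hm using Submodule.span_induction with
    | mem m hm =>
      obtain ⟨w'', hw', t', ht', m', hm', rfl⟩ := hm
      rw [smul_smul, S.unit_mul (by rwa [S.v_o, S.v_o]) (by rwa [S.v_o, S.v_o])]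
      by_cases h1 : w.1 = w'.1
      · by_cases h2 : w'.1 = w''.1
        · obtain ⟨b1, c1⟩ := w
          obtain ⟨b2, c2⟩ := w'
          obtain ⟨b3, c3⟩ := w''
          simp only at h1 h2
          subst h1 h2
          obtain rfl : c1 = c3 := by cases c1 <;> cases c2 <;> cases c3 <;> simp_all
          rw [heven _ _ (gr_mul ht ht') _ hm']
          have hc : (c1 == c2) = false := by cases c1 <;> cases c2 <;> simp_all
          rw [gr_eq_part, hc, mem_part_false] at ht
          rw [mul_c1, ht.1, zero_mul, zero_smul]
        · rw [eq_zero_of_mem_gr h2 ht', mul_zero, map_zero, zero_smul]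
      · rw [eq_zero_of_mem_gr h1 ht, zero_mul, map_zero, zero_smul]
    | zero => exact smul_zero _
    | add m m' _ _ h h' => rw [smul_add, h, h', add_zero]
    | smul c m _ h => rw [smul_algebra_smul_comm, h, smul_zero]
  -- The complements `T` at one type and the images `R` at the other type form a submodule, and the
  -- two submodules obtained in this way are complementary.
  choose C hC using fun w => Submodule.exists_isCompl (R w)
  let T : B × Bool → Submodule k M := fun w => C w ⊓ S.fiber M w
  have hT : ∀ w, R w ⊓ T w = ⊥ := fun w => by
    rw [← inf_assoc, (hC w).inf_eq_bot, bot_inf_eq]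
  have hT' : ∀ w, R w ⊔ T w = S.fiber M w := fun w => by
    rw [← sup_inf_assoc_of_le _ (hR w), (hC w).sup_eq_top, top_inf_eq]
  let p : Bool → B × Bool → Submodule k M := fun c w => if w.2 = c then T w else R w
  have hp : ∀ c w w', ∀ t ∈ gr k w w', ∀ m ∈ p c w', S.unit (S.o w) (S.o w') t • m ∈ p c w := by
    intro c w w' t ht m hm
    have hm' : m ∈ S.fiber M w' := by
      change m ∈ (if _ then _ else _ : Submodule k M) at hm
      split_ifs at hm
      · exact hm.2
      · exact hR _ hm
    by_cases hw : w = w'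
    · subst hw
      rw [heven w t ht m hm']
      exact Submodule.smul_mem _ _ hm
    · by_cases hc' : w'.2 = c
      · by_cases hb' : w.1 = w'.1
        · have hc : w.2 ≠ c := fun h => hw (Prod.ext hb' (h.trans hc'.symm))
          simp only [p, if_neg hc]
          exact Submodule.subset_span ⟨w', Ne.symm hw, t, ht, m, hm', rfl⟩
        · rw [eq_zero_of_mem_gr hb' ht, map_zero, zero_smul]
          exact Submodule.zero_mem _
      · simp only [p, if_neg hc'] at hm
        rw [hkill w w' hw t ht m hm]
        exact Submodule.zero_mem _
  have hcases := S.eq_bot_of_family hM (p true) (p false) (hp true) (hp false)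
    (fun ⟨b, c⟩ => by cases c <;> simp [p, hT, inf_comm (T _)])
    (fun ⟨b, c⟩ => by cases c <;> simp [p, hT', sup_comm (T _)])
  obtain ⟨c, hc⟩ : ∃ c, ∀ w, p (!c) w = ⊥ := by
    rcases hcases with h | h
    · exact ⟨false, h⟩
    · exact ⟨true, h⟩
  refine ⟨b, c, hfib, heven, fun t ht m hm => ?_⟩
  have h1 : S.unit (S.o (b, c)) (S.o (b, !c)) t • m ∈ R (b, c) :=
    Submodule.subset_span ⟨(b, !c), by simp, t, ht, m, hm, rfl⟩
  have h2 := hc (b, c)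
  simp only [p] at h2
  rw [if_neg (by simp)] at h2
  rwa [h2, Submodule.mem_bot] at h1

variable (M) in
/-- The action of a matrix unit between the parts at two vertices. -/
def arrow (w w' : B × Bool) (t : ArrowRing k) : S.fiber M w →ₗ[k] S.fiber M w' where
  toFun m := ⟨S.unit (S.o w') (S.o w) t • m, S.unit_smul_mem_fiber _ _ _ _⟩
  map_add' m m' := by ext; simp [smul_add]
  map_smul' c m := by ext; simp [smul_algebra_smul_comm]

lemma arrow_coe (w w' : B × Bool) (t : ArrowRing k) (m : S.fiber M w) :
    (S.arrow M w w' t m : M) = S.unit (S.o w') (S.o w) t • (m : M) := rfl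

lemma exists_fiber_ne_bot [Nontrivial M] : ∃ w, S.fiber M w ≠ ⊥ := by
  obtain ⟨m, hm⟩ := exists_ne (0 : M)
  obtain ⟨x, hx⟩ := S.exists_eps_smul_ne_zero hm
  obtain ⟨h1, h2⟩ := S.exists_vertex hx
  exact ⟨S.v x, fun h => h2 (by rw [← Submodule.mem_bot k, ← h]; exact h1)⟩

variable (k) in
lemma odd_eq {b : B} {c : Bool} {t : ArrowRing k} (ht : t ∈ gr k (b, !c) (b, c)) :
    t = t.cx • x k + t.cy • y k := by
  refine eq_of_mem_part_false ?_
  have : ((!c) == c) = false := by cases c <;> rfl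
  rwa [gr_eq_part, this] at ht

variable {S}

lemma OneWay.eq_or_eq {b : B} {c : Bool} (h : S.OneWay M b c) {w : B × Bool}
    (hw : S.fiber M w ≠ ⊥) : w = (b, c) ∨ w = (b, !c) := by
  obtain ⟨b', c'⟩ := w
  obtain rfl : b' = b := by
    by_contra hb
    exact hw (h.fiber_eq_bot _ hb)
  cases c <;> cases c' <;> simp

/-- The two arrows out of a vertex form an indecomposable pencil. -/
lemma OneWay.pencilIndec {b : B} {c : Bool} (h : S.OneWay M b c) (hM : IsIndecomposableModule A M) :
    PencilIndec (S.arrow M (b, c) (b, !c) (x k)) (S.arrow M (b, c) (b, !c) (y k)) := by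
  have := hM.1
  have hne : ((b, !c) : B × Bool) ≠ (b, c) := by simp
  constructor
  · obtain ⟨w, hw⟩ := S.exists_fiber_ne_bot (M := M)
    rcases h.eq_or_eq hw with rfl | rfl
    · exact Or.inl (Submodule.nontrivial_iff_ne_bot.2 hw)
    · exact Or.inr (Submodule.nontrivial_iff_ne_bot.2 hw)
  intro p p' q q' hp hq hAq hBq hAq' hBq'
  let f : Submodule k (S.fiber M (b, c)) → Submodule k (S.fiber M (b, !c)) → B × Bool →
      Submodule k M := fun p q w => if w = (b, c) then p.map (Submodule.subtype _) else
    if w = (b, !c) then q.map (Submodule.subtype _) else ⊥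
  have hf1 : ∀ p q, f p q (b, c) = p.map (Submodule.subtype _) := fun p q => if_pos rfl
  have hf2 : ∀ p q, f p q (b, !c) = q.map (Submodule.subtype _) := fun p q =>
    (if_neg hne).trans (if_pos rfl)
  have hf3 : ∀ p q w, w ≠ (b, c) → w ≠ (b, !c) → f p q w = ⊥ := fun p q w h1 h2 =>
    (if_neg h1).trans (if_neg h2)
  have hle : ∀ p q w, f p q w ≤ S.fiber M w := by
    intro p q w
    by_cases h1 : w = (b, c)
    · subst h1
      rw [hf1]
      exact Submodule.map_subtype_le _ _
    · by_cases h2 : w = (b, !c)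
      · subst h2
        rw [hf2]
        exact Submodule.map_subtype_le _ _
      · rw [hf3 p q w h1 h2]
        exact bot_le
  have hst : ∀ p q, p ≤ q.comap (S.arrow M (b, c) (b, !c) (x k)) →
      p ≤ q.comap (S.arrow M (b, c) (b, !c) (y k)) → ∀ w w', ∀ t ∈ gr k w w', ∀ m ∈ f p q w',
      S.unit (S.o w) (S.o w') t • m ∈ f p q w := by
    intro p q h1 h2 w w' t ht m hm
    rcases h.unit_smul ht (hle p q w' hm) with ⟨rfl, h3⟩ | ⟨rfl, rfl⟩ | h3
    · rw [h3]
      exact Submodule.smul_mem _ _ hm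
    · rw [hf1] at hm
      obtain ⟨m, hm, rfl⟩ := hm
      rw [hf2]
      have := q.add_mem (q.smul_mem t.cx (h1 hm)) (q.smul_mem t.cy (h2 hm))
      refine ⟨_, this, ?_⟩
      conv_rhs => rw [odd_eq k ht]
      simp [arrow_coe, add_smul, smul_assoc]
    · rw [h3]
      exact Submodule.zero_mem _
  have hmap : ∀ w (p p' : Submodule k (S.fiber M w)), IsCompl p p' →
      p.map (Submodule.subtype _) ⊓ p'.map (Submodule.subtype _) = ⊥ ∧
      p.map (Submodule.subtype _) ⊔ p'.map (Submodule.subtype _) = S.fiber M w := by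
    intro w p p' hp
    rw [← Submodule.map_sup, hp.sup_eq_top, ← Submodule.map_inf _ (Submodule.subtype_injective _),
      hp.inf_eq_bot]
    simp
  have hcases := S.eq_bot_of_family hM (f p q) (f p' q') (hst p q hAq hBq) (hst p' q' hAq' hBq')
    (fun w => ?_) (fun w => ?_)
  · have hb : ∀ p q, (∀ w, f p q w = ⊥) → p = ⊥ ∧ q = ⊥ := by
      intro p q h0
      have h1 := h0 (b, c)
      have h2 := h0 (b, !c)
      have hinj : ∀ w (p : Submodule k (S.fiber M w)), p.map (Submodule.subtype _) = ⊥ → p = ⊥ :=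
        fun w p hp => Submodule.map_injective_of_injective (Submodule.subtype_injective _)
          (hp.trans (Submodule.map_bot _).symm)
      rw [hf1] at h1
      rw [hf2] at h2
      exact ⟨hinj _ p h1, hinj _ q h2⟩
    exact hcases.imp (hb p q) (hb p' q')
  · by_cases h1 : w = (b, c)
    · subst h1
      rw [hf1, hf1]
      exact (hmap _ p p' hp).1
    · by_cases h2 : w = (b, !c)
      · subst h2
        rw [hf2, hf2]
        exact (hmap _ q q' hq).1
      · rw [hf3 p q w h1 h2, bot_inf_eq]
  · by_cases h1 : w = (b, c)
    · subst h1
      rw [hf1, hf1]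
      exact (hmap _ p p' hp).2
    · by_cases h2 : w = (b, !c)
      · subst h2
        rw [hf2, hf2]
        exact (hmap _ q q' hq).2
      · rw [hf3 p q w h1 h2, hf3 p' q' w h1 h2, bot_sup_eq, eq_comm]
        by_contra h3
        exact (h.eq_or_eq h3).elim h1 h2

/-- A module with arrows in one direction is determined by its pencil. -/
lemma OneWay.nonempty_equiv {b : B} {c : Bool} (h : S.OneWay M b c) (h' : S.OneWay M' b c)
    (hiso : PencilIso (S.arrow M (b, c) (b, !c) (x k)) (S.arrow M (b, c) (b, !c) (y k))
      (S.arrow M' (b, c) (b, !c) (x k)) (S.arrow M' (b, c) (b, !c) (y k))) :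
    Nonempty (M ≃ₗ[A] M') := by
  obtain ⟨g, e, hx, hy⟩ := hiso
  have hne : ((b, !c) : B × Bool) ≠ (b, c) := by simp
  let toF : ∀ (M : Type u) [AddCommGroup M] [Module A M] [Module k M] [IsScalarTower k A M] (w),
      M →ₗ[k] S.fiber M w := fun M _ _ _ _ w =>
    { toFun := fun m => ⟨S.eps (S.o w) • m, S.unit_smul_mem_fiber _ _ _ _⟩
      map_add' := fun m m' => by ext; simp [smul_add]
      map_smul' := fun c m => by ext; simp [smul_algebra_smul_comm] }
  let G : ∀ (M M' : Type u) [AddCommGroup M] [Module A M] [Module k M] [IsScalarTower k A M]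
      [AddCommGroup M'] [Module A M'] [Module k M'] [IsScalarTower k A M']
      (g : S.fiber M (b, c) →ₗ[k] S.fiber M' (b, c))
      (e : S.fiber M (b, !c) →ₗ[k] S.fiber M' (b, !c)), B × Bool → M →ₗ[k] M' :=
    fun M M' _ _ _ _ _ _ _ _ g e w =>
      if w = (b, c) then (Submodule.subtype _) ∘ₗ g ∘ₗ toF M (b, c) else
      if w = (b, !c) then (Submodule.subtype _) ∘ₗ e ∘ₗ toF M (b, !c) else 0
  have key : ∀ (M M' : Type u) [AddCommGroup M] [Module A M] [Module k M] [IsScalarTower k A M]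
      [AddCommGroup M'] [Module A M'] [Module k M'] [IsScalarTower k A M']
      (g : S.fiber M (b, c) →ₗ[k] S.fiber M' (b, c))
      (e : S.fiber M (b, !c) →ₗ[k] S.fiber M' (b, !c)),
      (∀ m : S.fiber M (b, c), G M M' g e (b, c) m = g m) ∧
      (∀ m : S.fiber M (b, !c), G M M' g e (b, !c) m = e m) := by
    intro M M' _ _ _ _ _ _ _ _ g e
    have hF : ∀ w (m : S.fiber M w), toF M w m = m := fun w m => Subtype.ext m.2
    constructor
    · intro m
      have h1 : G M M' g e (b, c) = (Submodule.subtype _) ∘ₗ g ∘ₗ toF M (b, c) := if_pos rfl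
      rw [h1]
      simp [hF]
    · intro m
      have h1 : G M M' g e (b, !c) = (Submodule.subtype _) ∘ₗ e ∘ₗ toF M (b, !c) :=
        (if_neg hne).trans (if_pos rfl)
      rw [h1]
      simp [hF]
  have hfib : ∀ (M : Type u) [AddCommGroup M] [Module A M] [Module k M] [IsScalarTower k A M]
      (h : S.OneWay M b c) (P : (w : B × Bool) → M → Prop), (∀ m : S.fiber M (b, c), P (b, c) m) →
      (∀ m : S.fiber M (b, !c), P (b, !c) m) → (∀ w, P w 0) → ∀ w, ∀ m ∈ S.fiber M w, P w m := by
    intro M _ _ _ _ h P h1 h2 h3 w m hm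
    by_cases hw : S.fiber M w = ⊥
    · rw [hw, Submodule.mem_bot] at hm
      rw [hm]
      exact h3 w
    · rcases h.eq_or_eq hw with rfl | rfl
      · exact h1 ⟨m, hm⟩
      · exact h2 ⟨m, hm⟩
  obtain ⟨k1, k2⟩ := key M M' g.toLinearMap e.toLinearMap
  obtain ⟨k3, k4⟩ := key M' M g.symm.toLinearMap e.symm.toLinearMap
  refine S.nonempty_equiv_of_family (G M M' g.toLinearMap e.toLinearMap)
    (G M' M g.symm.toLinearMap e.symm.toLinearMap) ?_ ?_ ?_ ?_ ?_
  · exact hfib M h (fun w m => _ ∈ S.fiber M' w) (fun m => by rw [k1]; exact (g m).2)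
      (fun m => by rw [k2]; exact (e m).2) (fun w => by rw [map_zero]; exact Submodule.zero_mem _)
  · exact hfib M' h' (fun w m => _ ∈ S.fiber M w) (fun m => by rw [k3]; exact (g.symm m).2)
      (fun m => by rw [k4]; exact (e.symm m).2) (fun w => by rw [map_zero]; exact Submodule.zero_mem _)
  · exact hfib M h (fun w m => G _ _ _ _ w (G _ _ _ _ w m) = m)
      (fun m => by rw [k1, k3]; simp) (fun m => by rw [k2, k4]; simp) (fun w => by simp)
  · exact hfib M' h' (fun w m => G _ _ _ _ w (G _ _ _ _ w m) = m)
      (fun m => by rw [k3, k1]; simp) (fun m => by rw [k4, k2]; simp) (fun w => by simp)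
  · intro w w' t ht m hm
    have hG : ∀ w, ∀ m ∈ S.fiber M w, G M M' g.toLinearMap e.toLinearMap w m ∈ S.fiber M' w :=
      hfib M h (fun w m => _ ∈ S.fiber M' w) (fun m => by rw [k1]; exact (g m).2)
        (fun m => by rw [k2]; exact (e m).2) (fun w => by rw [map_zero]; exact Submodule.zero_mem _)
    have heven : w = w' → G M M' g.toLinearMap e.toLinearMap w (S.unit (S.o w) (S.o w') t • m) =
        S.unit (S.o w) (S.o w') t • G M M' g.toLinearMap e.toLinearMap w' m := by
      rintro rfl
      rw [h.even_smul w t ht m hm, map_smul, h'.even_smul w t ht _ (hG w m hm)]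
    have hodd : w = (b, !c) ∧ w' = (b, c) →
        G M M' g.toLinearMap e.toLinearMap w (S.unit (S.o w) (S.o w') t • m) =
        S.unit (S.o w) (S.o w') t • G M M' g.toLinearMap e.toLinearMap w' m := by
      rintro ⟨rfl, rfl⟩
      rw [odd_eq k ht]
      have e1 := k2 (t.cx • S.arrow M (b, c) (b, !c) (x k) ⟨m, hm⟩ +
        t.cy • S.arrow M (b, c) (b, !c) (y k) ⟨m, hm⟩)
      have e2 := k1 ⟨m, hm⟩
      simp only [LinearEquiv.coe_coe, map_add, map_smul, hx, hy, Submodule.coe_add,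
        Submodule.coe_smul, arrow_coe] at e1 e2
      simp only [map_add, map_smul, add_smul, smul_assoc]
      rw [e1, e2]
    rcases h.unit_smul ht hm with h1 | h1 | h1
    · exact heven h1.1
    · exact hodd h1
    · rcases h'.unit_smul ht (hG w' m hm) with h2 | h2 | h2
      · exact heven h2.1
      · exact hodd h2
      · rw [h1, h2, map_zero]

end OneWay

end MatrixModel

namespace MatrixModel

/-! ### One-parameter families and tameness -/

section Family

variable {k : Type u} [Field k]

/-- The action of the ring of arrows between two types of a block in a module whose arrows start at
the type `c`, with `x` acting as the identity and `y` as the matrix `J`. -/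
def arrowBlock {K : Type u} [CommRing K] [Algebra k K] {m : ℕ} (J : Matrix (Fin m) (Fin m) K)
    (c c'' c' : Bool) : ArrowRing k →ₗ[k] Matrix (Fin m) (Fin m) K where
  toFun t := if c'' = c' then t.c1 • 1 else if c' = c then t.cx • 1 + t.cy • J else 0
  map_add' t t' := by
    split_ifs <;> simp only [add_c1, add_cx, add_cy, add_smul, add_zero]
    abel
  map_smul' r t := by
    split_ifs <;> simp only [smul_c1, smul_cx, smul_cy, mul_smul, RingHom.id_apply, smul_add, smul_zero]

set_option linter.unusedSimpArgs false in
/-- The blocks multiply like the entries: even entries act by their scalar part, and the product of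
two odd entries, a multiple of `s`, acts as zero because the arrows act in one direction. -/
lemma arrowBlock_mul {K : Type u} [CommRing K] [Algebra k K] {m : ℕ} (J : Matrix (Fin m) (Fin m) K)
    (c c₁ c₂ c₃ : Bool) {t t' : ArrowRing k} (ht : t ∈ part (c₁ == c₂)) (ht' : t' ∈ part (c₂ == c₃)) :
    arrowBlock J c c₁ c₂ t * arrowBlock J c c₂ c₃ t' = arrowBlock J c c₁ c₃ (t * t') := by
  have htrue : ∀ {t : ArrowRing k}, t ∈ part true → t.cx = 0 ∧ t.cy = 0 := fun h => h
  have hfalse : ∀ {t : ArrowRing k}, t ∈ part false → t.c1 = 0 ∧ t.cs = 0 := fun h => h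
  change (if _ then _ else if _ then _ else _) * (if _ then _ else if _ then _ else _) =
    (if _ then _ else if _ then _ else _)
  cases c <;> cases c₁ <;> cases c₂ <;> cases c₃ <;>
    first
      | (obtain ⟨h1, h2⟩ := htrue ht; obtain ⟨h3, h4⟩ := htrue ht'
         simp [smul_smul, h1, h2, h3, h4, mul_comm])
      | (obtain ⟨h1, h2⟩ := htrue ht; obtain ⟨h3, h4⟩ := hfalse ht'
         simp [smul_smul, mul_add, add_mul, smul_add, h1, h2, h3, h4, mul_comm])
      | (obtain ⟨h1, h2⟩ := hfalse ht; obtain ⟨h3, h4⟩ := htrue ht'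
         simp [smul_smul, mul_add, add_mul, smul_add, h1, h2, h3, h4, mul_comm])
      | (obtain ⟨h1, h2⟩ := hfalse ht; obtain ⟨h3, h4⟩ := hfalse ht'
         simp [h1, h2, h3, h4])

variable {A : Type u} [Ring A] [Algebra k A] {X B : Type}
  [Fintype X] [DecidableEq X] [DecidableEq B] (S : MatrixModel k A X B)

/-- The representation of the block `b` with the arrows at `(b, c)` acting by the pencil
`(1, J)`. -/
def pencilRep {K : Type u} [CommRing K] [Algebra k K] {m : ℕ} (b : B) (c : Bool)
    (J : Matrix (Fin m) (Fin m) K) :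
    A →ₐ[k] Matrix ({x // (S.v x).1 = b} × Fin m) ({x // (S.v x).1 = b} × Fin m) K :=
  AlgHom.ofLinearMap
    { toFun := fun a => Matrix.of fun p p' =>
        arrowBlock J c (S.v p.1).2 (S.v p'.1).2 (S.toHom a p.1 p'.1) p.2 p'.2
      map_add' := fun a a' => by
        ext p p'
        simp only [Matrix.of_apply, Matrix.add_apply]
        rw [map_add S.toHom, Matrix.add_apply, map_add, Matrix.add_apply]
      map_smul' := fun r a => by
        ext p p'
        simp only [Matrix.of_apply, Matrix.smul_apply, RingHom.id_apply]
        rw [map_smul S.toHom, Matrix.smul_apply, map_smul, Matrix.smul_apply] }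
    (by
      ext ⟨p, s⟩ ⟨p', s'⟩
      simp only [LinearMap.coe_mk, AddHom.coe_mk, Matrix.of_apply]
      rw [map_one S.toHom]
      by_cases hp : p = p'
      · subst hp
        rw [Matrix.one_apply_eq]
        simp [arrowBlock, Matrix.one_apply]
      · rw [Matrix.one_apply_ne (fun h => hp (Subtype.ext h)), map_zero, Matrix.one_apply_ne]
        · rfl
        · exact fun h => hp (congrArg Prod.fst h))
    (fun a a' => by
      ext ⟨⟨p, hp⟩, s⟩ ⟨⟨p', hp'⟩, s'⟩
      simp only [LinearMap.coe_mk, AddHom.coe_mk, Matrix.of_apply, Matrix.mul_apply]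
      rw [map_mul S.toHom, Matrix.mul_apply, map_sum, Matrix.sum_apply, Fintype.sum_prod_type,
        ← Fintype.sum_subtype_add_sum_subtype (fun z => (S.v z).1 = b), add_eq_left.2]
      · refine Finset.sum_congr rfl fun z _ => ?_
        have h1 := S.mem_gr a p z.1
        have h2 := S.mem_gr a' z.1 p'
        rw [gr, if_pos (hp.trans z.2.symm)] at h1
        rw [gr, if_pos (z.2.trans hp'.symm)] at h2
        rw [← arrowBlock_mul J c _ _ _ h1 h2, Matrix.mul_apply]
      · refine Finset.sum_eq_zero fun z _ => ?_
        rw [S.toHom_eq_zero (fun h => z.2 (h.symm.trans hp)), zero_mul, map_zero, Matrix.zero_apply])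

lemma pencilRep_apply {K : Type u} [CommRing K] [Algebra k K] {m : ℕ} (b : B) (c : Bool)
    (J : Matrix (Fin m) (Fin m) K) (a : A) (p p' : {x // (S.v x).1 = b} × Fin m) :
    S.pencilRep b c J a p p' =
      arrowBlock J c (S.v p.1).2 (S.v p'.1).2 (S.toHom a p.1 p'.1) p.2 p'.2 := rfl

/-- The Jordan block, with the subdiagonal entries equal to `1`. -/
def jordanBlock {K : Type u} [CommRing K] (m : ℕ) (r : K) : Matrix (Fin m) (Fin m) K :=
  Matrix.of fun s s' => if s = s' then r else if s.1 = s'.1 + 1 then 1 else 0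

/-- The one-parameter family of representations of a block with a Jordan block as pencil. -/
def familyRep {d m : ℕ} (b : B) (c : Bool) (e : {x // (S.v x).1 = b} × Fin m ≃ Fin d) :
    A →ₐ[k] Matrix (Fin d) (Fin d) k[X] :=
  (Matrix.reindexAlgEquiv k k[X] e).toAlgHom.comp
    (S.pencilRep b c (jordanBlock m (Polynomial.X : k[X])))

lemma specialize_familyRep {d m : ℕ} (b : B) (c : Bool) (e : {x // (S.v x).1 = b} × Fin m ≃ Fin d)
    (r : k) (a : A) (i j : Fin d) : specialize (S.familyRep b c e) r a i j =
      S.pencilRep b c (jordanBlock m r) a (e.symm i) (e.symm j) := by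
  change aeval r (S.pencilRep b c (jordanBlock m (Polynomial.X : k[X])) a (e.symm i) (e.symm j)) = _
  rw [pencilRep_apply, pencilRep_apply]
  simp only [arrowBlock, LinearMap.coe_mk, AddHom.coe_mk]
  have h1 : ∀ s s', aeval r ((1 : Matrix (Fin m) (Fin m) k[X]) s s') = (1 : Matrix _ _ k) s s' := by
    intro s s'
    rw [Matrix.one_apply, Matrix.one_apply]
    split_ifs <;> simp
  have h2 : ∀ s s', aeval r (jordanBlock m (Polynomial.X : k[X]) s s') = jordanBlock m r s s' := by
    intro s s'
    change aeval r (if _ then _ else if _ then _ else _ : k[X]) = (if _ then _ else if _ then _ else _)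
    split_ifs <;> simp
  split_ifs
  · rw [Matrix.smul_apply, Matrix.smul_apply, map_smul, h1]
  · rw [Matrix.add_apply, Matrix.add_apply, map_add, Matrix.smul_apply, Matrix.smul_apply,
      Matrix.smul_apply, Matrix.smul_apply, map_smul, map_smul, h1, h2]
  · exact map_zero _

/-- The matrices of the action between the parts at the vertices, when the pencil is `(1, J)` with a
Jordan block `J`. -/
lemma OneWay.toMatrix_arrow {S : MatrixModel k A X B} {M : Type u} [AddCommGroup M]
    [Module A M] [Module k M] [IsScalarTower k A M] {b : B} {c : Bool} (h : S.OneWay M b c)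
    {m : ℕ} (r : k) (β : ∀ c', Module.Basis (Fin m) k (S.fiber M (b, c')))
    (hx : ∀ s, S.arrow M (b, c) (b, !c) (x k) (β c s) = β (!c) s)
    (hy : ∀ s, S.arrow M (b, c) (b, !c) (y k) (β c s) =
      r • β (!c) s + if hs : s.1 + 1 < m then β (!c) ⟨s.1 + 1, hs⟩ else 0)
    (c' c'' : Bool) (t : ArrowRing k) (ht : t ∈ gr k (b, c'') (b, c')) :
    LinearMap.toMatrix (β c') (β c'') (S.arrow M (b, c') (b, c'') t) =
      arrowBlock (jordanBlock m r) c c'' c' t := by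
  ext s s'
  rw [LinearMap.toMatrix_apply]
  change _ = (if _ then _ else if _ then _ else _ : Matrix (Fin m) (Fin m) k) s s'
  split_ifs with h1 h2
  · subst h1
    have : S.arrow M (b, c'') (b, c'') t (β c'' s') = t.c1 • β c'' s' :=
      Subtype.ext (h.even_smul _ t ht _ (β c'' s').2)
    rw [this, map_smul, Module.Basis.repr_self, Finsupp.smul_single, Finsupp.single_apply]
    simp [Matrix.one_apply, eq_comm]
  · subst h2
    obtain rfl : c'' = !c' := by cases c' <;> cases c'' <;> simp_all
    have : S.arrow M (b, c') (b, !c') t (β c' s') =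
        t.cx • S.arrow M (b, c') (b, !c') (x k) (β c' s') +
          t.cy • S.arrow M (b, c') (b, !c') (y k) (β c' s') := by
      refine Subtype.ext ?_
      rw [Submodule.coe_add, Submodule.coe_smul, Submodule.coe_smul]
      simp only [arrow_coe]
      conv_lhs => rw [odd_eq k ht]
      rw [map_add, map_smul, map_smul, add_smul, smul_assoc, smul_assoc]
    rw [this, hx, hy]
    simp only [map_add, map_smul, Module.Basis.repr_self, Finsupp.add_apply, Finsupp.smul_apply,
      Matrix.add_apply, Matrix.smul_apply, Finsupp.single_apply, Matrix.one_apply, jordanBlock,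
      Matrix.of_apply]
    have hnext : (β !c').repr (if hs : s'.1 + 1 < m then β (!c') ⟨s'.1 + 1, hs⟩ else 0) s =
        if s.1 = s'.1 + 1 then 1 else 0 := by
      by_cases hs : s'.1 + 1 < m
      · rw [dif_pos hs, Module.Basis.repr_self, Finsupp.single_apply]
        exact if_congr ⟨fun h => by rw [← h], fun h => Fin.ext h.symm⟩ rfl rfl
      · rw [dif_neg hs, map_zero, Finsupp.zero_apply, if_neg (by omega)]
    rw [hnext]
    by_cases hss : s = s'
    · subst hss
      simp
    · simp [hss, Ne.symm hss]
  · obtain rfl : c' = !c := by cases c' <;> cases c <;> simp_all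
    obtain rfl : c'' = c := by cases c'' <;> cases c <;> simp_all
    have : S.arrow M (b, !c'') (b, c'') t (β (!c'') s') = 0 :=
      Subtype.ext (h.odd_smul t ht _ (β (!c'') s').2)
    rw [this, map_zero]
    rfl

lemma nonempty_equiv_repSpace {A : Type u} [Ring A] [Algebra k A] {M : Type u} [AddCommGroup M]
    [Module A M] {d : ℕ} (ρ : A →ₐ[k] Matrix (Fin d) (Fin d) k) {ι : Type} [Fintype ι] (e : ι ≃ Fin d)
    (F : M →+ (ι → k)) (hF : Function.Bijective F)
    (hsmul : ∀ (a : A) (u : M) p, F (a • u) p = ∑ p', ρ a (e p) (e p') * F u p') :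
    Nonempty (M ≃ₗ[A] RepSpace ρ) := by
  let L : M →ₗ[A] RepSpace ρ :=
    { toFun := fun u => show Fin d → k from F u ∘ e.symm
      map_add' := fun u u' => funext fun i => congrFun (F.map_add u u') (e.symm i)
      map_smul' := fun a u => funext fun i => by
        change F (a • u) (e.symm i) = ∑ j, ρ a i j * F u (e.symm j)
        rw [hsmul, Equiv.apply_symm_apply, ← Equiv.sum_comp e]
        simp_rw [Equiv.symm_apply_apply] }
  have hL : Function.Bijective L :=
    (Equiv.bijective (Equiv.arrowCongr e (Equiv.refl k))).comp hF
  exact ⟨LinearEquiv.ofBijective L hL⟩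

section Coordinates

variable {S} {M : Type u} [AddCommGroup M] [Module A M] [Module k M] [IsScalarTower k A M] {b : B}
  {c : Bool}

lemma v_eq (z : {x // (S.v x).1 = b}) : S.v z.1 = (b, (S.v z.1).2) := Prod.ext z.2 rfl

variable (S M) in
/-- The component of a module at an index of the block `b`. -/
def toFiber (z : {x // (S.v x).1 = b}) : M →ₗ[k] S.fiber M (b, (S.v z.1).2) where
  toFun u := ⟨S.unit (S.o (S.v z.1)) z.1 1 • u, by rw [← v_eq]; exact S.unit_smul_mem_fiber _ _ _ _⟩
  map_add' _ _ := Subtype.ext (smul_add _ _ _)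
  map_smul' _ _ := Subtype.ext (smul_algebra_smul_comm _ _ _)

lemma toFiber_apply_smul (a : A) (u : M) (z : {x // (S.v x).1 = b}) : S.toFiber M z (a • u) =
    ∑ z', S.arrow M (b, (S.v z'.1).2) (b, (S.v z.1).2) (S.toHom a z.1 z'.1) (S.toFiber M z' u) := by
  refine Subtype.ext ?_
  rw [Submodule.coe_sum]
  change S.unit (S.o (S.v z.1)) z.1 1 • a • u = _
  rw [S.toFiber_smul, ← Fintype.sum_subtype_add_sum_subtype (fun z => (S.v z).1 = b)]
  refine (add_eq_left.2 (Finset.sum_eq_zero fun z' _ => ?_)).trans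
    (Finset.sum_congr rfl fun z' _ => ?_)
  · rw [S.toHom_eq_zero (fun h => z'.2 (h.symm.trans z.2)), map_zero, zero_smul]
  · rw [arrow_coe]
    change _ = S.unit _ _ _ • S.unit (S.o (S.v z'.1)) z'.1 1 • u
    rw [← v_eq z, ← v_eq z']

/-- The coordinates of an element of a module with respect to bases of its parts. -/
def coords {m : ℕ} (β : ∀ c', Module.Basis (Fin m) k (S.fiber M (b, c'))) :
    M →ₗ[k] ({x // (S.v x).1 = b} × Fin m → k) :=
  LinearMap.pi fun p => (β (S.v p.1.1).2).coord p.2 ∘ₗ S.toFiber M p.1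

lemma coords_apply {m : ℕ} (β : ∀ c', Module.Basis (Fin m) k (S.fiber M (b, c'))) (u : M)
    (p : {x // (S.v x).1 = b} × Fin m) :
    coords β u p = (β (S.v p.1.1).2).repr (S.toFiber M p.1 u) p.2 := rfl

lemma OneWay.coords_injective (h : S.OneWay M b c) {m : ℕ}
    (β : ∀ c', Module.Basis (Fin m) k (S.fiber M (b, c'))) : Function.Injective (coords β) := by
  rw [injective_iff_map_eq_zero]
  intro u hu
  refine S.ext_toFiber fun z => ?_
  rw [smul_zero]
  by_cases hz : (S.v z).1 = b
  · have : S.toFiber M ⟨z, hz⟩ u = 0 := by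
      apply (β (S.v z).2).repr.injective
      rw [map_zero]
      ext s
      exact congrFun hu (⟨z, hz⟩, s)
    exact congrArg Subtype.val this
  · have h1 : S.unit (S.o (S.v z)) z 1 • u ∈ S.fiber M (S.v z) := S.unit_smul_mem_fiber _ _ _ _
    rwa [h.fiber_eq_bot _ hz, Submodule.mem_bot] at h1

/-- Elements of the module may be prescribed separately at the indices of the block. -/
lemma coords_surjective {m : ℕ} (β : ∀ c', Module.Basis (Fin m) k (S.fiber M (b, c'))) :
    Function.Surjective (coords β) := by
  intro f
  let g : ∀ z : {x // (S.v x).1 = b}, S.fiber M (b, (S.v z.1).2) := fun z =>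
    (β (S.v z.1).2).equivFun.symm fun s => f (z, s)
  let fam : X → M := fun z => if hz : (S.v z).1 = b then g ⟨z, hz⟩ else 0
  have hfam : ∀ z, fam z ∈ S.fiber M (S.v z) := by
    intro z
    simp only [fam]
    split_ifs with hz
    · have h1 : S.v z = (b, (S.v z).2) := v_eq ⟨z, hz⟩
      exact (congrArg (S.fiber M) h1).ge (g ⟨z, hz⟩).2
    · exact Submodule.zero_mem _
  refine ⟨∑ z, S.unit z (S.o (S.v z)) 1 • fam z, ?_⟩
  ext ⟨z, s⟩
  have h1 : S.toFiber M z (∑ z, S.unit z (S.o (S.v z)) 1 • fam z) = g z := by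
    refine Subtype.ext ?_
    change S.unit (S.o (S.v z.1)) z.1 1 • ∑ z, S.unit z (S.o (S.v z)) 1 • fam z = _
    rw [S.toFiber_sum_fromFiber hfam]
    exact dif_pos z.2
  rw [coords_apply, h1]
  exact congrFun ((β (S.v z.1).2).equivFun.apply_symm_apply _) s

lemma OneWay.coords_smul (h : S.OneWay M b c) {m : ℕ} (r : k)
    (β : ∀ c', Module.Basis (Fin m) k (S.fiber M (b, c')))
    (hx : ∀ s, S.arrow M (b, c) (b, !c) (x k) (β c s) = β (!c) s)
    (hy : ∀ s, S.arrow M (b, c) (b, !c) (y k) (β c s) =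
      r • β (!c) s + if hs : s.1 + 1 < m then β (!c) ⟨s.1 + 1, hs⟩ else 0)
    (a : A) (u : M) (p : {x // (S.v x).1 = b} × Fin m) :
    coords β (a • u) p = ∑ p', S.pencilRep b c (jordanBlock m r) a p p' * coords β u p' := by
  rw [coords_apply, toFiber_apply_smul, map_sum, Finsupp.finsetSum_apply, Fintype.sum_prod_type]
  refine Finset.sum_congr rfl fun z' _ => ?_
  rw [← LinearMap.toMatrix_mulVec_repr (β (S.v z'.1).2), h.toMatrix_arrow r β hx hy _ _ _ (by
    rw [← v_eq, ← v_eq]; exact S.mem_gr _ _ _)]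
  rfl

/-- A module with arrows in one direction whose pencil is `(1, J)` in suitable bases is the
representation defined by `J`. -/
lemma OneWay.nonempty_equiv_repSpace (h : S.OneWay M b c)
    {d m : ℕ} (e : {x // (S.v x).1 = b} × Fin m ≃ Fin d) (r : k)
    (β : ∀ c', Module.Basis (Fin m) k (S.fiber M (b, c')))
    (hx : ∀ s, S.arrow M (b, c) (b, !c) (x k) (β c s) = β (!c) s)
    (hy : ∀ s, S.arrow M (b, c) (b, !c) (y k) (β c s) =
      r • β (!c) s + if hs : s.1 + 1 < m then β (!c) ⟨s.1 + 1, hs⟩ else 0) :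
    Nonempty (M ≃ₗ[A] RepSpace (specialize (S.familyRep b c e) r)) := by
  refine MatrixModel.nonempty_equiv_repSpace _ e (coords β).toAddMonoidHom
    ⟨h.coords_injective β, coords_surjective β⟩ fun a u p => ?_
  simp_rw [S.specialize_familyRep, Equiv.symm_apply_apply]
  exact h.coords_smul r β hx hy a u p

end Coordinates

/-- An indecomposable module with arrows in one direction, the first of which is invertible, belongs
to the one-parameter family. -/
lemma OneWay.exists_equiv_repSpace [IsAlgClosed k] {S : MatrixModel k A X B} {M : Type u}
    [AddCommGroup M] [Module A M] [Module k M] [IsScalarTower k A M] [FiniteDimensional k M] {b : B}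
    {c : Bool} (h : S.OneWay M b c) (hM : IsIndecomposableModule A M)
    (hA : Function.Bijective (S.arrow M (b, c) (b, !c) (x k))) :
    ∃ m ≤ Module.finrank k M,
      Nonempty ({x // (S.v x).1 = b} × Fin m ≃ Fin (Module.finrank k M)) ∧
      ∀ e : {x // (S.v x).1 = b} × Fin m ≃ Fin (Module.finrank k M),
        ∃ r, Nonempty (M ≃ₗ[A] RepSpace (specialize (S.familyRep b c e) r)) := by
  obtain ⟨r, -, β, hβ⟩ := (h.pencilIndec hM).exists_basis hA
  obtain ⟨γ, hγ, hγ'⟩ : ∃ γ : ∀ c', Module.Basis (Fin (Module.finrank k (S.fiber M (b, c)))) k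
      (S.fiber M (b, c')), γ c = β ∧ γ (!c) = β.map (LinearEquiv.ofBijective _ hA) := by
    cases c
    · exact ⟨fun | false => β | true => β.map (LinearEquiv.ofBijective _ hA), rfl, rfl⟩
    · exact ⟨fun | true => β | false => β.map (LinearEquiv.ofBijective _ hA), rfl, rfl⟩
  have hdim : ∀ c', Module.finrank k (S.fiber M (b, c')) = Module.finrank k (S.fiber M (b, c)) :=
    fun c' => by rw [Module.finrank_eq_card_basis (γ c'), Fintype.card_fin]
  refine ⟨Module.finrank k (S.fiber M (b, c)), Submodule.finrank_le _, ?_, fun e =>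
    ⟨r, h.nonempty_equiv_repSpace e r γ (fun s => ?_) fun s => ?_⟩⟩
  · refine Fintype.card_eq.1 ?_
    rw [Fintype.card_prod, Fintype.card_fin, Fintype.card_fin, (S.fiberEquiv M).finrank_eq,
      Module.finrank_pi_fintype, ← Fintype.sum_subtype_add_sum_subtype (fun z => (S.v z).1 = b),
      add_eq_left.2]
    · rw [Finset.sum_congr rfl fun z _ => ?_, Finset.sum_const, Finset.card_univ, smul_eq_mul]
      have : S.v z.1 = (b, (S.v z.1).2) := Prod.ext z.2 rfl
      rw [← hdim (S.v z.1).2, ← this]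
    · exact Finset.sum_eq_zero fun z _ => by rw [h.fiber_eq_bot _ z.2, finrank_bot]
  · rw [hγ, hγ']
    rfl
  · rw [hγ, hγ', hβ]
    split_ifs <;> rfl

/-- Indecomposable modules with arrows in one direction, the first of which is not invertible, are
determined by the dimensions of their parts. -/
lemma OneWay.nonempty_equiv_of_finrank_eq [IsAlgClosed k] {S : MatrixModel k A X B} {M M' : Type u}
    [AddCommGroup M] [Module A M] [Module k M] [IsScalarTower k A M] [FiniteDimensional k M]
    [AddCommGroup M'] [Module A M'] [Module k M'] [IsScalarTower k A M'] [FiniteDimensional k M']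
    {b : B} {c : Bool} (h : S.OneWay M b c) (hM : IsIndecomposableModule A M)
    (h' : S.OneWay M' b c) (hM' : IsIndecomposableModule A M')
    (hA : ¬ Function.Bijective (S.arrow M (b, c) (b, !c) (x k)))
    (hA' : ¬ Function.Bijective (S.arrow M' (b, c) (b, !c) (x k)))
    (hd : ∀ c', Module.finrank k (S.fiber M (b, c')) = Module.finrank k (S.fiber M' (b, c'))) :
    Nonempty (M ≃ₗ[A] M') :=
  h.nonempty_equiv h' ((h.pencilIndec hM).iso_of_not_bijective (h'.pencilIndec hM') (hd c) (hd !c)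
    hA hA')

/-- The exceptional modules: the arrows act in one direction and the first one is not invertible. -/
def IsExceptional (b : B) (c : Bool) (f : Bool → ℕ) (M : Type u) [AddCommGroup M] [Module A M]
    [Module k M] [IsScalarTower k A M] : Prop :=
  FiniteDimensional k M ∧ IsIndecomposableModule A M ∧ S.OneWay M b c ∧
    (∀ c', Module.finrank k (S.fiber M (b, c')) = f c') ∧
    ¬ Function.Bijective (S.arrow M (b, c) (b, !c) (x k))

/-- An algebra of graded matrices over an algebraically closed field is tame. The one-parameter
families are indexed by a block, a direction of the arrows and the common dimension of the two
spaces; up to isomorphism the other indecomposable modules are the projective ones and at most one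
exceptional module for each block, direction and pair of dimensions. -/
theorem isTame [IsAlgClosed k] [Fintype B] [Nonempty B] (S : MatrixModel k A X B) : IsTame k A := by
  classical
  have : Infinite k := IsAlgClosed.instInfinite
  refine ⟨S.infinite_isoClasses, fun d => ?_⟩
  let I := {p : B × Bool × Fin (d + 1) //
    Nonempty ({x // (S.v x).1 = p.1} × Fin (p.2.2 : ℕ) ≃ Fin d)}
  let J := (B × Bool) ⊕ (B × Bool × (Bool → Fin (d + 1)))
  let Φ : I → (A →ₐ[k] Matrix (Fin d) (Fin d) k[X]) := fun p =>
    S.familyRep p.1.1 p.1.2.1 p.2.some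
  let Q : B × Bool × (Bool → Fin (d + 1)) → ModuleCat.{u} A → Prop := fun p N =>
    ∃ (_ : Module k N) (_ : IsScalarTower k A N),
      S.IsExceptional p.1 p.2.1 (fun c => (p.2.2 c : ℕ)) N
  let Y : J → ModuleCat.{u} A := Sum.elim (fun w => ModuleCat.of A (S.P w))
    (fun p => if h : ∃ N, Q p N then h.choose else ModuleCat.of A A)
  refine ⟨Fintype.card I, Φ ∘ (Fintype.equivFin I).symm, Fintype.card J,
    Y ∘ (Fintype.equivFin J).symm, ?_⟩
  intro M _ _ _ _ hfin hd hM
  have hJ : ∀ j : J, Nonempty (M ≃ₗ[A] Y j) →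
      ∃ t, Nonempty (M ≃ₗ[A] (Y ∘ (Fintype.equivFin J).symm) t) := fun j hj =>
    ⟨Fintype.equivFin J j, by rwa [Function.comp_apply, Equiv.symm_apply_apply]⟩
  by_cases h0 : ∀ w, ∀ u : M, S.soc w • u = 0
  · obtain ⟨b, c, h⟩ := S.exists_oneWay hM h0
    by_cases hA : Function.Bijective (S.arrow M (b, c) (b, !c) (x k))
    · right
      obtain ⟨m, hm, he, hr⟩ := h.exists_equiv_repSpace hM hA
      rw [hd] at hm
      subst hd
      let i : I := ⟨(b, c, ⟨m, by omega⟩), he⟩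
      obtain ⟨r, hr⟩ := hr i.2.some
      refine ⟨Fintype.equivFin I i, r, ?_⟩
      rw [Function.comp_apply, Equiv.symm_apply_apply]
      exact hr
    · left
      have hle : ∀ c', Module.finrank k (S.fiber M (b, c')) < d + 1 := fun c' => by
        have := Submodule.finrank_le (S.fiber M (b, c'))
        omega
      let p : B × Bool × (Bool → Fin (d + 1)) := (b, c, fun c' => ⟨_, hle c'⟩)
      have hp : S.IsExceptional b c (fun c' => (p.2.2 c' : ℕ)) M :=
        ⟨hfin, hM, h, fun _ => rfl, hA⟩
      have hex : ∃ N, Q p N := ⟨ModuleCat.of A M, ‹Module k M›, ‹IsScalarTower k A M›, hp⟩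
      refine hJ (Sum.inr p) ?_
      have hY : Y (Sum.inr p) = hex.choose := dif_pos hex
      rw [hY]
      obtain ⟨_, _, h1, h2, h3, h4, h5⟩ := hex.choose_spec
      exact h.nonempty_equiv_of_finrank_eq hM h3 h2 hA h5 fun c' => (h4 c').symm
  · push Not at h0
    obtain ⟨w, u, hu⟩ := h0
    exact Or.inl (hJ (Sum.inl w) (S.nonempty_equiv_P_of_soc_smul hM hu))

end Family

end MatrixModel

/-! ### Relations and a spanning set of the quantum group -/

section Relations

variable (k : Type u) [Field k] (n : ℕ) (q : k)

/-- The quotient map onto the quantum group. -/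
def mk : FreeAlgebra k Gen →ₐ[k] QU k n q := RingQuot.mkAlgHom k (Rel k n q)

lemma mk_surjective : Function.Surjective (mk k n q) := RingQuot.mkAlgHom_surjective k (Rel k n q)

variable {k n q}

lemma mk_ι (g : Gen) : mk k n q (FreeAlgebra.ι k g) = gen n q g := rfl

lemma mk_rel {a b : FreeAlgebra k Gen} (h : Rel k n q a b) : mk k n q a = mk k n q b :=
  RingQuot.mkAlgHom_rel k h

lemma kk_pow : gen n q Gen.kk ^ n = 1 := by
  simpa only [map_pow, map_one, mk_ι] using mk_rel (Rel.kk_pow (k := k) (n := n) (q := q))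

lemma kh_pow : gen n q Gen.kh ^ n * gen n q Gen.kk ^ 2 = 1 := by
  simpa only [map_mul, map_pow, map_one, mk_ι] using mk_rel (Rel.kh_pow (k := k) (n := n) (q := q))

lemma kk_kh : Commute (gen n q Gen.kk) (gen n q Gen.kh) := by
  change _ = _
  simpa only [map_mul, mk_ι] using mk_rel (Rel.kk_kh (k := k) (n := n) (q := q))

lemma kk_E : gen n q Gen.kk * gen n q Gen.E = q ^ n • (gen n q Gen.E * gen n q Gen.kk) := by
  simpa only [map_mul, map_smul, mk_ι] using mk_rel (Rel.kk_E (k := k) (n := n) (q := q))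

lemma kk_F : gen n q Gen.kk * gen n q Gen.F = (q ^ n)⁻¹ • (gen n q Gen.F * gen n q Gen.kk) := by
  simpa only [map_mul, map_smul, mk_ι] using mk_rel (Rel.kk_F (k := k) (n := n) (q := q))

lemma kh_E : gen n q Gen.kh * gen n q Gen.E =
    (q ^ n * (q ^ 2)⁻¹) • (gen n q Gen.E * gen n q Gen.kh) := by
  simpa only [map_mul, map_smul, mk_ι] using mk_rel (Rel.kh_E (k := k) (n := n) (q := q))

lemma kh_F : gen n q Gen.kh * gen n q Gen.F =
    ((q ^ n)⁻¹ * q ^ 2) • (gen n q Gen.F * gen n q Gen.kh) := by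
  simpa only [map_mul, map_smul, mk_ι] using mk_rel (Rel.kh_F (k := k) (n := n) (q := q))

lemma E_pow : gen n q Gen.E ^ (n ^ 2) = 0 := by
  simpa only [map_pow, map_zero, mk_ι] using mk_rel (Rel.E_pow (k := k) (n := n) (q := q))

lemma F_pow : gen n q Gen.F ^ (n ^ 2) = 0 := by
  simpa only [map_pow, map_zero, mk_ι] using mk_rel (Rel.F_pow (k := k) (n := n) (q := q))

lemma F_E : gen n q Gen.F * gen n q Gen.E - q⁻¹ • (gen n q Gen.E * gen n q Gen.F) =
    1 - cartan n q := by
  simpa only [map_mul, map_smul, map_sub, map_pow, map_one, mk_ι, cartan] using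
    mk_rel (Rel.F_E (k := k) (n := n) (q := q))

/-- Powers of an element that commutes with another one up to a scalar. -/
lemma pow_mul_of_smul {A : Type u} [Ring A] [Algebra k A] {g e : A} {c : k} (h : g * e = c • (e * g))
    (m : ℕ) : g ^ m * e = c ^ m • (e * g ^ m) := by
  induction m with
  | zero => simp
  | succ m ih =>
    rw [pow_succ, mul_assoc, h, mul_smul_comm, ← mul_assoc, ih, smul_mul_assoc, smul_smul, mul_assoc,
      pow_succ, mul_comm c]

lemma mul_pow_of_smul {A : Type u} [Ring A] [Algebra k A] {g e : A} {c : k} (h : g * e = c • (e * g))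
    (m : ℕ) : g * e ^ m = c ^ m • (e ^ m * g) := by
  induction m with
  | zero => simp
  | succ m ih =>
    rw [pow_succ, ← mul_assoc, ih, smul_mul_assoc, mul_assoc, h, mul_smul_comm, smul_smul, ← mul_assoc,
      pow_succ]

lemma mul_mul_of_smul {A : Type u} [Ring A] [Algebra k A] {g g' e : A} {c c' : k}
    (h : g * e = c • (e * g)) (h' : g' * e = c' • (e * g')) :
    g * g' * e = (c * c') • (e * (g * g')) := by
  rw [mul_assoc, h', mul_smul_comm, ← mul_assoc, h, smul_mul_assoc, smul_smul, mul_assoc, mul_comm c]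

lemma kk_cartan (hn : 0 < n) : gen n q Gen.kk * cartan n q = gen n q Gen.kh := by
  rw [cartan, ← mul_assoc, ← pow_succ', Nat.sub_add_cancel hn, kk_pow, one_mul]

lemma commute_kk_cartan : Commute (gen n q Gen.kk) (cartan n q) :=
  ((Commute.refl _).pow_right _).mul_right kk_kh

lemma commute_cartan_parity : Commute (cartan n q) (parity n q) :=
  (((Commute.refl _).pow_left _).mul_left kk_kh.symm).mul_right
    ((kk_kh.pow_left _).mul_left (Commute.refl _)|>.pow_right _)

lemma kk_sq_mul_cartan_pow (hn : 0 < n) : gen n q Gen.kk ^ 2 * cartan n q ^ n = 1 := by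
  have := kh_pow (k := k) (n := n) (q := q)
  rw [← kk_cartan hn, commute_kk_cartan.mul_pow, kk_pow, one_mul] at this
  rw [← this]
  exact (commute_kk_cartan.pow_pow 2 n).eq

lemma cartan_pow (hn : 0 < n) (h4 : 4 ∣ n) : cartan n q ^ (n ^ 2 / 2) = 1 := by
  obtain ⟨r, rfl⟩ := h4
  have h1 : (4 * r) ^ 2 / 2 = 4 * r * (2 * r) := by
    rw [show (4 * r) ^ 2 = 2 * (4 * r * (2 * r)) by ring]
    simp
  have h2 := congrArg (· ^ (2 * r)) (kk_sq_mul_cartan_pow (k := k) (q := q) hn)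
  rw [h1, pow_mul]
  simp only [one_pow] at h2
  rw [(commute_kk_cartan.pow_pow _ _).mul_pow, ← pow_mul, show 2 * (2 * r) = 4 * r by ring, kk_pow,
    one_mul] at h2
  exact h2

lemma parity_sq (h4 : 4 ∣ n) : parity n q * parity n q = 1 := by
  rw [← pow_two, parity, (kk_kh.pow_right _).mul_pow, ← pow_mul, Nat.div_mul_cancel
    (dvd_trans (by norm_num) h4), (kk_kh.pow_pow 2 n).eq, kh_pow]

/-- The generators of the torus are monomials in `cartan` and `parity`. -/
lemma kk_eq (hn : 0 < n) (h4 : 4 ∣ n) :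
    gen n q Gen.kk = parity n q * cartan n q ^ (n / 2 * (n / 2 - 1)) := by
  have h0 := kk_sq_mul_cartan_pow (k := k) (q := q) hn
  have h5 := commute_kk_cartan (k := k) (n := n) (q := q)
  rw [parity, ← kk_cartan hn, h5.mul_pow, mul_assoc, mul_assoc, ← pow_add]
  obtain ⟨r, rfl⟩ := h4
  have h1 : 4 * r / 2 = 2 * r := by omega
  rw [h1]
  have h2 : 2 * r + 2 * r * (2 * r - 1) = 4 * r * r := by
    obtain ⟨t, rfl⟩ : ∃ t, r = t + 1 := ⟨r - 1, by omega⟩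
    rw [show 2 * (t + 1) - 1 = 2 * t + 1 by omega]
    ring
  have h3 := congrArg (· ^ r) h0
  simp only [one_pow] at h3
  rw [(h5.pow_pow _ _).mul_pow, ← pow_mul, ← pow_mul] at h3
  rw [h2, h3, mul_one]

lemma q_ne_zero (hn : 0 < n) (hq : IsPrimitiveRoot q (n ^ 2)) : q ≠ 0 :=
  hq.ne_zero (by positivity)

lemma cartan_E (hn : 0 < n) (hq : IsPrimitiveRoot q (n ^ 2)) :
    cartan n q * gen n q Gen.E = q⁻¹ ^ 2 • (gen n q Gen.E * cartan n q) := by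
  rw [cartan, mul_mul_of_smul (pow_mul_of_smul kk_E _) kh_E]
  congr 1
  rw [← mul_assoc, ← pow_succ, Nat.sub_add_cancel hn, ← pow_mul, ← pow_two, hq.pow_eq_one, one_mul,
    inv_pow]

lemma cartan_F (hn : 0 < n) (hq : IsPrimitiveRoot q (n ^ 2)) :
    cartan n q * gen n q Gen.F = q ^ 2 • (gen n q Gen.F * cartan n q) := by
  rw [cartan, mul_mul_of_smul (pow_mul_of_smul kk_F _) kh_F]
  congr 1
  rw [← mul_assoc, ← pow_succ, Nat.sub_add_cancel hn, inv_pow, ← pow_mul, ← pow_two, hq.pow_eq_one,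
    inv_one, one_mul]

lemma q_pow_half (hn : 0 < n) (h4 : 4 ∣ n) (hq : IsPrimitiveRoot q (n ^ 2)) :
    q ^ (n ^ 2 / 2) = -1 := by
  have h2 : 2 ∣ n ^ 2 := dvd_trans (dvd_trans (by norm_num) h4) (dvd_pow_self n (by norm_num))
  exact (hq.pow (by positivity) (Nat.div_mul_cancel h2).symm).eq_neg_one_of_two_right

lemma parity_scalar (hn : 0 < n) (h4 : 4 ∣ n) (hq : IsPrimitiveRoot q (n ^ 2)) :
    q ^ n * (q ^ n * (q ^ 2)⁻¹) ^ (n / 2) = -1 := by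
  have h0 := q_ne_zero hn hq
  obtain ⟨r, hr⟩ := h4
  have h1 : n / 2 = 2 * r := by omega
  have h2 : n ^ 2 / 2 = n * (2 * r) := by
    rw [show n ^ 2 = 2 * (n * (2 * r)) by rw [hr]; ring]
    simp
  have h3 := q_pow_half hn ⟨r, hr⟩ hq
  rw [h1, mul_pow, ← pow_mul, inv_pow, ← pow_mul, show 2 * (2 * r) = n by omega, ← h2, h3]
  field_simp

lemma parity_E (hn : 0 < n) (h4 : 4 ∣ n) (hq : IsPrimitiveRoot q (n ^ 2)) :
    parity n q * gen n q Gen.E = (-1 : k) • (gen n q Gen.E * parity n q) := by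
  rw [parity, mul_mul_of_smul kk_E (pow_mul_of_smul kh_E _), parity_scalar hn h4 hq]

lemma parity_F (hn : 0 < n) (h4 : 4 ∣ n) (hq : IsPrimitiveRoot q (n ^ 2)) :
    parity n q * gen n q Gen.F = (-1 : k) • (gen n q Gen.F * parity n q) := by
  rw [parity, mul_mul_of_smul kk_F (pow_mul_of_smul kh_F _)]
  congr 1
  rw [← inv_inj, mul_inv, inv_inv, ← inv_pow, mul_inv, inv_inv, parity_scalar hn h4 hq]
  norm_num

lemma E_F (hn : 0 < n) (hq : IsPrimitiveRoot q (n ^ 2)) : gen n q Gen.E * gen n q Gen.F =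
    q • (gen n q Gen.F * gen n q Gen.E) - q • 1 + q • cartan n q := by
  have h := congrArg (q • ·) (F_E (k := k) (n := n) (q := q))
  simp only [smul_sub, smul_smul, mul_inv_cancel₀ (q_ne_zero hn hq), one_smul] at h
  rw [← sub_eq_zero] at h ⊢
  rw [← neg_eq_zero, ← h]
  abel

variable (n q) in
/-- The monomials `F ^ a cartan ^ s parity ^ j E ^ b`. -/
def mono (a s j b : ℕ) : QU k n q :=
  gen n q Gen.F ^ a * (cartan n q ^ s * parity n q ^ j) * gen n q Gen.E ^ b

lemma F_mul_mono (a s j b : ℕ) : gen n q Gen.F * mono n q a s j b = mono n q (a + 1) s j b := by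
  rw [mono, mono, pow_succ']
  simp only [mul_assoc]

lemma cartan_mul_mono (hn : 0 < n) (hq : IsPrimitiveRoot q (n ^ 2)) (a s j b : ℕ) :
    cartan n q * mono n q a s j b = (q ^ 2) ^ a • mono n q a (s + 1) j b := by
  rw [mono, mono, ← mul_assoc, ← mul_assoc, mul_pow_of_smul (cartan_F hn hq), smul_mul_assoc,
    smul_mul_assoc, pow_succ' (cartan n q)]
  simp only [mul_assoc]

lemma parity_mul_mono (hn : 0 < n) (h4 : 4 ∣ n) (hq : IsPrimitiveRoot q (n ^ 2)) (a s j b : ℕ) :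
    parity n q * mono n q a s j b = (-1 : k) ^ a • mono n q a s (j + 1) b := by
  rw [mono, mono, ← mul_assoc, ← mul_assoc, mul_pow_of_smul (parity_F hn h4 hq), smul_mul_assoc,
    smul_mul_assoc, pow_succ', ← mul_assoc (cartan n q ^ s), (commute_cartan_parity.pow_left s).eq]
  simp only [mul_assoc]

lemma E_mul_torus (hn : 0 < n) (h4 : 4 ∣ n) (hq : IsPrimitiveRoot q (n ^ 2)) (s j : ℕ) :
    gen n q Gen.E * (cartan n q ^ s * parity n q ^ j) =
      ((q ^ 2) ^ s * (-1) ^ j) • (cartan n q ^ s * parity n q ^ j * gen n q Gen.E) := by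
  rw [mul_mul_of_smul (pow_mul_of_smul (cartan_E hn hq) s) (pow_mul_of_smul (parity_E hn h4 hq) j),
    smul_smul]
  rw [show (q ^ 2) ^ s * (-1) ^ j * ((q⁻¹ ^ 2) ^ s * (-1) ^ j) = (q * q⁻¹) ^ (2 * s) * ((-1) * (-1)) ^ j
    by rw [mul_pow, mul_pow]; ring]
  simp [mul_inv_cancel₀ (q_ne_zero hn hq)]

variable (n q) in
/-- The span of all monomials. -/
def monoSpan : Submodule k (QU k n q) :=
  Submodule.span k (Set.range fun p : ℕ × ℕ × ℕ × ℕ => mono n q p.1 p.2.1 p.2.2.1 p.2.2.2)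

lemma mono_mem (a s j b : ℕ) : mono n q a s j b ∈ monoSpan n q :=
  Submodule.subset_span ⟨(a, s, j, b), rfl⟩

lemma mul_mem_monoSpan {g : QU k n q} (h : ∀ a s j b, g * mono n q a s j b ∈ monoSpan n q)
    {z : QU k n q} (hz : z ∈ monoSpan n q) : g * z ∈ monoSpan n q := by
  induction hz using Submodule.span_induction with
  | mem z hz =>
    obtain ⟨p, rfl⟩ := hz
    exact h _ _ _ _
  | zero => rw [mul_zero]; exact Submodule.zero_mem _
  | add z z' _ _ h1 h2 => rw [mul_add]; exact Submodule.add_mem _ h1 h2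
  | smul c z _ h1 => rw [mul_smul_comm]; exact Submodule.smul_mem _ _ h1

/-- The span of the monomials is stable under left multiplication by the generators and contains
`1`. -/
lemma monoSpan_eq_top (hn : 0 < n) (h4 : 4 ∣ n) (hq : IsPrimitiveRoot q (n ^ 2)) :
    monoSpan n q = ⊤ := by
  have hF : ∀ z ∈ monoSpan n q, gen n q Gen.F * z ∈ monoSpan n q := fun z => mul_mem_monoSpan
    fun a s j b => by rw [F_mul_mono]; exact mono_mem _ _ _ _
  have hK : ∀ z ∈ monoSpan n q, cartan n q * z ∈ monoSpan n q := fun z => mul_mem_monoSpan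
    fun a s j b => by rw [cartan_mul_mono hn hq]; exact Submodule.smul_mem _ _ (mono_mem _ _ _ _)
  have hp : ∀ z ∈ monoSpan n q, parity n q * z ∈ monoSpan n q := fun z => mul_mem_monoSpan
    fun a s j b => by rw [parity_mul_mono hn h4 hq]; exact Submodule.smul_mem _ _ (mono_mem _ _ _ _)
  have hE : ∀ z ∈ monoSpan n q, gen n q Gen.E * z ∈ monoSpan n q := fun z => mul_mem_monoSpan
    fun a s j b => by
      induction a with
      | zero =>
        rw [mono, pow_zero, one_mul, ← mul_assoc, E_mul_torus hn h4 hq, smul_mul_assoc, mul_assoc,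
          ← pow_succ']
        refine Submodule.smul_mem _ _ ?_
        have := mono_mem (n := n) (q := q) 0 s j (b + 1)
        rwa [mono, pow_zero, one_mul] at this
      | succ a ih =>
        rw [← F_mul_mono, ← mul_assoc, E_F hn hq, add_mul, sub_mul, smul_mul_assoc, smul_mul_assoc,
          smul_mul_assoc, one_mul, mul_assoc]
        exact Submodule.add_mem _ (Submodule.sub_mem _ (Submodule.smul_mem _ _ (hF _ ih))
          (Submodule.smul_mem _ _ (mono_mem _ _ _ _))) (Submodule.smul_mem _ _ (hK _ (mono_mem _ _ _ _)))
  have hKs : ∀ s, ∀ z ∈ monoSpan n q, cartan n q ^ s * z ∈ monoSpan n q := by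
    intro s
    induction s with
    | zero => intro z hz; rwa [pow_zero, one_mul]
    | succ s ih =>
      intro z hz
      rw [pow_succ', mul_assoc]
      exact hK _ (ih z hz)
  have hkk : ∀ z ∈ monoSpan n q, gen n q Gen.kk * z ∈ monoSpan n q := by
    intro z hz
    rw [kk_eq hn h4, mul_assoc]
    exact hp _ (hKs _ z hz)
  refine eq_top_of_generators (mk k n q) (mk_surjective k n q) _ ?_ ?_
  · have := mono_mem (k := k) (n := n) (q := q) 0 0 0 0
    simpa [mono] using this
  · intro g z hz
    rw [mk_ι]
    cases g with
    | kk => exact hkk z hz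
    | kh =>
      rw [← kk_cartan hn, mul_assoc]
      exact hkk _ (hK z hz)
    | E => exact hE z hz
    | F => exact hF z hz

variable (n q) in
/-- The reduced monomials. -/
def redMono (p : Fin (n ^ 2) × Fin (n ^ 2 / 2) × Fin 2 × Fin (n ^ 2)) : QU k n q :=
  mono n q p.1 p.2.1 p.2.2.1 p.2.2.2

lemma span_redMono (hn : 0 < n) (h4 : 4 ∣ n) (hq : IsPrimitiveRoot q (n ^ 2)) :
    ⊤ ≤ Submodule.span k (Set.range (redMono n q)) := by
  have hN : 0 < n ^ 2 / 2 := Nat.div_pos (by nlinarith [Nat.le_of_dvd hn h4]) (by norm_num)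
  rw [← monoSpan_eq_top hn h4 hq, monoSpan, Submodule.span_le]
  rintro _ ⟨⟨a, s, j, b⟩, rfl⟩
  by_cases ha : a < n ^ 2
  · by_cases hb : b < n ^ 2
    · refine Submodule.subset_span ⟨(⟨a, ha⟩, ⟨s % (n ^ 2 / 2), Nat.mod_lt _ hN⟩,
        ⟨j % 2, Nat.mod_lt _ (by norm_num)⟩, ⟨b, hb⟩), ?_⟩
      have h1 : cartan n q ^ (s % (n ^ 2 / 2)) = cartan n q ^ s :=
        (pow_eq_pow_mod s (cartan_pow hn h4)).symm
      have h2 : parity n q ^ (j % 2) = parity n q ^ j :=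
        (pow_eq_pow_mod j ((pow_two _).trans (parity_sq h4))).symm
      simp only [redMono, mono, h1, h2]
    · have : gen n q Gen.E ^ b = 0 := pow_eq_zero_of_le (not_lt.1 hb) E_pow
      simp [mono, this]
  · have : gen n q Gen.F ^ a = 0 := pow_eq_zero_of_le (not_lt.1 ha) F_pow
    simp [mono, this]

lemma card_redMono (h4 : 4 ∣ n) :
    Fintype.card (Fin (n ^ 2) × Fin (n ^ 2 / 2) × Fin 2 × Fin (n ^ 2)) = (n ^ 2) ^ 3 := by
  have h2 : 2 ∣ n ^ 2 := dvd_trans (dvd_trans (by norm_num) h4) (dvd_pow_self n (by norm_num))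
  simp only [Fintype.card_prod, Fintype.card_fin]
  obtain ⟨r, hr⟩ := h2
  rw [hr, Nat.mul_div_cancel_left _ (by norm_num)]
  ring

end Relations

/-! ### Weighted cyclic shifts -/

section Shift

variable {R : Type u} [CommRing R] {I : Type} [DecidableEq I] {N : ℕ}

/-- The matrix that moves the position by `d`, with weights `f`. -/
def shift (d : ZMod N) (f : I × ZMod N → R) : Matrix (I × ZMod N) (I × ZMod N) R :=
  Matrix.of fun x y => if x = (y.1, y.2 + d) then f y else 0

lemma shift_apply (d : ZMod N) (f : I × ZMod N → R) (x y : I × ZMod N) :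
    shift d f x y = if x = (y.1, y.2 + d) then f y else 0 := rfl

lemma shift_apply_self (d : ZMod N) (f : I × ZMod N → R) (y : I × ZMod N) :
    shift d f (y.1, y.2 + d) y = f y := if_pos rfl

lemma one_eq_shift : (1 : Matrix (I × ZMod N) (I × ZMod N) R) = shift 0 fun _ => 1 := by
  ext x y
  simp [shift_apply, Matrix.one_apply]

lemma shift_smul {S : Type*} [SMulZeroClass S R] (c : S) (d : ZMod N) (f : I × ZMod N → R) :
    c • shift d f = shift d fun z => c • f z := by
  ext x y
  simp only [Matrix.smul_apply, shift_apply]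
  split_ifs <;> simp

lemma shift_sub (d : ZMod N) (f f' : I × ZMod N → R) :
    shift d f - shift d f' = shift d fun z => f z - f' z := by
  ext x y
  simp only [Matrix.sub_apply, shift_apply]
  split_ifs <;> simp

variable [Fintype I] [NeZero N]

lemma shift_mul (d d' : ZMod N) (f f' : I × ZMod N → R) :
    shift d f * shift d' f' = shift (d' + d) fun z => f (z.1, z.2 + d') * f' z := by
  ext x z
  rw [Matrix.mul_apply, Finset.sum_eq_single (z.1, z.2 + d')]
  · simp only [shift_apply, if_true, add_assoc]
    split_ifs <;> simp
  · intro y _ hy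
    simp only [shift_apply]
    rw [if_neg hy, mul_zero]
  · simp

lemma shift_pow (d : ZMod N) (f : I × ZMod N → R) (m : ℕ) :
    shift d f ^ m =
    shift ((m : ZMod N) * d) fun z => ∏ t ∈ Finset.range m, f (z.1, z.2 + (t : ZMod N) * d) := by
  induction m with
  | zero => simp [one_eq_shift]
  | succ m ih =>
    rw [pow_succ, ih, shift_mul]
    congr 1
    · push_cast; ring
    · funext z
      rw [Finset.prod_range_succ']
      congr 1
      · refine Finset.prod_congr rfl fun t _ => ?_
        congr 2
        push_cast; ring
      · simp

lemma shift_zero_pow (f : I × ZMod N → R) (m : ℕ) :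
    shift 0 f ^ m = shift (0 : ZMod N) fun z => f z ^ m := by
  rw [shift_pow]
  simp

lemma shift_zero_mul (f f' : I × ZMod N → R) :
    shift (0 : ZMod N) f * shift 0 f' = shift 0 fun z => f z * f' z := by
  rw [shift_mul]
  simp

/-- A full cycle of weights vanishes if two of the weights have product zero. -/
lemma shift_pow_eq_zero {d : ZMod N} {f : I × ZMod N → R} (hd : ∀ r s : ZMod N, ∃ t < N, r + (t : ZMod N) * d = s)
    (h : ∀ i, ∃ r s, r ≠ s ∧ f (i, r) * f (i, s) = 0) : shift d f ^ N = 0 := by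
  rw [shift_pow]
  ext x z
  rw [shift_apply, Matrix.zero_apply]
  split_ifs
  · obtain ⟨r, s, hrs, h0⟩ := h z.1
    obtain ⟨t, ht, rfl⟩ := hd z.2 r
    obtain ⟨t', ht', rfl⟩ := hd z.2 s
    have hne : t' ≠ t := fun h => hrs (by rw [h])
    rw [← Finset.mul_prod_erase _ _ (Finset.mem_range.2 ht), ← Finset.mul_prod_erase _ _
      (Finset.mem_erase.2 ⟨hne, Finset.mem_range.2 ht'⟩), ← mul_assoc, h0, zero_mul]
  · rfl

end Shift

/-! ### The matrix representation of the quantum group -/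

section Rep

variable {k : Type u} [Field k] {n : ℕ} {q : k}

lemma two_dvd_sq (h4 : 4 ∣ n) : 2 ∣ n ^ 2 :=
  dvd_trans (dvd_trans (by norm_num) h4) (dvd_pow_self n (by norm_num))

/-- The indices of the matrices: a block and a position. The block `b` contains the vertices of
`γ_{2i,0}` and `γ_{n^2+2-2i,1}` for `i = b + 1`. -/
abbrev Idx (n : ℕ) : Type := Fin (n ^ 2 / 2) × ZMod (n ^ 2)

lemma natCast_mul_self : (n : ZMod (n ^ 2)) * n = 0 := by
  rw [← Nat.cast_mul, ← pow_two, ZMod.natCast_self]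

/-- The number of positions of the first type in a block, i.e. `n ^ 2 - 2 i + 1`. -/
def len (b : Fin (n ^ 2 / 2)) : ℕ := n ^ 2 - (2 * b + 1)

lemma len_pos (b : Fin (n ^ 2 / 2)) : 0 < len b := by
  have := b.2
  unfold len
  omega

lemma len_lt (b : Fin (n ^ 2 / 2)) : len b < n ^ 2 := by
  have := b.2
  unfold len
  omega

lemma len_cast (b : Fin (n ^ 2 / 2)) : (len b : ZMod (n ^ 2)) = 1 - 2 * (b + 1 : ℕ) := by
  have := b.2
  rw [len, Nat.cast_sub (by omega), ZMod.natCast_self]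
  push_cast
  ring

lemma len_cast_ne_zero (b : Fin (n ^ 2 / 2)) : (len b : ZMod (n ^ 2)) ≠ 0 := by
  rw [Ne, ZMod.natCast_eq_zero_iff]
  exact fun h => (Nat.le_of_dvd (len_pos b) h).not_gt (len_lt b)

lemma val_len (b : Fin (n ^ 2 / 2)) : (len b : ZMod (n ^ 2)).val = len b :=
  ZMod.val_natCast_of_lt (len_lt b)

/-- The type of a position: the first `len b` positions are those of one vertex of the block, the
remaining ones those of the other vertex. -/
def vert (z : Idx n) : Fin (n ^ 2 / 2) × Bool := (z.1, decide (len z.1 ≤ z.2.val))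

lemma vert_zero (b : Fin (n ^ 2 / 2)) : vert ((b, 0) : Idx n) = (b, false) := by
  simp [vert, (len_pos b).ne']

lemma vert_len (b : Fin (n ^ 2 / 2)) : vert ((b, (len b : ZMod (n ^ 2))) : Idx n) = (b, true) := by
  simp only [vert, val_len, le_refl, decide_true]

/-- The logarithm to the base `q` of the eigenvalue of `κ` at a position. -/
def wt (z : Idx n) : ZMod (n ^ 2) := (n ^ 2 / 2 : ℕ) * (z.1 + 1 : ℕ) + n * ((z.1 + 1 : ℕ) + z.2)

lemma mul_wt (h4 : 4 ∣ n) (z : Idx n) : n * wt z = 0 := by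
  obtain ⟨r, hr⟩ := h4
  have h1 : ((n ^ 2 / 2 : ℕ) : ZMod (n ^ 2)) = n * (2 * r : ℕ) := by
    rw [← Nat.cast_mul]
    congr 1
    rw [show n ^ 2 = 2 * (n * (2 * r)) by nth_rw 2 [hr]; rw [hr]; ring]
    simp
  have h2 := natCast_mul_self (n := n)
  rw [wt, h1]
  linear_combination ((2 * r : ℕ) * (z.1 + 1 : ℕ) + ((z.1 + 1 : ℕ) + z.2)) * h2

lemma q_sub_one_ne_zero (hq : IsPrimitiveRoot q (n ^ 2)) (hn : 1 < n) : q - 1 ≠ 0 :=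
  sub_ne_zero.2 (hq.ne_one (by nlinarith))

variable [NeZero n]

lemma val_succ {r : ZMod (n ^ 2)} (h : r + 1 ≠ 0) : (r + 1).val = r.val + 1 := by
  have h1 : ((r.val + 1 : ℕ) : ZMod (n ^ 2)) = r + 1 := by simp
  rw [← h1]
  refine ZMod.val_natCast_of_lt ?_
  by_contra h2
  have h3 : r.val + 1 = n ^ 2 := le_antisymm r.val_lt (not_lt.1 h2)
  rw [h3, ZMod.natCast_self] at h1
  exact h h1.symm

lemma vert_neg_one {b : Fin (n ^ 2 / 2)} {r : ZMod (n ^ 2)} (h : r + 1 = 0) :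
    vert ((b, r) : Idx n) = (b, true) := by
  have h1 : ((n ^ 2 - 1 : ℕ) : ZMod (n ^ 2)) = r := by
    rw [eq_neg_of_add_eq_zero_left h, Nat.cast_sub (Nat.pos_of_neZero _), ZMod.natCast_self]
    simp
  have h2 : r.val = n ^ 2 - 1 := by
    rw [← h1]
    exact ZMod.val_natCast_of_lt (Nat.sub_lt (Nat.pos_of_neZero _) one_pos)
  have := len_lt b
  simp only [vert, h2, Prod.mk.injEq, decide_eq_true_eq, true_and]
  omega

lemma vert_len_pred {b : Fin (n ^ 2 / 2)} {r : ZMod (n ^ 2)} (h : r + 1 = len b) :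
    vert ((b, r) : Idx n) = (b, false) := by
  have h0 : r + 1 ≠ 0 := h ▸ len_cast_ne_zero b
  have h1 := val_succ h0
  rw [h, val_len] at h1
  simp only [vert, h1, Prod.mk.injEq, decide_eq_false_iff_not, true_and]
  omega

lemma vert_succ {b : Fin (n ^ 2 / 2)} {r : ZMod (n ^ 2)} (h : r + 1 ≠ 0) (h' : r + 1 ≠ len b) :
    vert ((b, r + 1) : Idx n) = vert ((b, r) : Idx n) := by
  have h1 := val_succ h
  have h2 : r.val + 1 ≠ len b := fun h3 => h' (by rw [← h3]; simp)
  simp only [vert, h1, Prod.mk.injEq, decide_eq_decide, true_and]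
  omega

/-- The weights are the values of the character that maps `1` to `q`. -/
def chi (hq : IsPrimitiveRoot q (n ^ 2)) : AddChar (ZMod (n ^ 2)) k :=
  AddChar.zmodChar (n ^ 2) hq.pow_eq_one

variable (hq : IsPrimitiveRoot q (n ^ 2))

lemma chi_natCast (m : ℕ) : chi hq (m : ZMod (n ^ 2)) = q ^ m := AddChar.zmodChar_apply' _ _

lemma chi_one : chi hq 1 = q := by
  have := chi_natCast hq 1
  simpa using this

lemma chi_injective : Function.Injective (chi hq) := by
  intro a b h
  rw [chi, AddChar.zmodChar_apply, AddChar.zmodChar_apply] at h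
  exact ZMod.val_injective _ (hq.pow_inj a.val_lt b.val_lt h)

lemma chi_eq_one_iff {a : ZMod (n ^ 2)} : chi hq a = 1 ↔ a = 0 := by
  rw [← AddChar.map_zero_eq_one (chi hq)]
  exact (chi_injective hq).eq_iff

lemma chi_ne_zero (a : ZMod (n ^ 2)) : chi hq a ≠ 0 := fun h => by
  have := AddChar.map_add_eq_mul (chi hq) a (-a)
  rw [h, zero_mul, add_neg_cancel, AddChar.map_zero_eq_one] at this
  exact one_ne_zero this

/-- The weight of `cartan`. -/
def cartanWt (z : Idx n) : k := chi hq (-2 * ((z.1 + 1 : ℕ) + z.2))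

/-- The scalar part of `E F` at a position. -/
def coef (z : Idx n) : k :=
  q / (q - 1) * (1 - chi hq (-z.2)) * (1 - chi hq (len z.1 - z.2))

/-- The action of `E F` at a position. -/
def efWt (z : Idx n) : ArrowRing k := ⟨coef hq z, 0, 0, chi hq (len z.1 - z.2)⟩

variable (k) in
/-- The weights of `E`. -/
def eWt (z : Idx n) : ArrowRing k :=
  if z.2 + 1 = len z.1 then x k else if z.2 + 1 = 0 then y k else 1

/-- The weights of `F`. -/
def fWt (z : Idx n) : ArrowRing k :=
  if z.2 = 0 then chi hq (len z.1) • y k else if z.2 = len z.1 then x k else efWt hq z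

lemma eWt_mul_fWt (b : Fin (n ^ 2 / 2)) (r : ZMod (n ^ 2)) :
    eWt k (b, r + -1) * fWt hq (b, r) = efWt hq (b, r) := by
  simp only [eWt, fWt, neg_add_cancel_right]
  have h0 := len_cast_ne_zero b
  by_cases h1 : r = 0
  · subst h1
    rw [if_neg h0.symm, if_pos rfl, if_pos rfl]
    ext <;> simp [efWt, coef]
  · by_cases h2 : r = len b
    · subst h2
      rw [if_pos rfl, if_neg h0, if_pos rfl]
      ext <;> simp [efWt, coef]
    · rw [if_neg h2, if_neg h1, if_neg h1, if_neg h2, one_mul]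

lemma chi_len_sub (b : Fin (n ^ 2 / 2)) (r : ZMod (n ^ 2)) :
    chi hq ((len b : ZMod (n ^ 2)) - r) =
      q * chi hq (-2 * (((b + 1 : ℕ) : ZMod (n ^ 2)) + r)) * (chi hq (-r))⁻¹ := by
  have h : chi hq ((len b : ZMod (n ^ 2)) - r) * chi hq (-r) =
      chi hq 1 * chi hq (-2 * (((b + 1 : ℕ) : ZMod (n ^ 2)) + r)) := by
    rw [← AddChar.map_add_eq_mul, ← AddChar.map_add_eq_mul, len_cast]
    congr 1
    push_cast
    ring
  rw [eq_mul_inv_iff_mul_eq₀ (chi_ne_zero hq _), h, chi_one]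

lemma chi_sub_one (r : ZMod (n ^ 2)) : chi hq (r - 1) = chi hq r * q⁻¹ := by
  have h0 : q ≠ 0 := by rw [← chi_one hq]; exact chi_ne_zero hq _
  have h : chi hq r = chi hq (r - 1) * chi hq 1 := by
    rw [← AddChar.map_add_eq_mul, sub_add_cancel]
  rw [h, chi_one, mul_inv_cancel_right₀ h0]

lemma efWt_succ (hn : 1 < n) (b : Fin (n ^ 2 / 2)) (r : ZMod (n ^ 2)) :
    efWt hq (b, r + 1) - q⁻¹ • efWt hq (b, r) =
      1 - algebraMap k (ArrowRing k) (cartanWt hq (b, r)) := by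
  have h0 : q ≠ 0 := by rw [← chi_one hq]; exact chi_ne_zero hq _
  have h1 := q_sub_one_ne_zero hq hn
  have e1 : chi hq (-(r + 1)) = chi hq (-r) * q⁻¹ := by
    rw [← chi_sub_one]; congr 1; ring
  have e2 : chi hq (len b - (r + 1)) = chi hq (len b - r) * q⁻¹ := by
    rw [← chi_sub_one]; congr 1; ring
  have hc := chi_ne_zero hq (-r)
  rw [ArrowRing.algebraMap_eq, sub_eq_add_neg, sub_eq_add_neg]
  ext
  · simp only [efWt, coef, cartanWt, e1, e2, chi_len_sub, add_c1, neg_c1, smul_c1, one_c1]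
    field_simp
    ring
  · simp [efWt]
  · simp [efWt]
  · simp only [efWt, e2, add_cs, neg_cs, smul_cs, one_cs]
    ring

/-- The matrices of the generators. -/
def repGen : Gen → Matrix (Idx n) (Idx n) (ArrowRing k)
  | .kk => shift 0 fun z => algebraMap k _ (chi hq (wt z))
  | .kh => shift 0 fun z => algebraMap k _ (chi hq (wt z) * cartanWt hq z)
  | .E => shift 1 (eWt k)
  | .F => shift (-1) (fWt hq)

lemma chi_wt_pow (h4 : 4 ∣ n) (z : Idx n) : chi hq (wt z) ^ n = 1 := by
  rw [← AddChar.map_nsmul_eq_pow, nsmul_eq_mul, mul_wt h4, AddChar.map_zero_eq_one]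

lemma cartanWt_pow_mul (z : Idx n) (h4 : 4 ∣ n) : cartanWt hq z ^ n * chi hq (wt z) ^ 2 = 1 := by
  have h2 : ((2 : ℕ) : ZMod (n ^ 2)) * (n ^ 2 / 2 : ℕ) = 0 := by
    rw [← Nat.cast_mul, Nat.mul_div_cancel' (two_dvd_sq h4), ZMod.natCast_self]
  rw [cartanWt, ← AddChar.map_nsmul_eq_pow, ← AddChar.map_nsmul_eq_pow, ← AddChar.map_add_eq_mul,
    chi_eq_one_iff, nsmul_eq_mul, nsmul_eq_mul, wt]
  push_cast at h2 ⊢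
  linear_combination ((z.1 : ZMod (n ^ 2)) + 1) * h2

lemma chi_wt_succ (b : Fin (n ^ 2 / 2)) (r : ZMod (n ^ 2)) :
    chi hq (wt (b, r + 1)) = q ^ n * chi hq (wt (b, r)) := by
  rw [← chi_natCast hq, ← AddChar.map_add_eq_mul, wt, wt]
  congr 1
  ring

lemma cartanWt_succ (b : Fin (n ^ 2 / 2)) (r : ZMod (n ^ 2)) :
    cartanWt hq (b, r + 1) = (q ^ 2)⁻¹ * cartanWt hq (b, r) := by
  rw [eq_inv_mul_iff_mul_eq₀ (pow_ne_zero 2 (by rw [← chi_one hq]; exact chi_ne_zero hq _)),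
    ← chi_natCast hq, cartanWt, cartanWt, ← AddChar.map_add_eq_mul]
  congr 1
  push_cast
  ring

lemma one_lt_of_dvd (h4 : 4 ∣ n) : 1 < n := by
  have := Nat.le_of_dvd (Nat.pos_of_neZero n) h4
  omega

lemma repGen_E_pow : repGen hq .E ^ (n ^ 2) = 0 := by
  refine shift_pow_eq_zero (fun r s => ⟨(s - r).val, ZMod.val_lt _, by simp⟩) fun b =>
    ⟨-1, len b - 1, fun h => len_cast_ne_zero b ?_, ?_⟩
  · linear_combination -h
  · have h0 := len_cast_ne_zero b
    simp only [eWt, neg_add_cancel, sub_add_cancel, if_true]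
    rw [if_neg h0.symm, y_mul_x]

lemma repGen_F_pow : repGen hq .F ^ (n ^ 2) = 0 := by
  refine shift_pow_eq_zero (fun r s => ⟨(r - s).val, ZMod.val_lt _, by simp⟩) fun b =>
    ⟨0, len b, (len_cast_ne_zero b).symm, ?_⟩
  have h0 := len_cast_ne_zero b
  simp only [fWt, if_true]
  rw [if_neg h0, smul_mul_assoc, y_mul_x, smul_zero]

lemma repGen_F_E (hn : 1 < n) : repGen hq .F * repGen hq .E - q⁻¹ • (repGen hq .E * repGen hq .F) =
    1 - shift 0 fun z => algebraMap k _ (cartanWt hq z) := by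
  rw [repGen, repGen, shift_mul, shift_mul, shift_smul, add_neg_cancel, neg_add_cancel, shift_sub,
    one_eq_shift, shift_sub]
  congr 1
  funext ⟨b, r⟩
  have h1 := eWt_mul_fWt hq b (r + 1)
  rw [add_neg_cancel_right] at h1
  rw [← efWt_succ hq hn, ← h1, ← eWt_mul_fWt hq b r, mul_comm]

lemma repGen_cartan (h4 : 4 ∣ n) : repGen hq .kk ^ (n - 1) * repGen hq .kh =
    shift 0 fun z => algebraMap k _ (cartanWt hq z) := by
  rw [repGen, repGen, shift_zero_pow, shift_zero_mul]
  congr 1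
  funext z
  rw [← map_pow, ← map_mul, ← mul_assoc, ← pow_succ, Nat.sub_add_cancel (Nat.pos_of_neZero n),
    chi_wt_pow hq h4, one_mul]

/-- The matrices satisfy the defining relations: those with `κ` and `κ̂` hold because the weights are
character values, the nilpotency because a full cycle of positions passes both arrows, whose
product is zero, and the commutation of `E` and `F` is `efWt_succ`. -/
lemma repGen_rel (h4 : 4 ∣ n) {a b : FreeAlgebra k Gen} (h : Rel k n q a b) :
    FreeAlgebra.lift k (repGen hq) a = FreeAlgebra.lift k (repGen hq) b := by
  have h0 : q ≠ 0 := by rw [← chi_one hq]; exact chi_ne_zero hq _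
  have hw := chi_wt_succ hq
  have hc := cartanWt_succ hq
  have hw' : ∀ b r, chi hq (wt (b, r + -1)) = (q ^ n)⁻¹ * chi hq (wt (b, r)) := fun b r => by
    have := hw b (r + -1)
    rw [neg_add_cancel_right] at this
    rw [this, inv_mul_cancel_left₀ (pow_ne_zero _ h0)]
  have hc' : ∀ b r, cartanWt hq (b, r + -1) = q ^ 2 * cartanWt hq (b, r) := fun b r => by
    have := hc b (r + -1)
    rw [neg_add_cancel_right] at this
    rw [this, mul_inv_cancel_left₀ (pow_ne_zero _ h0)]
  have hsm : ∀ (d : ZMod (n ^ 2)) (c : k) (f : Idx n → k) (g : Idx n → ArrowRing k),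
      (∀ b r, f (b, r + d) = c * f (b, r)) →
      shift 0 (fun z => algebraMap k (ArrowRing k) (f z)) * shift d g =
        c • (shift d g * shift 0 fun z => algebraMap k (ArrowRing k) (f z)) := by
    intro d c f g hf
    rw [shift_mul, shift_mul, shift_smul, add_zero, zero_add]
    congr 1
    funext ⟨b, r⟩
    simp only [hf, add_zero]
    rw [Algebra.smul_def, map_mul, mul_assoc, mul_comm (g _)]
  cases h with
  | kk_pow =>
    simp only [map_pow, map_one, FreeAlgebra.lift_ι_apply, repGen]
    rw [shift_zero_pow, one_eq_shift]
    congr 1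
    funext z
    rw [← map_pow, chi_wt_pow hq h4, map_one]
  | kh_pow =>
    simp only [map_mul, map_pow, map_one, FreeAlgebra.lift_ι_apply]
    rw [repGen, repGen, shift_zero_pow, shift_zero_pow, shift_zero_mul, one_eq_shift]
    congr 1
    funext z
    rw [← map_pow, ← map_pow, ← map_mul, mul_pow, chi_wt_pow hq h4, one_mul, cartanWt_pow_mul hq z h4,
      map_one]
  | kk_kh =>
    simp only [map_mul, FreeAlgebra.lift_ι_apply]
    rw [repGen, repGen, shift_zero_mul, shift_zero_mul]
    congr 1
    funext z
    rw [mul_comm]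
  | kk_E =>
    simp only [map_mul, map_smul, FreeAlgebra.lift_ι_apply]
    exact hsm _ _ _ _ hw
  | kk_F =>
    simp only [map_mul, map_smul, FreeAlgebra.lift_ι_apply]
    exact hsm _ _ _ _ hw'
  | kh_E =>
    simp only [map_mul, map_smul, FreeAlgebra.lift_ι_apply]
    exact hsm _ _ (fun z => chi hq (wt z) * cartanWt hq z) _ fun b r => by rw [hw, hc]; ring
  | kh_F =>
    simp only [map_mul, map_smul, FreeAlgebra.lift_ι_apply]
    exact hsm _ _ (fun z => chi hq (wt z) * cartanWt hq z) _ fun b r => by rw [hw', hc']; ring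
  | E_pow =>
    simp only [map_pow, map_zero, FreeAlgebra.lift_ι_apply]
    exact repGen_E_pow hq
  | F_pow =>
    simp only [map_pow, map_zero, FreeAlgebra.lift_ι_apply]
    exact repGen_F_pow hq
  | F_E =>
    simp only [map_mul, map_smul, map_sub, map_pow, map_one, FreeAlgebra.lift_ι_apply]
    rw [repGen_F_E hq (one_lt_of_dvd h4), repGen_cartan hq h4]

/-- The representation of the quantum group by graded matrices. -/
def rep (h4 : 4 ∣ n) : QU k n q →ₐ[k] Matrix (Idx n) (Idx n) (ArrowRing k) :=
  RingQuot.liftAlgHom k ⟨FreeAlgebra.lift k (repGen hq), fun _ _ h => repGen_rel hq h4 h⟩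

lemma rep_gen (h4 : 4 ∣ n) (g : Gen) : rep hq h4 (gen n q g) = repGen hq g := by
  refine (RingQuot.liftAlgHom_mkAlgHom_apply k _ _ _).trans ?_
  exact FreeAlgebra.lift_ι_apply _ _

lemma rep_cartan (h4 : 4 ∣ n) :
    rep hq h4 (cartan n q) = shift 0 fun z => algebraMap k _ (cartanWt hq z) := by
  rw [cartan, map_mul, map_pow, rep_gen, rep_gen, repGen_cartan hq h4]

/-- The weight of `parity`. -/
def parityWt (z : Idx n) : k := chi hq ((n ^ 2 / 2 : ℕ) * z.2)

lemma rep_parity (h4 : 4 ∣ n) :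
    rep hq h4 (parity n q) = shift 0 fun z => algebraMap k _ (parityWt hq z) := by
  rw [parity, map_mul, map_pow, rep_gen, rep_gen, repGen, repGen, shift_zero_pow, shift_zero_mul]
  congr 1
  funext z
  rw [← map_pow, ← map_mul, mul_pow, ← mul_assoc, ← pow_succ', cartanWt, parityWt,
    ← AddChar.map_nsmul_eq_pow, ← AddChar.map_nsmul_eq_pow, ← AddChar.map_add_eq_mul]
  congr 2
  obtain ⟨r, hr⟩ := h4
  have h1 : n ^ 2 / 2 = n * (2 * r) := by
    rw [show n ^ 2 = 2 * (n * (2 * r)) by nth_rw 2 [hr]; rw [hr]; ring]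
    simp
  have h2 := natCast_mul_self (n := n)
  have h3 : n / 2 = 2 * r := by omega
  have h5 : (n : ZMod (n ^ 2)) = 4 * r := by
    have := congrArg (Nat.cast : ℕ → ZMod (n ^ 2)) hr
    push_cast at this
    exact this
  have h6 : ((n ^ 2 / 2 : ℕ) : ZMod (n ^ 2)) = n * (2 * r : ℕ) := by rw [h1, Nat.cast_mul]
  rw [nsmul_eq_mul, nsmul_eq_mul, wt, h6, h3]
  push_cast
  linear_combination ((z.1 : ZMod (n ^ 2)) + 1 + z.2 - r * n * (z.1 + 1) - n * (z.1 + 1)) * h5 +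
    (r * ((z.1 : ZMod (n ^ 2)) + 1) + (z.1 + 1)) * h2

end Rep

/-! ### Generating the algebra of graded matrices -/

section Generate

variable {k : Type u} [Field k] {X B : Type} [Fintype X] [DecidableEq X] [DecidableEq B]

/-- The algebra of graded matrices. -/
def gradedMatrices (k : Type u) [Field k] (v : X → B × Bool) :
    Subalgebra k (Matrix X X (ArrowRing k)) where
  carrier := {m | ∀ x y, m x y ∈ gr k (v x) (v y)}
  mul_mem' h h' x y := Submodule.sum_mem _ fun z _ => gr_mul (h x z) (h' z y)
  add_mem' h h' x y := Submodule.add_mem _ (h x y) (h' x y)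
  algebraMap_mem' c x y := by
    rw [Matrix.algebraMap_matrix_apply]
    split_ifs with h
    · subst h
      rw [Algebra.algebraMap_eq_smul_one]
      exact Submodule.smul_mem _ _ (one_mem_gr _)
    · exact Submodule.zero_mem _

variable {T : Subalgebra k (Matrix X X (ArrowRing k))}

lemma single_mul_mem {x y z : X} {t t' : ArrowRing k} (h : Matrix.single x y t ∈ T)
    (h' : Matrix.single y z t' ∈ T) : Matrix.single x z (t * t') ∈ T := by
  have := T.mul_mem h h'
  rwa [Matrix.single_mul_single_same] at this

lemma single_add_mem {x y : X} {t t' : ArrowRing k} (h : Matrix.single x y t ∈ T)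
    (h' : Matrix.single x y t' ∈ T) : Matrix.single x y (t + t') ∈ T := by
  rw [Matrix.single_add]
  exact T.add_mem h h'

lemma single_smul_mem {x y : X} {t : ArrowRing k} (c : k) (h : Matrix.single x y t ∈ T) :
    Matrix.single x y (c • t) ∈ T := by
  rw [← Matrix.smul_single]
  exact T.smul_mem h c

lemma single_entry_mem {x y : X} (hx : Matrix.single x x 1 ∈ T) (hy : Matrix.single y y 1 ∈ T)
    {m : Matrix X X (ArrowRing k)} (hm : m ∈ T) : Matrix.single x y (m x y) ∈ T := by
  have h : Matrix.single x x 1 * m * Matrix.single y y 1 = Matrix.single x y (m x y) := by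
    rw [Matrix.single_mul_mul_single, one_mul, mul_one]
  rw [← h]
  exact T.mul_mem (T.mul_mem hx hm) hy

lemma mul_inverse_even {t : ArrowRing k} (ht : t ∈ part true) (h0 : t.c1 ≠ 0) :
    t * ((t.c1 ^ 2)⁻¹ • ((2 * t.c1) • 1 + (-1 : k) • t)) = 1 := by
  obtain ⟨h1, h2⟩ := ht
  ext
  · simp; field_simp; ring
  · simp [h1]
  · simp [h2]
  · simp [h1, h2]; field_simp; ring

/-- Subalgebras contain the inverses of the even units they contain. -/
lemma single_inverse_mem {x : X} {t : ArrowRing k}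
    (hx : Matrix.single x x 1 ∈ T) (h : Matrix.single x x t ∈ T) :
    Matrix.single x x ((t.c1 ^ 2)⁻¹ • ((2 * t.c1) • 1 + (-1 : k) • t)) ∈ T :=
  single_smul_mem _ (single_add_mem (single_smul_mem _ hx) (single_smul_mem _ h))

/-- A subalgebra contains a diagonal matrix unit if diagonal matrices of the subalgebra separate
the index from all other indices. -/
lemma single_one_mem {x : X} (h : ∀ y, y ≠ x → ∃ d : X → ArrowRing k, Matrix.diagonal d ∈ T ∧
    d y = 0 ∧ (d x).c1 ≠ 0 ∧ d x ∈ part true) : Matrix.single x x 1 ∈ T := by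
  have key : ∀ s : Finset X, ∃ d : X → ArrowRing k, Matrix.diagonal d ∈ T ∧
      (∀ y ∈ s, y ≠ x → d y = 0) ∧ (d x).c1 ≠ 0 ∧ d x ∈ part true := by
    intro s
    induction s using Finset.induction_on with
    | empty =>
      refine ⟨fun _ => 1, ?_, by simp, by simp, one_mem⟩
      rw [Matrix.diagonal_one]
      exact T.one_mem
    | insert y s _ ih =>
      obtain ⟨d, h1, h2, h3, h4⟩ := ih
      by_cases hy : y = x
      · refine ⟨d, h1, fun z hz hzx => ?_, h3, h4⟩
        rcases Finset.mem_insert.1 hz with rfl | hz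
        · exact absurd hy hzx
        · exact h2 z hz hzx
      · obtain ⟨d', h1', h2', h3', h4'⟩ := h y hy
        refine ⟨fun z => d z * d' z, ?_, fun z hz hzx => ?_, ?_, ?_⟩
        · rw [← Matrix.diagonal_mul_diagonal]
          exact T.mul_mem h1 h1'
        · rcases Finset.mem_insert.1 hz with rfl | hz
          · change d z * d' z = 0
            rw [h2', mul_zero]
          · change d z * d' z = 0
            rw [h2 z hz hzx, zero_mul]
        · rw [mul_c1]
          exact mul_ne_zero h3 h3'
        · exact mul_mem_part h4 h4'
  obtain ⟨d, h1, h2, h3, h4⟩ := key Finset.univ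
  have h5 : Matrix.diagonal d = Matrix.single x x (d x) := by
    ext1 y z
    by_cases hyz : y = z
    · subst hyz
      by_cases hy : y = x
      · subst hy
        simp
      · rw [Matrix.diagonal_apply_eq, h2 y (Finset.mem_univ _) hy,
          Matrix.single_apply_of_row_ne (Ne.symm hy)]
    · rw [Matrix.diagonal_apply_ne _ hyz, Matrix.single_apply_of_ne]
      rintro ⟨rfl, rfl⟩
      exact hyz rfl
  rw [h5] at h1
  -- the inverse of a unit is a polynomial in it without constant term
  have h7 : d x * ((d x).c1 ^ 2)⁻¹ • ((2 * (d x).c1) • 1 + (-1 : k) • d x) =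
      ((d x).c1 ^ 2)⁻¹ • ((2 * (d x).c1) • d x + (-1 : k) • (d x * d x)) := by
    rw [mul_smul_comm, mul_add, mul_smul_comm, mul_smul_comm, mul_one]
  rw [← mul_inverse_even h4 h3, h7]
  exact single_smul_mem _ (single_add_mem (single_smul_mem _ h1)
    (single_smul_mem _ (single_mul_mem h1 h1)))

end Generate

section Shift

variable {R : Type u} [CommRing R] {I : Type} [DecidableEq I] {N : ℕ}

lemma shift_zero_eq_diagonal (f : I × ZMod N → R) : shift 0 f = Matrix.diagonal f := by
  ext1 x y
  rw [shift_apply, add_zero, Matrix.diagonal_apply]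
  by_cases h : x = y
  · subst h; simp
  · rw [if_neg h, if_neg h]

end Shift

/-! ### The quantum group as an algebra of graded matrices -/

section Model

variable {k : Type u} [Field k] {n : ℕ} {q : k}

/-- The base position of a vertex. -/
def base (w : Fin (n ^ 2 / 2) × Bool) : Idx n := (w.1, if w.2 then (len w.1 : ZMod (n ^ 2)) else 0)

lemma vert_base (w : Fin (n ^ 2 / 2) × Bool) : vert (base w) = w := by
  obtain ⟨b, c⟩ := w
  cases c
  · exact vert_zero b
  · exact vert_len b

variable [NeZero n]

lemma eWt_mem (b : Fin (n ^ 2 / 2)) (r : ZMod (n ^ 2)) :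
    eWt k (b, r) ∈ gr k (vert ((b, r + 1) : Idx n)) (vert ((b, r) : Idx n)) := by
  simp only [eWt]
  split_ifs with h1 h2
  · rw [h1, vert_len, vert_len_pred h1]
    exact x_mem_gr b false
  · rw [h2, vert_zero, vert_neg_one h2]
    exact y_mem_gr b true
  · rw [vert_succ h2 h1]
    exact one_mem_gr _

variable (hq : IsPrimitiveRoot q (n ^ 2))

lemma fWt_mem (b : Fin (n ^ 2 / 2)) (r : ZMod (n ^ 2)) :
    fWt hq (b, r) ∈ gr k (vert ((b, r + -1) : Idx n)) (vert ((b, r) : Idx n)) := by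
  simp only [fWt]
  split_ifs with h1 h2
  · subst h1
    rw [vert_zero, vert_neg_one (by ring)]
    exact Submodule.smul_mem _ _ (y_mem_gr b false)
  · subst h2
    rw [vert_len, vert_len_pred (by ring)]
    exact x_mem_gr b true
  · have h3 := vert_succ (b := b) (r := r + -1) (by rwa [neg_add_cancel_right])
      (by rwa [neg_add_cancel_right])
    rw [neg_add_cancel_right] at h3
    rw [← h3, gr_self]
    exact ⟨rfl, rfl⟩

lemma shift_mem (d : ZMod (n ^ 2)) {f : Idx n → ArrowRing k}
    (hf : ∀ b r, f (b, r) ∈ gr k (vert ((b, r + d) : Idx n)) (vert ((b, r) : Idx n))) :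
    shift d f ∈ gradedMatrices k (vert (n := n)) := by
  intro x y
  rw [shift_apply]
  split_ifs with h
  · rw [h]
    exact hf _ _
  · exact Submodule.zero_mem _

lemma shift_zero_mem (f : Idx n → k) :
    shift 0 (fun z => algebraMap k (ArrowRing k) (f z)) ∈ gradedMatrices k (vert (n := n)) :=
  shift_mem 0 fun b r => by
    rw [add_zero, Algebra.algebraMap_eq_smul_one]
    exact Submodule.smul_mem _ _ (one_mem_gr _)

lemma rep_mem (h4 : 4 ∣ n) (a : QU k n q) : rep hq h4 a ∈ gradedMatrices k (vert (n := n)) := by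
  have h := eq_top_of_generators (mk k n q) (mk_surjective k n q)
    ((Subalgebra.toSubmodule (gradedMatrices k (vert (n := n)))).comap (rep hq h4).toLinearMap) ?_ ?_
  · have : a ∈ (⊤ : Submodule k (QU k n q)) := trivial
    rw [← h] at this
    exact this
  · change rep hq h4 1 ∈ gradedMatrices k _
    rw [map_one]
    exact one_mem _
  · intro g z hz
    change rep hq h4 (gen n q g * z) ∈ gradedMatrices k _
    rw [map_mul]
    refine mul_mem ?_ hz
    rw [rep_gen]
    cases g with
    | kk => exact shift_zero_mem _
    | kh => exact shift_zero_mem _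
    | E => exact shift_mem 1 eWt_mem
    | F => exact shift_mem (-1) (fWt_mem hq)

/-- The weights of `cartan`, `parity` and `E F` separate the positions. -/
lemma eq_of_weights (h4 : 4 ∣ n) {z z' : Idx n} (hc : cartanWt hq z = cartanWt hq z')
    (hp : parityWt hq z = parityWt hq z') (hf : coef hq z = coef hq z') : z = z' := by
  obtain ⟨b, r⟩ := z
  obtain ⟨b', r'⟩ := z'
  have hn := one_lt_of_dvd h4
  have h0 : q ≠ 0 := hq.ne_zero (NeZero.ne _)
  have h1 := q_sub_one_ne_zero hq hn
  -- the two factors of `coef` have the same sum and the same product at both positions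
  have hmul : chi hq (-r) * chi hq (len b - r) = chi hq (-r') * chi hq (len b' - r') := by
    rw [chi_len_sub, chi_len_sub]
    change chi hq (-r) * (q * cartanWt hq (b, r) * _) = chi hq (-r') * (q * cartanWt hq (b', r') * _)
    rw [hc]
    field_simp [chi_ne_zero hq (-r), chi_ne_zero hq (-r')]
  have hadd : chi hq (-r) + chi hq (len b - r) = chi hq (-r') + chi hq (len b' - r') := by
    simp only [coef] at hf
    rw [mul_assoc, mul_assoc] at hf
    have := mul_left_cancel₀ (div_ne_zero h0 h1) hf
    linear_combination hmul - this
  have hcases : (chi hq (-r) - chi hq (-r')) * (chi hq (-r) - chi hq (len b' - r')) = 0 := by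
    linear_combination chi hq (-r) * hadd - hmul
  have hpar : r.val ≡ r'.val [MOD 2] := by
    have h := chi_injective hq hp
    have h' : ((n ^ 2 / 2 * r.val : ℕ) : ZMod (n ^ 2)) = (n ^ 2 / 2 * r'.val : ℕ) := by simpa using h
    rw [ZMod.natCast_eq_natCast_iff] at h'
    have hd : n ^ 2 / 2 * 2 ∣ n ^ 2 := (Nat.div_mul_cancel (two_dvd_sq h4)).dvd
    refine Nat.ModEq.mul_left_cancel' (Nat.div_pos ?_ two_pos).ne' (h'.of_dvd hd)
    nlinarith
  have hb := b.2
  have hb' := b'.2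
  rcases mul_eq_zero.1 hcases with h | h
  · have hr : r = r' := neg_injective (chi_injective hq (sub_eq_zero.1 h))
    subst hr
    have hc' := chi_injective hq hc
    have h' : ((2 * b : ℕ) : ZMod (n ^ 2)) = (2 * b' : ℕ) := by
      push_cast at hc' ⊢
      linear_combination -hc'
    rw [ZMod.natCast_eq_natCast_iff] at h'
    have := h'.eq_of_lt_of_lt (by omega) (by omega)
    rw [show b = b' from Fin.ext (by omega)]
  · exfalso
    have hr := chi_injective hq (sub_eq_zero.1 h)
    rw [len_cast] at hr
    have h' : ((r'.val + 2 * (b' + 1) : ℕ) : ZMod (n ^ 2)) = (r.val + 1 : ℕ) := by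
      push_cast at hr ⊢
      rw [ZMod.natCast_zmod_val, ZMod.natCast_zmod_val]
      linear_combination hr
    rw [ZMod.natCast_eq_natCast_iff] at h'
    have := h'.of_dvd (two_dvd_sq h4)
    unfold Nat.ModEq at this hpar
    omega

lemma diagonal_sub_mem {T : Subalgebra k (Matrix (Idx n) (Idx n) (ArrowRing k))}
    {f : Idx n → ArrowRing k} (hf : Matrix.diagonal f ∈ T) (c : k) :
    Matrix.diagonal (fun z => f z - algebraMap k _ c) ∈ T := by
  have h := T.sub_mem hf (T.algebraMap_mem c)
  rwa [Matrix.algebraMap_eq_diagonal, Matrix.diagonal_sub] at h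

lemma rep_E_mul_F (h4 : 4 ∣ n) :
    rep hq h4 (gen n q .E * gen n q .F) = Matrix.diagonal (efWt hq) := by
  rw [map_mul, rep_gen, rep_gen, repGen, repGen, shift_mul, neg_add_cancel,
    ← shift_zero_eq_diagonal]
  congr 1
  funext ⟨b, r⟩
  exact eWt_mul_fWt hq b r

/-- The weights of `cartan`, `parity` and `E F` together separate the positions, so that a product of
differences of these diagonal matrices is a diagonal matrix unit. -/
lemma single_one_mem_range (h4 : 4 ∣ n) (z : Idx n) :
    Matrix.single z z 1 ∈ (rep hq h4).range := by
  refine single_one_mem fun y hy => ?_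
  by_cases hc : cartanWt hq z = cartanWt hq y
  · by_cases hp : parityWt hq z = parityWt hq y
    · have hf : coef hq z ≠ coef hq y := fun hf => hy (eq_of_weights hq h4 hc hp hf).symm
      have h1 : Matrix.diagonal (efWt hq) ∈ (rep hq h4).range := ⟨_, rep_E_mul_F hq h4⟩
      have h2 := diagonal_sub_mem h1 (coef hq y)
      have h3 := Subalgebra.mul_mem _ h2 h2
      rw [Matrix.diagonal_mul_diagonal] at h3
      refine ⟨_, h3, ?_, ?_, ?_⟩
      · ext <;> simp [efWt, ArrowRing.algebraMap_eq, sub_eq_add_neg]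
      · simp only [efWt, ArrowRing.algebraMap_eq, sub_eq_add_neg]
        simpa [← sub_eq_add_neg, sub_eq_zero] using hf
      · constructor <;> simp [efWt, ArrowRing.algebraMap_eq, sub_eq_add_neg]
    · have h1 : Matrix.diagonal (fun z => algebraMap k (ArrowRing k) (parityWt hq z)) ∈
          (rep hq h4).range := ⟨_, (rep_parity hq h4).trans (shift_zero_eq_diagonal _)⟩
      refine ⟨_, diagonal_sub_mem h1 (parityWt hq y), sub_self _, ?_, ?_⟩
      · simpa [ArrowRing.algebraMap_eq, sub_eq_add_neg, ← sub_eq_add_neg, sub_eq_zero] using hp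
      · constructor <;> simp [ArrowRing.algebraMap_eq, sub_eq_add_neg]
  · have h1 : Matrix.diagonal (fun z => algebraMap k (ArrowRing k) (cartanWt hq z)) ∈
        (rep hq h4).range := ⟨_, (rep_cartan hq h4).trans (shift_zero_eq_diagonal _)⟩
    refine ⟨_, diagonal_sub_mem h1 (cartanWt hq y), sub_self _, ?_, ?_⟩
    · simpa [ArrowRing.algebraMap_eq, sub_eq_add_neg, ← sub_eq_add_neg, sub_eq_zero] using hc
    · constructor <;> simp [ArrowRing.algebraMap_eq, sub_eq_add_neg]

lemma single_E_mem (h4 : 4 ∣ n) (b : Fin (n ^ 2 / 2)) (r : ZMod (n ^ 2)) :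
    Matrix.single ((b, r + 1) : Idx n) (b, r) (eWt k (b, r)) ∈ (rep hq h4).range := by
  have h := single_entry_mem (single_one_mem_range hq h4 (b, r + 1))
    (single_one_mem_range hq h4 (b, r)) ⟨gen n q .E, rep_gen hq h4 .E⟩
  rwa [repGen, shift_apply_self 1 (eWt k) (b, r)] at h

lemma single_F_mem (h4 : 4 ∣ n) (b : Fin (n ^ 2 / 2)) (r : ZMod (n ^ 2)) :
    Matrix.single ((b, r + -1) : Idx n) (b, r) (fWt hq (b, r)) ∈ (rep hq h4).range := by
  have h := single_entry_mem (single_one_mem_range hq h4 (b, r + -1))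
    (single_one_mem_range hq h4 (b, r)) ⟨gen n q .F, rep_gen hq h4 .F⟩
  rwa [repGen, shift_apply_self (-1) (fWt hq) (b, r)] at h

lemma coef_ne_zero (h4 : 4 ∣ n) {b : Fin (n ^ 2 / 2)} {r : ZMod (n ^ 2)} (h0 : r ≠ 0)
    (h1 : r ≠ len b) : coef hq (b, r) ≠ 0 := by
  have h2 := q_sub_one_ne_zero hq (one_lt_of_dvd h4)
  have h3 : q ≠ 0 := hq.ne_zero (NeZero.ne _)
  refine mul_ne_zero (mul_ne_zero (div_ne_zero h3 h2) ?_) ?_ <;>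
    rw [Ne, sub_eq_zero, eq_comm, chi_eq_one_iff]
  · rwa [neg_eq_zero]
  · exact fun h => h1 (sub_eq_zero.1 h).symm

/-- Neighbouring positions of the same vertex are connected by matrix units. -/
lemma single_succ_mem (h4 : 4 ∣ n) {b : Fin (n ^ 2 / 2)} {r : ZMod (n ^ 2)} (h0 : r + 1 ≠ 0)
    (h1 : r + 1 ≠ len b) :
    Matrix.single ((b, r + 1) : Idx n) (b, r) 1 ∈ (rep hq h4).range ∧
    Matrix.single ((b, r) : Idx n) (b, r + 1) 1 ∈ (rep hq h4).range := by
  have hE := single_E_mem hq h4 b r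
  have hF := single_F_mem hq h4 b (r + 1)
  have he : eWt k (b, r) = 1 := by simp only [eWt, if_neg h0, if_neg h1]
  have hf : fWt hq (b, r + 1) = efWt hq (b, r + 1) := by simp only [fWt, if_neg h0, if_neg h1]
  rw [he] at hE
  rw [hf, add_neg_cancel_right] at hF
  refine ⟨hE, ?_⟩
  have h2 := single_mul_mem hF hE
  rw [mul_one] at h2
  have h3 := single_mul_mem (single_inverse_mem (single_one_mem_range hq h4 (b, r)) h2) hF
  rwa [mul_comm, mul_inverse_even ⟨rfl, rfl⟩ (coef_ne_zero hq h4 h0 h1)] at h3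

/-- All positions are connected to the base positions of their vertices. -/
lemma single_base_mem (h4 : 4 ∣ n) (z : Idx n) :
    Matrix.single z (base (vert z)) 1 ∈ (rep hq h4).range ∧
    Matrix.single (base (vert z)) z 1 ∈ (rep hq h4).range := by
  obtain ⟨b, r⟩ := z
  have key : ∀ m : ℕ, Matrix.single ((b, (m : ZMod (n ^ 2))) : Idx n)
        (base (vert ((b, (m : ZMod (n ^ 2))) : Idx n))) 1 ∈ (rep hq h4).range ∧
      Matrix.single (base (vert ((b, (m : ZMod (n ^ 2))) : Idx n)))
        ((b, (m : ZMod (n ^ 2))) : Idx n) 1 ∈ (rep hq h4).range := by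
    intro m
    induction m with
    | zero =>
      rw [Nat.cast_zero, vert_zero]
      exact ⟨single_one_mem_range hq h4 _, single_one_mem_range hq h4 _⟩
    | succ m ih =>
      rw [Nat.cast_succ]
      by_cases h0 : (m : ZMod (n ^ 2)) + 1 = 0
      · rw [h0, vert_zero]
        exact ⟨single_one_mem_range hq h4 _, single_one_mem_range hq h4 _⟩
      · by_cases h1 : (m : ZMod (n ^ 2)) + 1 = len b
        · rw [h1, vert_len]
          exact ⟨single_one_mem_range hq h4 _, single_one_mem_range hq h4 _⟩
        · rw [vert_succ h0 h1]
          obtain ⟨h2, h3⟩ := single_succ_mem hq h4 h0 h1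
          exact ⟨by simpa using single_mul_mem h2 ih.1, by simpa using single_mul_mem ih.2 h3⟩
  have := key r.val
  rwa [ZMod.natCast_zmod_val] at this

/-- Both arrows occur in both directions: `E` gives `x` when it enters the position `len b` and `y`
when it enters `0`, while `F` gives `y` when it leaves `0` and `x` when it leaves `len b`. -/
lemma single_arrow_mem (h4 : 4 ∣ n) (b : Fin (n ^ 2 / 2)) (c : Bool) :
    Matrix.single (base (b, !c)) (base (b, c)) (x k) ∈ (rep hq h4).range ∧
    Matrix.single (base (b, !c)) (base (b, c)) (y k) ∈ (rep hq h4).range := by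
  have h0 := len_cast_ne_zero b
  have hl := single_base_mem hq h4 (b, (len b : ZMod (n ^ 2)) + -1)
  rw [vert_len_pred (b := b) (r := len b + -1) (by ring)] at hl
  have hz := single_base_mem hq h4 (b, (0 : ZMod (n ^ 2)) + -1)
  rw [vert_neg_one (b := b) (r := 0 + -1) (by ring)] at hz
  cases c with
  | false =>
    have h1 := single_E_mem hq h4 b (len b + -1)
    have h2 := single_F_mem hq h4 b 0
    have e1 : eWt k (b, (len b : ZMod (n ^ 2)) + -1) = x k := by
      simp only [eWt, neg_add_cancel_right, if_true]
    have e2 : fWt hq (b, 0) = chi hq (len b) • y k := by simp only [fWt, if_true]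
    rw [e1, neg_add_cancel_right] at h1
    rw [e2] at h2
    have h3 := single_mul_mem h1 hl.1
    have h4' := single_smul_mem (chi hq (len b))⁻¹ (single_mul_mem hz.2 h2)
    rw [mul_one] at h3
    rw [one_mul, smul_smul, inv_mul_cancel₀ (chi_ne_zero hq _), one_smul] at h4'
    exact ⟨h3, h4'⟩
  | true =>
    have h1 := single_E_mem hq h4 b (0 + -1)
    have h2 := single_F_mem hq h4 b (len b)
    have e1 : eWt k (b, (0 : ZMod (n ^ 2)) + -1) = y k := by
      simp only [eWt, neg_add_cancel_right, if_true, if_neg h0.symm]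
    have e2 : fWt hq (b, (len b : ZMod (n ^ 2))) = x k := by simp only [fWt, if_true, if_neg h0]
    rw [e1, neg_add_cancel_right] at h1
    rw [e2] at h2
    have h3 := single_mul_mem h1 hz.1
    have h4' := single_mul_mem hl.2 h2
    rw [mul_one] at h3
    rw [one_mul] at h4'
    exact ⟨h4', h3⟩

lemma single_base_base_mem (h4 : 4 ∣ n) (b : Fin (n ^ 2 / 2)) (c c' : Bool) {t : ArrowRing k}
    (ht : t ∈ gr k (b, c) (b, c')) :
    Matrix.single (base (b, c)) (base (b, c')) t ∈ (rep hq h4).range := by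
  rw [gr_eq_part] at ht
  by_cases hc : c = c'
  · subst hc
    rw [beq_self_eq_true] at ht
    have h1 := single_mul_mem (single_arrow_mem hq h4 b !c).1 (by
      simpa using (single_arrow_mem hq h4 b c).1)
    rw [Bool.not_not, x_mul_x] at h1
    rw [eq_of_mem_part_true ht]
    exact single_add_mem (single_smul_mem _ (single_one_mem_range hq h4 _)) (single_smul_mem _ h1)
  · obtain rfl : c = !c' := by cases c <;> cases c' <;> simp_all
    rw [show ((!c') == c') = false by cases c' <;> rfl] at ht
    rw [eq_of_mem_part_false ht]
    exact single_add_mem (single_smul_mem _ (single_arrow_mem hq h4 b c').1)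
      (single_smul_mem _ (single_arrow_mem hq h4 b c').2)

lemma rep_range (h4 : 4 ∣ n) {m : Matrix (Idx n) (Idx n) (ArrowRing k)}
    (hm : ∀ z z', m z z' ∈ gr k (vert z) (vert z')) : ∃ a, rep hq h4 a = m := by
  change m ∈ (rep hq h4).range
  rw [Matrix.matrix_eq_sum_single m]
  refine Subalgebra.sum_mem _ fun z _ => Subalgebra.sum_mem _ fun z' _ => ?_
  have ht := hm z z'
  generalize m z z' = t at ht ⊢
  by_cases hb : (vert z).1 = (vert z').1
  · have h1 : vert z = ((vert z).1, (vert z).2) := rfl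
    have h2 : vert z' = ((vert z).1, (vert z').2) := Prod.ext hb.symm rfl
    have h3 := single_base_mem hq h4 z
    have h4' := single_base_mem hq h4 z'
    rw [h1] at h3
    rw [h2] at h4' ht
    have := single_mul_mem (single_mul_mem h3.1 (single_base_base_mem hq h4 _ _ _ ht)) h4'.2
    rwa [one_mul, mul_one] at this
  · rw [eq_zero_of_mem_gr hb ht, Matrix.single_zero]
    exact Subalgebra.zero_mem _

/-- The representation as a linear map to the graded matrices. -/
def repGr (h4 : 4 ∣ n) :
    QU k n q →ₗ[k] (∀ p : Idx n × Idx n, gr k (vert p.1) (vert p.2)) where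
  toFun a p := ⟨rep hq h4 a p.1 p.2, rep_mem hq h4 a p.1 p.2⟩
  map_add' a b := by ext p : 2; simp
  map_smul' c a := by ext p : 2; simp

lemma repGr_surjective (h4 : 4 ∣ n) : Function.Surjective (repGr hq h4) := fun f => by
  obtain ⟨a, ha⟩ := rep_range hq h4 (m := fun z z' => (f (z, z')).1) fun z z' => (f (z, z')).2
  refine ⟨a, ?_⟩
  ext p : 2
  exact congrFun (congrFun ha p.1) p.2

lemma finrank_graded (h4 : 4 ∣ n) :
    Module.finrank k (∀ p : Idx n × Idx n, gr k (vert p.1) (vert p.2)) = (n ^ 2) ^ 3 := by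
  have h2 := Nat.div_mul_cancel (two_dvd_sq h4)
  have h (p : Idx n × Idx n) : (if (vert p.1).1 = (vert p.2).1 then 2 else 0) =
      if p.1.1 = p.2.1 then 2 else 0 := rfl
  rw [Module.finrank_pi_fintype]
  refine (Finset.sum_congr rfl fun p _ => (finrank_gr _ _).trans (h p)).trans ?_
  have h3 (z : Idx n) : ∑ z' : Idx n, (if z.1 = z'.1 then 2 else 0) = n ^ 2 * 2 := by
    rw [Fintype.sum_prod_type]
    have h5 (b : Fin (n ^ 2 / 2)) : ∑ _r : ZMod (n ^ 2), (if z.1 = b then 2 else 0) =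
        if z.1 = b then n ^ 2 * 2 else 0 := by
      rw [Finset.sum_const, Finset.card_univ, ZMod.card, smul_eq_mul, mul_ite, mul_zero]
    rw [Finset.sum_congr rfl fun b _ => h5 b, Finset.sum_ite_eq, if_pos (Finset.mem_univ _)]
  rw [Fintype.sum_prod_type, Finset.sum_congr rfl fun z _ => h3 z, Finset.sum_const,
    Finset.card_univ, Fintype.card_prod, Fintype.card_fin, ZMod.card, smul_eq_mul]
  linear_combination (n ^ 2) ^ 2 * h2

/-- The reduced monomials span a space that is not too large. -/
lemma finite_and_finrank_le (hq : IsPrimitiveRoot q (n ^ 2)) (h4 : 4 ∣ n) :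
    Module.Finite k (QU k n q) ∧ Module.finrank k (QU k n q) ≤ (n ^ 2) ^ 3 := by
  have h := top_le_iff.1 (span_redMono (Nat.pos_of_neZero n) h4 hq)
  refine ⟨⟨h ▸ Submodule.fg_span (Set.finite_range _)⟩, ?_⟩
  have h1 := finrank_range_le_card (R := k) (redMono n q)
  rwa [Set.finrank, h, finrank_top, card_redMono h4] at h1

lemma finrank_QU (hq : IsPrimitiveRoot q (n ^ 2)) (h4 : 4 ∣ n) : Module.finrank k (QU k n q) = (n ^ 2) ^ 3 := by
  have := (finite_and_finrank_le hq h4).1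
  refine le_antisymm (finite_and_finrank_le hq h4).2 ?_
  rw [← finrank_graded (k := k) h4]
  exact LinearMap.finrank_le_finrank_of_surjective (repGr_surjective hq h4)

lemma rep_injective (h4 : 4 ∣ n) : Function.Injective (rep hq h4) := by
  have := (finite_and_finrank_le hq h4).1
  have h1 := (LinearMap.injective_iff_surjective_of_finrank_eq_finrank
    ((finrank_QU hq h4).trans (finrank_graded h4).symm)).2 (repGr_surjective hq h4)
  intro a b hab
  refine h1 ?_
  ext p : 2
  exact congrFun (congrFun hab p.1) p.2

/-- The PBW basis. -/
def pbw (h4 : 4 ∣ n) :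
    Module.Basis (Fin (n ^ 2) × Fin (n ^ 2 / 2) × Fin 2 × Fin (n ^ 2)) k (QU k n q) :=
  basisOfTopLeSpanOfCardEqFinrank (redMono n q) (span_redMono (Nat.pos_of_neZero n) h4 hq)
    ((card_redMono h4).trans (finrank_QU hq h4).symm)

lemma pbw_apply (h4 : 4 ∣ n) (p : Fin (n ^ 2) × Fin (n ^ 2 / 2) × Fin 2 × Fin (n ^ 2)) :
    pbw hq h4 p = redMono n q p :=
  congrFun (coe_basisOfTopLeSpanOfCardEqFinrank _ _ _) p

/-- The quantum group is an algebra of graded matrices. -/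
def model (h4 : 4 ∣ n) : MatrixModel k (QU k n q) (Idx n) (Fin (n ^ 2 / 2)) where
  v := vert
  o := base
  v_o := vert_base
  toHom := rep hq h4
  injective := rep_injective hq h4
  mem_gr := rep_mem hq h4
  surj _ hm := rep_range hq h4 hm

end Model

/-! ### Division by `F` -/

section Division

variable {k : Type u} [Field k] {n : ℕ} {q : k}

lemma mono_eq_zero {a s j b : ℕ} (hb : n ^ 2 ≤ b) : mono n q a s j b = 0 := by
  rw [mono, pow_eq_zero_of_le hb E_pow, mul_zero]

variable [NeZero n]

lemma half_sq_pos (h4 : 4 ∣ n) : 0 < n ^ 2 / 2 :=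
  Nat.div_pos (by nlinarith [one_lt_of_dvd h4]) two_pos

/-- The index of a monomial in the PBW basis. -/
def pbwIdx (h4 : 4 ∣ n) {a b : ℕ} (s j : ℕ) (ha : a < n ^ 2) (hb : b < n ^ 2) :
    Fin (n ^ 2) × Fin (n ^ 2 / 2) × Fin 2 × Fin (n ^ 2) :=
  (⟨a, ha⟩, ⟨s % (n ^ 2 / 2), Nat.mod_lt _ (half_sq_pos h4)⟩, ⟨j % 2, Nat.mod_lt _ two_pos⟩, ⟨b, hb⟩)

lemma mono_mod (h4 : 4 ∣ n) (a s j b : ℕ) :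
    mono n q a (s % (n ^ 2 / 2)) (j % 2) b = mono n q a s j b := by
  have h1 : cartan n q ^ (s % (n ^ 2 / 2)) = cartan n q ^ s :=
    (pow_eq_pow_mod s (cartan_pow (Nat.pos_of_neZero n) h4)).symm
  have h2 : parity n q ^ (j % 2) = parity n q ^ j :=
    (pow_eq_pow_mod j ((pow_two _).trans (parity_sq h4))).symm
  simp only [mono, h1, h2]

variable (hq : IsPrimitiveRoot q (n ^ 2))

lemma pbw_pbwIdx (h4 : 4 ∣ n) {a b : ℕ} (s j : ℕ) (ha : a < n ^ 2) (hb : b < n ^ 2) :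
    pbw hq h4 (pbwIdx h4 s j ha hb) = mono n q a s j b := by
  rw [pbw_apply]
  exact mono_mod h4 a s j b

/-- Left division of the elements of the PBW basis by `F`. -/
def divF (h4 : 4 ∣ n) : QU k n q →ₗ[k] QU k n q :=
  (pbw hq h4).constr k fun p =>
    if (p.1 : ℕ) = 0 then 0 else mono n q (p.1 - 1) p.2.1 p.2.2.1 p.2.2.2

lemma divF_mono_zero (h4 : 4 ∣ n) (s j b : ℕ) : divF hq h4 (mono n q 0 s j b) = 0 := by
  by_cases hb : b < n ^ 2
  · rw [← pbw_pbwIdx hq h4 s j (Nat.pos_of_neZero _) hb, divF, Module.Basis.constr_basis]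
    exact if_pos rfl
  · rw [mono_eq_zero (not_lt.1 hb), map_zero]

lemma divF_mono_succ (h4 : 4 ∣ n) {a : ℕ} (ha : a + 1 < n ^ 2) (s j b : ℕ) :
    divF hq h4 (mono n q (a + 1) s j b) = mono n q a s j b := by
  by_cases hb : b < n ^ 2
  · rw [← pbw_pbwIdx hq h4 s j ha hb, divF, Module.Basis.constr_basis]
    exact (if_neg (Nat.succ_ne_zero a)).trans (mono_mod h4 a s j b)
  · rw [mono_eq_zero (not_lt.1 hb), mono_eq_zero (not_lt.1 hb), map_zero]

omit [NeZero n] in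
lemma mono_mem_truncated {a : ℕ} (ha : a + 1 < n ^ 2) (s j b : ℕ) :
    mono n q a s j b ∈ truncated n q := by
  have hk : gen n q .kk ∈ Algebra.adjoin k {gen n q .kk, gen n q .kh} :=
    Algebra.subset_adjoin (Set.mem_insert _ _)
  have hh : gen n q .kh ∈ Algebra.adjoin k {gen n q .kk, gen n q .kh} :=
    Algebra.subset_adjoin (Set.mem_insert_of_mem _ rfl)
  exact Submodule.subset_span ⟨a, by omega, b, cartan n q ^ s * parity n q ^ j,
    mul_mem (pow_mem (mul_mem (pow_mem hk _) hh) _) (pow_mem (mul_mem hk (pow_mem hh _)) _), rfl⟩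

/-- The monomials `cartan ^ s parity ^ j` span the algebra generated by `κ` and `κ̂`. -/
lemma adjoin_le_span (h4 : 4 ∣ n) :
    Subalgebra.toSubmodule (Algebra.adjoin k {gen n q .kk, gen n q .kh}) ≤
      Submodule.span k {t | ∃ s j : ℕ, t = cartan n q ^ s * parity n q ^ j} := by
  have hn := Nat.pos_of_neZero n
  rw [Algebra.adjoin_eq_span]
  refine Submodule.span_mono fun t ht => ?_
  have hk := kk_eq (k := k) (q := q) hn h4
  have hc := commute_cartan_parity (k := k) (n := n) (q := q)
  induction ht using Submonoid.closure_induction with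
  | mem t ht =>
    rcases ht with rfl | rfl
    · exact ⟨n / 2 * (n / 2 - 1), 1, by rw [hk, ← (hc.pow_left _).eq, pow_one]⟩
    · exact ⟨n / 2 * (n / 2 - 1) + 1, 1, by
        rw [← kk_cartan hn, hk, pow_one, mul_assoc, ← pow_succ, ← (hc.pow_left _).eq]⟩
  | one => exact ⟨0, 0, by simp⟩
  | mul t t' _ _ h h' =>
    obtain ⟨s, j, rfl⟩ := h
    obtain ⟨s', j', rfl⟩ := h'
    exact ⟨s + s', j + j', by
      rw [pow_add, pow_add, mul_assoc, mul_assoc, ← mul_assoc (parity n q ^ j),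
        ← (hc.pow_pow s' j).eq, mul_assoc]⟩

lemma truncated_eq (h4 : 4 ∣ n) : truncated n q =
    Submodule.span k {z | ∃ a s j b : ℕ, a + 1 < n ^ 2 ∧ z = mono n q a s j b} := by
  refine le_antisymm (Submodule.span_le.2 ?_) (Submodule.span_le.2 ?_)
  · rintro _ ⟨a, ha, b, t, ht, rfl⟩
    have ht' := adjoin_le_span h4 ht
    clear ht
    change gen n q .F ^ a * t * gen n q .E ^ b ∈ Submodule.span k _
    induction ht' using Submodule.span_induction with
    | mem t ht =>
      obtain ⟨s, j, rfl⟩ := ht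
      exact Submodule.subset_span ⟨a, s, j, b, by omega, rfl⟩
    | zero => simp
    | add t t' _ _ h h' =>
      rw [mul_add, add_mul]
      exact Submodule.add_mem _ h h'
    | smul c t _ h =>
      rw [mul_smul_comm, smul_mul_assoc]
      exact Submodule.smul_mem _ _ h
  · rintro _ ⟨a, s, j, b, ha, rfl⟩
    exact mono_mem_truncated ha s j b

/-- A linear statement about truncated elements may be checked on monomials. -/
lemma truncated_induction (h4 : 4 ∣ n) {V : Type*} [AddCommGroup V] [Module k V]
    {f g : QU k n q →ₗ[k] V}
    (h : ∀ a s j b : ℕ, a + 1 < n ^ 2 → f (mono n q a s j b) = g (mono n q a s j b))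
    {z : QU k n q} (hz : z ∈ truncated n q) : f z = g z := by
  rw [truncated_eq h4] at hz
  refine LinearMap.eqOn_span ?_ hz
  rintro _ ⟨a, s, j, b, ha, rfl⟩
  exact h a s j b ha

lemma divF_F_mul (h4 : 4 ∣ n) {z : QU k n q} (hz : z ∈ truncated n q) :
    divF hq h4 (gen n q .F * z) = z :=
  truncated_induction (f := divF hq h4 ∘ₗ LinearMap.mulLeft k (gen n q .F)) (g := LinearMap.id) h4
    (fun a s j b ha => by
      change divF hq h4 (gen n q .F * mono n q a s j b) = mono n q a s j b
      rw [F_mul_mono, divF_mono_succ hq h4 ha]) hz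

lemma divF_mem_truncated (h4 : 4 ∣ n) (z : QU k n q) : divF hq h4 z ∈ truncated n q := by
  have h : z ∈ Submodule.span k (Set.range (redMono n q)) :=
    span_redMono (Nat.pos_of_neZero n) h4 hq trivial
  induction h using Submodule.span_induction with
  | mem z hz =>
    obtain ⟨⟨⟨a, ha⟩, s, j, b⟩, rfl⟩ := hz
    rw [redMono]
    dsimp only
    rcases a with _ | a
    · rw [divF_mono_zero]
      exact Submodule.zero_mem _
    · rw [divF_mono_succ hq h4 ha]
      exact mono_mem_truncated ha _ _ _
  | zero => rw [map_zero]; exact Submodule.zero_mem _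
  | add z z' _ _ h h' => rw [map_add]; exact Submodule.add_mem _ h h'
  | smul c z _ h => rw [map_smul]; exact Submodule.smul_mem _ _ h

/-- The remainder of the division by `F` has no `F` in it. -/
lemma sub_F_mul_divF_mem (h4 : 4 ∣ n) (z : QU k n q) : z - gen n q .F * divF hq h4 z ∈
    Submodule.span k {z | ∃ s j b : ℕ, z = mono n q 0 s j b} := by
  have h : z ∈ Submodule.span k (Set.range (redMono n q)) :=
    span_redMono (Nat.pos_of_neZero n) h4 hq trivial
  induction h using Submodule.span_induction with
  | mem z hz =>
    obtain ⟨⟨⟨a, ha⟩, s, j, b⟩, rfl⟩ := hz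
    rw [redMono]
    dsimp only
    rcases a with _ | a
    · rw [divF_mono_zero, mul_zero, sub_zero]
      exact Submodule.subset_span ⟨_, _, _, rfl⟩
    · rw [divF_mono_succ hq h4 ha, F_mul_mono, sub_self]
      exact Submodule.zero_mem _
  | zero => rw [map_zero, mul_zero, sub_zero]; exact Submodule.zero_mem _
  | add z z' _ _ h h' =>
    rw [map_add, mul_add, add_sub_add_comm]
    exact Submodule.add_mem _ h h'
  | smul c z _ h =>
    rw [map_smul, mul_smul_comm, ← smul_sub]
    exact Submodule.smul_mem _ _ h

/-- An element is divisible by `F` if it is killed by the last nonzero power of `F`. -/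
lemma F_mul_divF (h4 : 4 ∣ n) {z : QU k n q} (hz : gen n q .F ^ (n ^ 2 - 1) * z = 0) :
    gen n q .F * divF hq h4 z = z := by
  have hN : 0 < n ^ 2 := Nat.pos_of_neZero _
  have h1 := sub_F_mul_divF_mem hq h4 z
  have h2 : gen n q .F ^ (n ^ 2 - 1) * (z - gen n q .F * divF hq h4 z) = 0 := by
    rw [mul_sub, hz, ← mul_assoc, ← pow_succ, Nat.sub_add_cancel hN, F_pow, zero_mul, sub_zero]
  -- repeated division recovers the remainder from its multiple
  have h3 : ∀ m < n ^ 2, ((divF hq h4) ^ m) (gen n q .F ^ m * (z - gen n q .F * divF hq h4 z)) =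
      z - gen n q .F * divF hq h4 z := by
    intro m
    induction m with
    | zero => intro _; simp
    | succ m ih =>
      intro hm
      rw [pow_succ, Module.End.mul_apply, pow_succ' (gen n q .F), mul_assoc, divF_F_mul,
        ih (by omega)]
      generalize z - gen n q .F * divF hq h4 z = y at h1
      induction h1 using Submodule.span_induction with
      | mem y hy =>
        obtain ⟨s, j, b, rfl⟩ := hy
        have h5 : gen n q .F ^ m * mono n q 0 s j b = mono n q m s j b := by
          rw [mono, mono, pow_zero, one_mul, mul_assoc, mul_assoc, mul_assoc]
        rw [h5]
        exact mono_mem_truncated hm _ _ _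
      | zero => rw [mul_zero]; exact Submodule.zero_mem _
      | add y y' _ _ h h' => rw [mul_add]; exact Submodule.add_mem _ h h'
      | smul c y _ h => rw [mul_smul_comm]; exact Submodule.smul_mem _ _ h
  have h6 := h3 (n ^ 2 - 1) (by omega)
  rw [h2, map_zero] at h6
  exact (sub_eq_zero.1 h6.symm).symm

lemma cartan_mul_mem_truncated (hq : IsPrimitiveRoot q (n ^ 2)) (h4 : 4 ∣ n) {z : QU k n q} (hz : z ∈ truncated n q) :
    cartan n q * z ∈ truncated n q := by
  rw [truncated_eq h4] at hz
  induction hz using Submodule.span_induction with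
  | mem z hz =>
    obtain ⟨a, s, j, b, ha, rfl⟩ := hz
    rw [cartan_mul_mono (Nat.pos_of_neZero n) hq]
    exact Submodule.smul_mem _ _ (mono_mem_truncated ha _ _ _)
  | zero => rw [mul_zero]; exact Submodule.zero_mem _
  | add y y' _ _ h h' => rw [mul_add]; exact Submodule.add_mem _ h h'
  | smul c y _ h => rw [mul_smul_comm]; exact Submodule.smul_mem _ _ h

lemma parity_mul_mem_truncated (hq : IsPrimitiveRoot q (n ^ 2)) (h4 : 4 ∣ n) {z : QU k n q} (hz : z ∈ truncated n q) :
    parity n q * z ∈ truncated n q := by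
  rw [truncated_eq h4] at hz
  induction hz using Submodule.span_induction with
  | mem z hz =>
    obtain ⟨a, s, j, b, ha, rfl⟩ := hz
    rw [parity_mul_mono (Nat.pos_of_neZero n) h4 hq]
    exact Submodule.smul_mem _ _ (mono_mem_truncated ha _ _ _)
  | zero => rw [mul_zero]; exact Submodule.zero_mem _
  | add y y' _ _ h h' => rw [mul_add]; exact Submodule.add_mem _ h h'
  | smul c y _ h => rw [mul_smul_comm]; exact Submodule.smul_mem _ _ h

end Division

/-! ### The elements `α` and `β` -/

section Alpha

variable {k : Type u} [Field k] {n : ℕ} {q : k}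

lemma two_mul_le {i : ℕ} (hi : i ∈ Finset.Icc 1 (n ^ 2 / 2)) : 2 * i ≤ n ^ 2 := by
  have := (Finset.mem_Icc.1 hi).2
  omega

lemma half_mul (h4 : 4 ∣ n) : n / 2 * n = n ^ 2 / 2 := by
  obtain ⟨r, rfl⟩ := h4
  rw [show (4 * r) ^ 2 = 2 * (2 * r * (4 * r)) by ring, Nat.mul_div_cancel_left _ two_pos,
    show 4 * r = 2 * (2 * r) by ring, Nat.mul_div_cancel_left _ two_pos]

lemma cartan_mul_phi (hn : 0 < n) (h4 : 4 ∣ n) (hq : IsPrimitiveRoot q (n ^ 2)) (i : ℕ) :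
    cartan n q * phi n q i = q ^ (2 * i) • phi n q i := by
  have h0 := q_ne_zero hn hq
  have h1 : ∀ t, (q⁻¹ ^ (2 * i * t)) • cartan n q ^ t = (q⁻¹ ^ (2 * i) • cartan n q) ^ t :=
    fun t => by rw [_root_.smul_pow, pow_mul]
  have h2 : (q⁻¹ ^ (2 * i) • cartan n q) ^ (n / 2 * n) = 1 := by
    rw [_root_.smul_pow, half_mul h4, cartan_pow hn h4, ← pow_mul, show 2 * i * (n ^ 2 / 2) = n ^ 2 * i by
      rw [mul_right_comm, mul_comm 2, Nat.div_mul_cancel (two_dvd_sq h4)], pow_mul, inv_pow,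
      hq.pow_eq_one, inv_one, one_pow, one_smul]
  have h3 := mul_geom_sum (q⁻¹ ^ (2 * i) • cartan n q) (n / 2 * n)
  rw [h2, sub_self, sub_mul, one_mul, sub_eq_zero, smul_mul_assoc] at h3
  simp only [phi, h1]
  rw [mul_smul_comm, smul_comm (q ^ (2 * i))]
  congr 1
  nth_rw 2 [← h3]
  rw [smul_smul, ← mul_pow, mul_inv_cancel₀ h0, one_pow, one_smul]

lemma parity_mul_parityIdem (h4 : 4 ∣ n) (j : Fin 2) :
    parity n q * parityIdem n q j = (-1 : k) ^ (j : ℕ) • parityIdem n q j := by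
  have h : (-1 : k) ^ (j : ℕ) * (-1 : k) ^ (j : ℕ) = 1 := by
    rw [← mul_pow, neg_one_mul, neg_neg, one_pow]
  rw [parityIdem, mul_smul_comm, smul_comm ((-1 : k) ^ (j : ℕ)), mul_add, mul_one, mul_smul_comm,
    parity_sq h4, smul_add ((-1 : k) ^ (j : ℕ)), smul_smul ((-1 : k) ^ (j : ℕ)), h, one_smul, add_comm]

lemma commute_parity_phi (i : ℕ) : Commute (parity n q) (phi n q i) :=
  (Commute.sum_right _ _ _ fun t _ =>
    ((commute_cartan_parity.symm.pow_right t).smul_right _)).smul_right _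

lemma cartan_mul_idem (hn : 0 < n) (h4 : 4 ∣ n) (hq : IsPrimitiveRoot q (n ^ 2)) (i : ℕ)
    (j : Fin 2) : cartan n q * idem n q i j = q ^ (2 * i) • idem n q i j := by
  rw [idem, ← mul_assoc, cartan_mul_phi hn h4 hq, smul_mul_assoc]

lemma parity_mul_idem (h4 : 4 ∣ n) (i : ℕ) (j : Fin 2) :
    parity n q * idem n q i j = (-1 : k) ^ (j : ℕ) • idem n q i j := by
  rw [idem, ← mul_assoc, (commute_parity_phi i).eq, mul_assoc, parity_mul_parityIdem h4,
    mul_smul_comm]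

/-- The weight of `E ^ r α`. -/
lemma cartan_mul_E_pow_alpha (hn : 0 < n) (h4 : 4 ∣ n) (hq : IsPrimitiveRoot q (n ^ 2)) (i : ℕ)
    (j : Fin 2) (r : ℕ) : cartan n q * (gen n q .E ^ r * alpha n q i j) =
      (q ^ (2 * i) * q⁻¹ ^ (2 * (r + 1))) • (gen n q .E ^ r * alpha n q i j) := by
  have h0 := q_ne_zero hn hq
  have hN : 0 < n ^ 2 := by positivity
  have h1 : (q ^ 2) ^ (n ^ 2 - 1) = q⁻¹ ^ 2 := by
    refine (eq_inv_of_mul_eq_one_left ?_).trans (inv_pow q 2).symm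
    rw [← pow_succ, Nat.sub_add_cancel hN,
      ← pow_mul, mul_comm, pow_mul, hq.pow_eq_one, one_pow]
  rw [alpha, ← mul_assoc, mul_pow_of_smul (cartan_E hn hq), smul_mul_assoc, mul_assoc,
    ← mul_assoc (cartan n q), mul_pow_of_smul (cartan_F hn hq), smul_mul_assoc, mul_assoc,
    cartan_mul_idem hn h4 hq, h1, mul_smul_comm, mul_smul_comm, mul_smul_comm, smul_smul, smul_smul]
  congr 1
  ring

lemma parity_mul_E_pow_alpha (hn : 0 < n) (h4 : 4 ∣ n) (hq : IsPrimitiveRoot q (n ^ 2)) (i : ℕ)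
    (j : Fin 2) (r : ℕ) : parity n q * (gen n q .E ^ r * alpha n q i j) =
      ((-1) ^ (r + 1) * (-1 : k) ^ (j : ℕ)) • (gen n q .E ^ r * alpha n q i j) := by
  have hN : 0 < n ^ 2 := by positivity
  have h1 : (-1 : k) ^ (n ^ 2 - 1) = -1 := by
    refine Odd.neg_one_pow (Nat.Even.sub_odd hN ?_ odd_one)
    exact even_iff_two_dvd.2 (two_dvd_sq h4)
  rw [alpha, ← mul_assoc, mul_pow_of_smul (parity_E hn h4 hq), smul_mul_assoc, mul_assoc,
    ← mul_assoc (parity n q), mul_pow_of_smul (parity_F hn h4 hq), smul_mul_assoc, mul_assoc,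
    parity_mul_idem h4, h1, mul_smul_comm, mul_smul_comm, mul_smul_comm, smul_smul, smul_smul]
  congr 1
  ring

lemma F_mul_alpha (hn : 0 < n) (i : ℕ) (j : Fin 2) : gen n q .F * alpha n q i j = 0 := by
  have hN : 0 < n ^ 2 := by positivity
  rw [alpha, ← mul_assoc, ← pow_succ', Nat.sub_add_cancel hN, F_pow, zero_mul]

/-- The scalar by which `F E` acts on `E ^ r α`. -/
def feCoef (q : k) (i r : ℕ) : k :=
  q⁻¹ ^ r * (q ^ (r + 1) - 1) / (q - 1) * (1 - q ^ (2 * i) * q⁻¹ ^ (r + 2))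

/-- Since `F α = 0`, commuting `F` past `E ^ (r + 1)` leaves a scalar multiple of
`E ^ r α`. -/
lemma F_mul_E_pow_alpha (hn : 0 < n) (h4 : 4 ∣ n) (hq : IsPrimitiveRoot q (n ^ 2)) (i : ℕ)
    (j : Fin 2) (r : ℕ) : gen n q .F * (gen n q .E ^ (r + 1) * alpha n q i j) =
      feCoef q i r • (gen n q .E ^ r * alpha n q i j) := by
  have h0 := q_ne_zero hn hq
  have h1 : q - 1 ≠ 0 := q_sub_one_ne_zero hq
    (lt_of_lt_of_le (by norm_num) (Nat.le_of_dvd hn h4))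
  have hFE : gen n q .F * gen n q .E =
      q⁻¹ • (gen n q .E * gen n q .F) + (1 - cartan n q) := by
    rw [← F_E]; abel
  induction r with
  | zero =>
    have h := cartan_mul_E_pow_alpha hn h4 hq i j 0
    rw [pow_zero, one_mul] at h ⊢
    rw [zero_add, pow_one, ← mul_assoc, hFE, add_mul, smul_mul_assoc, mul_assoc, F_mul_alpha hn,
      mul_zero, smul_zero, zero_add, sub_mul, one_mul, h, feCoef]
    nth_rw 1 [← one_smul k (alpha n q i j)]
    rw [← sub_smul]
    congr 1
    field_simp
    ring
  | succ r ih =>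
    have h := cartan_mul_E_pow_alpha hn h4 hq i j (r + 1)
    rw [pow_succ' _ (r + 1), mul_assoc, ← mul_assoc, hFE, add_mul, smul_mul_assoc, mul_assoc, ih,
      mul_smul_comm, ← mul_assoc, ← pow_succ', sub_mul, one_mul, h, smul_smul]
    nth_rw 2 [← one_smul k (gen n q .E ^ (r + 1) * alpha n q i j)]
    rw [← sub_smul, ← add_smul]
    congr 1
    simp only [feCoef, inv_pow]
    field_simp
    ring

lemma feCoef_eq_zero (h0 : q ≠ 0) {i : ℕ} (hi : 1 ≤ i) : feCoef q i (2 * i - 2) = 0 := by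
  rw [feCoef, show 2 * i - 2 + 2 = 2 * i by omega, ← mul_pow, mul_inv_cancel₀ h0, one_pow, sub_self,
    mul_zero]

lemma F_E_beta (hn : 0 < n) (h4 : 4 ∣ n) (hq : IsPrimitiveRoot q (n ^ 2)) {i : ℕ} (hi : 1 ≤ i)
    (j : Fin 2) : gen n q .F * (gen n q .E * beta n q i j) = 0 := by
  rw [beta, ← mul_assoc (gen n q .E), ← pow_succ', F_mul_E_pow_alpha hn h4 hq,
    feCoef_eq_zero (q_ne_zero hn hq) hi, zero_smul]

lemma F_pow_mul_E_pow_alpha (hn : 0 < n) (h4 : 4 ∣ n) (hq : IsPrimitiveRoot q (n ^ 2)) (i : ℕ)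
    (j : Fin 2) (r : ℕ) : gen n q .F ^ (r + 1) * (gen n q .E ^ r * alpha n q i j) = 0 := by
  induction r with
  | zero => rw [zero_add, pow_one, pow_zero, one_mul, F_mul_alpha hn]
  | succ r ih => rw [pow_succ, mul_assoc, F_mul_E_pow_alpha hn h4 hq, mul_smul_comm, ih, smul_zero]

lemma F_pow_mul_beta (hn : 0 < n) (h4 : 4 ∣ n) (hq : IsPrimitiveRoot q (n ^ 2)) {i : ℕ}
    (hi : i ∈ Finset.Icc 1 (n ^ 2 / 2)) (j : Fin 2) :
    gen n q .F ^ (n ^ 2 - 1) * beta n q i j = 0 := by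
  have h1 := (Finset.mem_Icc.1 hi).1
  have h2 := two_mul_le hi
  rw [beta, show n ^ 2 - 1 = (n ^ 2 - 2 * i) + (2 * i - 2 + 1) by omega, pow_add, mul_assoc,
    F_pow_mul_E_pow_alpha hn h4 hq, mul_zero]

end Alpha

/-! ### Existence and uniqueness of the elements `γ` -/

section Existence

variable {k : Type u} [Field k] {n : ℕ} {q : k} [NeZero n]

lemma eq_of_F_mul_eq (hq : IsPrimitiveRoot q (n ^ 2)) (h4 : 4 ∣ n) {z z' : QU k n q}
    (hz : z ∈ truncated n q) (hz' : z' ∈ truncated n q) (h : gen n q .F * z = gen n q .F * z') :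
    z = z' := by
  rw [← divF_F_mul hq h4 hz, h, divF_F_mul hq h4 hz']

/-- The elements `γ` exist, and the truncated one is unique. -/
lemma exists_isGamma (hq : IsPrimitiveRoot q (n ^ 2)) (h4 : 4 ∣ n) {i : ℕ}
    (hi : i ∈ Finset.Icc 1 (n ^ 2 / 2)) (j : Fin 2) :
    ∃ g ∈ truncated n q, IsGamma n q i j g ∧
      ∀ g' ∈ truncated n q, gen n q Gen.F * g' = beta n q i j → g' = g := by
  have hn := Nat.pos_of_neZero n
  have h0 := q_ne_zero hn hq
  have h1 := (Finset.mem_Icc.1 hi).1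
  have hF := F_mul_divF hq h4 (F_pow_mul_beta hn h4 hq hi j)
  have hT := divF_mem_truncated hq h4 (beta n q i j)
  refine ⟨divF hq h4 (beta n q i j), hT, ⟨hF, ?_, ?_⟩, fun g' hg' h =>
    eq_of_F_mul_eq hq h4 hg' hT (h.trans hF.symm)⟩
  · refine eq_of_F_mul_eq hq h4 (cartan_mul_mem_truncated hq h4 hT) (Submodule.smul_mem _ _ hT) ?_
    have h := cartan_F (k := k) hn hq
    have h' : gen n q .F * cartan n q = q⁻¹ ^ 2 • (cartan n q * gen n q .F) := by
      rw [h, smul_smul, ← mul_pow, inv_mul_cancel₀ h0, one_pow, one_smul]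
    rw [← mul_assoc, h', smul_mul_assoc, mul_assoc, mul_smul_comm, hF, beta,
      cartan_mul_E_pow_alpha hn h4 hq, smul_smul]
    congr 1
    rw [show 2 * (2 * i - 2 + 1) = 2 * i + (2 * i - 2) by omega, pow_add, ← mul_assoc (q ^ (2 * i)),
      ← mul_pow q, mul_inv_cancel₀ h0, one_pow, one_mul, ← pow_add]
    congr 1
    omega
  · refine eq_of_F_mul_eq hq h4 (parity_mul_mem_truncated hq h4 hT) (Submodule.smul_mem _ _ hT) ?_
    have h' : gen n q .F * parity n q = (-1 : k) • (parity n q * gen n q .F) := by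
      rw [parity_F hn h4 hq, smul_smul, neg_one_mul, neg_neg, one_smul]
    rw [← mul_assoc, h', smul_mul_assoc, mul_assoc, mul_smul_comm, hF, beta,
      parity_mul_E_pow_alpha hn h4 hq, smul_smul]
    congr 1
    have : Even (2 * i - 2) := ⟨i - 1, by omega⟩
    rw [pow_succ, this.neg_one_pow]
    ring

end Existence

/-! ### The vertices of the elements `γ` -/

section Vertex

variable {k : Type u} [Field k] {n : ℕ} {q : k}

/-- The vertex of `γ_{2i,j}`. -/
def gammaVert {i : ℕ} (hi : i ∈ Finset.Icc 1 (n ^ 2 / 2)) (j : Fin 2) : Fin (n ^ 2 / 2) × Bool :=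
  if j = 0 then (⟨i - 1, by have := Finset.mem_Icc.1 hi; omega⟩, false)
  else (⟨n ^ 2 / 2 - i, by have := Finset.mem_Icc.1 hi; omega⟩, true)

lemma gammaVert_injective {i i' : ℕ} (hi : i ∈ Finset.Icc 1 (n ^ 2 / 2))
    (hi' : i' ∈ Finset.Icc 1 (n ^ 2 / 2)) {j j' : Fin 2}
    (h : gammaVert hi j = gammaVert hi' j') : i = i' ∧ j = j' := by
  have h1 := Finset.mem_Icc.1 hi
  have h2 := Finset.mem_Icc.1 hi'
  fin_cases j <;> fin_cases j' <;> simp [gammaVert] at h ⊢ <;> omega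

lemma gammaVert_surjective (w : Fin (n ^ 2 / 2) × Bool) :
    ∃ (i : ℕ) (hi : i ∈ Finset.Icc 1 (n ^ 2 / 2)) (j : Fin 2), gammaVert hi j = w := by
  obtain ⟨⟨b, hb⟩, c⟩ := w
  cases c
  · exact ⟨b + 1, Finset.mem_Icc.2 ⟨by omega, by omega⟩, 0, by simp [gammaVert]⟩
  · refine ⟨n ^ 2 / 2 - b, Finset.mem_Icc.2 ⟨by omega, by omega⟩, 1, ?_⟩
    simp only [gammaVert, one_ne_zero, if_false, Prod.mk.injEq, Fin.mk.injEq, and_true]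
    omega

lemma gammaVert_fst_eq_iff (h4 : 4 ∣ n) {i i' : ℕ} (hi : i ∈ Finset.Icc 1 (n ^ 2 / 2))
    (hi' : i' ∈ Finset.Icc 1 (n ^ 2 / 2)) {j j' : Fin 2} :
    (gammaVert hi j).1 = (gammaVert hi' j').1 ↔
      (i = i' ∧ j = j') ∨ (2 * i + 2 * i' = n ^ 2 + 2 ∧ (j : ℕ) + (j' : ℕ) = 1) := by
  have h1 := Finset.mem_Icc.1 hi
  have h2 := Finset.mem_Icc.1 hi'
  have h3 := Nat.div_mul_cancel (two_dvd_sq h4)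
  fin_cases j <;> fin_cases j' <;> simp [gammaVert] <;> omega

variable [NeZero n] (hq : IsPrimitiveRoot q (n ^ 2))

lemma cartanWt_zero (b : Fin (n ^ 2 / 2)) :
    cartanWt hq (b, 0) * q ^ (2 * (b + 1 : ℕ)) = 1 := by
  rw [← chi_natCast hq, cartanWt, ← AddChar.map_add_eq_mul, ← AddChar.map_zero_eq_one (chi hq)]
  congr 1
  push_cast
  ring

lemma cartanWt_len (b : Fin (n ^ 2 / 2)) :
    cartanWt hq (b, (len b : ZMod (n ^ 2))) = q ^ (2 * b : ℕ) := by
  rw [← chi_natCast hq, cartanWt, len_cast]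
  congr 1
  push_cast
  ring

lemma parityWt_zero (b : Fin (n ^ 2 / 2)) : parityWt hq (b, 0) = 1 := by
  rw [parityWt, mul_zero, AddChar.map_zero_eq_one]

lemma parityWt_len (h4 : 4 ∣ n) (b : Fin (n ^ 2 / 2)) :
    parityWt hq (b, (len b : ZMod (n ^ 2))) = -1 := by
  have h2 : ((n ^ 2 / 2 : ℕ) : ZMod (n ^ 2)) * 2 = 0 := by
    have := congrArg (Nat.cast : ℕ → ZMod (n ^ 2)) (Nat.div_mul_cancel (two_dvd_sq h4))
    rwa [ZMod.natCast_self, Nat.cast_mul, Nat.cast_two] at this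
  rw [parityWt, ← q_pow_half (Nat.pos_of_neZero n) h4 hq, ← chi_natCast hq, len_cast]
  congr 1
  push_cast at h2 ⊢
  linear_combination -((b : ZMod (n ^ 2)) + 1) * h2

lemma weights_base (h4 : 4 ∣ n) {i : ℕ} (hi : i ∈ Finset.Icc 1 (n ^ 2 / 2)) (j : Fin 2) :
    cartanWt hq (base (gammaVert hi j)) * q ^ (2 * i) = 1 ∧
      parityWt hq (base (gammaVert hi j)) = (-1) ^ (j : ℕ) := by
  have h1 := Finset.mem_Icc.1 hi
  have h3 := Nat.div_mul_cancel (two_dvd_sq h4)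
  fin_cases j
  · have h := cartanWt_zero hq ⟨i - 1, by omega⟩
    dsimp only at h
    rw [Nat.sub_add_cancel h1.1] at h
    exact ⟨h, (parityWt_zero hq _).trans (pow_zero _).symm⟩
  · have h := cartanWt_len hq ⟨n ^ 2 / 2 - i, by omega⟩
    refine ⟨?_, (parityWt_len hq h4 _).trans (pow_one _).symm⟩
    change cartanWt hq ((⟨n ^ 2 / 2 - i, by omega⟩ : Fin (n ^ 2 / 2)), _) * _ = 1
    refine (congrArg (· * q ^ (2 * i)) h).trans ?_
    dsimp only
    rw [← pow_add, show 2 * (n ^ 2 / 2 - i) + 2 * i = n ^ 2 by omega, hq.pow_eq_one]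

/-- The weights of `cartan` and `parity` determine the vertex among the base positions. -/
lemma eq_base_of_weights [CharZero k] (h4 : 4 ∣ n) {i : ℕ} (hi : i ∈ Finset.Icc 1 (n ^ 2 / 2)) (j : Fin 2)
    {z : Idx n} (hz : z.2 = 0 ∨ z.2 = len z.1) (hc : cartanWt hq z * q ^ (2 * i) = 1)
    (hp : parityWt hq z = (-1) ^ (j : ℕ)) : z = base (gammaVert hi j) := by
  have h1 := Finset.mem_Icc.1 hi
  have h3 := Nat.div_mul_cancel (two_dvd_sq h4)
  obtain ⟨b, r⟩ := z
  have hb := b.2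
  have hne : (1 : k) ≠ -1 := by
    intro h
    have : (2 : k) = 0 := by linear_combination h
    exact two_ne_zero this
  rcases hz with hz | hz
  · dsimp only at hz
    subst hz
    rw [parityWt_zero] at hp
    obtain rfl : j = 0 := by
      fin_cases j
      · rfl
      · simp at hp
        exact absurd hp hne
    have h := (cartanWt_zero hq b).trans hc.symm
    have h0 : cartanWt hq (b, 0) ≠ 0 := chi_ne_zero hq _
    have h5 := mul_left_cancel₀ h0 h
    have h6 : b + 1 = i := by
      -- the exponents lie between `2` and `n ^ 2`
      have h7 : q ^ (2 * b : ℕ) = q ^ (2 * (i - 1)) := by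
        have hq0 : q ^ 2 ≠ 0 := pow_ne_zero 2 (hq.ne_zero (NeZero.ne _))
        refine mul_right_cancel₀ hq0 ?_
        rw [← pow_add, ← pow_add, show 2 * (b : ℕ) + 2 = 2 * (b + 1) by ring, h5]
        congr 1
        omega
      have := hq.pow_inj (by omega) (by omega) h7
      omega
    refine Prod.ext (Fin.ext ?_) rfl
    change (b : ℕ) = i - 1
    omega
  · dsimp only at hz
    subst hz
    rw [parityWt_len hq h4] at hp
    obtain rfl : j = 1 := by
      fin_cases j
      · simp at hp
        exact absurd hp.symm hne
      · rfl
    rw [cartanWt_len, ← pow_add, hq.pow_eq_one_iff_dvd] at hc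
    obtain ⟨c, hc⟩ := hc
    have hc1 : c = 1 := by
      have h5 : c ≠ 0 := by rintro rfl; omega
      by_contra h6
      have : n ^ 2 * 2 ≤ n ^ 2 * c := Nat.mul_le_mul_left _ (by omega)
      omega
    have h6 : b = ⟨n ^ 2 / 2 - i, by omega⟩ := Fin.ext (by
      change (b : ℕ) = n ^ 2 / 2 - i
      rw [hc1] at hc
      omega)
    rw [h6]
    rfl

lemma shift_mul_apply {R : Type*} [CommRing R] {I : Type} [DecidableEq I] [Fintype I] {N : ℕ}
    [NeZero N] (d : ZMod N) (f : I × ZMod N → R) (m : Matrix (I × ZMod N) (I × ZMod N) R)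
    (y z : I × ZMod N) : (shift d f * m) (y.1, y.2 + d) z = f y * m y z := by
  rw [Matrix.mul_apply, Finset.sum_eq_single y]
  · rw [shift_apply_self]
  · intro y' _ hy
    rw [shift_apply, if_neg, zero_mul]
    intro h
    refine hy (Prod.ext (congrArg Prod.fst h).symm ?_)
    exact (add_right_cancel (congrArg Prod.snd h)).symm
  · simp

variable [CharZero k]

/-- An element `γ` has entries only in the row of the base position of its vertex. -/
lemma IsGamma.entry_eq_zero (h4 : 4 ∣ n) {i : ℕ} (hi : i ∈ Finset.Icc 1 (n ^ 2 / 2)) {j : Fin 2}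
    {g : QU k n q} (hg : IsGamma n q i j g) {z : Idx n} (hz : z ≠ base (gammaVert hi j))
    (z' : Idx n) : rep hq h4 g z z' = 0 := by
  have hn := Nat.pos_of_neZero n
  have h0 := q_ne_zero hn hq
  by_contra hne
  have hsm : ∀ c c' : k, algebraMap k (ArrowRing k) c * rep hq h4 g z z' =
      c' • rep hq h4 g z z' → c = c' := fun c c' h => by
    rw [← Algebra.smul_def, ← sub_eq_zero, ← sub_smul] at h
    by_contra hc
    refine hne ?_
    rw [← one_smul k (rep hq h4 g z z'), ← inv_mul_cancel₀ (sub_ne_zero.2 hc), mul_smul, h, smul_zero]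
  have hc : cartanWt hq z = q⁻¹ ^ (2 * i) := by
    have h := congrArg (rep hq h4) hg.cartan_mul
    rw [map_mul, rep_cartan, shift_zero_eq_diagonal, map_smul] at h
    have := congrFun (congrFun h z) z'
    rw [Matrix.diagonal_mul] at this
    exact hsm _ _ this
  have hp : parityWt hq z = (-1) ^ (j : ℕ) := by
    have h := congrArg (rep hq h4) hg.parity_mul
    rw [map_mul, rep_parity, shift_zero_eq_diagonal, map_smul] at h
    have := congrFun (congrFun h z) z'
    rw [Matrix.diagonal_mul] at this
    exact hsm _ _ this
  -- `F E F γ = F E β = 0`, and at the other positions `F` and `E F` act by units.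
  have hF : rep hq h4 (gen n q .F) * (Matrix.diagonal (efWt hq) * rep hq h4 g) = 0 := by
    rw [← rep_E_mul_F hq h4, ← map_mul, ← map_mul, mul_assoc (gen n q .E), hg.F_mul,
      F_E_beta hn h4 hq (Finset.mem_Icc.1 hi).1, map_zero]
  rw [rep_gen, repGen] at hF
  have h := shift_mul_apply (-1) (fWt hq) (Matrix.diagonal (efWt hq) * rep hq h4 g) z z'
  rw [hF, Matrix.zero_apply, Matrix.diagonal_mul] at h
  refine hz (eq_base_of_weights hq h4 hi j ?_ ?_ hp)
  · by_contra! hr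
    obtain ⟨b, r⟩ := z
    have hf : fWt hq (b, r) = efWt hq (b, r) := by simp only [fWt, if_neg hr.1, if_neg hr.2]
    have hc1 : (efWt hq (b, r)).c1 ≠ 0 := coef_ne_zero hq h4 hr.1 hr.2
    have hu : IsUnit (efWt hq (b, r)) := IsUnit.of_mul_eq_one _ (mul_inverse_even ⟨rfl, rfl⟩ hc1)
    rw [hf] at h
    exact hne (hu.mul_right_eq_zero.1 (hu.mul_right_eq_zero.1 h.symm))
  · rw [hc, ← mul_pow, inv_mul_cancel₀ h0, one_pow]

lemma IsGamma.eps_mul (h4 : 4 ∣ n) {i : ℕ} (hi : i ∈ Finset.Icc 1 (n ^ 2 / 2)) {j : Fin 2}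
    {g : QU k n q} (hg : IsGamma n q i j g) :
    (model hq h4).eps ((model hq h4).o (gammaVert hi j)) * g = g := by
  refine (model hq h4).injective ?_
  rw [map_mul, MatrixModel.eps, (model hq h4).toHom_unit_of_mem (one_mem_gr _)]
  ext1 z z'
  by_cases hz : z = base (gammaVert hi j)
  · subst hz
    exact (Matrix.single_mul_apply_same _ _ _ _ _).trans (one_mul _)
  · refine (Matrix.single_mul_apply_of_ne _ _ _ _ _ hz _).trans ?_
    exact (hg.entry_eq_zero hq h4 hi hz z').symm

end Vertex

/-! ### The left ideals generated by the elements `γ` -/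

section NonVanishing

variable {k : Type u} [Field k] {n : ℕ} {q : k}

lemma c1_prod_ne_zero {ι : Type*} {s : Finset ι} {f : ι → ArrowRing k}
    (h : ∀ t ∈ s, (f t).c1 ≠ 0) : (∏ t ∈ s, f t).c1 ≠ 0 :=
  Finset.prod_induction _ (fun a : ArrowRing k => a.c1 ≠ 0)
    (fun a b ha hb => by rw [mul_c1]; exact mul_ne_zero ha hb) (by simp) h

lemma parityIdem_mul_of_eigen [CharZero k] (j : Fin 2) {z : QU k n q}
    (hz : parity n q * z = (-1 : k) ^ (j : ℕ) • z) : parityIdem n q j * z = z := by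
  have h : (-1 : k) ^ (j : ℕ) * (-1 : k) ^ (j : ℕ) = 1 := by
    rw [← mul_pow, neg_one_mul, neg_neg, one_pow]
  rw [parityIdem, smul_mul_assoc, add_mul, one_mul, smul_mul_assoc, hz, smul_smul, h, one_smul,
    ← two_smul k z, smul_smul, inv_mul_cancel₀ two_ne_zero, one_smul]

/-- With `o` the base position of the vertex of `γ_{2i,j}`, the positions `0` and `len b` at which
the type changes are `o` and `o - 2 i + 1`. -/
lemma base_gammaVert_or (h4 : 4 ∣ n) {i : ℕ} (hi : i ∈ Finset.Icc 1 (n ^ 2 / 2)) (j : Fin 2)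
    {r : ZMod (n ^ 2)} (hr : r = 0 ∨ r = len (gammaVert hi j).1) :
    r = (base (gammaVert hi j)).2 ∨ r = (base (gammaVert hi j)).2 - 2 * i + 1 := by
  have h1 := Finset.mem_Icc.1 hi
  have h3 := Nat.div_mul_cancel (two_dvd_sq h4)
  fin_cases j
  · have hl : (len (⟨i - 1, by omega⟩ : Fin (n ^ 2 / 2)) : ZMod (n ^ 2)) = 0 - 2 * i + 1 := by
      rw [len_cast]
      dsimp only
      rw [Nat.sub_add_cancel h1.1]
      ring
    exact hr.imp id fun h => h.trans hl
  · have hl : (len (⟨n ^ 2 / 2 - i, by omega⟩ : Fin (n ^ 2 / 2)) : ZMod (n ^ 2)) = 2 * i - 1 := by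
      have : len (⟨n ^ 2 / 2 - i, by omega⟩ : Fin (n ^ 2 / 2)) = 2 * i - 1 := by
        unfold len
        dsimp only
        omega
      rw [this, Nat.cast_sub (by omega)]
      push_cast
      ring
    refine hr.symm.imp id fun h => ?_
    change r = (len (⟨n ^ 2 / 2 - i, by omega⟩ : Fin (n ^ 2 / 2)) : ZMod (n ^ 2)) - 2 * i + 1
    rw [h, hl]
    ring

variable [NeZero n] (hq : IsPrimitiveRoot q (n ^ 2))

/-- At a base position, `E` arrives and `F` leaves through the same arrow, up to scalars. -/
lemma exists_arrow_base (w : Fin (n ^ 2 / 2) × Bool) : ∃ (a : ArrowRing k) (c : k), c ≠ 0 ∧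
    a * a = s k ∧ eWt k ((base w).1, (base w).2 - 1) = a ∧ fWt hq (base w) = c • a := by
  obtain ⟨b, d⟩ := w
  have h0 := len_cast_ne_zero b
  cases d
  · refine ⟨y k, chi hq (len b), chi_ne_zero hq _, y_mul_y, ?_, ?_⟩
    · change eWt k (b, (0 : ZMod (n ^ 2)) - 1) = y k
      simp only [eWt, sub_add_cancel, if_true, if_neg h0.symm]
    · change fWt hq (b, 0) = _
      simp only [fWt, if_true]
  · refine ⟨x k, 1, one_ne_zero, x_mul_x, ?_, ?_⟩
    · change eWt k (b, (len b : ZMod (n ^ 2)) - 1) = x k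
      simp only [eWt, sub_add_cancel, if_true]
    · change fWt hq (b, (len b : ZMod (n ^ 2))) = _
      simp only [fWt, if_true, if_neg h0, one_smul]

/-- The column in which `E ^ (2 i - 1) F ^ (n ^ 2 - 1)` reaches the base position. -/
lemma entry_E_pow_mul_F_pow_ne_zero (h4 : 4 ∣ n) {i : ℕ} (hi : i ∈ Finset.Icc 1 (n ^ 2 / 2))
    (j : Fin 2) : gen n q .E ^ (2 * i - 1) * gen n q .F ^ (n ^ 2 - 1) *
      (model hq h4).eps ((gammaVert hi j).1, (base (gammaVert hi j)).2 - 2 * i) ≠ 0 := by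
  have h1 := Finset.mem_Icc.1 hi
  have h2 := two_mul_le hi
  have hN : 0 < n ^ 2 := by omega
  obtain ⟨a, c, hc, ha, he, hf⟩ := exists_arrow_base hq (gammaVert hi j)
  have hor := fun r => base_gammaVert_or h4 hi j (r := r)
  change eWt k ((gammaVert hi j).1, _) = a at he
  change fWt hq ((gammaVert hi j).1, (base (gammaVert hi j)).2) = c • a at hf
  generalize (gammaVert hi j).1 = b at *
  generalize (base (gammaVert hi j)).2 = o at *
  intro h
  replace h := congrArg (rep hq h4) h
  have heps : rep hq h4 ((model hq h4).eps (b, o - 2 * i)) = Matrix.single (b, o - 2 * i) (b, o - 2 * i) 1 :=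
    (model hq h4).toHom_unit_of_mem (one_mem_gr _)
  rw [map_mul, heps, map_zero, map_mul, map_pow, map_pow, rep_gen, rep_gen, repGen, repGen,
    shift_pow, shift_pow, shift_mul] at h
  -- all weights on the way from the starting position to the base position
  have hstep : ∀ m : ℕ, m < n ^ 2 → (m : ZMod (n ^ 2)) = 0 → m = 0 := fun m hm hm0 => by
    rw [ZMod.natCast_eq_zero_iff] at hm0
    exact Nat.eq_zero_of_dvd_of_lt hm0 hm
  have hE : ∏ t ∈ Finset.range (2 * i - 1), eWt k (b, o - 2 * i + 1 + (t : ZMod (n ^ 2)) * 1) = a := by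
    rw [show 2 * i - 1 = 2 * i - 2 + 1 by omega, Finset.prod_range_succ, Finset.prod_eq_one, one_mul]
    · rw [← he, Nat.cast_sub (by omega)]
      congr 2
      push_cast
      ring
    · intro t ht
      rw [Finset.mem_range] at ht
      have hne : ¬ (o - 2 * i + 1 + (t : ZMod (n ^ 2)) * 1 + 1 = 0 ∨
          o - 2 * i + 1 + (t : ZMod (n ^ 2)) * 1 + 1 = len b) := fun hh => by
        rcases hor _ hh with hr | hr
        · have := hstep (2 * i - 2 - t) (by omega) (by
            rw [Nat.cast_sub (by omega), Nat.cast_sub (by omega)]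
            push_cast
            linear_combination -hr)
          omega
        · have := hstep (t + 1) (by omega) (by
            push_cast
            linear_combination hr)
          omega
      push Not at hne
      simp only [eWt, if_neg hne.1, if_neg hne.2]
  have hF : ∃ u : ArrowRing k, u.c1 ≠ 0 ∧
      ∏ t ∈ Finset.range (n ^ 2 - 1), fWt hq (b, o - 2 * i + (t : ZMod (n ^ 2)) * -1) = c • a * u := by
    have hmem : n ^ 2 - 2 * i ∈ Finset.range (n ^ 2 - 1) := Finset.mem_range.2 (by omega)
    rw [← Finset.mul_prod_erase _ _ hmem]
    refine ⟨∏ t ∈ (Finset.range (n ^ 2 - 1)).erase (n ^ 2 - 2 * i),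
      fWt hq (b, o - 2 * i + (t : ZMod (n ^ 2)) * -1), c1_prod_ne_zero fun t ht => ?_, ?_⟩
    rotate_left
    · congr 1
      rw [← hf, Nat.cast_sub h2, ZMod.natCast_self]
      congr 2
      push_cast
      ring
    · rw [Finset.mem_erase, Finset.mem_range] at ht
      have hne : ¬ (o - 2 * i + (t : ZMod (n ^ 2)) * -1 = 0 ∨
          o - 2 * i + (t : ZMod (n ^ 2)) * -1 = len b) := fun hh => by
        rcases hor _ hh with hr | hr
        · have h5 : ((t + 2 * i : ℕ) : ZMod (n ^ 2)) = 0 := by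
            push_cast
            linear_combination -hr
          rw [ZMod.natCast_eq_zero_iff] at h5
          obtain ⟨m, hm⟩ := h5
          have hm1 : m = 1 := by
            have h6 : m ≠ 0 := by rintro rfl; omega
            by_contra h7
            have : n ^ 2 * 2 ≤ n ^ 2 * m := Nat.mul_le_mul_left _ (by omega)
            omega
          rw [hm1] at hm
          omega
        · have := hstep (t + 1) (by omega) (by
            push_cast
            linear_combination -hr)
          omega
      push Not at hne
      have hw : fWt hq (b, o - 2 * i + (t : ZMod (n ^ 2)) * -1) =
          efWt hq (b, o - 2 * i + (t : ZMod (n ^ 2)) * -1) := by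
        simp only [fWt, if_neg hne.1, if_neg hne.2]
      rw [hw]
      exact coef_ne_zero hq h4 hne.1 hne.2
  obtain ⟨u, hu, hF⟩ := hF
  have hd : o - 2 * i + ((n ^ 2 - 1 : ℕ) : ZMod (n ^ 2)) * -1 = o - 2 * i + 1 := by
    rw [Nat.cast_sub (by omega), ZMod.natCast_self]
    push_cast
    ring
  have h5 := congrFun (congrFun h ((b, o - 2 * i).1, (b, o - 2 * i).2 +
    (((n ^ 2 - 1 : ℕ) : ZMod (n ^ 2)) * -1 + ((2 * i - 1 : ℕ) : ZMod (n ^ 2)) * 1))) (b, o - 2 * i)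
  rw [Matrix.mul_single_apply_same, shift_apply_self, Matrix.zero_apply, mul_one] at h5
  dsimp only at h5
  rw [hd, hE, hF, smul_mul_assoc, mul_smul_comm, ← mul_assoc, ha] at h5
  have h6 := congrArg ArrowRing.cs h5
  simp [hc, hu] at h6

lemma phi_mul_of_eigen [CharZero k] (hq : IsPrimitiveRoot q (n ^ 2)) (h4 : 4 ∣ n) (i : ℕ) {z : QU k n q}
    (hz : cartan n q * z = q ^ (2 * i) • z) : phi n q i * z = z := by
  have hn := Nat.pos_of_neZero n
  have hpow : ∀ t : ℕ, cartan n q ^ t * z = q ^ (2 * i * t) • z := by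
    intro t
    induction t with
    | zero => simp
    | succ t ih =>
      rw [pow_succ, mul_assoc, hz, mul_smul_comm, ih, smul_smul, ← pow_add]
      congr 2
      ring
  have hM : ((n / 2 * n : ℕ) : k) ≠ 0 := by
    rw [half_mul h4]
    exact Nat.cast_ne_zero.2 (half_sq_pos h4).ne'
  have hterm : ∀ t ∈ Finset.range (n / 2 * n),
      (q⁻¹ ^ (2 * i * t) • cartan n q ^ t) * z = z := fun t _ => by
    rw [smul_mul_assoc, hpow, smul_smul, ← mul_pow, inv_mul_cancel₀ (q_ne_zero hn hq), one_pow,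
      one_smul]
  rw [phi, smul_mul_assoc, Finset.sum_mul, Finset.sum_congr rfl hterm, Finset.sum_const,
    Finset.card_range, ← Nat.cast_smul_eq_nsmul k, smul_smul, inv_mul_cancel₀ hM, one_smul]

lemma rep_eps (h4 : 4 ∣ n) (z : Idx n) :
    rep hq h4 ((model hq h4).eps z) = Matrix.single z z 1 :=
  (model hq h4).toHom_unit_of_mem (one_mem_gr _)

lemma diagonal_algebraMap_mul_single (f : Idx n → k) (z : Idx n) :
    Matrix.diagonal (fun z => algebraMap k (ArrowRing k) (f z)) * Matrix.single z z 1 =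
      f z • Matrix.single z z (1 : ArrowRing k) := by
  ext1 y y'
  rw [Matrix.diagonal_mul, Matrix.smul_apply, Algebra.smul_def]
  by_cases hy : z = y
  · rw [hy]
  · rw [Matrix.single_apply_of_row_ne hy, mul_zero, mul_zero]

lemma cartan_mul_eps (h4 : 4 ∣ n) (z : Idx n) :
    cartan n q * (model hq h4).eps z = cartanWt hq z • (model hq h4).eps z :=
  rep_injective hq h4 (by
    rw [map_mul, map_smul, rep_eps, rep_cartan, shift_zero_eq_diagonal,
      diagonal_algebraMap_mul_single])

lemma parity_mul_eps (h4 : 4 ∣ n) (z : Idx n) :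
    parity n q * (model hq h4).eps z = parityWt hq z • (model hq h4).eps z :=
  rep_injective hq h4 (by
    rw [map_mul, map_smul, rep_eps, rep_parity, shift_zero_eq_diagonal,
      diagonal_algebraMap_mul_single])

lemma efWt_base (w : Fin (n ^ 2 / 2) × Bool) : ∃ c : k, efWt hq (base w) = c • s k := by
  obtain ⟨b, d⟩ := w
  cases d
  · refine ⟨chi hq (len b), ?_⟩
    change efWt hq (b, 0) = _
    ext <;> simp [efWt, coef]
  · refine ⟨1, ?_⟩
    change efWt hq (b, (len b : ZMod (n ^ 2))) = _
    ext <;> simp [efWt, coef]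

variable [CharZero k]

/-- The position `o - 2 i` has the weights of the idempotent `e_{2i,j}`. -/
lemma idem_mul_eps (h4 : 4 ∣ n) {i : ℕ} (hi : i ∈ Finset.Icc 1 (n ^ 2 / 2)) (j : Fin 2) :
    idem n q i j * (model hq h4).eps ((gammaVert hi j).1, (base (gammaVert hi j)).2 - 2 * i) =
      (model hq h4).eps ((gammaVert hi j).1, (base (gammaVert hi j)).2 - 2 * i) := by
  obtain ⟨h1, h2⟩ := weights_base hq h4 hi j
  have hc : cartanWt hq ((gammaVert hi j).1, (base (gammaVert hi j)).2 - 2 * i) = q ^ (2 * i) := by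
    have h3 : cartanWt hq ((gammaVert hi j).1, (base (gammaVert hi j)).2 - 2 * i) =
        cartanWt hq (base (gammaVert hi j)) * q ^ (2 * i + 2 * i) := by
      rw [← chi_natCast hq, cartanWt, cartanWt, ← AddChar.map_add_eq_mul]
      congr 1
      change -2 * (_ + _) = -2 * ((((gammaVert hi j).1 + 1 : ℕ) : ZMod (n ^ 2)) + _) + _
      push_cast
      ring
    rw [h3, pow_add, ← mul_assoc, h1, one_mul]
  have hp : parityWt hq ((gammaVert hi j).1, (base (gammaVert hi j)).2 - 2 * i) =
      (-1) ^ (j : ℕ) := by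
    rw [← h2, parityWt, parityWt]
    congr 1
    have h5 : ((n ^ 2 / 2 : ℕ) : ZMod (n ^ 2)) * 2 = 0 := by
      have := congrArg (Nat.cast : ℕ → ZMod (n ^ 2)) (Nat.div_mul_cancel (two_dvd_sq h4))
      rwa [ZMod.natCast_self, Nat.cast_mul, Nat.cast_two] at this
    linear_combination -(i : ZMod (n ^ 2)) * h5
  rw [idem, mul_assoc, parityIdem_mul_of_eigen j (by rw [parity_mul_eps, hp]),
    phi_mul_of_eigen hq h4 i (by rw [cartan_mul_eps, hc])]

lemma E_mul_beta_ne_zero (hq : IsPrimitiveRoot q (n ^ 2)) (h4 : 4 ∣ n) {i : ℕ} (hi : i ∈ Finset.Icc 1 (n ^ 2 / 2)) (j : Fin 2) :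
    gen n q .E * beta n q i j ≠ 0 := by
  have h1 := Finset.mem_Icc.1 hi
  intro h
  refine entry_E_pow_mul_F_pow_ne_zero hq h4 hi j ?_
  rw [← idem_mul_eps hq h4 hi j, mul_assoc, ← mul_assoc _ (idem n q i j), ← mul_assoc, ← alpha,
    show 2 * i - 1 = (2 * i - 2) + 1 by omega, pow_succ', mul_assoc (gen n q .E), ← beta, h, zero_mul]

lemma IsGamma.soc_mul_ne_zero (h4 : 4 ∣ n) {i : ℕ} (hi : i ∈ Finset.Icc 1 (n ^ 2 / 2)) {j : Fin 2}
    {g : QU k n q} (hg : IsGamma n q i j g) : (model hq h4).soc (gammaVert hi j) * g ≠ 0 := by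
  intro h
  refine E_mul_beta_ne_zero hq h4 hi j (rep_injective hq h4 ?_)
  have hsoc : rep hq h4 ((model hq h4).soc (gammaVert hi j)) =
      Matrix.single (base (gammaVert hi j)) (base (gammaVert hi j)) (s k) :=
    (model hq h4).toHom_unit_of_mem (s_mem_gr _)
  replace h := congrArg (rep hq h4) h
  rw [map_mul, hsoc, map_zero] at h
  -- `E F` acts on the only nonzero row of `γ` by a multiple of `s`, that is, as `soc` does.
  rw [← hg.F_mul, ← mul_assoc, map_mul, rep_E_mul_F, map_zero]
  ext1 z z'
  rw [Matrix.diagonal_mul, Matrix.zero_apply]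
  by_cases hz : z = base (gammaVert hi j)
  · subst hz
    obtain ⟨c, hc⟩ := efWt_base hq (gammaVert hi j)
    have := congrFun (congrFun h (base (gammaVert hi j))) z'
    rw [Matrix.single_mul_apply_same, Matrix.zero_apply] at this
    rw [hc, smul_mul_assoc, this, smul_zero]
  · rw [hg.entry_eq_zero hq h4 hi hz, mul_zero]

/-- The left ideal generated by an element `γ` is the projective module of its vertex. -/
def IsGamma.equivPMod (h4 : 4 ∣ n) {i : ℕ} (hi : i ∈ Finset.Icc 1 (n ^ 2 / 2)) {j : Fin 2}
    {g : QU k n q} (hg : IsGamma n q i j g) :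
    (model hq h4).P (gammaVert hi j) ≃ₗ[QU k n q] PMod g :=
  (model hq h4).equivSpan (hg.eps_mul hq h4 hi) (hg.soc_mul_ne_zero hq h4 hi)

end NonVanishing

/-! ### Counting -/

section Counting

lemma ncard_isoClasses {A : Type u} [Ring A] {ι : Type} [Fintype ι] {C : ModuleCat.{u} A → Prop}
    (M : ι → ModuleCat.{u} A) (hC : ∀ i, C (M i))
    (hinj : ∀ i i', Nonempty (M i ≃ₗ[A] M i') → i = i')
    (hsurj : ∀ N, C N → ∃ i, Nonempty (N ≃ₗ[A] M i)) :
    (isoClasses A C).ncard = Fintype.card ι := by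
  have h : isoClasses A C = Set.range fun i => Quotient.mk (isIsomorphicSetoid _) (M i) := by
    ext c
    constructor
    · rintro ⟨N, hN, rfl⟩
      obtain ⟨i, ⟨e⟩⟩ := hsurj N hN
      exact ⟨i, Quotient.sound ⟨e.symm.toModuleIso⟩⟩
    · rintro ⟨i, rfl⟩
      exact ⟨M i, hC i, rfl⟩
  rw [h, ← Set.image_univ, Set.ncard_image_of_injective, Set.ncard_univ, Nat.card_eq_fintype_card]
  intro i i' hii
  obtain ⟨e⟩ := Quotient.exact hii
  exact hinj i i' ⟨e.toLinearEquiv⟩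

variable {n : ℕ} [NeZero n]

lemma card_vert_fst (b : Fin (n ^ 2 / 2)) :
    Fintype.card {z : Idx n // (vert z).1 = b} = n ^ 2 := by
  refine (Fintype.card_congr (β := ZMod (n ^ 2))
    { toFun := fun z => z.1.2
      invFun := fun r => ⟨(b, r), rfl⟩
      left_inv := fun z => Subtype.ext (Prod.ext z.2.symm rfl)
      right_inv := fun r => rfl }).trans (ZMod.card _)

lemma card_vert (b : Fin (n ^ 2 / 2)) (c : Bool) : Fintype.card {z : Idx n // vert z = (b, c)} =
    ((Finset.range (n ^ 2)).filter fun t => decide (len b ≤ t) = c).card := by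
  rw [Fintype.card_subtype]
  refine Finset.card_bij (fun z _ => z.2.val) (fun z hz => ?_) (fun z hz z' hz' h => ?_)
    fun t ht => ?_
  · rw [Finset.mem_filter] at hz ⊢
    obtain ⟨rfl, h⟩ := Prod.ext_iff.1 hz.2
    exact ⟨Finset.mem_range.2 (ZMod.val_lt _), h⟩
  · rw [Finset.mem_filter] at hz hz'
    exact Prod.ext ((congrArg Prod.fst hz.2).trans (congrArg Prod.fst hz'.2).symm)
      (ZMod.val_injective _ h)
  · rw [Finset.mem_filter, Finset.mem_range] at ht
    have hv : ((t : ℕ) : ZMod (n ^ 2)).val = t := ZMod.val_natCast_of_lt ht.1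
    refine ⟨(b, (t : ZMod (n ^ 2))), Finset.mem_filter.2 ⟨Finset.mem_univ _, ?_⟩, hv⟩
    simp only [vert, hv, ht.2]

lemma card_vert_false (b : Fin (n ^ 2 / 2)) :
    Fintype.card {z : Idx n // vert z = (b, false)} = len b := by
  refine (card_vert b false).trans ((congrArg Finset.card ?_).trans (Finset.card_range _))
  ext t
  have := len_lt b
  simp only [Finset.mem_filter, Finset.mem_range, decide_eq_false_iff_not]
  omega

lemma card_vert_true (b : Fin (n ^ 2 / 2)) :
    Fintype.card {z : Idx n // vert z = (b, true)} = n ^ 2 - len b := by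
  refine (card_vert b true).trans ((congrArg Finset.card ?_).trans (Nat.card_Ico _ _))
  ext t
  simp only [Finset.mem_filter, Finset.mem_range, decide_eq_true_eq, Finset.mem_Ico]
  omega

lemma card_vert_gammaVert (h4 : 4 ∣ n) {i : ℕ} (hi : i ∈ Finset.Icc 1 (n ^ 2 / 2)) (j : Fin 2) :
    Fintype.card {z : Idx n // vert z = gammaVert hi j} = n ^ 2 + 1 - 2 * i := by
  have h1 := Finset.mem_Icc.1 hi
  have h2 := Nat.div_mul_cancel (two_dvd_sq h4)
  fin_cases j
  · refine (card_vert_false _).trans ?_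
    simp only [len]
    omega
  · refine (card_vert_true _).trans ?_
    simp only [len]
    omega

end Counting

end QuasiSl2

end

open QuasiSl2 in
theorem corollary2p14 (k : Type u) [Field k] [IsAlgClosed k] [CharZero k]
    (n : ℕ) (hn : 0 < n) (h4 : 4 ∣ n) (q : k) (hq : IsPrimitiveRoot q (n ^ 2)) :
    -- the elements `γ_{2i,j}` exist, with a unique normalized choice
    (∀ i ∈ Finset.Icc 1 (n ^ 2 / 2), ∀ j : Fin 2,
      ∃ g ∈ truncated n q, IsGamma n q i j g ∧
        ∀ g' ∈ truncated n q, gen n q Gen.F * g' = beta n q i j → g' = g) ∧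
    -- for every choice of the `γ_{2i,j}`, with `P_{2i,j}` and `S_{2i,j}` formed from it:
    (∀ γ : ℕ → Fin 2 → QU k n q,
      (∀ i ∈ Finset.Icc 1 (n ^ 2 / 2), ∀ j : Fin 2, IsGamma n q i j (γ i j)) →
      -- the `P_{2i,j}` are the indecomposable projectives
      (∀ i ∈ Finset.Icc 1 (n ^ 2 / 2), ∀ j : Fin 2,
        Module.Projective (QU k n q) (PMod (γ i j)) ∧
        IsIndecomposableModule (QU k n q) (PMod (γ i j))) ∧
      (∀ i ∈ Finset.Icc 1 (n ^ 2 / 2), ∀ i' ∈ Finset.Icc 1 (n ^ 2 / 2), ∀ j j' : Fin 2,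
        Nonempty (PMod (γ i j) ≃ₗ[QU k n q] PMod (γ i' j')) → i = i' ∧ j = j') ∧
      (∀ (M : Type w) [AddCommGroup M] [Module (QU k n q) M],
        Module.Projective (QU k n q) M → IsIndecomposableModule (QU k n q) M →
        ∃ i ∈ Finset.Icc 1 (n ^ 2 / 2), ∃ j : Fin 2,
          Nonempty (M ≃ₗ[QU k n q] PMod (γ i j))) ∧
      -- the `S_{2i,j}` are the simple modules
      (∀ i ∈ Finset.Icc 1 (n ^ 2 / 2), ∀ j : Fin 2,
        IsSimpleModule (QU k n q) (SMod (γ i j)) ∧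
        Module.finrank k (SMod (γ i j)) = n ^ 2 + 1 - 2 * i) ∧
      (∀ i ∈ Finset.Icc 1 (n ^ 2 / 2), ∀ i' ∈ Finset.Icc 1 (n ^ 2 / 2), ∀ j j' : Fin 2,
        Nonempty (SMod (γ i j) ≃ₗ[QU k n q] SMod (γ i' j')) → i = i' ∧ j = j') ∧
      (∀ (M : Type w) [AddCommGroup M] [Module (QU k n q) M],
        IsSimpleModule (QU k n q) M →
        ∃ i ∈ Finset.Icc 1 (n ^ 2 / 2), ∃ j : Fin 2,
          Nonempty (M ≃ₗ[QU k n q] SMod (γ i j))) ∧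
      -- the distribution into blocks
      (∀ i ∈ Finset.Icc 1 (n ^ 2 / 2), ∀ i' ∈ Finset.Icc 1 (n ^ 2 / 2), ∀ j j' : Fin 2,
        SameBlock (QU k n q) (PMod (γ i j)) (PMod (γ i' j')) ↔
          (i = i' ∧ j = j') ∨
          (2 * i + 2 * i' = n ^ 2 + 2 ∧ (j : ℕ) + (j' : ℕ) = 1))) ∧
    -- number and dimension of the indecomposable projectives
    (isoClasses (QU k n q) fun M =>
      Module.Projective (QU k n q) M ∧ IsIndecomposableModule (QU k n q) M).ncard = n ^ 2 ∧
    (∀ (M : Type w) [AddCommGroup M] [Module k M] [Module (QU k n q) M]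
      [IsScalarTower k (QU k n q) M],
      Module.Projective (QU k n q) M → IsIndecomposableModule (QU k n q) M →
      Module.finrank k M = 2 * n ^ 2) ∧
    -- number and dimensions of the simple modules
    (isoClasses (QU k n q) fun M => IsSimpleModule (QU k n q) M).ncard = n ^ 2 ∧
    (∀ (M : Type w) [AddCommGroup M] [Module k M] [Module (QU k n q) M]
      [IsScalarTower k (QU k n q) M],
      IsSimpleModule (QU k n q) M → Odd (Module.finrank k M)) ∧
    -- number, dimension and Morita class of the blocks
    {e : QU k n q | IsBlockIdempotent e}.ncard = n ^ 2 / 2 ∧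
    (∀ (e : QU k n q) (he : IsBlockIdempotent e),
      Module.finrank k he.idem.Corner = 2 * n ^ 4 ∧
      IsMoritaEquivalent k he.idem.Corner (BasicLambda k)) ∧
    IsBasicAlgebra k (BasicLambda k) ∧
    -- tameness
    IsTame k (QU k n q) := by
  have : NeZero n := ⟨hn.ne'⟩
  have h2 := Nat.div_mul_cancel (two_dvd_sq h4)
  have hcard : Fintype.card (Fin (n ^ 2 / 2) × Bool) = n ^ 2 := by
    rw [Fintype.card_prod, Fintype.card_fin, Fintype.card_bool, h2]
  have hpos : 0 < n ^ 2 / 2 := half_sq_pos h4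
  have : Nonempty (Fin (n ^ 2 / 2)) := ⟨⟨0, hpos⟩⟩
  let S := model hq h4
  refine ⟨fun i hi j => exists_isGamma hq h4 hi j, fun γ hγ => ?_, ?_, ?_, ?_, ?_, ?_, ?_,
    isBasicAlgebra_lambda, S.isTame⟩
  · have eP : ∀ i (hi : i ∈ Finset.Icc 1 (n ^ 2 / 2)) (j : Fin 2),
        Nonempty (S.P (gammaVert hi j) ≃ₗ[QU k n q] PMod (γ i j)) := fun i hi j =>
      ⟨(hγ i hi j).equivPMod hq h4 hi⟩
    have eL : ∀ i (hi : i ∈ Finset.Icc 1 (n ^ 2 / 2)) (j : Fin 2),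
        Nonempty (SMod (γ i j) ≃ₗ[QU k n q] S.L (gammaVert hi j)) := fun i hi j =>
      S.nonempty_socle_equiv (eP i hi j).some
    refine ⟨fun i hi j => ?_, fun i hi i' hi' j j' ⟨f⟩ => ?_, fun M _ _ hM hM' => ?_,
      fun i hi j => ⟨?_, ?_⟩, fun i hi i' hi' j j' ⟨f⟩ => ?_, fun M _ _ hM => ?_,
      fun i hi i' hi' j j' => ?_⟩
    · obtain ⟨e⟩ := eP i hi j
      have := S.projective_P (gammaVert hi j)
      exact ⟨Module.Projective.of_equiv e, isIndecomposableModule_congr e (S.isIndecomposable_P _)⟩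
    · obtain ⟨e⟩ := eP i hi j
      obtain ⟨e'⟩ := eP i' hi' j'
      exact gammaVert_injective hi hi' (S.eq_of_equiv_P (e ≪≫ₗ f ≪≫ₗ e'.symm))
    · obtain ⟨w, ⟨f⟩⟩ := S.exists_equiv_P hM'
      obtain ⟨i, hi, j, rfl⟩ := gammaVert_surjective w
      obtain ⟨e⟩ := eP i hi j
      exact ⟨i, hi, j, ⟨f ≪≫ₗ e⟩⟩
    · obtain ⟨e⟩ := eL i hi j
      have := S.isSimple_L (gammaVert hi j)
      exact IsSimpleModule.congr e
    · obtain ⟨e⟩ := eL i hi j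
      exact (e.restrictScalars k).finrank_eq.trans
        ((S.finrank_L _).trans (card_vert_gammaVert h4 hi j))
    · obtain ⟨e⟩ := eL i hi j
      obtain ⟨e'⟩ := eL i' hi' j'
      exact gammaVert_injective hi hi' (S.eq_of_equiv_L (e.symm ≪≫ₗ f ≪≫ₗ e'))
    · obtain ⟨w, ⟨f⟩⟩ := S.exists_equiv_L hM
      obtain ⟨i, hi, j, rfl⟩ := gammaVert_surjective w
      obtain ⟨e⟩ := eL i hi j
      exact ⟨i, hi, j, ⟨f ≪≫ₗ e.symm⟩⟩
    · rw [S.sameBlock_iff (eP i hi j).some (eP i' hi' j').some, gammaVert_fst_eq_iff h4 hi hi']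
  · rw [← hcard]
    exact ncard_isoClasses (fun w => ModuleCat.of _ (S.P w))
      (fun w => ⟨S.projective_P w, S.isIndecomposable_P w⟩) (fun w w' ⟨e⟩ => S.eq_of_equiv_P e)
      fun N hN => by
        have := hN.1
        exact S.exists_equiv_P hN.2
  · intro M _ _ _ _ hM hM'
    obtain ⟨w, ⟨e⟩⟩ := S.exists_equiv_P hM'
    refine (e.restrictScalars k).finrank_eq.trans ((S.finrank_P w).trans ?_)
    rw [← Finset.sum_filter, Finset.sum_const, smul_eq_mul, mul_comm, ← Fintype.card_subtype]
    exact congrArg (2 * ·) (card_vert_fst w.1)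
  · rw [← hcard]
    exact ncard_isoClasses (fun w => ModuleCat.of _ (S.L w)) (fun w => S.isSimple_L w)
      (fun w w' ⟨e⟩ => S.eq_of_equiv_L e) fun N hN => S.exists_equiv_L hN
  · intro M _ _ _ _ hM
    obtain ⟨w, ⟨e⟩⟩ := S.exists_equiv_L hM
    obtain ⟨i, hi, j, rfl⟩ := gammaVert_surjective w
    rw [(e.restrictScalars k).finrank_eq.trans
      ((S.finrank_L _).trans (card_vert_gammaVert h4 hi j))]
    have h1 := Finset.mem_Icc.1 hi
    exact ⟨n ^ 2 / 2 - i, by omega⟩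
  · rw [S.ncard_blockIdempotent, Fintype.card_fin]
  · intro e he
    obtain ⟨b, rfl⟩ := S.isBlockIdempotent_iff.1 he
    refine ⟨(S.finrank_block b he.idem).trans ?_, S.isMoritaEquivalent_block b he.idem⟩
    refine (congrArg (fun m => 2 * m ^ 2) (card_vert_fst b)).trans ?_
    ring
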